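/- **Setting.** Let $N\ge 1$ be an integer, $1<p<p_c$ with $p_c=1+\frac4{N-1}$ ($p_c=+\infty$ if $N=1$), $0\le q<p$, $M>0$, and let $f,g:\mathbb R\to\mathbb R$ be locally Lipschitz with $|f(x)|\le M(1+|x|^q)$ and $|g(x)|\le M(1+|x|)$ for all $x$. Consider $$u_{tt}=\Delta u+|u|^{p-1}u+f(u)+g(u_t),\qquad (u,u_t)(0)=(u_0,u_1)\in H^1_{loc,u}(\mathbb R^N)\times L^2_{loc,u}(\mathbb R^N),\tag{1.1}$$ where $L^2_{loc,u}$ is the space of $a$ with $\sup_{c}\int_{|x-c|\le 1}|a|^2dx<\infty$ and $H^1_{loc,u}$ that of $a\in L^2_{loc,u}$ with weak gradient in $L^2_{loc,u}$. Let $u$ be a blow-up solution of (1.1) with maximal influence domain $D_u=\{(x,t): 0\le t<T(x)\}$. This means that $T:\mathbb R^N\to(0,\infty)$ is $1$-Lipschitz; that, locally in $D_u$, $u$ is a (mild) energy solution, i.e. $(u,u_t)$ is continuous in time with values in $H^1\times L^2$, the right-hand side $|u|^{p-1}u+f(u)+g(u_t)$ is $L^1$ in time with values in $L^2$, and (1.1)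 holds weakly with the given data; and that $u$ does not extend to a solution of this kind on $\{0\le t<T'(x)\}$ for any $1$-Lipschitz $T'\ge T$, $T'\neq T$. A point $x_0$ is non-characteristic if there is $\delta_0\in(0,1)$ such that every $(\xi,\tau)\ne(x_0,T(x_0))$ with $0\le\tau\le T(x_0)-\delta_0|\xi-x_0|$ belongs to $D_u$. For $0<T_0\le T(x_0)$ the function $w=w_{x_0,T_0}$ is defined by $$y=\frac{x-x_0}{T_0-t},\qquad s=-\log(T_0-t),\qquad u(x,t)=(T_0-t)^{-\frac2{p-1}}\,w(y,s).$$ Let $B$ be the unit ball of $\mathbb R^N$ and $\rho(y)=(1-|y|^2)^{\alpha}$, $\alpha=\frac2{p-1}-\frac{N-1}2>0$. **Proposition 3.2 (control of the space-time $L^{p+1}$ norm of $w$).** Let $N,p,q,M$ be as above. There are a number $S_3=S_3(N,p,q,M)\in\mathbb R$ and a real-valued function $K_1$ of two real variables, determined by $N,p,q,M$ only, such that the following holds for all $f,g$ as above, every blow-up solution $u$ of (1.1) as above, every non-characteristic point $x_0$ with constant $\delta_0$ and every $T_0\in(0,T(x_0)]$. Put $\widehat s_3=\max(S_3,-\log T_0)$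 and $t_3=T_0-e^{-\widehat s_3}$. Then for all $s\ge 1+\widehat s_3$, $$\int_s^{s+1}\int_B|w(y,\sigma)|^{p+1}\rho(y)\,dy\,d\sigma\;\le\;K_1\Big(\widehat s_3,\ \|(u(t_3),u_t(t_3))\|_{H^1\times L^2\left(B\left(x_0,\,e^{-\widehat s_3}/\delta_0\right)\right)}\Big).$$ -/

import Mathlib

open Set Filter Topology MeasureTheory
open scoped ContDiff ENNReal NNReal

namespace HamzaZaag

noncomputable section

/-- The space `ℝ^N` with its Euclidean norm. -/
abbrev E (N : ℕ) : Type := EuclideanSpace ℝ (Fin N)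

/-- The part `0 ≤ t < T(x)` of space-time below the graph of `T`; points are written `(x, t)`. -/
def domain {N : ℕ} (T : E N → ℝ) : Set (E N × ℝ) :=
  {z | 0 ≤ z.2 ∧ z.2 < T z.1}

/-- The section at time `t` of the region below the graph of `T`. -/
def slice {N : ℕ} (T : E N → ℝ) (t : ℝ) : Set (E N) := {x | t < T x}

/-- Smooth real functions with compact support contained in `Ω`. -/
structure IsTest {N : ℕ} (Ω : Set (E N)) (ψ : E N → ℝ) : Prop where
  smooth : ContDiff ℝ ∞ ψ
  compact : HasCompactSupport ψ
  support_subset : tsupport ψ ⊆ Ω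

/-- `G` is the weak (distributional) gradient of `a` on the open set `Ω`. -/
def IsWeakGradientOn {N : ℕ} (Ω : Set (E N)) (a : E N → ℝ) (G : E N → E N) : Prop :=
  ∀ ψ : E N → ℝ, IsTest Ω ψ → ∀ e : E N,
    ∫ x, a x * fderiv ℝ ψ x e = - ∫ x, inner ℝ (G x) e * ψ x

/-- The uniformly local space `L²_{loc,u}(ℝ^N)`. -/
def MemL2LocU {N : ℕ} {F : Type*} [NormedAddCommGroup F] (a : E N → F) : Prop :=
  AEStronglyMeasurable a volume ∧
    (⨆ c : E N, ∫⁻ x in Metric.closedBall c 1, ‖a x‖ₑ ^ 2) < ⊤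

/-- The uniformly local space `H¹_{loc,u}(ℝ^N)`. -/
def MemH1LocU {N : ℕ} (a : E N → ℝ) : Prop :=
  MemL2LocU a ∧ ∃ G : E N → E N, IsWeakGradientOn univ a G ∧ MemL2LocU G

/-- `t ↦ h t` is continuous with values in `L²_loc`, locally in the region below the graph of `T`:
for all `τ ≥ 0` and all compact `K` with `[0, τ] × K` below the graph, `h ∈ C([0, τ]; L²(K))`. -/
structure ContL2Loc {N : ℕ} {F : Type*} [NormedAddCommGroup F] (T : E N → ℝ)
    (h : ℝ → E N → F) : Prop where
  meas : AEStronglyMeasurable (fun z : E N × ℝ => h z.2 z.1) (volume.restrict (domain T))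
  memLp : ∀ τ : ℝ, 0 ≤ τ → ∀ K : Set (E N), IsCompact K → K ⊆ slice T τ →
    ∀ t ∈ Icc 0 τ, MemLp (h t) 2 (volume.restrict K)
  cont : ∀ τ : ℝ, 0 ≤ τ → ∀ K : Set (E N), IsCompact K → K ⊆ slice T τ →
    ∀ t ∈ Icc 0 τ, Tendsto (fun t' => eLpNorm (h t' - h t) 2 (volume.restrict K))
      (𝓝[Icc 0 τ] t) (𝓝 0)

/-- The right-hand side `|u|^{p-1} u + f(u) + g(u_t)`, for the values `a` of `u` and `b` of `u_t`. -/
def source (p : ℝ) (f g : ℝ → ℝ) (a b : ℝ) : ℝ := |a| ^ (p - 1) * a + f a + g b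

/-- `u` is a (strong energy, i.e. mild) solution of
`u_tt = Δu + |u|^{p-1} u + f(u) + g(u_t)`, `(u, u_t)(0) = (u₀, u₁)`,
on the region `0 ≤ t < T(x)`, where `v = u_t` and `G = ∇u`. As usual `(u, u_t)` is continuous in
time with values in `H¹ × L²`, the right-hand side is `L¹` in time with values in `L²` (everything
locally in the region), and the equation holds weakly. The region is an influence
domain: with a point it contains the backward light cone of that point, i.e. `T` is `1`-Lipschitz. -/
structure IsSolution {N : ℕ} (p : ℝ) (f g : ℝ → ℝ) (u₀ u₁ : E N → ℝ) (T : E N → ℝ)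
    (u v : ℝ → E N → ℝ) (G : ℝ → E N → E N) : Prop where
  T_pos : ∀ x, 0 < T x
  T_lip : LipschitzWith 1 T
  init_u : u 0 =ᵐ[volume] u₀
  init_v : v 0 =ᵐ[volume] u₁
  cont_u : ContL2Loc T u
  cont_v : ContL2Loc T v
  cont_G : ContL2Loc T G
  grad : ∀ t : ℝ, 0 ≤ t → IsWeakGradientOn (slice T t) (u t) (G t)
  source_L1L2 : ∀ τ : ℝ, 0 ≤ τ → ∀ K : Set (E N), IsCompact K → K ⊆ slice T τ →
    ∫⁻ t in Icc 0 τ, eLpNorm (fun x => source p f g (u t x) (v t x)) 2 (volume.restrict K) < ⊤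
  /- `∂_t u = v` -/
  evol_u : ∀ τ : ℝ, 0 ≤ τ → ∀ ψ : E N → ℝ, IsTest (slice T τ) ψ →
    (∫ x, u τ x * ψ x) - ∫ x, u₀ x * ψ x = ∫ t in (0 : ℝ)..τ, ∫ x, v t x * ψ x
  /- `∂_t v = div G + source` -/
  evol_v : ∀ τ : ℝ, 0 ≤ τ → ∀ ψ : E N → ℝ, IsTest (slice T τ) ψ →
    (∫ x, v τ x * ψ x) - ∫ x, u₁ x * ψ x =
      ∫ t in (0 : ℝ)..τ, ((- ∫ x, fderiv ℝ ψ x (G t x)) +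
        ∫ x, source p f g (u t x) (v t x) * ψ x)

/-- `u` is a blow-up solution, whose maximal influence domain is the region below the graph of
the (finite) function `T`: `u` solves the Cauchy problem there, with data in
`H¹_{loc,u} × L²_{loc,u}`, and cannot be extended as a solution to a larger such region. -/
structure IsBlowupSolution {N : ℕ} (p : ℝ) (f g : ℝ → ℝ) (u₀ u₁ : E N → ℝ) (T : E N → ℝ)
    (u v : ℝ → E N → ℝ) (G : ℝ → E N → E N) : Prop where
  data_u : MemH1LocU u₀
  data_v : MemL2LocU u₁
  sol : IsSolution p f g u₀ u₁ T u v G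
  maximal : ∀ (T' : E N → ℝ) (u' v' : ℝ → E N → ℝ) (G' : ℝ → E N → E N),
    IsSolution p f g u₀ u₁ T' u' v' G' → (∀ x, T x ≤ T' x) →
    (∀ t : ℝ, 0 ≤ t → u' t =ᵐ[volume.restrict (slice T t)] u t) → T' = T

/-- The truncated backward cone with vertex `(x, t)` and slope `δ`, without its vertex. -/
def cone {N : ℕ} (x : E N) (t δ : ℝ) : Set (E N × ℝ) :=
  {z | z ≠ (x, t) ∧ 0 ≤ z.2 ∧ z.2 ≤ t - δ * ‖z.1 - x‖}

/-- `x₀` is a non characteristic point, with the constant `δ₀ ∈ (0, 1)`. -/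
def NonCharacteristic {N : ℕ} (T : E N → ℝ) (x₀ : E N) (δ₀ : ℝ) : Prop :=
  0 < δ₀ ∧ δ₀ < 1 ∧ cone x₀ (T x₀) δ₀ ⊆ domain T

/-- The function `w_{x₀,T₀}(y, s)` in similarity variables
`y = (x - x₀) / (T₀ - t)`, `s = -log (T₀ - t)`, `u(x, t) = (T₀ - t)^{-2/(p-1)} w_{x₀,T₀}(y, s)`. -/
def simW {N : ℕ} (p : ℝ) (u : ℝ → E N → ℝ) (x₀ : E N) (T₀ : ℝ) (y : E N) (s : ℝ) : ℝ :=
  Real.exp (-s) ^ (2 / (p - 1)) * u (T₀ - Real.exp (-s)) (x₀ + Real.exp (-s) • y)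

/-- The exponent `α = 2/(p-1) - (N-1)/2`. -/
def alpha (N : ℕ) (p : ℝ) : ℝ := 2 / (p - 1) - ((N : ℝ) - 1) / 2

/-- The weight `ρ(y) = (1 - |y|²)^α`. -/
def rho {N : ℕ} (p : ℝ) (y : E N) : ℝ := (1 - ‖y‖ ^ 2) ^ alpha N p

/-- The norm of `(u(t), u_t(t))` in `H¹ × L²` of the ball `B(x₀, r)`. -/
def energyNorm {N : ℕ} (u v : ℝ → E N → ℝ) (G : ℝ → E N → E N) (t : ℝ) (x₀ : E N) (r : ℝ) : ℝ :=
  Real.sqrt (∫ x in Metric.ball x₀ r, (u t x ^ 2 + ‖G t x‖ ^ 2 + v t x ^ 2))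

/-- The starting time `ŝ₃(T₀) = max (S₃, -log T₀)`. -/
def sHat (S₃ T₀ : ℝ) : ℝ := max S₃ (-Real.log T₀)

end

end HamzaZaag

/-! ### Mollification in L². -/

namespace HamzaZaag

noncomputable section

/-! Put r = b - t for a light cone with vertex (x₀, b), c₀ = 2/(p-1) and w(y,s) = r^{c₀} u. For the
pure power equation the Antonini–Merle energy E = ½∫(w_s² + |∇w|² - (y·∇w)² + c₀(c₀+1)w²)ρ -
∫|w|^{p+1}ρ/(p+1) satisfies dE/ds = -2α∫w_s² ρ/(1-|y|²). The terms f and g perturb this by r^γ =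
e^{-γs} times quantities that are not all controlled by the dissipation, in particular ∫|w|^{p+1}ρ.
The remedy is to subtract η r^γ J with J = ∫ w w_s ρ: by the energy, dJ/ds equals 2∫w_s²ρ - 2E +
(1-2/(p+1))∫|w|^{p+1}ρ up to harmless terms, so the new term supplies the missing negative multiple
of r^γ∫|w|^{p+1}ρ, and the remaining multiple of r^γ E is removed by an integrating factor exp(C
r^γ). The modified energy then decreases up to integrable errors and dissipates ∫w_s²ρ/(1-|y|²)
(`IsBalance.decay`, `Trajectory.rate_le`).

A lower bound of the modified energy is also needed. Here it comes from cones with vertex time b <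
T₀ ≤ T(x₀): such a vertex is interior, |u|^{p+1} is integrable around it, and scaling gives
∫|w|^{p+1}ρ = O(r^{2α+1}), so this term tends to 0 and the energy cannot be very negative near the
vertex (`IsSolution.eventually_qP_le`, `IsBalance.ge_of_small`). Monotonicity carries the bound back
in time. With the upper bound at the initial time, where the nonlinear term has a good sign, both
the modified energy and the total dissipation are bounded by the H¹×L² data
(`Trajectory.abs_modE_le`). Integrating the formula for dJ/ds against a squared cut-off in s bounds
∫∫|w|^{p+1}ρ on a window of unit length (`Trajectory.lintegral_le`). All constants are independent
of b, and Fatou's lemma gives the claim as b increases to T₀ (`lintegral_simW_le_of_approx`).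

Since u is only a weak solution, the identities need justification. They are combinations of
multiplier identities in the original variables (energy, momentum, u u_t, u², and the primitive of
the nonlinearity), each proved for mollifications and passed to the limit (`LWave.energy_identity`,
`LWave.momentum_identity` and relatives). No Sobolev embedding is used: the equation itself puts
|u|^p into L¹ in time with values in L² (`IsSolution.isFam_rpow`), and testing the power with u_t
then bounds the L^{p+1} norm (`LWave.power_bound`). The weight (1-|y|²)^α is replaced by smooth
profiles vanishing near the cone, whose error tends to 0 for a fixed truncated cone
(`exists_isProfile`, `IsSolution.eventually_qErr_le`). The boundary degeneracy of |∇w|² - (y·∇w)² is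
compensated by the factor 1/(1-|y|²) in the dissipation (`cross_le`). -/

/-- The `L²` norm of a function on `ℝ^N`, as a real number. -/
def nrm {N : ℕ} (f : E N → ℝ) : ℝ := (eLpNorm f 2 volume).toReal

/-- Convolution of `f` with the kernel `k`. -/
def cv {N : ℕ} (k f : E N → ℝ) (x : E N) : ℝ := ∫ z, f z * k (x - z)

/-- A sequence of smooth bump functions concentrating at the origin. -/
def bump (N n : ℕ) : ContDiffBump (0 : E N) where
  rIn := 1 / (2 * ((n : ℝ) + 1))
  rOut := 1 / ((n : ℝ) + 1)
  rIn_pos := by positivity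
  rIn_lt_rOut := by
    apply one_div_lt_one_div_of_lt <;> linarith [(Nat.cast_nonneg n : (0 : ℝ) ≤ n)]

/-- The standard mollifiers. -/
def mol (N n : ℕ) : E N → ℝ := (bump N n).normed volume

variable {N : ℕ}

theorem nrm_nonneg (f : E N → ℝ) : 0 ≤ nrm f := ENNReal.toReal_nonneg

theorem mol_contDiff (n : ℕ) : ContDiff ℝ ∞ (mol N n) := (bump N n).contDiff_normed

theorem mol_compact (n : ℕ) : HasCompactSupport (mol N n) := (bump N n).hasCompactSupport_normed

theorem mol_nonneg (n : ℕ) (x : E N) : 0 ≤ mol N n x := (bump N n).nonneg_normed x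

theorem mol_integral (n : ℕ) : ∫ x, mol N n x = 1 := (bump N n).integral_normed

theorem mol_support (n : ℕ) (x : E N) (hx : 1 / ((n : ℝ) + 1) ≤ ‖x‖) : mol N n x = 0 := by
  have h : Function.support (mol N n) = Metric.ball 0 (bump N n).rOut :=
    (bump N n).support_normed_eq
  by_contra h0
  have : x ∈ Function.support (mol N n) := h0
  rw [h, mem_ball_zero_iff] at this
  exact absurd this (not_lt.2 hx)

theorem mol_tsupport (n : ℕ) : tsupport (mol N n) = Metric.closedBall 0 (1 / ((n : ℝ) + 1)) :=
  (bump N n).tsupport_normed_eq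

theorem mol_bump_tendsto : Tendsto (fun n => (bump N n).rOut) atTop (𝓝 0) :=
  tendsto_one_div_add_atTop_nhds_zero_nat

theorem cv_eq_convolution (k f : E N → ℝ) :
    cv k f = convolution f k (ContinuousLinearMap.mul ℝ ℝ) volume := by
  ext x; simp [cv, convolution_def]

theorem cv_swap (k f : E N → ℝ) (x : E N) : cv k f x = ∫ z, k z * f (x - z) := by
  rw [cv, ← integral_sub_left_eq_self _ _ x]
  simp [mul_comm]

theorem locInt {f : E N → ℝ} (hf : MemLp f 2 volume) : LocallyIntegrable f volume :=
  hf.locallyIntegrable (by norm_num)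

theorem cv_contDiff {k f : E N → ℝ} (hk : ContDiff ℝ ∞ k) (hc : HasCompactSupport k)
    (hf : MemLp f 2 volume) : ContDiff ℝ ∞ (cv k f) := by
  rw [cv_eq_convolution]
  exact hc.contDiff_convolution_right _ (locInt hf) hk

/-- The derivative falls on the kernel, so no regularity of `f` is needed and the derivative is
again a pairing of `f` with a test function, which is what the weak equations control. -/
theorem cv_fderiv {k f : E N → ℝ} (hk : ContDiff ℝ ∞ k) (hc : HasCompactSupport k)
    (hf : MemLp f 2 volume) (x e : E N) :
    fderiv ℝ (cv k f) x e = cv (fun y => fderiv ℝ k y e) f x := by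
  rw [cv_eq_convolution, cv_eq_convolution]
  rw [(hc.hasFDerivAt_convolution_right (ContinuousLinearMap.mul ℝ ℝ) (locInt hf)
    (hk.of_le (by simp)) x).fderiv]
  exact convolution_precompR_apply _ (locInt hf) (hc.fderiv ℝ) (hk.continuous_fderiv (by simp)) x e

theorem abs_integral_mul_le {c f g : E N → ℝ} {C : ℝ} (hc : ∀ x, |c x| ≤ C)
    (hf : MemLp f 2 volume) (hg : MemLp g 2 volume) :
    |∫ x, c x * (f x * g x)| ≤ C * (nrm f * nrm g) := by
  have hC : 0 ≤ C := (abs_nonneg _).trans (hc 0)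
  have h1 : ∫⁻ x, ‖f x * g x‖ₑ ≤ eLpNorm f 2 volume * eLpNorm g 2 volume := by
    have := eLpNorm_smul_le_mul_eLpNorm (p := 2) (q := 2) (r := 1) hg.1 hf.1
    simpa [eLpNorm_one_eq_lintegral_enorm] using this
  have hfi : Integrable (fun x => f x * g x) := hf.integrable_mul hg
  have h2 : ∫ x, |f x * g x| ≤ nrm f * nrm g := by
    have := integral_norm_eq_lintegral_enorm hfi.1
    simp only [Real.norm_eq_abs] at this
    rw [this, nrm, nrm, ← ENNReal.toReal_mul]
    exact ENNReal.toReal_mono (ENNReal.mul_ne_top hf.2.ne hg.2.ne) h1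
  calc |∫ x, c x * (f x * g x)| ≤ ∫ x, C * |f x * g x| := by
        rw [← Real.norm_eq_abs]
        refine norm_integral_le_of_norm_le (hfi.abs.const_mul C) (Eventually.of_forall fun x => ?_)
        rw [Real.norm_eq_abs, abs_mul]
        exact mul_le_mul_of_nonneg_right (hc x) (abs_nonneg _)
    _ = C * ∫ x, |f x * g x| := integral_const_mul _ _
    _ ≤ _ := mul_le_mul_of_nonneg_left h2 hC

theorem memLp_two_of_compact {k : E N → ℝ} (hk : Continuous k) (hc : HasCompactSupport k) :
    MemLp k 2 volume := hk.memLp_of_hasCompactSupport hc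

theorem cv_bound {k f : E N → ℝ} (hk : Continuous k) (hc : HasCompactSupport k)
    (hf : MemLp f 2 volume) (x : E N) : |cv k f x| ≤ nrm k * nrm f := by
  have hmp : MeasurePreserving (fun z : E N => x - z) volume volume :=
    Measure.measurePreserving_sub_left volume x
  have hk2 := memLp_two_of_compact hk hc
  have h1 : MemLp (fun z => k (x - z)) 2 volume := hk2.comp_measurePreserving hmp
  have h2 : nrm (fun z => k (x - z)) = nrm k := by
    unfold nrm
    congr 1
    exact eLpNorm_comp_measurePreserving hk2.1 hmp
  have := abs_integral_mul_le (c := fun _ => (1 : ℝ)) (C := 1) (by simp) hf h1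
  rw [h2] at this
  simpa [cv, mul_comm] using this

/-- Translation is continuous in `L²`. -/
theorem tendsto_translate {f : E N → ℝ} (hf : MemLp f 2 volume) :
    Tendsto (fun z : E N => eLpNorm (fun x => f (x - z) - f x) 2 volume) (𝓝 0) (𝓝 0) := by
  -- Translations form a continuous family of measure preserving maps, so continuity of composition
  -- in L² applies.
  let g : E N → C(E N, E N) := fun z => ⟨fun x => x - z, by fun_prop⟩
  have hgm : ∀ z, MeasurePreserving (g z) (volume : Measure (E N)) volume := fun z =>
    measurePreserving_sub_right volume z
  have hg : Tendsto g (𝓝 0) (𝓝 (g 0)) := by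
    have : Continuous g := ContinuousMap.continuous_of_continuous_uncurry _ (by
      change Continuous fun p : E N × E N => p.2 - p.1
      fun_prop)
    exact this.tendsto 0
  have key := Filter.Tendsto.compMeasurePreservingLp
    (tendsto_const_nhds (x := hf.toLp f) (f := 𝓝 (0 : E N))) hg hgm (hgm 0) (by norm_num)
  have h0 : Lp.compMeasurePreserving (g 0) (hgm 0) (hf.toLp f) = hf.toLp f := by
    ext1
    refine (Lp.coeFn_compMeasurePreserving _ _).trans ?_
    simp [g, Function.comp_def]
  rw [h0] at key
  have key' : Tendsto (fun z : E N => (hf.comp_measurePreserving (hgm z)).toLp _) (𝓝 0)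
      (𝓝 (hf.toLp f)) := key
  rw [Lp.tendsto_Lp_iff_tendsto_eLpNorm''] at key'
  exact key'

/-- Cauchy–Schwarz with the constant 1, for the probability measure with density η. -/
theorem sq_lintegral_le {η : E N → ℝ≥0∞} (hη : Measurable η) (h1 : ∫⁻ z, η z = 1)
    {F : E N → ℝ≥0∞} (hF : AEMeasurable F volume) :
    (∫⁻ z, η z * F z) ^ 2 ≤ ∫⁻ z, η z * F z ^ 2 := by
  have := ENNReal.lintegral_mul_le_Lp_mul_Lq (volume.withDensity η) Real.HolderConjugate.two_two
    (f := F) (g := fun _ => 1) (hF.mono_ac (withDensity_absolutelyContinuous _ _))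
    aemeasurable_const
  have hm : (volume.withDensity η) univ = 1 := by simp [h1]
  simp only [Pi.mul_apply, mul_one, ENNReal.one_rpow, lintegral_const, hm] at this
  rw [lintegral_withDensity_eq_lintegral_mul₀ hη.aemeasurable hF,
    lintegral_withDensity_eq_lintegral_mul₀ hη.aemeasurable (hF.pow_const _)] at this
  simp only [Pi.mul_apply, ENNReal.rpow_two] at this
  calc _ ≤ ((∫⁻ z, η z * F z ^ 2) ^ (1 / 2 : ℝ)) ^ 2 := by gcongr
    _ = _ := by
      rw [← ENNReal.rpow_two, ← ENNReal.rpow_mul]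
      norm_num

theorem eLpNorm_two_sq (f : E N → ℝ) : eLpNorm f 2 volume ^ 2 = ∫⁻ x, ‖f x‖ₑ ^ 2 := by
  rw [eLpNorm_eq_lintegral_rpow_enorm_toReal (by norm_num) (by norm_num)]
  rw [← ENNReal.rpow_two, ← ENNReal.rpow_mul]
  norm_num

theorem lintegral_mol (n : ℕ) : ∫⁻ z, ENNReal.ofReal (mol N n z) = 1 := by
  rw [← ofReal_integral_eq_lintegral_ofReal
    ((mol_contDiff n).continuous.integrable_of_hasCompactSupport (mol_compact n))
    (Eventually.of_forall (mol_nonneg n)), mol_integral]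
  simp

/-- A mollified `L²` function differs from the function by at most the largest `L²` distance to a
small translate. -/
theorem eLpNorm_cv_sub_le {f : E N → ℝ} (hf : MemLp f 2 volume) (n : ℕ) {δ : ℝ≥0∞}
    (hδ : ∀ z : E N, ‖z‖ < 1 / ((n : ℝ) + 1) →
      eLpNorm (fun x => f (x - z) - f x) 2 volume ≤ δ) :
    eLpNorm (cv (mol N n) f - f) 2 volume ≤ δ := by
  have hmolc := (mol_contDiff (N := N) n).continuous
  have hsm : AEStronglyMeasurable (fun q : E N × E N => f (q.1 - q.2)) (volume.prod volume) :=
    hf.1.comp_quasiMeasurePreserving (quasiMeasurePreserving_sub_of_right_invariant volume volume)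
  have hsm2 : AEStronglyMeasurable (fun q : E N × E N => f q.1) (volume.prod volume) :=
    hf.1.comp_quasiMeasurePreserving Measure.quasiMeasurePreserving_fst
  have hη : Measurable fun z => ENNReal.ofReal (mol N n z) := hmolc.measurable.ennreal_ofReal
  have hpt : ∀ x, ‖cv (mol N n) f x - f x‖ₑ ≤
      ∫⁻ z, ENNReal.ofReal (mol N n z) * ‖f (x - z) - f x‖ₑ := by
    intro x
    have hmp : MeasurePreserving (fun z : E N => x - z) volume volume :=
      Measure.measurePreserving_sub_left volume x
    have i1 : Integrable (fun z => mol N n z * f (x - z)) :=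
      (memLp_two_of_compact hmolc (mol_compact n)).integrable_mul (hf.comp_measurePreserving hmp)
    have i2 : Integrable (fun z => mol N n z * f x) :=
      (hmolc.integrable_of_hasCompactSupport (mol_compact n)).mul_const _
    have : cv (mol N n) f x - f x = ∫ z, mol N n z * (f (x - z) - f x) := by
      have e : ∫ z, mol N n z * f x = f x := by
        rw [integral_mul_const, mol_integral, one_mul]
      rw [cv_swap, ← e, ← integral_sub i1 i2]
      simp_rw [e, mul_sub]
    rw [this]
    refine (enorm_integral_le_lintegral_enorm _).trans (le_of_eq ?_)
    congr 1; ext z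
    rw [enorm_mul, Real.enorm_of_nonneg (mol_nonneg n z)]
  have hx2 : ∀ᵐ x ∂(volume : Measure (E N)), ‖cv (mol N n) f x - f x‖ₑ ^ 2 ≤
      ∫⁻ z, ENNReal.ofReal (mol N n z) * ‖f (x - z) - f x‖ₑ ^ 2 := by
    refine Eventually.of_forall fun x => ?_
    have hmp : MeasurePreserving (fun z : E N => x - z) volume volume :=
      Measure.measurePreserving_sub_left volume x
    refine (pow_le_pow_left' (hpt x) 2).trans (sq_lintegral_le hη (lintegral_mol n) ?_)
    exact ((hf.1.comp_measurePreserving hmp).sub aestronglyMeasurable_const).enorm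
  -- Jensen's inequality in z followed by Tonelli reduces the claim to single translates, weighted
  -- by the mollifier; only translates inside its support count.
  have hmain : eLpNorm (cv (mol N n) f - f) 2 volume ^ 2 ≤ δ ^ 2 := by
    rw [eLpNorm_two_sq]
    calc ∫⁻ x, ‖(cv (mol N n) f - f) x‖ₑ ^ 2 
        ≤ ∫⁻ x, ∫⁻ z, ENNReal.ofReal (mol N n z) * ‖f (x - z) - f x‖ₑ ^ 2 :=
          lintegral_mono_ae hx2
      _ = ∫⁻ z, ∫⁻ x, ENNReal.ofReal (mol N n z) * ‖f (x - z) - f x‖ₑ ^ 2 := by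
          apply lintegral_lintegral_swap
          exact ((hη.comp measurable_snd).aemeasurable).mul
            ((hsm.sub hsm2).enorm.pow_const _)
      _ ≤ ∫⁻ z, ENNReal.ofReal (mol N n z) * δ ^ 2 := by
          refine lintegral_mono fun z => ?_
          rw [lintegral_const_mul' _ _ ENNReal.ofReal_ne_top]
          by_cases hz : ‖z‖ < 1 / ((n : ℝ) + 1)
          · gcongr
            rw [← eLpNorm_two_sq (fun x => f (x - z) - f x)]
            exact pow_le_pow_left' (hδ z hz) 2
          · rw [mol_support n z (not_lt.1 hz)]; simp
      _ = δ ^ 2 := by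
          rw [lintegral_mul_const _ hη, lintegral_mol, one_mul]
  exact (ENNReal.pow_le_pow_left_iff (by norm_num)).1 hmain

theorem cv_aesm {k f : E N → ℝ} (hk : ContDiff ℝ ∞ k) (hc : HasCompactSupport k)
    (hf : MemLp f 2 volume) : AEStronglyMeasurable (cv k f) volume :=
  (cv_contDiff hk hc hf).continuous.aestronglyMeasurable

theorem tendsto_cv_mol {f : E N → ℝ} (hf : MemLp f 2 volume) :
    Tendsto (fun n => eLpNorm (cv (mol N n) f - f) 2 volume) atTop (𝓝 0) := by
  rw [ENNReal.tendsto_nhds_zero]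
  intro ε hε
  have h := (ENNReal.tendsto_nhds_zero.1 (tendsto_translate hf)) ε hε
  obtain ⟨r, hr, hr'⟩ := Metric.eventually_nhds_iff.1 h
  have h2 := (tendsto_one_div_add_atTop_nhds_zero_nat (𝕜 := ℝ)).eventually_lt_const hr
  filter_upwards [h2] with n hn
  refine eLpNorm_cv_sub_le hf n fun z hz => hr' ?_
  rw [dist_zero_right]
  exact hz.trans hn

theorem eLpNorm_cv_sub_le_two {f : E N → ℝ} (hf : MemLp f 2 volume) (n : ℕ) :
    eLpNorm (cv (mol N n) f - f) 2 volume ≤ 2 * eLpNorm f 2 volume := by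
  refine eLpNorm_cv_sub_le hf n fun z _ => ?_
  have hmp : MeasurePreserving (fun x : E N => x - z) volume volume :=
    measurePreserving_sub_right volume z
  have h := hf.comp_measurePreserving hmp
  refine (eLpNorm_sub_le h.1 hf.1 (by norm_num)).trans (le_of_eq ?_)
  rw [eLpNorm_comp_measurePreserving hf.1 hmp, two_mul]

theorem memLp_cv {f : E N → ℝ} (hf : MemLp f 2 volume) (n : ℕ) :
    MemLp (cv (mol N n) f) 2 volume := by
  have h : MemLp (cv (mol N n) f - f) 2 volume :=
    ⟨(cv_aesm (mol_contDiff n) (mol_compact n) hf).sub hf.1,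
      (eLpNorm_cv_sub_le_two hf n).trans_lt (ENNReal.mul_lt_top (by norm_num) hf.2)⟩
  simpa using h.add hf

/-- The constant 3 is the crude 2 from comparing `f` with its translates, plus 1 for `f` itself.
Only uniformity in `n` matters. -/
theorem nrm_cv_le {f : E N → ℝ} (hf : MemLp f 2 volume) (n : ℕ) :
    nrm (cv (mol N n) f) ≤ 3 * nrm f := by
  have h : eLpNorm (cv (mol N n) f) 2 volume ≤ 3 * eLpNorm f 2 volume := by
    have h1 : eLpNorm ((cv (mol N n) f - f) + f) 2 volume ≤ _ :=
      eLpNorm_add_le ((memLp_cv hf n).1.sub hf.1) hf.1 (by norm_num)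
    simp only [sub_add_cancel] at h1
    refine h1.trans ((add_le_add (eLpNorm_cv_sub_le_two hf n) le_rfl).trans (le_of_eq ?_))
    ring
  have := ENNReal.toReal_mono (ENNReal.mul_ne_top (by norm_num) hf.2.ne) h
  simpa [nrm] using this

theorem tendsto_nrm_cv {f : E N → ℝ} (hf : MemLp f 2 volume) :
    Tendsto (fun n => nrm (cv (mol N n) f - f)) atTop (𝓝 0) := by
  have := (ENNReal.tendsto_toReal ENNReal.zero_ne_top).comp (tendsto_cv_mol hf)
  simpa [nrm, Function.comp_def] using this

/-- Convergence almost everywhere is needed besides L² convergence to pass to the limit in s(u) for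
a merely continuous s. The ratio of the radii of `bump` is 2, hence `K := 2`. -/
theorem ae_tendsto_cv {f : E N → ℝ} (hf : MemLp f 2 volume) :
    ∀ᵐ x ∂(volume : Measure (E N)), Tendsto (fun n => cv (mol N n) f x) atTop (𝓝 (f x)) := by
  have h := ContDiffBump.ae_convolution_tendsto_right_of_locallyIntegrable (K := 2)
    (mol_bump_tendsto (N := N)) (Eventually.of_forall fun n => by
      simp only [bump]
      apply le_of_eq
      field_simp) (locInt hf)
  filter_upwards [h] with x hx
  refine hx.congr fun n => ?_
  rw [cv_swap, convolution_def]
  rfl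

end

end HamzaZaag

/-! ### Dominated limits in time and the product rule for mollified families. -/

namespace HamzaZaag

noncomputable section

/-- The weighted bilinear form `∫ c f g`. -/
def bil {N : ℕ} (c f g : E N → ℝ) : ℝ := ∫ x, c x * (f x * g x)

/-- Lebesgue measure on the strip `(t₁, t₂] × ℝ^N`. -/
def strip (N : ℕ) (t₁ t₂ : ℝ) : Measure (ℝ × E N) := (volume.restrict (Ioc t₁ t₂)).prod volume

/-- `F n` converges to `f` on `(t₁, t₂]` almost everywhere and dominatedly. -/
structure DomLim (t₁ t₂ : ℝ) (F : ℕ → ℝ → ℝ) (f : ℝ → ℝ) : Prop where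
  meas : ∀ n, AEStronglyMeasurable (F n) (volume.restrict (Ioc t₁ t₂))
  bd : ∃ g : ℝ → ℝ, IntegrableOn g (Ioc t₁ t₂) ∧
    ∀ n, ∀ᵐ t ∂(volume.restrict (Ioc t₁ t₂)), |F n t| ≤ g t
  lim : ∀ᵐ t ∂(volume.restrict (Ioc t₁ t₂)), Tendsto (fun n => F n t) atTop (𝓝 (f t))

namespace DomLim

variable {t₁ t₂ : ℝ} {F F' : ℕ → ℝ → ℝ} {f f' : ℝ → ℝ}

theorem add (h : DomLim t₁ t₂ F f) (h' : DomLim t₁ t₂ F' f') :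
    DomLim t₁ t₂ (fun n t => F n t + F' n t) (fun t => f t + f' t) where
  meas n := (h.meas n).add (h'.meas n)
  bd := by
    obtain ⟨g, hg, hb⟩ := h.bd
    obtain ⟨g', hg', hb'⟩ := h'.bd
    refine ⟨fun t => g t + g' t, hg.add hg', fun n => ?_⟩
    filter_upwards [hb n, hb' n] with t h1 h2
    exact (abs_add_le _ _).trans (add_le_add h1 h2)
  lim := by
    filter_upwards [h.lim, h'.lim] with t h1 h2
    exact h1.add h2

theorem const_mul (h : DomLim t₁ t₂ F f) (c : ℝ) :
    DomLim t₁ t₂ (fun n t => c * F n t) (fun t => c * f t) where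
  meas n := (h.meas n).const_mul c
  bd := by
    obtain ⟨g, hg, hb⟩ := h.bd
    refine ⟨fun t => |c| * g t, hg.const_mul _, fun n => ?_⟩
    filter_upwards [hb n] with t h1
    rw [abs_mul]
    exact mul_le_mul_of_nonneg_left h1 (abs_nonneg _)
  lim := by
    filter_upwards [h.lim] with t h1
    exact h1.const_mul c

theorem sub (h : DomLim t₁ t₂ F f) (h' : DomLim t₁ t₂ F' f') :
    DomLim t₁ t₂ (fun n t => F n t - F' n t) (fun t => f t - f' t) := by
  simpa [sub_eq_add_neg] using h.add (h'.const_mul (-1))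

theorem zero : DomLim t₁ t₂ (fun _ _ => 0) (fun _ => 0) where
  meas _ := aestronglyMeasurable_const
  bd := ⟨0, integrableOn_zero, fun _ => by simp⟩
  lim := by simp

theorem sum {ι : Type*} (s : Finset ι) {F : ι → ℕ → ℝ → ℝ} {f : ι → ℝ → ℝ}
    (h : ∀ i ∈ s, DomLim t₁ t₂ (F i) (f i)) :
    DomLim t₁ t₂ (fun n t => ∑ i ∈ s, F i n t) (fun t => ∑ i ∈ s, f i t) := by
  classical
  induction s using Finset.induction_on with
  | empty => simpa using zero
  | insert a s ha ih =>
    simp only [Finset.sum_insert ha]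
    exact (h a (Finset.mem_insert_self a s)).add
      (ih fun i hi => h i (Finset.mem_insert_of_mem hi))

/-- The limit inherits measurability and the dominating function, so each identity obtained as a
limit comes with its integrability. -/
theorem intervalIntegrable_lim (h : DomLim t₁ t₂ F f) (h12 : t₁ ≤ t₂) :
    IntervalIntegrable f volume t₁ t₂ := by
  rw [intervalIntegrable_iff_integrableOn_Ioc_of_le h12]
  obtain ⟨g, hg, hb⟩ := h.bd
  refine Integrable.mono' hg (aestronglyMeasurable_of_tendsto_ae atTop h.meas h.lim) ?_
  filter_upwards [ae_all_iff.2 hb, h.lim] with t h1 h2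
  exact le_of_tendsto h2.abs (Eventually.of_forall h1)

theorem tendsto (h : DomLim t₁ t₂ F f) (h12 : t₁ ≤ t₂) :
    Tendsto (fun n => ∫ t in t₁..t₂, F n t) atTop (𝓝 (∫ t in t₁..t₂, f t)) := by
  obtain ⟨g, hg, hb⟩ := h.bd
  simp only [intervalIntegral.integral_of_le h12]
  exact tendsto_integral_of_dominated_convergence g h.meas hg hb h.lim

end DomLim

/-- A measurable family of `L²` functions whose norm is bounded by `β`. -/
structure IsFam {N : ℕ} (t₁ t₂ : ℝ) (A : ℝ → E N → ℝ) (β : ℝ → ℝ) : Prop where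
  meas : AEStronglyMeasurable (fun z : ℝ × E N => A z.1 z.2) (strip N t₁ t₂)
  bd : ∀ᵐ t ∂(volume.restrict (Ioc t₁ t₂)), MemLp (A t) 2 volume ∧ nrm (A t) ≤ β t

/-- A weight: continuous for `t ∈ [t₁, t₂]` and vanishing outside of `K`. -/
structure IsCoef {N : ℕ} (t₁ t₂ : ℝ) (K : Set (E N)) (c : ℝ → E N → ℝ) : Prop where
  cont : ContinuousOn (fun z : ℝ × E N => c z.1 z.2) (Icc t₁ t₂ ×ˢ univ)
  supp : ∀ t ∈ Icc t₁ t₂, ∀ x, x ∉ K → c t x = 0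

variable {N : ℕ} {t₁ t₂ : ℝ} {K : Set (E N)}

theorem ae_strip {P : ℝ → Prop} (h : ∀ᵐ t ∂(volume.restrict (Ioc t₁ t₂)), P t) :
    ∀ᵐ z ∂(strip N t₁ t₂), P z.1 :=
  Measure.quasiMeasurePreserving_fst.ae h

theorem ae_Ioc {P : ℝ → Prop} (h : ∀ t ∈ Icc t₁ t₂, P t) :
    ∀ᵐ t ∂(volume.restrict (Ioc t₁ t₂)), P t := by
  filter_upwards [ae_restrict_mem measurableSet_Ioc] with t ht
  exact h t (Ioc_subset_Icc_self ht)

namespace IsCoef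

variable {c c' : ℝ → E N → ℝ}

theorem bdd (hc : IsCoef t₁ t₂ K c) (hK : IsCompact K) :
    ∃ C : ℝ, 0 ≤ C ∧ ∀ t ∈ Icc t₁ t₂, ∀ x, |c t x| ≤ C := by
  obtain ⟨C, hC⟩ := (isCompact_Icc.prod hK).exists_bound_of_continuousOn
    (hc.cont.mono (prod_mono_right (subset_univ K)))
  refine ⟨max C 0, le_max_right _ _, fun t ht x => ?_⟩
  by_cases hx : x ∈ K
  · exact (hC (t, x) ⟨ht, hx⟩).trans (le_max_left _ _)
  · rw [hc.supp t ht x hx]; simp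

theorem cont_x (hc : IsCoef t₁ t₂ K c) {t : ℝ} (ht : t ∈ Icc t₁ t₂) : Continuous (c t) := by
  have : ContinuousOn (fun x : E N => c t x) univ :=
    hc.cont.comp (f := fun x : E N => (t, x)) (by fun_prop) (fun x _ => ⟨ht, mem_univ _⟩)
  exact continuousOn_univ.1 this

theorem meas (hc : IsCoef t₁ t₂ K c) :
    AEStronglyMeasurable (fun z : ℝ × E N => c z.1 z.2) (strip N t₁ t₂) := by
  have h : strip N t₁ t₂ = (volume : Measure (ℝ × E N)).restrict (Ioc t₁ t₂ ×ˢ univ) := by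
    rw [strip, Measure.volume_eq_prod, ← Measure.prod_restrict, Measure.restrict_univ]
  rw [h]
  exact (hc.cont.mono (prod_mono_left Ioc_subset_Icc_self)).aestronglyMeasurable
    (measurableSet_Ioc.prod MeasurableSet.univ)

theorem compact (hc : IsCoef t₁ t₂ K c) (hK : IsCompact K) {t : ℝ} (ht : t ∈ Icc t₁ t₂) :
    HasCompactSupport (c t) :=
  HasCompactSupport.intro hK fun x hx => hc.supp t ht x hx

end IsCoef

/-- Replacing the family by a jointly measurable representative changes the convolution only for a
null set of times, by Fubini. -/
theorem cv_meas {k : E N → ℝ} (hk : Continuous k) {A : ℝ → E N → ℝ}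
    (hA : AEStronglyMeasurable (fun z : ℝ × E N => A z.1 z.2) (strip N t₁ t₂)) :
    AEStronglyMeasurable (fun z : ℝ × E N => cv k (A z.1) z.2) (strip N t₁ t₂) := by
  obtain ⟨B, hB, hAB⟩ := hA
  refine ⟨fun z => ∫ y, B (z.1, y) * k (z.2 - y), ?_, ?_⟩
  · refine StronglyMeasurable.integral_prod_right
      (f := fun (z : ℝ × E N) (y : E N) => B (z.1, y) * k (z.2 - y)) ?_
    refine (hB.comp_measurable (by fun_prop : Measurable fun w : (ℝ × E N) × E N =>
      (w.1.1, w.2))).mul ?_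
    exact (hk.comp (by fun_prop : Continuous fun w : (ℝ × E N) × E N =>
      w.1.2 - w.2)).stronglyMeasurable
  · have h2 : ∀ᵐ t ∂(volume.restrict (Ioc t₁ t₂)), ∀ᵐ y ∂(volume : Measure (E N)),
        A t y = B (t, y) := Measure.ae_ae_of_ae_prod hAB
    filter_upwards [ae_strip h2] with z hz
    apply integral_congr_ae
    filter_upwards [hz] with y hy
    rw [hy]

theorem cv_meas_time {k : E N → ℝ} (hk : Continuous k) {A : ℝ → E N → ℝ}
    (hA : AEStronglyMeasurable (fun z : ℝ × E N => A z.1 z.2) (strip N t₁ t₂)) (x : E N) :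
    AEStronglyMeasurable (fun t => cv k (A t) x) (volume.restrict (Ioc t₁ t₂)) := by
  refine AEStronglyMeasurable.integral_prod_right' (f := fun z : ℝ × E N => A z.1 z.2 * k (x - z.2))
    (μ := volume.restrict (Ioc t₁ t₂)) (hA.mul ?_)
  exact (hk.comp (by fun_prop : Continuous fun w : ℝ × E N => x - w.2)).aestronglyMeasurable

theorem bil_meas {c A B : ℝ → E N → ℝ}
    (hc : AEStronglyMeasurable (fun z : ℝ × E N => c z.1 z.2) (strip N t₁ t₂))
    (hA : AEStronglyMeasurable (fun z : ℝ × E N => A z.1 z.2) (strip N t₁ t₂))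
    (hB : AEStronglyMeasurable (fun z : ℝ × E N => B z.1 z.2) (strip N t₁ t₂)) :
    AEStronglyMeasurable (fun t => bil (c t) (A t) (B t)) (volume.restrict (Ioc t₁ t₂)) :=
  AEStronglyMeasurable.integral_prod_right'
    (f := fun z : ℝ × E N => c z.1 z.2 * (A z.1 z.2 * B z.1 z.2))
    (μ := volume.restrict (Ioc t₁ t₂)) (hc.mul (hA.mul hB))

theorem bil_integrable {c f g : E N → ℝ} (hc : Continuous c) (hcc : HasCompactSupport c)
    (hf : MemLp f 2 volume) (hg : MemLp g 2 volume) :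
    Integrable (fun x => c x * (f x * g x)) := by
  obtain ⟨C, hC⟩ := hc.bounded_above_of_compact_support hcc
  exact (hf.integrable_mul hg).bdd_mul hc.aestronglyMeasurable (Eventually.of_forall hC)

/-- Telescoping: one factor is replaced at a time, and the other stays bounded uniformly in `n`. -/
theorem bil_tendsto {c f g : E N → ℝ} (hc : Continuous c) (hcc : HasCompactSupport c)
    (hf : MemLp f 2 volume) (hg : MemLp g 2 volume) :
    Tendsto (fun n => bil c (cv (mol N n) f) (cv (mol N n) g)) atTop (𝓝 (bil c f g)) := by
  obtain ⟨C, hC⟩ := hc.bounded_above_of_compact_support hcc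
  rw [tendsto_iff_norm_sub_tendsto_zero]
  have hb : ∀ n, ‖bil c (cv (mol N n) f) (cv (mol N n) g) - bil c f g‖ ≤
      C * (nrm (cv (mol N n) f - f) * (3 * nrm g)) + C * (nrm f * nrm (cv (mol N n) g - g)) := by
    intro n
    have hF := memLp_cv hf n
    have hG := memLp_cv hg n
    have e : bil c (cv (mol N n) f) (cv (mol N n) g) - bil c f g =
        bil c (cv (mol N n) f - f) (cv (mol N n) g) + bil c f (cv (mol N n) g - g) := by
      unfold bil
      rw [← integral_sub (bil_integrable hc hcc hF hG) (bil_integrable hc hcc hf hg),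
        ← integral_add (bil_integrable hc hcc (hF.sub hf) hG)
          (bil_integrable hc hcc hf (hG.sub hg))]
      congr 1; ext x; simp only [Pi.sub_apply]; ring
    rw [e]
    refine (norm_add_le _ _).trans (add_le_add ?_ ?_)
    · refine (abs_integral_mul_le hC (hF.sub hf) hG).trans ?_
      have : 0 ≤ C := (norm_nonneg _).trans (hC 0)
      gcongr
      · exact nrm_nonneg _
      · exact nrm_cv_le hg n
    · exact abs_integral_mul_le hC hf (hG.sub hg)
  refine squeeze_zero (fun _ => norm_nonneg _) hb ?_
  have h1 := ((tendsto_nrm_cv hf).mul_const (3 * nrm g)).const_mul C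
  have h2 := ((tendsto_nrm_cv hg).const_mul (nrm f)).const_mul C
  simpa using h1.add h2

/-- Only the product of the two bounds has to be integrable. This admits the source, which is merely
L¹ in time, against a family bounded in L². -/
theorem domLim_bil {A B c : ℝ → E N → ℝ} {βA βB : ℝ → ℝ} (hK : IsCompact K)
    (hc : IsCoef t₁ t₂ K c) (hA : IsFam t₁ t₂ A βA) (hB : IsFam t₁ t₂ B βB)
    (hβ : IntegrableOn (fun t => βA t * βB t) (Ioc t₁ t₂)) :
    DomLim t₁ t₂ (fun n t => bil (c t) (cv (mol N n) (A t)) (cv (mol N n) (B t)))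
      (fun t => bil (c t) (A t) (B t)) where
  meas n := bil_meas hc.meas (cv_meas (mol_contDiff n).continuous hA.meas)
    (cv_meas (mol_contDiff n).continuous hB.meas)
  bd := by
    obtain ⟨C, hC0, hC⟩ := hc.bdd hK
    refine ⟨fun t => C * (9 * (βA t * βB t)), (hβ.const_mul 9).const_mul C, fun n => ?_⟩
    filter_upwards [hA.bd, hB.bd, ae_Ioc hC] with t h1 h2 h3
    refine (abs_integral_mul_le h3 (memLp_cv h1.1 n) (memLp_cv h2.1 n)).trans ?_
    have e1 := nrm_cv_le h1.1 n
    have e2 := nrm_cv_le h2.1 n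
    have n1 := nrm_nonneg (A t)
    have n2 := nrm_nonneg (B t)
    calc C * (nrm (cv (mol N n) (A t)) * nrm (cv (mol N n) (B t)))
        ≤ C * ((3 * βA t) * (3 * βB t)) := by
          gcongr
          · exact nrm_nonneg _
          · linarith
          · linarith
          · linarith
      _ = _ := by ring
  lim := by
    filter_upwards [hA.bd, hB.bd, ae_restrict_mem measurableSet_Ioc] with t h1 h2 h3
    have h4 := Ioc_subset_Icc_self h3
    exact bil_tendsto (hc.cont_x h4) (hc.compact hK h4) h1.1 h2.1

/-- A family which, at each point of `K`, is absolutely continuous in time with derivative `a`. -/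
structure PtAC {N : ℕ} (t₁ t₂ : ℝ) (K : Set (E N)) (A a : ℝ → E N → ℝ) : Prop where
  contA : ∀ t ∈ Icc t₁ t₂, Continuous (A t)
  measA : AEStronglyMeasurable (fun z : ℝ × E N => A z.1 z.2) (strip N t₁ t₂)
  meas : AEStronglyMeasurable (fun z : ℝ × E N => a z.1 z.2) (strip N t₁ t₂)
  meas_time : ∀ x ∈ K, AEStronglyMeasurable (fun t => a t x) (volume.restrict (Ioc t₁ t₂))
  bdd : ∃ C, ∀ t ∈ Icc t₁ t₂, ∀ x ∈ K, |A t x| ≤ C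
  bdd_deriv : ∃ β : ℝ → ℝ, IntegrableOn β (Ioc t₁ t₂) ∧
    ∀ᵐ t ∂(volume.restrict (Ioc t₁ t₂)), ∀ x ∈ K, |a t x| ≤ β t
  ftc : ∀ x ∈ K, ∀ t ∈ Icc t₁ t₂, A t x = A t₁ x + ∫ τ in t₁..t, a τ x

theorem PtAC.intervalIntegrable {A a : ℝ → E N → ℝ} (h : PtAC t₁ t₂ K A a) (h12 : t₁ ≤ t₂)
    {x : E N} (hx : x ∈ K) : IntervalIntegrable (fun t => a t x) volume t₁ t₂ := by
  rw [intervalIntegrable_iff_integrableOn_Ioc_of_le h12]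
  obtain ⟨β, hβ, hb⟩ := h.bdd_deriv
  refine Integrable.mono' hβ (h.meas_time x hx) ?_
  filter_upwards [hb] with t ht
  exact ht x hx

/-- Primitives of integrable functions are absolutely continuous, so the product can be integrated
through its almost everywhere derivative, which Lebesgue differentiation identifies. -/
theorem ac_product {A a B b c ct : ℝ → ℝ} (h12 : t₁ ≤ t₂)
    (ha : IntervalIntegrable a volume t₁ t₂) (hb : IntervalIntegrable b volume t₁ t₂)
    (hA : ∀ t ∈ Icc t₁ t₂, A t = A t₁ + ∫ τ in t₁..t, a τ)
    (hB : ∀ t ∈ Icc t₁ t₂, B t = B t₁ + ∫ τ in t₁..t, b τ)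
    (hc : ∀ t ∈ Icc t₁ t₂, HasDerivAt c (ct t) t) (hct : ContinuousOn ct (Icc t₁ t₂)) :
    c t₂ * (A t₂ * B t₂) - c t₁ * (A t₁ * B t₁) =
      ∫ t in t₁..t₂, (ct t * (A t * B t) + c t * (a t * B t) + c t * (A t * b t)) := by
  have hu : uIcc t₁ t₂ = Icc t₁ t₂ := uIcc_of_le h12
  have ac0 : ∀ {A a : ℝ → ℝ}, IntervalIntegrable a volume t₁ t₂ →
      (∀ t ∈ Icc t₁ t₂, A t = A t₁ + ∫ τ in t₁..t, a τ) →
      AbsolutelyContinuousOnInterval (fun t => A t₁ + ∫ τ in t₁..t, a τ) t₁ t₂ := by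
    intro A a ha hA
    have h1 : AbsolutelyContinuousOnInterval (fun _ : ℝ => A t₁) t₁ t₂ :=
      contDiffOn_const.absolutelyContinuousOnInterval
    exact h1.add (ha.absolutelyContinuousOnInterval_intervalIntegral (by simp))
  have hci : IntervalIntegrable ct volume t₁ t₂ := by
    apply ContinuousOn.intervalIntegrable
    rwa [hu]
  have hC : ∀ t ∈ Icc t₁ t₂, c t = c t₁ + ∫ τ in t₁..t, ct τ := by
    intro t ht
    rw [intervalIntegral.integral_eq_sub_of_hasDerivAt]
    · ring
    · intro s hs
      rw [uIcc_of_le ht.1] at hs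
      exact hc s ⟨hs.1, hs.2.trans ht.2⟩
    · exact hci.mono_set (by rw [uIcc_of_le ht.1, hu]; exact Icc_subset_Icc_right ht.2)
  have key := AbsolutelyContinuousOnInterval.integral_deriv_mul_eq_sub (ac0 hci hC)
    ((ac0 ha hA).fun_mul (ac0 hb hB))
  have e1 := hA t₁ (left_mem_Icc.2 h12)
  have e2 := hB t₁ (left_mem_Icc.2 h12)
  have e3 := hC t₁ (left_mem_Icc.2 h12)
  simp only [← hA t₂ (right_mem_Icc.2 h12), ← hB t₂ (right_mem_Icc.2 h12),
    ← hC t₂ (right_mem_Icc.2 h12), ← e1, ← e2, ← e3] at key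
  rw [← key]
  apply intervalIntegral.integral_congr_ae
  filter_upwards [ha.ae_hasDerivAt_integral, hb.ae_hasDerivAt_integral,
    hci.ae_hasDerivAt_integral] with t h1 h2 h3 ht
  have htu : t ∈ uIcc t₁ t₂ := uIoc_subset_uIcc ht
  have htI : t ∈ Icc t₁ t₂ := hu ▸ htu
  have d1 := (h1 htu t₁ (by simp)).const_add (A t₁)
  have d2 := (h2 htu t₁ (by simp)).const_add (B t₁)
  have d3 := (h3 htu t₁ (by simp)).const_add (c t₁)
  rw [d3.deriv, (d1.fun_mul d2).deriv, ← hA t htI, ← hB t htI, ← hC t htI]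
  ring

/-- Differentiation in time of `∫ c A B`. -/
theorem PtAC.product {A a B b c ct : ℝ → E N → ℝ} (h12 : t₁ ≤ t₂) (hK : IsCompact K)
    (hA : PtAC t₁ t₂ K A a) (hB : PtAC t₁ t₂ K B b) (hc : IsCoef t₁ t₂ K c)
    (hct : IsCoef t₁ t₂ K ct)
    (hd : ∀ t ∈ Icc t₁ t₂, ∀ x, HasDerivAt (fun s => c s x) (ct t x) t) :
    IntervalIntegrable (fun t => bil (ct t) (A t) (B t) + bil (c t) (a t) (B t) +
      bil (c t) (A t) (b t)) volume t₁ t₂ ∧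
    bil (c t₂) (A t₂) (B t₂) - bil (c t₁) (A t₁) (B t₁) =
      ∫ t in t₁..t₂, (bil (ct t) (A t) (B t) + bil (c t) (a t) (B t) +
        bil (c t) (A t) (b t)) := by
  obtain ⟨CA, hCA⟩ := hA.bdd
  obtain ⟨CB, hCB⟩ := hB.bdd
  obtain ⟨βa, hβa, hba⟩ := hA.bdd_deriv
  obtain ⟨βb, hβb, hbb⟩ := hB.bdd_deriv
  obtain ⟨C, hC0, hC⟩ := hc.bdd hK
  obtain ⟨C', hC'0, hC'⟩ := hct.bdd hK
  have hKm := hK.measurableSet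
  have hI2 : t₂ ∈ Icc t₁ t₂ := right_mem_Icc.2 h12
  have hI1 : t₁ ∈ Icc t₁ t₂ := left_mem_Icc.2 h12
  have integ : ∀ {d P Q : ℝ → E N → ℝ} {D : ℝ} {p q : ℝ → ℝ}, IsCoef t₁ t₂ K d → 0 ≤ D →
      (∀ t ∈ Icc t₁ t₂, ∀ x, |d t x| ≤ D) →
      AEStronglyMeasurable (fun z : ℝ × E N => P z.1 z.2) (strip N t₁ t₂) →
      AEStronglyMeasurable (fun z : ℝ × E N => Q z.1 z.2) (strip N t₁ t₂) →
      (∀ᵐ t ∂(volume.restrict (Ioc t₁ t₂)), ∀ x ∈ K, |P t x| ≤ p t) →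
      (∀ᵐ t ∂(volume.restrict (Ioc t₁ t₂)), ∀ x ∈ K, |Q t x| ≤ q t) →
      IntegrableOn (fun t => p t * q t) (Ioc t₁ t₂) →
      Integrable (fun z : ℝ × E N => d z.1 z.2 * (P z.1 z.2 * Q z.1 z.2)) (strip N t₁ t₂) := by
    intro d P Q D p q hd hD hdD hP hQ hp hq hpq
    have h1 : Integrable (fun z : ℝ × E N => (D * (p z.1 * q z.1)) * K.indicator 1 z.2)
        (strip N t₁ t₂) := by
      refine Integrable.mul_prod (f := fun t => D * (p t * q t)) (hpq.const_mul D) ?_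
      rw [integrable_indicator_iff hKm]
      exact integrableOn_const hK.measure_ne_top
    refine h1.mono' (hd.meas.mul (hP.mul hQ)) ?_
    filter_upwards [ae_strip hp, ae_strip hq, ae_strip (ae_Ioc hdD),
      ae_strip (ae_restrict_mem measurableSet_Ioc)] with z e1 e2 e3 e4
    by_cases hz : z.2 ∈ K
    · rw [Real.norm_eq_abs, abs_mul, abs_mul, indicator_of_mem hz, Pi.one_apply, mul_one]
      exact mul_le_mul (e3 _) (mul_le_mul (e1 _ hz) (e2 _ hz) (abs_nonneg _)
        ((abs_nonneg _).trans (e1 _ hz))) (by positivity) hD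
    · rw [hd.supp _ (Ioc_subset_Icc_self e4) _ hz, indicator_of_notMem hz]
      simp
  have j1 := integ hct hC'0 hC' hA.measA hB.measA (ae_Ioc hCA) (ae_Ioc hCB)
    (integrableOn_const (by simp))
  have j2 := integ hc hC0 hC hA.meas hB.measA hba (ae_Ioc hCB) (hβa.mul_const CB)
  have j3 := integ hc hC0 hC hA.measA hB.meas (ae_Ioc hCA) hbb (hβb.const_mul CA)
  have hu : uIoc t₁ t₂ = Ioc t₁ t₂ := uIoc_of_le h12
  let F : ℝ → E N → ℝ := fun t x => ct t x * (A t x * B t x) + c t x * (a t x * B t x) +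
    c t x * (A t x * b t x)
  have jF : Integrable (Function.uncurry F) ((volume.restrict (uIoc t₁ t₂)).prod volume) := by
    rw [hu]; exact (j1.add j2).add j3
  have hae : ∀ᵐ t ∂(volume.restrict (Ioc t₁ t₂)), bil (ct t) (A t) (B t) +
      bil (c t) (a t) (B t) + bil (c t) (A t) (b t) = ∫ x, F t x := by
    filter_upwards [j1.prod_right_ae, j2.prod_right_ae, j3.prod_right_ae] with t k1 k2 k3
    have k12 : Integrable (fun x => ct t x * (A t x * B t x) + c t x * (a t x * B t x)) :=
      k1.add k2
    simp only [F, bil]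
    rw [integral_add k12 k3, integral_add k1 k2]
  have hFi : IntegrableOn (fun t => ∫ x, F t x) (Ioc t₁ t₂) := by
    rw [hu] at jF
    exact jF.integral_prod_left
  refine ⟨?_, ?_⟩
  · rw [intervalIntegrable_iff_integrableOn_Ioc_of_le h12]
    exact hFi.congr (hae.mono fun t ht => ht.symm)
  · have hpt : ∀ t ∈ Icc t₁ t₂, Integrable (fun x => c t x * (A t x * B t x)) := by
      intro t ht
      exact ((hc.cont_x ht).mul ((hA.contA t ht).mul (hB.contA t ht))).integrable_of_hasCompactSupport
        ((hc.compact hK ht).mul_right)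
    -- Fubini puts the time integral inside, so that the product rule is applied for each fixed x.
    rw [intervalIntegral.integral_of_le h12, integral_congr_ae hae,
      ← intervalIntegral.integral_of_le h12, intervalIntegral_integral_swap jF, bil, bil,
      ← integral_sub (hpt _ hI2) (hpt _ hI1)]
    congr 1
    ext x
    by_cases hx : x ∈ K
    · refine ac_product h12 (hA.intervalIntegrable h12 hx) (hB.intervalIntegrable h12 hx)
        (hA.ftc x hx) (hB.ftc x hx) (fun t ht => hd t ht x) ?_
      exact hct.cont.comp (f := fun t : ℝ => (t, x)) (by fun_prop) (fun t ht => ⟨ht, mem_univ _⟩)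
    · rw [hc.supp _ hI2 _ hx, hc.supp _ hI1 _ hx]
      symm
      simp only [zero_mul, sub_zero]
      rw [intervalIntegral.integral_of_le h12]
      apply integral_eq_zero_of_ae
      filter_upwards [ae_restrict_mem measurableSet_Ioc] with t ht
      have ht' := Ioc_subset_Icc_self ht
      simp [F, hc.supp t ht' x hx, hct.supp t ht' x hx]

end

end HamzaZaag

/-! ### The linear wave equation and its mollification. -/

namespace HamzaZaag

noncomputable section

/-- The standard basis of `ℝ^N`. -/
def ei {N : ℕ} (i : Fin N) : E N := EuclideanSpace.single i 1

/-- The partial derivatives of the mollifiers. -/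
def dk (N n : ℕ) (i : Fin N) (y : E N) : ℝ := fderiv ℝ (mol N n) y (ei i)

/-- A measurable family of functions which is bounded in `L²`. -/
structure IsBFam {N : ℕ} (t₁ t₂ : ℝ) (A : ℝ → E N → ℝ) : Prop where
  meas : AEStronglyMeasurable (fun z : ℝ × E N => A z.1 z.2) (strip N t₁ t₂)
  mem : ∀ t ∈ Icc t₁ t₂, MemLp (A t) 2 volume
  bd : ∃ C : ℝ, ∀ t ∈ Icc t₁ t₂, nrm (A t) ≤ C

/-- A weak solution of `∂ₜu = v`, `∂ₜv = div G + h`, `G = ∇u` on `[t₁, t₂] × O`. -/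
structure LWave {N : ℕ} (t₁ t₂ : ℝ) (O : Set (E N)) (u v h : ℝ → E N → ℝ)
    (G : Fin N → ℝ → E N → ℝ) : Prop where
  le : t₁ ≤ t₂
  fam_u : IsBFam t₁ t₂ u
  fam_v : IsBFam t₁ t₂ v
  fam_G : ∀ i, IsBFam t₁ t₂ (G i)
  fam_h : ∃ β : ℝ → ℝ, IntegrableOn β (Ioc t₁ t₂) ∧ IsFam t₁ t₂ h β
  grad : ∀ t ∈ Icc t₁ t₂, ∀ ψ : E N → ℝ, IsTest O ψ → ∀ i,
    ∫ x, u t x * fderiv ℝ ψ x (ei i) = - ∫ x, G i t x * ψ x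
  evu : ∀ t ∈ Icc t₁ t₂, ∀ ψ : E N → ℝ, IsTest O ψ →
    ∫ x, u t x * ψ x = (∫ x, u t₁ x * ψ x) + ∫ τ in t₁..t, ∫ x, v τ x * ψ x
  evv : ∀ t ∈ Icc t₁ t₂, ∀ ψ : E N → ℝ, IsTest O ψ →
    ∫ x, v t x * ψ x = (∫ x, v t₁ x * ψ x) +
      ∫ τ in t₁..t, (-(∑ i, ∫ x, G i τ x * fderiv ℝ ψ x (ei i)) + ∫ x, h τ x * ψ x)

/-- All balls of the radius of the `n`-th mollifier centred in `K` are contained in `O`. -/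
def Fits {N : ℕ} (n : ℕ) (K O : Set (E N)) : Prop :=
  ∀ x ∈ K, Metric.closedBall x (1 / ((n : ℝ) + 1)) ⊆ O

variable {N : ℕ} {t₁ t₂ : ℝ} {K O : Set (E N)}

theorem dk_contDiff (n : ℕ) (i : Fin N) : ContDiff ℝ ∞ (dk N n i) :=
  ((mol_contDiff n).fderiv_right (m := ∞) (by simp)).clm_apply contDiff_const

theorem dk_tsupport (n : ℕ) (i : Fin N) : tsupport (dk N n i) ⊆ tsupport (mol N n) :=
  tsupport_fderiv_apply_subset ℝ _

theorem dk_compact (n : ℕ) (i : Fin N) : HasCompactSupport (dk N n i) :=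
  (mol_compact n).of_isClosed_subset (isClosed_tsupport _) (dk_tsupport n i)

theorem cv_fderiv_ei {f : E N → ℝ} (n : ℕ) (hf : MemLp f 2 volume) (x : E N) (i : Fin N) :
    fderiv ℝ (cv (mol N n) f) x (ei i) = cv (dk N n i) f x :=
  cv_fderiv (mol_contDiff n) (mol_compact n) hf x (ei i)

theorem cvm_cont {f : E N → ℝ} (n : ℕ) (hf : MemLp f 2 volume) : Continuous (cv (mol N n) f) :=
  (cv_contDiff (mol_contDiff n) (mol_compact n) hf).continuous

theorem cvd_cont {f : E N → ℝ} (n : ℕ) (i : Fin N) (hf : MemLp f 2 volume) :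
    Continuous (cv (dk N n i) f) :=
  (cv_contDiff (dk_contDiff n i) (dk_compact n i) hf).continuous

/-- A mollified value at x is the pairing with the kernel centred at x, an admissible test function
as soon as its ball lies in `O`. The kernel is arbitrary so that derivatives of the mollifier are
covered too. -/
theorem isTest_reflect {k : E N → ℝ} {n : ℕ} {x : E N} (hk : ContDiff ℝ ∞ k)
    (hs : tsupport k ⊆ tsupport (mol N n))
    (hx : Metric.closedBall x (1 / ((n : ℝ) + 1)) ⊆ O) : IsTest O (fun z => k (x - z)) := by
  have h : tsupport (fun z => k (x - z)) ⊆ Metric.closedBall x (1 / ((n : ℝ) + 1)) := by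
    refine closure_minimal (fun z hz => ?_) Metric.isClosed_closedBall
    have h1 : x - z ∈ tsupport (mol N n) := hs (subset_tsupport _ hz)
    rw [mol_tsupport, mem_closedBall_zero_iff] at h1
    rwa [Metric.mem_closedBall, dist_comm, dist_eq_norm]
  refine ⟨by fun_prop, ?_, h.trans hx⟩
  exact (isCompact_closedBall x _).of_isClosed_subset (isClosed_tsupport _) h

theorem fderiv_reflect {k : E N → ℝ} (hk : ContDiff ℝ ∞ k) (x z e : E N) :
    fderiv ℝ (fun z => k (x - z)) z e = - fderiv ℝ k (x - z) e := by
  have h1 : HasFDerivAt (fun z : E N => x - z) (-ContinuousLinearMap.id ℝ (E N)) z :=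
    (hasFDerivAt_id z).const_sub x
  have h2 : HasFDerivAt k (fderiv ℝ k (x - z)) (x - z) :=
    (hk.differentiable (by simp)).differentiableAt.hasFDerivAt
  have h3 : HasFDerivAt (fun z => k (x - z))
      ((fderiv ℝ k (x - z)).comp (-ContinuousLinearMap.id ℝ (E N))) z := h2.comp z h1
  rw [h3.fderiv]
  simp

theorem IsBFam.isFam {A : ℝ → E N → ℝ} (h : IsBFam t₁ t₂ A) :
    ∃ C : ℝ, 0 ≤ C ∧ IsFam t₁ t₂ A (fun _ => C) := by
  obtain ⟨C, hC⟩ := h.bd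
  exact ⟨max C 0, le_max_right _ _, h.meas,
    ae_Ioc fun t ht => ⟨h.mem t ht, (hC t ht).trans (le_max_left _ _)⟩⟩

theorem IsBFam.cv_bdd {A : ℝ → E N → ℝ} (h : IsBFam t₁ t₂ A) {k : E N → ℝ}
    (hk : Continuous k) (hc : HasCompactSupport k) :
    ∃ C, ∀ t ∈ Icc t₁ t₂, ∀ x, |cv k (A t) x| ≤ C := by
  obtain ⟨C, hC⟩ := h.bd
  refine ⟨nrm k * C, fun t ht x => (cv_bound hk hc (h.mem t ht) x).trans ?_⟩
  exact mul_le_mul_of_nonneg_left (hC t ht) (nrm_nonneg _)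

namespace LWave

variable {u v h : ℝ → E N → ℝ} {G : Fin N → ℝ → E N → ℝ} {n : ℕ}

theorem grad_cv (W : LWave t₁ t₂ O u v h G) {t : ℝ} (ht : t ∈ Icc t₁ t₂) {x : E N}
    (hx : Metric.closedBall x (1 / ((n : ℝ) + 1)) ⊆ O) (i : Fin N) :
    cv (dk N n i) (u t) x = cv (mol N n) (G i t) x := by
  have := W.grad t ht _ (isTest_reflect (mol_contDiff n) subset_rfl hx) i
  simp only [fderiv_reflect (mol_contDiff n), mul_neg, integral_neg, neg_inj] at this
  exact this

/-- A gradient is curl-free: both sides are pairings of u with second derivatives of the mollifier,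
which commute. -/
theorem symm_cv (W : LWave t₁ t₂ O u v h G) {t : ℝ} (ht : t ∈ Icc t₁ t₂) {x : E N}
    (hx : Metric.closedBall x (1 / ((n : ℝ) + 1)) ⊆ O) (i j : Fin N) :
    cv (dk N n j) (G i t) x = cv (dk N n i) (G j t) x := by
  have key : ∀ i j, ∫ z, u t z * fderiv ℝ (dk N n j) (x - z) (ei i) =
      cv (dk N n j) (G i t) x := by
    intro i j
    have := W.grad t ht _ (isTest_reflect (dk_contDiff n j) (dk_tsupport n j) hx) i
    simp only [fderiv_reflect (dk_contDiff n j), mul_neg, integral_neg, neg_inj] at this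
    exact this
  rw [← key, ← key]
  congr 1
  ext z
  congr 1
  have h2 : ∀ (i j : Fin N) (y : E N), fderiv ℝ (dk N n j) y (ei i) =
      fderiv ℝ (fderiv ℝ (mol N n)) y (ei i) (ei j) := by
    intro i j y
    have hd : DifferentiableAt ℝ (fderiv ℝ (mol N n)) y :=
      (((mol_contDiff n).fderiv_right (m := ∞) (by simp)).differentiable
        (by simp)).differentiableAt
    have h3 := fderiv_clm_apply hd (differentiableAt_const (c := ei j) (x := y))
    change fderiv ℝ (fun y => fderiv ℝ (mol N n) y (ei j)) y (ei i) = _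
    rw [h3]
    simp
  rw [h2, h2]
  have hs : IsSymmSndFDerivAt ℝ (mol N n) (x - z) :=
    (mol_contDiff n).contDiffAt.isSymmSndFDerivAt (by
      simp only [minSmoothness_of_isRCLikeNormedField]
      exact WithTop.coe_le_coe.2 le_top)
  exact hs _ _

theorem ptAC_u (W : LWave t₁ t₂ O u v h G) (hK : Fits n K O) :
    PtAC t₁ t₂ K (fun t => cv (mol N n) (u t)) (fun t => cv (mol N n) (v t)) where
  contA t ht := cvm_cont n (W.fam_u.mem t ht)
  measA := cv_meas (mol_contDiff n).continuous W.fam_u.meas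
  meas := cv_meas (mol_contDiff n).continuous W.fam_v.meas
  meas_time x _ := cv_meas_time (mol_contDiff n).continuous W.fam_v.meas x
  bdd := by
    obtain ⟨C, hC⟩ := W.fam_u.cv_bdd (mol_contDiff n).continuous (mol_compact n)
    exact ⟨C, fun t ht x _ => hC t ht x⟩
  bdd_deriv := by
    obtain ⟨C, hC⟩ := W.fam_v.cv_bdd (mol_contDiff n).continuous (mol_compact n)
    exact ⟨fun _ => C, integrableOn_const (by simp), ae_Ioc fun t ht x _ => hC t ht x⟩
  ftc x hx t ht := W.evu t ht _ (isTest_reflect (mol_contDiff n) subset_rfl (hK x hx))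

/-- No equation for the time derivative of G is assumed. The mollified G is the derivative of the
mollified u, so the equation for u can be tested with the derivative of the mollifier. -/
theorem ptAC_G (W : LWave t₁ t₂ O u v h G) (hK : Fits n K O) (i : Fin N) :
    PtAC t₁ t₂ K (fun t => cv (mol N n) (G i t)) (fun t => cv (dk N n i) (v t)) where
  contA t ht := cvm_cont n ((W.fam_G i).mem t ht)
  measA := cv_meas (mol_contDiff n).continuous (W.fam_G i).meas
  meas := cv_meas (dk_contDiff n i).continuous W.fam_v.meas
  meas_time x _ := cv_meas_time (dk_contDiff n i).continuous W.fam_v.meas x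
  bdd := by
    obtain ⟨C, hC⟩ := (W.fam_G i).cv_bdd (mol_contDiff n).continuous (mol_compact n)
    exact ⟨C, fun t ht x _ => hC t ht x⟩
  bdd_deriv := by
    obtain ⟨C, hC⟩ := W.fam_v.cv_bdd (dk_contDiff n i).continuous (dk_compact n i)
    exact ⟨fun _ => C, integrableOn_const (by simp), ae_Ioc fun t ht x _ => hC t ht x⟩
  ftc x hx t ht := by
    rw [← W.grad_cv ht (hK x hx), ← W.grad_cv (left_mem_Icc.2 W.le) (hK x hx)]
    exact W.evu t ht _ (isTest_reflect (dk_contDiff n i) (dk_tsupport n i) (hK x hx))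

/-- The divergence is moved onto the mollifier; its sign is cancelled by the reflection of the
kernel. The source has an integrable, not necessarily bounded, norm in time, which suffices for
absolute continuity. -/
theorem ptAC_v (W : LWave t₁ t₂ O u v h G) (hK : Fits n K O) :
    PtAC t₁ t₂ K (fun t => cv (mol N n) (v t))
      (fun t x => (∑ i, cv (dk N n i) (G i t) x) + cv (mol N n) (h t) x) where
  contA t ht := cvm_cont n (W.fam_v.mem t ht)
  measA := cv_meas (mol_contDiff n).continuous W.fam_v.meas
  meas := by
    obtain ⟨β, -, hβ⟩ := W.fam_h
    refine AEStronglyMeasurable.add ?_ (cv_meas (mol_contDiff n).continuous hβ.meas)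
    exact Finset.aestronglyMeasurable_fun_sum _ fun i _ =>
      cv_meas (dk_contDiff n i).continuous (W.fam_G i).meas
  meas_time x _ := by
    obtain ⟨β, -, hβ⟩ := W.fam_h
    refine AEStronglyMeasurable.add ?_ (cv_meas_time (mol_contDiff n).continuous hβ.meas x)
    exact Finset.aestronglyMeasurable_fun_sum _ fun i _ =>
      cv_meas_time (dk_contDiff n i).continuous (W.fam_G i).meas x
  bdd := by
    obtain ⟨C, hC⟩ := W.fam_v.cv_bdd (mol_contDiff n).continuous (mol_compact n)
    exact ⟨C, fun t ht x _ => hC t ht x⟩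
  bdd_deriv := by
    obtain ⟨β, hi, hβ⟩ := W.fam_h
    choose C hC using fun i => (W.fam_G i).cv_bdd (dk_contDiff n i).continuous (dk_compact n i)
    refine ⟨fun t => (∑ i, C i) + nrm (mol N n) * β t,
      (integrableOn_const (by simp)).add (hi.const_mul _), ?_⟩
    filter_upwards [hβ.bd, ae_Ioc fun t ht => ht] with t h1 h2 x _
    refine (abs_add_le _ _).trans (add_le_add ?_ ?_)
    · exact (Finset.abs_sum_le_sum_abs _ _).trans (Finset.sum_le_sum fun i _ => hC i t h2 x)
    · exact (cv_bound (mol_contDiff n).continuous (mol_compact n) h1.1 x).trans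
        (mul_le_mul_of_nonneg_left h1.2 (nrm_nonneg _))
  ftc x hx t ht := by
    have := W.evv t ht _ (isTest_reflect (mol_contDiff n) subset_rfl (hK x hx))
    simp only [fderiv_reflect (mol_contDiff n), mul_neg, integral_neg, Finset.sum_neg_distrib,
      neg_neg] at this
    exact this

end LWave

/-- Integration by parts in space for mollified functions. -/
theorem bil_parts {c cx f g : E N → ℝ} (n : ℕ) (i : Fin N) (hc : Differentiable ℝ c)
    (hcc : HasCompactSupport c) (hcx : ∀ x, fderiv ℝ c x (ei i) = cx x) (hcxc : Continuous cx)
    (hf : MemLp f 2 volume) (hg : MemLp g 2 volume) :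
    bil c (cv (mol N n) f) (cv (dk N n i) g) + bil c (cv (dk N n i) f) (cv (mol N n) g) =
      - bil cx (cv (mol N n) f) (cv (mol N n) g) := by
  have cf := cvm_cont n hf
  have cg := cvm_cont n hg
  have cdf := cvd_cont n i hf
  have cdg := cvd_cont n i hg
  have hcxs : HasCompactSupport cx := by
    have : cx = fun x => fderiv ℝ c x (ei i) := by ext x; exact (hcx x).symm
    rw [this]; exact hcc.fderiv_apply ℝ _
  have df : Differentiable ℝ (cv (mol N n) f) :=
    (cv_contDiff (mol_contDiff n) (mol_compact n) hf).differentiable (by simp)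
  have dg : Differentiable ℝ (cv (mol N n) g) :=
    (cv_contDiff (mol_contDiff n) (mol_compact n) hg).differentiable (by simp)
  have hprod : ∀ x, fderiv ℝ (fun x => c x * cv (mol N n) f x) x (ei i) =
      c x * cv (dk N n i) f x + cx x * cv (mol N n) f x := by
    intro x
    rw [fderiv_fun_mul hc.differentiableAt df.differentiableAt]
    simp [cv_fderiv_ei n hf, hcx, mul_comm]
  have i1 : Integrable (fun x => c x * cv (dk N n i) f x * cv (mol N n) g x) :=
    ((hc.continuous.mul cdf).mul cg).integrable_of_hasCompactSupport (hcc.mul_right.mul_right)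
  have i2 : Integrable (fun x => cx x * cv (mol N n) f x * cv (mol N n) g x) :=
    ((hcxc.mul cf).mul cg).integrable_of_hasCompactSupport (hcxs.mul_right.mul_right)
  have key := integral_mul_fderiv_eq_neg_fderiv_mul_of_integrable (μ := (volume : Measure (E N)))
    (f := fun x => c x * cv (mol N n) f x) (g := cv (mol N n) g) (v := ei i)
    (by simp only [hprod, add_mul]; exact i1.add i2)
    (by
      simp only [cv_fderiv_ei n hg]
      exact ((hc.continuous.mul cf).mul cdg).integrable_of_hasCompactSupport
        (hcc.mul_right.mul_right))
    (((hc.continuous.mul cf).mul cg).integrable_of_hasCompactSupport (hcc.mul_right.mul_right))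
    (fun x _ => (hc.mul df).differentiableAt) (fun x _ => dg.differentiableAt)
  simp only [cv_fderiv_ei n hg, hprod, add_mul] at key
  rw [integral_add i1 i2] at key
  simp only [bil, ← mul_assoc]
  rw [key]
  ring

theorem bil_comm (c f g : E N → ℝ) : bil c f g = bil c g f := by
  unfold bil; congr 1; ext x; ring

theorem bil_add_right {c f g g' : E N → ℝ} (hc : Continuous c) (hcc : HasCompactSupport c)
    (hf : Continuous f) (hg : Continuous g) (hg' : Continuous g') :
    bil c f (fun x => g x + g' x) = bil c f g + bil c f g' := by
  unfold bil
  rw [← integral_add]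
  · congr 1; ext x; ring
  · exact (hc.mul (hf.mul hg)).integrable_of_hasCompactSupport hcc.mul_right
  · exact (hc.mul (hf.mul hg')).integrable_of_hasCompactSupport hcc.mul_right

theorem bil_sum_right {c f : E N → ℝ} {g : Fin N → E N → ℝ} (hc : Continuous c)
    (hcc : HasCompactSupport c) (hf : Continuous f) (hg : ∀ i, Continuous (g i)) :
    bil c f (fun x => ∑ i, g i x) = ∑ i, bil c f (g i) := by
  unfold bil
  rw [← integral_finsetSum]
  · congr 1; ext x; rw [Finset.mul_sum, Finset.mul_sum]
  · intro i _
    exact (hc.mul (hf.mul (hg i))).integrable_of_hasCompactSupport hcc.mul_right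

/-- Identities such as `grad_cv` hold only on the support of the weight, and this is all that is
needed. -/
theorem bil_congr {c f g f' g' : E N → ℝ} (h : ∀ x, c x ≠ 0 → f x * g x = f' x * g' x) :
    bil c f g = bil c f' g' := by
  unfold bil; congr 1; ext x
  by_cases hx : c x = 0
  · simp [hx]
  · rw [h x hx]

end

end HamzaZaag

/-! ### Multiplier identities for weak solutions. -/

namespace HamzaZaag

noncomputable section

/-- A `C¹` weight on `[t₁, t₂] × ℝ^N` supported in `K`, with its time and space derivatives. -/
structure IsWeight {N : ℕ} (t₁ t₂ : ℝ) (K : Set (E N)) (φ φt : ℝ → E N → ℝ)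
    (φx : Fin N → ℝ → E N → ℝ) : Prop where
  coef : IsCoef t₁ t₂ K φ
  coef_t : IsCoef t₁ t₂ K φt
  coef_x : ∀ i, IsCoef t₁ t₂ K (φx i)
  deriv_t : ∀ t ∈ Icc t₁ t₂, ∀ x, HasDerivAt (fun s => φ s x) (φt t x) t
  diff : ∀ t ∈ Icc t₁ t₂, Differentiable ℝ (φ t)
  deriv_x : ∀ t ∈ Icc t₁ t₂, ∀ x i, fderiv ℝ (φ t) x (ei i) = φx i t x

variable {N : ℕ} {t₁ t₂ : ℝ} {K O : Set (E N)}

theorem eventually_fits (hK : IsCompact K) (hO : IsOpen O) (h : K ⊆ O) :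
    ∀ᶠ n in atTop, Fits n K O := by
  obtain ⟨δ, hδ, hsub⟩ := hK.exists_cthickening_subset_open hO h
  have h2 := (tendsto_one_div_add_atTop_nhds_zero_nat (𝕜 := ℝ)).eventually_lt_const hδ
  filter_upwards [h2] with n hn x hx
  refine Subset.trans ?_ hsub
  exact (Metric.closedBall_subset_closedBall hn.le).trans (Metric.closedBall_subset_cthickening hx δ)

namespace LWave

variable {u v h : ℝ → E N → ℝ} {G : Fin N → ℝ → E N → ℝ}
  {φ φt : ℝ → E N → ℝ} {φx : Fin N → ℝ → E N → ℝ}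

theorem domLim_BB {A B c : ℝ → E N → ℝ} (hK : IsCompact K) (hc : IsCoef t₁ t₂ K c)
    (hA : IsBFam t₁ t₂ A) (hB : IsBFam t₁ t₂ B) :
    DomLim t₁ t₂ (fun n t => bil (c t) (cv (mol N n) (A t)) (cv (mol N n) (B t)))
      (fun t => bil (c t) (A t) (B t)) := by
  obtain ⟨C, -, hA'⟩ := hA.isFam
  obtain ⟨D, -, hB'⟩ := hB.isFam
  exact domLim_bil hK hc hA' hB' (integrableOn_const (by simp))

theorem domLim_hB (W : LWave t₁ t₂ O u v h G) {B c : ℝ → E N → ℝ} (hK : IsCompact K)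
    (hc : IsCoef t₁ t₂ K c) (hB : IsBFam t₁ t₂ B) :
    DomLim t₁ t₂ (fun n t => bil (c t) (cv (mol N n) (h t)) (cv (mol N n) (B t)))
      (fun t => bil (c t) (h t) (B t)) := by
  obtain ⟨β, hβ, hh⟩ := W.fam_h
  obtain ⟨D, -, hB'⟩ := hB.isFam
  exact domLim_bil hK hc hh hB' (hβ.mul_const D)

theorem tendsto_end {A B c : ℝ → E N → ℝ} (hK : IsCompact K) (hc : IsCoef t₁ t₂ K c)
    (hA : IsBFam t₁ t₂ A) (hB : IsBFam t₁ t₂ B) {t : ℝ} (ht : t ∈ Icc t₁ t₂) :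
    Tendsto (fun n => bil (c t) (cv (mol N n) (A t)) (cv (mol N n) (B t))) atTop
      (𝓝 (bil (c t) (A t) (B t))) :=
  bil_tendsto (hc.cont_x ht) (hc.compact hK ht) (hA.mem t ht) (hB.mem t ht)

theorem h_mem (W : LWave t₁ t₂ O u v h G) :
    ∀ᵐ t ∂(volume.restrict (Ioc t₁ t₂)), MemLp (h t) 2 volume := by
  obtain ⟨β, -, hh⟩ := W.fam_h
  exact hh.bd.mono fun t ht => ht.1

/-- `∫ c (div G + h) f` for the mollified functions. -/
theorem bil_divG (W : LWave t₁ t₂ O u v h G) {c f : E N → ℝ} (hc : Continuous c)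
    (hcc : HasCompactSupport c) (hf : Continuous f) {t : ℝ} (ht : t ∈ Icc t₁ t₂)
    (hht : MemLp (h t) 2 volume) (n : ℕ) :
    bil c f (fun x => (∑ i, cv (dk N n i) (G i t) x) + cv (mol N n) (h t) x) =
      (∑ i, bil c f (cv (dk N n i) (G i t))) + bil c f (cv (mol N n) (h t)) := by
  rw [bil_add_right hc hcc hf _ (cvm_cont n hht), bil_sum_right hc hcc hf]
  · exact fun i => cvd_cont n i ((W.fam_G i).mem t ht)
  · exact continuous_finsetSum _ fun i _ => cvd_cont n i ((W.fam_G i).mem t ht)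

/-- The identity for `∫ φ u²`. -/
theorem sq_identity (W : LWave t₁ t₂ O u v h G) (hK : IsCompact K) (hO : IsOpen O) (hKO : K ⊆ O)
    (hφ : IsWeight t₁ t₂ K φ φt φx) :
    IntervalIntegrable (fun t => bil (φt t) (u t) (u t) + 2 * bil (φ t) (u t) (v t))
      volume t₁ t₂ ∧
    bil (φ t₂) (u t₂) (u t₂) - bil (φ t₁) (u t₁) (u t₁) =
      ∫ t in t₁..t₂, (bil (φt t) (u t) (u t) + 2 * bil (φ t) (u t) (v t)) := by
  have D := (domLim_BB hK hφ.coef_t W.fam_u W.fam_u).add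
    ((domLim_BB hK hφ.coef W.fam_u W.fam_v).const_mul 2)
  have I2 := right_mem_Icc.2 W.le
  have I1 := left_mem_Icc.2 W.le
  refine ⟨D.intervalIntegrable_lim W.le, ?_⟩
  -- The mollified functions satisfy the identity exactly once their balls fit into `O`; both sides
  -- converge, and limits are unique. The other identities follow this scheme.
  refine tendsto_nhds_unique_of_eventuallyEq ((tendsto_end hK hφ.coef W.fam_u W.fam_u I2).sub
    (tendsto_end hK hφ.coef W.fam_u W.fam_u I1)) (D.tendsto W.le) ?_
  filter_upwards [eventually_fits hK hO hKO] with n hn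
  rw [((W.ptAC_u hn).product W.le hK (W.ptAC_u hn) hφ.coef hφ.coef_t hφ.deriv_t).2]
  congr 1; ext t
  rw [bil_comm (φ t) (cv (mol N n) (v t))]
  ring

/-- The identity for `∫ φ u v`. -/
theorem mixed_identity (W : LWave t₁ t₂ O u v h G) (hK : IsCompact K) (hO : IsOpen O)
    (hKO : K ⊆ O) (hφ : IsWeight t₁ t₂ K φ φt φx) :
    IntervalIntegrable (fun t => bil (φt t) (u t) (v t) + bil (φ t) (v t) (v t)
      - (∑ i, bil (φx i t) (u t) (G i t)) - (∑ i, bil (φ t) (G i t) (G i t))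
      + bil (φ t) (h t) (u t)) volume t₁ t₂ ∧
    bil (φ t₂) (u t₂) (v t₂) - bil (φ t₁) (u t₁) (v t₁) =
      ∫ t in t₁..t₂, (bil (φt t) (u t) (v t) + bil (φ t) (v t) (v t)
        - (∑ i, bil (φx i t) (u t) (G i t)) - (∑ i, bil (φ t) (G i t) (G i t))
        + bil (φ t) (h t) (u t)) := by
  have D := ((((domLim_BB hK hφ.coef_t W.fam_u W.fam_v).add
    (domLim_BB hK hφ.coef W.fam_v W.fam_v)).sub
    (DomLim.sum Finset.univ fun i _ => domLim_BB hK (hφ.coef_x i) W.fam_u (W.fam_G i))).sub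
    (DomLim.sum Finset.univ fun i _ => domLim_BB hK hφ.coef (W.fam_G i) (W.fam_G i))).add
    (W.domLim_hB hK hφ.coef W.fam_u)
  have I2 := right_mem_Icc.2 W.le
  have I1 := left_mem_Icc.2 W.le
  refine ⟨D.intervalIntegrable_lim W.le, ?_⟩
  refine tendsto_nhds_unique_of_eventuallyEq ((tendsto_end hK hφ.coef W.fam_u W.fam_v I2).sub
    (tendsto_end hK hφ.coef W.fam_u W.fam_v I1)) (D.tendsto W.le) ?_
  filter_upwards [eventually_fits hK hO hKO] with n hn
  rw [((W.ptAC_u hn).product W.le hK (W.ptAC_v hn) hφ.coef hφ.coef_t hφ.deriv_t).2]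
  rw [intervalIntegral.integral_of_le W.le, intervalIntegral.integral_of_le W.le]
  apply integral_congr_ae
  filter_upwards [W.h_mem, ae_restrict_mem measurableSet_Ioc] with t hh ht'
  have ht := Ioc_subset_Icc_self ht'
  have cu := cvm_cont n (W.fam_u.mem t ht)
  rw [W.bil_divG (hφ.coef.cont_x ht) (hφ.coef.compact hK ht) cu ht hh n]
  -- Integration by parts moves the divergence onto φ u, and the mollified gradient of u agrees with
  -- that of G on the support of φ.
  have e : ∀ i, bil (φ t) (cv (mol N n) (u t)) (cv (dk N n i) (G i t)) =
      - bil (φx i t) (cv (mol N n) (u t)) (cv (mol N n) (G i t))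
      - bil (φ t) (cv (mol N n) (G i t)) (cv (mol N n) (G i t)) := by
    intro i
    rw [← bil_parts n i (hφ.diff t ht) (hφ.coef.compact hK ht) (hφ.deriv_x t ht · i)
      ((hφ.coef_x i).cont_x ht) (W.fam_u.mem t ht) ((W.fam_G i).mem t ht)]
    have : bil (φ t) (cv (dk N n i) (u t)) (cv (mol N n) (G i t)) =
        bil (φ t) (cv (mol N n) (G i t)) (cv (mol N n) (G i t)) := by
      refine bil_congr fun x hx => ?_
      have hxK : x ∈ K := by
        by_contra h0; exact hx (hφ.coef.supp t ht x h0)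
      rw [W.grad_cv ht (hn x hxK)]
    rw [this]; ring
  simp only [e, Finset.sum_sub_distrib, Finset.sum_neg_distrib]
  rw [bil_comm (φ t) (cv (mol N n) (u t)) (cv (mol N n) (h t))]
  ring

/-- The energy identity. -/
theorem energy_identity (W : LWave t₁ t₂ O u v h G) (hK : IsCompact K) (hO : IsOpen O)
    (hKO : K ⊆ O) (hφ : IsWeight t₁ t₂ K φ φt φx) :
    IntervalIntegrable (fun t => bil (φt t) (v t) (v t) + (∑ i, bil (φt t) (G i t) (G i t))
      - 2 * (∑ i, bil (φx i t) (v t) (G i t)) + 2 * bil (φ t) (h t) (v t)) volume t₁ t₂ ∧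
    (bil (φ t₂) (v t₂) (v t₂) + ∑ i, bil (φ t₂) (G i t₂) (G i t₂)) -
      (bil (φ t₁) (v t₁) (v t₁) + ∑ i, bil (φ t₁) (G i t₁) (G i t₁)) =
      ∫ t in t₁..t₂, (bil (φt t) (v t) (v t) + (∑ i, bil (φt t) (G i t) (G i t))
        - 2 * (∑ i, bil (φx i t) (v t) (G i t)) + 2 * bil (φ t) (h t) (v t)) := by
  have D := ((((domLim_BB hK hφ.coef_t W.fam_v W.fam_v).add
    (DomLim.sum Finset.univ fun i _ => domLim_BB hK hφ.coef_t (W.fam_G i) (W.fam_G i))).sub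
    ((DomLim.sum Finset.univ fun i _ =>
      domLim_BB hK (hφ.coef_x i) W.fam_v (W.fam_G i)).const_mul 2)).add
    ((W.domLim_hB hK hφ.coef W.fam_v).const_mul 2))
  have I2 := right_mem_Icc.2 W.le
  have I1 := left_mem_Icc.2 W.le
  refine ⟨D.intervalIntegrable_lim W.le, ?_⟩
  have T := fun {t : ℝ} (ht : t ∈ Icc t₁ t₂) =>
    (tendsto_end hK hφ.coef W.fam_v W.fam_v ht).add
      (tendsto_finsetSum Finset.univ fun i _ =>
        tendsto_end hK hφ.coef (W.fam_G i) (W.fam_G i) ht)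
  refine tendsto_nhds_unique_of_eventuallyEq ((T I2).sub (T I1)) (D.tendsto W.le) ?_
  filter_upwards [eventually_fits hK hO hKO] with n hn
  have P1 := (W.ptAC_v hn).product W.le hK (W.ptAC_v hn) hφ.coef hφ.coef_t hφ.deriv_t
  have P2 := fun i => (W.ptAC_G hn i).product W.le hK (W.ptAC_G hn i) hφ.coef hφ.coef_t hφ.deriv_t
  rw [add_sub_add_comm, ← Finset.sum_sub_distrib, P1.2, Finset.sum_congr rfl fun i _ => (P2 i).2,
    ← intervalIntegral.integral_finsetSum fun i _ => (P2 i).1,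
    ← intervalIntegral.integral_add P1.1 (by
      have := IntervalIntegrable.sum Finset.univ fun i _ => (P2 i).1
      simpa only [Finset.sum_fn] using this)]
  rw [intervalIntegral.integral_of_le W.le, intervalIntegral.integral_of_le W.le]
  apply integral_congr_ae
  filter_upwards [W.h_mem, ae_restrict_mem measurableSet_Ioc] with t hh ht'
  have ht := Ioc_subset_Icc_self ht'
  have cvv := cvm_cont n (W.fam_v.mem t ht)
  rw [bil_comm (φ t) (fun x => (∑ i, cv (dk N n i) (G i t) x) + cv (mol N n) (h t) x)]
  rw [W.bil_divG (hφ.coef.cont_x ht) (hφ.coef.compact hK ht) cvv ht hh n]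
  -- The terms φ ∇v·G and φ v div G add up to a divergence, so that only the gradient of the weight
  -- survives.
  have e : ∀ i, bil (φ t) (cv (dk N n i) (v t)) (cv (mol N n) (G i t)) =
      - bil (φx i t) (cv (mol N n) (v t)) (cv (mol N n) (G i t))
      - bil (φ t) (cv (mol N n) (v t)) (cv (dk N n i) (G i t)) := by
    intro i
    rw [← bil_parts n i (hφ.diff t ht) (hφ.coef.compact hK ht) (hφ.deriv_x t ht · i)
      ((hφ.coef_x i).cont_x ht) (W.fam_v.mem t ht) ((W.fam_G i).mem t ht)]
    ring
  simp only [bil_comm (φ t) (cv (mol N n) (G _ t)) (cv (dk N n _) (v t)), e,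
    Finset.sum_sub_distrib, Finset.sum_neg_distrib, Finset.sum_add_distrib]
  rw [bil_comm (φ t) (cv (mol N n) (v t)) (cv (mol N n) (h t))]
  ring

/-- The momentum identity. -/
theorem momentum_identity (W : LWave t₁ t₂ O u v h G) (hK : IsCompact K) (hO : IsOpen O)
    (hKO : K ⊆ O) (hφ : IsWeight t₁ t₂ K φ φt φx) (i : Fin N) :
    IntervalIntegrable (fun t => bil (φt t) (v t) (G i t) - 1 / 2 * bil (φx i t) (v t) (v t)
      + 1 / 2 * (∑ j, bil (φx i t) (G j t) (G j t)) - (∑ j, bil (φx j t) (G i t) (G j t))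
      + bil (φ t) (h t) (G i t)) volume t₁ t₂ ∧
    bil (φ t₂) (v t₂) (G i t₂) - bil (φ t₁) (v t₁) (G i t₁) =
      ∫ t in t₁..t₂, (bil (φt t) (v t) (G i t) - 1 / 2 * bil (φx i t) (v t) (v t)
      + 1 / 2 * (∑ j, bil (φx i t) (G j t) (G j t)) - (∑ j, bil (φx j t) (G i t) (G j t))
      + bil (φ t) (h t) (G i t)) := by
  have D := ((((domLim_BB hK hφ.coef_t W.fam_v (W.fam_G i)).sub
    ((domLim_BB hK (hφ.coef_x i) W.fam_v W.fam_v).const_mul (1 / 2))).add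
    ((DomLim.sum Finset.univ fun j _ =>
      domLim_BB hK (hφ.coef_x i) (W.fam_G j) (W.fam_G j)).const_mul (1 / 2))).sub
    (DomLim.sum Finset.univ fun j _ => domLim_BB hK (hφ.coef_x j) (W.fam_G i) (W.fam_G j))).add
    (W.domLim_hB hK hφ.coef (W.fam_G i))
  have I2 := right_mem_Icc.2 W.le
  have I1 := left_mem_Icc.2 W.le
  refine ⟨D.intervalIntegrable_lim W.le, ?_⟩
  refine tendsto_nhds_unique_of_eventuallyEq ((tendsto_end hK hφ.coef W.fam_v (W.fam_G i) I2).sub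
    (tendsto_end hK hφ.coef W.fam_v (W.fam_G i) I1)) (D.tendsto W.le) ?_
  filter_upwards [eventually_fits hK hO hKO] with n hn
  rw [((W.ptAC_v hn).product W.le hK (W.ptAC_G hn i) hφ.coef hφ.coef_t hφ.deriv_t).2]
  rw [intervalIntegral.integral_of_le W.le, intervalIntegral.integral_of_le W.le]
  apply integral_congr_ae
  filter_upwards [W.h_mem, ae_restrict_mem measurableSet_Ioc] with t hh ht'
  have ht := Ioc_subset_Icc_self ht'
  have cG := cvm_cont n ((W.fam_G i).mem t ht)
  rw [bil_comm (φ t) (fun x => (∑ i, cv (dk N n i) (G i t) x) + cv (mol N n) (h t) x)]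
  rw [W.bil_divG (hφ.coef.cont_x ht) (hφ.coef.compact hK ht) cG ht hh n]
  have parts := fun {f g : E N → ℝ} (j : Fin N) (hf : MemLp f 2 volume) (hg : MemLp g 2 volume) =>
    bil_parts n j (hφ.diff t ht) (hφ.coef.compact hK ht) (hφ.deriv_x t ht · j)
      ((hφ.coef_x j).cont_x ht) hf hg
  have e1 : bil (φ t) (cv (mol N n) (v t)) (cv (dk N n i) (v t)) =
      - (1 / 2) * bil (φx i t) (cv (mol N n) (v t)) (cv (mol N n) (v t)) := by
    have := parts i (W.fam_v.mem t ht) (W.fam_v.mem t ht)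
    rw [bil_comm _ (cv (dk N n i) (v t))] at this
    linarith
  -- After one integration by parts, curl-freeness turns ∂_jG_i G_j into ∂_iG_j G_j, half of the
  -- derivative of G_j², and a second integration by parts removes all derivatives.
  have e2 : ∀ j, bil (φ t) (cv (mol N n) (G i t)) (cv (dk N n j) (G j t)) =
      - bil (φx j t) (cv (mol N n) (G i t)) (cv (mol N n) (G j t))
      + 1 / 2 * bil (φx i t) (cv (mol N n) (G j t)) (cv (mol N n) (G j t)) := by
    intro j
    have k1 := parts j ((W.fam_G i).mem t ht) ((W.fam_G j).mem t ht)
    have k2 := parts i ((W.fam_G j).mem t ht) ((W.fam_G j).mem t ht)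
    rw [bil_comm _ (cv (dk N n i) (G j t))] at k2
    have k3 : bil (φ t) (cv (dk N n j) (G i t)) (cv (mol N n) (G j t)) =
        bil (φ t) (cv (mol N n) (G j t)) (cv (dk N n i) (G j t)) := by
      refine bil_congr fun x hx => ?_
      have hxK : x ∈ K := by
        by_contra h0; exact hx (hφ.coef.supp t ht x h0)
      rw [W.symm_cv ht (hn x hxK), mul_comm]
    linarith
  simp only [e1, e2, Finset.sum_add_distrib, Finset.sum_neg_distrib, ← Finset.mul_sum]
  rw [bil_comm (φ t) (cv (mol N n) (G i t)) (cv (mol N n) (h t))]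
  ring

/-- Integration by parts in space for `u²`. -/
theorem space_identity (W : LWave t₁ t₂ O u v h G) (hK : IsCompact K) (hO : IsOpen O)
    (hKO : K ⊆ O) (hφ : IsWeight t₁ t₂ K φ φt φx) (i : Fin N) {t : ℝ} (ht : t ∈ Icc t₁ t₂) :
    bil (φx i t) (u t) (u t) = -2 * bil (φ t) (u t) (G i t) := by
  refine tendsto_nhds_unique_of_eventuallyEq (tendsto_end hK (hφ.coef_x i) W.fam_u W.fam_u ht)
    ((tendsto_end hK hφ.coef W.fam_u (W.fam_G i) ht).const_mul (-2)) ?_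
  filter_upwards [eventually_fits hK hO hKO] with n hn
  have k := bil_parts n i (hφ.diff t ht) (hφ.coef.compact hK ht) (hφ.deriv_x t ht · i)
      ((hφ.coef_x i).cont_x ht) (W.fam_u.mem t ht) (W.fam_u.mem t ht)
  rw [bil_comm _ (cv (dk N n i) (u t))] at k
  have k3 : bil (φ t) (cv (mol N n) (u t)) (cv (dk N n i) (u t)) =
      bil (φ t) (cv (mol N n) (u t)) (cv (mol N n) (G i t)) := by
    refine bil_congr fun x hx => ?_
    have hxK : x ∈ K := by
      by_contra h0; exact hx (hφ.coef.supp t ht x h0)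
    rw [W.grad_cv ht (hn x hxK)]
  rw [k3] at k
  linarith

end LWave

end

end HamzaZaag

/-! ### The chain rule for bounded nonlinearities. -/

namespace HamzaZaag

noncomputable section

/-- The primitive of `s` vanishing at `0`. -/
def prim (s : ℝ → ℝ) (y : ℝ) : ℝ := ∫ z in (0 : ℝ)..y, s z

/-- Truncation to `[-n, n]`. -/
def trunc (n : ℕ) (y : ℝ) : ℝ := max (-(n : ℝ)) (min y n)

theorem trunc_cont (n : ℕ) : Continuous (trunc n) := by unfold trunc; fun_prop

theorem trunc_abs_le (n : ℕ) (y : ℝ) : |trunc n y| ≤ |y| := by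
  have hn : (0 : ℝ) ≤ n := Nat.cast_nonneg n
  unfold trunc
  rcases abs_cases y with h | h <;> rw [abs_le] <;> constructor <;>
    rcases max_cases (-(n : ℝ)) (min y n) with h1 | h1 <;>
    rcases min_cases y (n : ℝ) with h2 | h2 <;> linarith

theorem trunc_abs_le_nat (n : ℕ) (y : ℝ) : |trunc n y| ≤ n := by
  have hn : (0 : ℝ) ≤ n := Nat.cast_nonneg n
  rw [abs_le]
  exact ⟨le_max_left _ _, max_le (by linarith) (min_le_right _ _)⟩

theorem trunc_eq {n : ℕ} {y : ℝ} (h : |y| ≤ n) : trunc n y = y := by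
  rw [abs_le] at h
  rw [trunc, min_eq_left h.2, max_eq_right h.1]

theorem prim_hasDerivAt {s : ℝ → ℝ} (hs : Continuous s) (y : ℝ) :
    HasDerivAt (prim s) (s y) y :=
  intervalIntegral.integral_hasDerivAt_right (hs.intervalIntegrable _ _)
    (hs.stronglyMeasurableAtFilter _ _) hs.continuousAt

theorem prim_cont {s : ℝ → ℝ} (hs : Continuous s) : Continuous (prim s) :=
  continuous_iff_continuousAt.2 fun y => (prim_hasDerivAt hs y).continuousAt

theorem prim_zero (s : ℝ → ℝ) : prim s 0 = 0 := by simp [prim]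

theorem prim_lip {s : ℝ → ℝ} (hs : Continuous s) {B : ℝ} (hB : ∀ y, |s y| ≤ B) (y z : ℝ) :
    |prim s y - prim s z| ≤ B * |y - z| := by
  have : prim s y - prim s z = ∫ x in z..y, s x :=
    intervalIntegral.integral_interval_sub_left (hs.intervalIntegrable _ _)
      (hs.intervalIntegrable _ _)
  rw [this, ← Real.norm_eq_abs]
  exact intervalIntegral.norm_integral_le_of_norm_le_const fun x _ => hB x

theorem prim_trunc {s : ℝ → ℝ} {n : ℕ} {y : ℝ} (h : |y| ≤ n) :
    prim (fun z => s (trunc n z)) y = prim s y := by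
  refine intervalIntegral.integral_congr fun z hz => ?_
  have : |z| ≤ |y| := by
    rcases le_total 0 y with hy | hy
    · rw [uIcc_of_le hy] at hz
      rw [abs_of_nonneg hz.1, abs_of_nonneg hy]; exact hz.2
    · rw [uIcc_of_ge hy] at hz
      rw [abs_of_nonpos hz.2, abs_of_nonpos hy]; linarith [hz.1]
  simp only [trunc_eq (this.trans h)]

theorem prim_growth {s : ℝ → ℝ} {C p : ℝ} (hp : 0 ≤ p) (hC : 0 ≤ C)
    (h : ∀ y, |s y| ≤ C * (1 + |y| ^ p)) (y : ℝ) :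
    |prim s y| ≤ C * (|y| + |y| ^ (p + 1)) := by
  have h1 : |prim s y| ≤ C * (1 + |y| ^ p) * |y - 0| := by
    rw [← Real.norm_eq_abs]
    refine intervalIntegral.norm_integral_le_of_norm_le_const (f := s) fun z hz => ?_
    refine (h z).trans ?_
    have : |z| ≤ |y| := by
      rcases le_total 0 y with hy | hy
      · rw [uIoc_of_le hy] at hz
        rw [abs_of_nonneg hz.1.le, abs_of_nonneg hy]; exact hz.2
      · rw [uIoc_of_ge hy] at hz
        rw [abs_of_nonpos hz.2, abs_of_nonpos hy]; linarith [hz.1]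
    gcongr
  refine h1.trans (le_of_eq ?_)
  rw [sub_zero]
  rcases eq_or_lt_of_le (abs_nonneg y) with h0 | h0
  · rw [← h0, Real.zero_rpow (by linarith : (0 : ℝ) < p + 1).ne']; simp
  · rw [Real.rpow_add_one h0.ne']; ring

variable {N : ℕ} {t₁ t₂ : ℝ} {K O : Set (E N)}

theorem memLp_one_indicator (hK : IsCompact K) :
    MemLp (K.indicator (fun _ => (1 : ℝ))) 2 volume :=
  memLp_indicator_const 2 hK.measurableSet 1 (Or.inr hK.measure_ne_top)

/-- The weighted integral `∫ c f`. -/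
def lin {N : ℕ} (c f : E N → ℝ) : ℝ := ∫ x, c x * f x

/-- The indicator of `K` serves as an L² partner, so that the bilinear estimates apply. -/
theorem lin_eq_bil {c f : E N → ℝ} (hs : ∀ x, x ∉ K → c x = 0) :
    lin c f = bil c f (K.indicator (fun _ => (1 : ℝ))) := by
  unfold lin bil; congr 1; ext x
  by_cases hx : x ∈ K
  · simp [hx]
  · simp [hs x hx]

theorem lin_eq_bil_one (c f : E N → ℝ) : lin c f = bil c f (fun _ => 1) := by
  simp [lin, bil]

section Bounded

variable {s : ℝ → ℝ} {B : ℝ}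

theorem prim_abs_le (hs : Continuous s) (hB : ∀ y, |s y| ≤ B) (y : ℝ) : |prim s y| ≤ B * |y| := by
  simpa [prim_zero] using prim_lip hs hB y 0

theorem memLp_prim (hs : Continuous s) (hB : ∀ y, |s y| ≤ B) {f : E N → ℝ}
    (hf : MemLp f 2 volume) : MemLp (fun x => prim s (f x)) 2 volume :=
  hf.of_le_mul ((prim_cont hs).comp_aestronglyMeasurable hf.1)
    (Eventually.of_forall fun x => prim_abs_le hs hB (f x))

theorem nrm_le_mul {f g : E N → ℝ} {B : ℝ} (hg : MemLp g 2 volume)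
    (h : ∀ x, |f x| ≤ B * |g x|) : nrm f ≤ |B| * nrm g := by
  have h1 : eLpNorm f 2 volume ≤ ENNReal.ofReal |B| * eLpNorm g 2 volume :=
    eLpNorm_le_mul_eLpNorm_of_ae_le_mul (Eventually.of_forall fun x => (h x).trans
      (mul_le_mul_of_nonneg_right (le_abs_self B) (abs_nonneg _))) 2
  have := ENNReal.toReal_mono (ENNReal.mul_ne_top ENNReal.ofReal_ne_top hg.2.ne) h1
  rwa [ENNReal.toReal_mul, ENNReal.toReal_ofReal (abs_nonneg B)] at this

theorem lin_prim_bound (hs : Continuous s) (hB : ∀ y, |s y| ≤ B) (hK : IsCompact K)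
    {c f : E N → ℝ} {C : ℝ} (hc : ∀ x, |c x| ≤ C) (hcs : ∀ x, x ∉ K → c x = 0)
    (hf : MemLp f 2 volume) :
    |lin c (fun x => prim s (f x))| ≤
      C * (|B| * nrm f * nrm (K.indicator (fun _ => (1 : ℝ)))) := by
  rw [lin_eq_bil hcs]
  refine (abs_integral_mul_le hc (memLp_prim hs hB hf) (memLp_one_indicator hK)).trans ?_
  have : 0 ≤ C := (abs_nonneg _).trans (hc 0)
  gcongr
  · exact nrm_nonneg _
  · exact nrm_le_mul hf fun x => prim_abs_le hs hB (f x)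

theorem lin_prim_tendsto (hs : Continuous s) (hB : ∀ y, |s y| ≤ B) (hK : IsCompact K)
    {c f : E N → ℝ} (hc : Continuous c) (hcs : ∀ x, x ∉ K → c x = 0) (hf : MemLp f 2 volume) :
    Tendsto (fun n => lin c (fun x => prim s (cv (mol N n) f x))) atTop
      (𝓝 (lin c (fun x => prim s (f x)))) := by
  have hcc : HasCompactSupport c := HasCompactSupport.intro hK hcs
  obtain ⟨C, hC⟩ := hc.bounded_above_of_compact_support hcc
  have hC0 : 0 ≤ C := (norm_nonneg _).trans (hC 0)
  rw [tendsto_iff_norm_sub_tendsto_zero]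
  have κ := memLp_one_indicator hK
  have hb : ∀ n, ‖lin c (fun x => prim s (cv (mol N n) f x)) - lin c (fun x => prim s (f x))‖ ≤
      C * (|B| * nrm (cv (mol N n) f - f) * nrm (K.indicator (fun _ => (1 : ℝ)))) := by
    intro n
    have hF := memLp_prim hs hB (memLp_cv hf n)
    have hG := memLp_prim hs hB hf
    rw [lin_eq_bil hcs, lin_eq_bil hcs, bil, bil,
      ← integral_sub (bil_integrable hc hcc hF κ) (bil_integrable hc hcc hG κ)]
    have e : ∀ x, c x * (prim s (cv (mol N n) f x) * K.indicator (fun _ => (1 : ℝ)) x) -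
        c x * (prim s (f x) * K.indicator (fun _ => (1 : ℝ)) x) = c x *
        ((prim s (cv (mol N n) f x) - prim s (f x)) * K.indicator (fun _ => (1 : ℝ)) x) :=
      fun x => by ring
    simp only [e]
    refine (abs_integral_mul_le hC (hF.sub hG) κ).trans ?_
    gcongr
    · exact nrm_nonneg _
    · exact nrm_le_mul ((memLp_cv hf n).sub hf) fun x => prim_lip hs hB _ _
  refine squeeze_zero (fun _ => norm_nonneg _) hb ?_
  simpa using (((tendsto_nrm_cv hf).const_mul |B|).mul_const
    (nrm (K.indicator (fun _ => (1 : ℝ))))).const_mul C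

theorem memLp_comp_mul (hs : Continuous s) (hB : ∀ y, |s y| ≤ B) {f g : E N → ℝ}
    (hf : AEStronglyMeasurable f volume) (hg : MemLp g 2 volume) :
    MemLp (fun x => s (f x) * g x) 2 volume :=
  hg.of_le_mul (c := B) ((hs.comp_aestronglyMeasurable hf).mul hg.1)
    (Eventually.of_forall fun x => by
      rw [norm_mul]
      exact mul_le_mul_of_nonneg_right (hB _) (norm_nonneg _))

theorem lin_comp_bound (hs : Continuous s) (hB : ∀ y, |s y| ≤ B) (hK : IsCompact K)
    {c f g : E N → ℝ} {C : ℝ} (hc : ∀ x, |c x| ≤ C) (hcs : ∀ x, x ∉ K → c x = 0)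
    (hf : AEStronglyMeasurable f volume) (hg : MemLp g 2 volume) :
    |lin c (fun x => s (f x) * g x)| ≤
      C * (|B| * nrm g * nrm (K.indicator (fun _ => (1 : ℝ)))) := by
  rw [lin_eq_bil hcs]
  refine (abs_integral_mul_le hc (memLp_comp_mul hs hB hf hg) (memLp_one_indicator hK)).trans ?_
  have : 0 ≤ C := (abs_nonneg _).trans (hc 0)
  gcongr
  · exact nrm_nonneg _
  · refine nrm_le_mul hg fun x => ?_
    rw [abs_mul]
    exact mul_le_mul_of_nonneg_right (hB _) (abs_nonneg _)

/-- Since s is only continuous, s of the mollified function is handled with `g` fixed by almost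
everywhere convergence and domination; the replacement of `g` costs an L² distance times the bound
of s. -/
theorem lin_comp_tendsto (hs : Continuous s) (hB : ∀ y, |s y| ≤ B) (hK : IsCompact K)
    {c f g : E N → ℝ} (hc : Continuous c) (hcs : ∀ x, x ∉ K → c x = 0)
    (hf : MemLp f 2 volume) (hg : MemLp g 2 volume) :
    Tendsto (fun n => lin c (fun x => s (cv (mol N n) f x) * cv (mol N n) g x)) atTop
      (𝓝 (lin c (fun x => s (f x) * g x))) := by
  have hcc : HasCompactSupport c := HasCompactSupport.intro hK hcs
  obtain ⟨C, hC⟩ := hc.bounded_above_of_compact_support hcc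
  have κ := memLp_one_indicator hK
  have int : ∀ {F H : E N → ℝ}, AEStronglyMeasurable F volume → MemLp H 2 volume →
      Integrable (fun x => c x * (s (F x) * H x)) := by
    intro F H hF hH
    refine (bil_integrable hc hcc (memLp_comp_mul hs hB hF hH) κ).congr
      (Eventually.of_forall fun x => ?_)
    by_cases hx : x ∈ K
    · simp [hx]
    · simp [hcs x hx]
  have h1 : Tendsto (fun n => lin c (fun x => s (cv (mol N n) f x) * g x)) atTop
      (𝓝 (lin c (fun x => s (f x) * g x))) := by
    have hcg : Integrable (fun x => c x * g x) := by
      refine (bil_integrable hc hcc hg κ).congr (Eventually.of_forall fun x => ?_)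
      by_cases hx : x ∈ K
      · simp [hx]
      · simp [hcs x hx]
    refine tendsto_integral_of_dominated_convergence (fun x => B * |c x * g x|)
      (fun n => (int (memLp_cv hf n).1 hg).1) (hcg.abs.const_mul B)
      (fun n => Eventually.of_forall fun x => ?_) ?_
    · rw [Real.norm_eq_abs, show c x * (s (cv (mol N n) f x) * g x) =
        s (cv (mol N n) f x) * (c x * g x) by ring, abs_mul]
      exact mul_le_mul_of_nonneg_right (hB _) (abs_nonneg _)
    · filter_upwards [ae_tendsto_cv hf] with x hx
      exact (((hs.tendsto _).comp hx).mul_const _).const_mul _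
  have h2 : Tendsto (fun n => lin c (fun x => s (cv (mol N n) f x) * (cv (mol N n) g - g) x))
      atTop (𝓝 0) := by
    rw [tendsto_zero_iff_norm_tendsto_zero]
    refine squeeze_zero (fun _ => norm_nonneg _) (fun n => lin_comp_bound hs hB hK hC hcs
      (memLp_cv hf n).1 ((memLp_cv hg n).sub hg)) ?_
    simpa using (((tendsto_nrm_cv hg).const_mul |B|).mul_const
      (nrm (K.indicator (fun _ => (1 : ℝ))))).const_mul C
  have h3 := h1.add h2
  rw [add_zero] at h3
  refine h3.congr fun n => ?_
  unfold lin
  rw [← integral_add (int (memLp_cv hf n).1 hg) (int (memLp_cv hf n).1 ((memLp_cv hg n).sub hg))]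
  congr 1; ext x; simp only [Pi.sub_apply]; ring

/-- U is C¹ in the interior because V is continuous, so the classical chain rule applies. The
mollified u has such a derivative, namely the mollified v. -/
theorem chain_ftc {U V : ℝ → ℝ} (hs : Continuous s) (hV : ContinuousOn V (Icc t₁ t₂))
    (hU : ∀ t ∈ Icc t₁ t₂, U t = U t₁ + ∫ τ in t₁..t, V τ) {t : ℝ} (ht : t ∈ Icc t₁ t₂) :
    prim s (U t) = prim s (U t₁) + ∫ τ in t₁..t, s (U τ) * V τ := by
  have hsub : Icc t₁ t ⊆ Icc t₁ t₂ := Icc_subset_Icc_right ht.2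
  have h12 : t₁ ≤ t₂ := ht.1.trans ht.2
  have hVi : IntervalIntegrable V volume t₁ t₂ :=
    ContinuousOn.intervalIntegrable (by rwa [uIcc_of_le h12])
  have hUc : ContinuousOn U (Icc t₁ t₂) := by
    have h0 : ContinuousOn (fun t => U t₁ + ∫ τ in t₁..t, V τ) (Icc t₁ t₂) := by
      have := intervalIntegral.continuousOn_primitive_interval' hVi (left_mem_uIcc)
      rw [uIcc_of_le h12] at this
      exact continuousOn_const.add this
    exact h0.congr hU
  have hUd : ∀ τ ∈ Ioo t₁ t, HasDerivAt U (V τ) τ := by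
    intro τ hτ
    have hn : Icc t₁ t₂ ∈ 𝓝 τ := Icc_mem_nhds hτ.1 (hτ.2.trans_le ht.2)
    have hVτ : ContinuousAt V τ := hV.continuousAt hn
    have hsm : StronglyMeasurableAtFilter V (𝓝 τ) volume :=
      (hV.stronglyMeasurableAtFilter_nhdsWithin measurableSet_Icc τ).filter_mono (by
        rw [nhdsWithin_eq_nhds.2 hn])
    have h1 := (intervalIntegral.integral_hasDerivAt_right (hVi.mono_set (by
      rw [uIcc_of_le hτ.1.le, uIcc_of_le h12]
      exact Icc_subset_Icc_right (hτ.2.le.trans ht.2))) hsm hVτ).const_add (U t₁)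
    refine h1.congr_of_eventuallyEq ?_
    filter_upwards [hn] with σ hσ
    exact hU σ hσ
  have key := intervalIntegral.integral_eq_sub_of_hasDerivAt_of_le ht.1
    ((prim_cont hs).comp_continuousOn (hUc.mono hsub))
    (fun τ hτ => (prim_hasDerivAt hs (U τ)).comp τ (hUd τ hτ))
    (ContinuousOn.intervalIntegrable (by
      rw [uIcc_of_le ht.1]
      exact (hs.comp_continuousOn (hUc.mono hsub)).mul (hV.mono hsub)))
  rw [key]
  simp

end Bounded

/-- A dummy second factor, which lets the product rule treat integrals with a single factor. -/
theorem ptAC_one : PtAC t₁ t₂ K (fun _ _ => (1 : ℝ)) (fun _ _ => 0) where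
  contA _ _ := continuous_const
  measA := aestronglyMeasurable_const
  meas := aestronglyMeasurable_const
  meas_time _ _ := aestronglyMeasurable_const
  bdd := ⟨1, by simp⟩
  bdd_deriv := ⟨fun _ => 0, integrableOn_zero, by simp⟩
  ftc := by simp

theorem PtAC.continuousOn {A a : ℝ → E N → ℝ} (h : PtAC t₁ t₂ K A a) (h12 : t₁ ≤ t₂) {x : E N}
    (hx : x ∈ K) : ContinuousOn (fun t => A t x) (Icc t₁ t₂) := by
  have := intervalIntegral.continuousOn_primitive_interval' (h.intervalIntegrable h12 hx)
    (left_mem_uIcc)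
  rw [uIcc_of_le h12] at this
  exact (continuousOn_const.add this).congr (h.ftc x hx)

namespace LWave

variable {u v h : ℝ → E N → ℝ} {G : Fin N → ℝ → E N → ℝ} {n : ℕ}
  {φ φt : ℝ → E N → ℝ} {φx : Fin N → ℝ → E N → ℝ} {s : ℝ → ℝ} {B : ℝ}

theorem ptAC_prim (W : LWave t₁ t₂ O u v h G) (hK : Fits n K O) (hs : Continuous s)
    (hB : ∀ y, |s y| ≤ B) :
    PtAC t₁ t₂ K (fun t x => prim s (cv (mol N n) (u t) x))
      (fun t x => s (cv (mol N n) (u t) x) * cv (mol N n) (v t) x) where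
  contA t ht := (prim_cont hs).comp (cvm_cont n (W.fam_u.mem t ht))
  measA := (prim_cont hs).comp_aestronglyMeasurable (W.ptAC_u hK).measA
  meas := (hs.comp_aestronglyMeasurable (W.ptAC_u hK).measA).mul (W.ptAC_u hK).meas
  meas_time x hx := (hs.comp_aestronglyMeasurable
    (cv_meas_time (mol_contDiff n).continuous W.fam_u.meas x)).mul ((W.ptAC_u hK).meas_time x hx)
  bdd := by
    obtain ⟨C, hC⟩ := (W.ptAC_u hK).bdd
    have hB0 : 0 ≤ B := (abs_nonneg _).trans (hB 0)
    exact ⟨B * C, fun t ht x hx => (prim_abs_le hs hB _).trans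
      (mul_le_mul_of_nonneg_left (hC t ht x hx) hB0)⟩
  bdd_deriv := by
    obtain ⟨C, hC⟩ := (W.ptAC_v hK).bdd
    have hB0 : 0 ≤ B := (abs_nonneg _).trans (hB 0)
    refine ⟨fun _ => B * C, integrableOn_const (by simp), ae_Ioc fun t ht x hx => ?_⟩
    rw [abs_mul]
    exact mul_le_mul (hB _) (hC t ht x hx) (abs_nonneg _) hB0
  ftc x hx t ht := chain_ftc hs ((W.ptAC_v hK).continuousOn W.le hx) ((W.ptAC_u hK).ftc x hx) ht

/-- The chain rule in time for a bounded nonlinearity. -/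
theorem prim_identity_bounded (W : LWave t₁ t₂ O u v h G) (hK : IsCompact K) (hO : IsOpen O)
    (hKO : K ⊆ O) (hφ : IsWeight t₁ t₂ K φ φt φx) (hs : Continuous s) (hB : ∀ y, |s y| ≤ B) :
    IntervalIntegrable (fun t => lin (φt t) (fun x => prim s (u t x)) +
      lin (φ t) (fun x => s (u t x) * v t x)) volume t₁ t₂ ∧
    lin (φ t₂) (fun x => prim s (u t₂ x)) - lin (φ t₁) (fun x => prim s (u t₁ x)) =
      ∫ t in t₁..t₂, (lin (φt t) (fun x => prim s (u t x)) +
        lin (φ t) (fun x => s (u t x) * v t x)) := by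
  obtain ⟨Cu, hCu⟩ := W.fam_u.bd
  obtain ⟨Cv, hCv⟩ := W.fam_v.bd
  obtain ⟨C, hC0, hC⟩ := hφ.coef.bdd hK
  obtain ⟨C', hC'0, hC'⟩ := hφ.coef_t.bdd hK
  have hm := (mol_contDiff (N := N) · |>.continuous)
  have one : AEStronglyMeasurable (fun _ : ℝ × E N => (1 : ℝ)) (strip N t₁ t₂) :=
    aestronglyMeasurable_const
  have D1 : DomLim t₁ t₂ (fun n t => lin (φt t) (fun x => prim s (cv (mol N n) (u t) x)))
      (fun t => lin (φt t) (fun x => prim s (u t x))) := by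
    refine ⟨fun n => ?_, ⟨fun _ => C' * (|B| * (3 * Cu) * nrm (K.indicator (fun _ => (1 : ℝ)))),
      integrableOn_const (by simp), fun n => ae_Ioc fun t ht => ?_⟩, ae_Ioc fun t ht => ?_⟩
    · simp only [lin_eq_bil_one]
      exact bil_meas hφ.coef_t.meas
        ((prim_cont hs).comp_aestronglyMeasurable (cv_meas (hm n) W.fam_u.meas)) one
    · refine (lin_prim_bound hs hB hK (hC' t ht) (hφ.coef_t.supp t ht)
        (memLp_cv (W.fam_u.mem t ht) n)).trans ?_
      dsimp only
      gcongr
      · exact nrm_nonneg _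
      · exact (nrm_cv_le (W.fam_u.mem t ht) n).trans (by linarith [hCu t ht])
    · exact lin_prim_tendsto hs hB hK (hφ.coef_t.cont_x ht) (hφ.coef_t.supp t ht)
        (W.fam_u.mem t ht)
  have D2 : DomLim t₁ t₂ (fun n t => lin (φ t) (fun x => s (cv (mol N n) (u t) x) *
      cv (mol N n) (v t) x)) (fun t => lin (φ t) (fun x => s (u t x) * v t x)) := by
    refine ⟨fun n => ?_, ⟨fun _ => C * (|B| * (3 * Cv) * nrm (K.indicator (fun _ => (1 : ℝ)))),
      integrableOn_const (by simp), fun n => ae_Ioc fun t ht => ?_⟩, ae_Ioc fun t ht => ?_⟩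
    · exact bil_meas hφ.coef.meas (hs.comp_aestronglyMeasurable (cv_meas (hm n) W.fam_u.meas))
        (cv_meas (hm n) W.fam_v.meas)
    · refine (lin_comp_bound hs hB hK (hC t ht) (hφ.coef.supp t ht)
        (memLp_cv (W.fam_u.mem t ht) n).1 (memLp_cv (W.fam_v.mem t ht) n)).trans ?_
      dsimp only
      gcongr
      · exact nrm_nonneg _
      · exact (nrm_cv_le (W.fam_v.mem t ht) n).trans (by linarith [hCv t ht])
    · exact lin_comp_tendsto hs hB hK (hφ.coef.cont_x ht) (hφ.coef.supp t ht)
        (W.fam_u.mem t ht) (W.fam_v.mem t ht)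
  have D := D1.add D2
  have I2 := right_mem_Icc.2 W.le
  have I1 := left_mem_Icc.2 W.le
  refine ⟨D.intervalIntegrable_lim W.le, ?_⟩
  have T := fun {t : ℝ} (ht : t ∈ Icc t₁ t₂) =>
    lin_prim_tendsto hs hB hK (hφ.coef.cont_x ht) (hφ.coef.supp t ht) (W.fam_u.mem t ht)
  refine tendsto_nhds_unique_of_eventuallyEq ((T I2).sub (T I1)) (D.tendsto W.le) ?_
  filter_upwards [eventually_fits hK hO hKO] with n hn
  have P := ((W.ptAC_prim hn hs hB).product W.le hK ptAC_one hφ.coef hφ.coef_t hφ.deriv_t).2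
  simp only [lin_eq_bil_one]
  rw [P]
  congr 1; ext t
  simp [bil]

/-- The chain rule in space for a bounded nonlinearity. -/
theorem prim_space_bounded (W : LWave t₁ t₂ O u v h G) (hK : IsCompact K) (hO : IsOpen O)
    (hKO : K ⊆ O) (hφ : IsWeight t₁ t₂ K φ φt φx) (hs : Continuous s) (hB : ∀ y, |s y| ≤ B)
    (i : Fin N) {t : ℝ} (ht : t ∈ Icc t₁ t₂) :
    lin (φx i t) (fun x => prim s (u t x)) = - lin (φ t) (fun x => s (u t x) * G i t x) := by
  have hu := W.fam_u.mem t ht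
  refine tendsto_nhds_unique_of_eventuallyEq
    (lin_prim_tendsto hs hB hK ((hφ.coef_x i).cont_x ht) ((hφ.coef_x i).supp t ht) hu)
    (lin_comp_tendsto hs hB hK (hφ.coef.cont_x ht) (hφ.coef.supp t ht) hu
      ((W.fam_G i).mem t ht)).neg ?_
  filter_upwards [eventually_fits hK hO hKO] with n hn
  have hcc := hφ.coef.compact hK ht
  have hxc := (hφ.coef_x i).compact hK ht
  have cu := cvm_cont n hu
  have cd := cvd_cont n i hu
  have hd : ∀ x, HasFDerivAt (fun x => prim s (cv (mol N n) (u t) x))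
      (s (cv (mol N n) (u t) x) • fderiv ℝ (cv (mol N n) (u t)) x) x := fun x =>
    (prim_hasDerivAt hs _).comp_hasFDerivAt x
      ((cv_contDiff (mol_contDiff n) (mol_compact n) hu).differentiable
        (by simp)).differentiableAt.hasFDerivAt
  have hfd : ∀ x, fderiv ℝ (fun x => prim s (cv (mol N n) (u t) x)) x (ei i) =
      s (cv (mol N n) (u t) x) * cv (dk N n i) (u t) x := by
    intro x
    rw [(hd x).fderiv]
    simp [cv_fderiv_ei n hu]
  have hxe : (fun x => fderiv ℝ (φ t) x (ei i)) = φx i t := by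
    ext x; exact hφ.deriv_x t ht x i
  have c1 : Continuous (fun x => prim s (cv (mol N n) (u t) x)) := (prim_cont hs).comp cu
  have c2 : Continuous (fun x => s (cv (mol N n) (u t) x)) := hs.comp cu
  have key := integral_mul_fderiv_eq_neg_fderiv_mul_of_integrable (μ := (volume : Measure (E N)))
    (f := φ t) (g := fun x => prim s (cv (mol N n) (u t) x)) (v := ei i)
    (by
      simp only [hφ.deriv_x t ht]
      exact (((hφ.coef_x i).cont_x ht).mul c1).integrable_of_hasCompactSupport hxc.mul_right)
    (by
      simp only [hfd]
      exact ((hφ.coef.cont_x ht).mul (c2.mul cd)).integrable_of_hasCompactSupport hcc.mul_right)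
    (((hφ.coef.cont_x ht).mul c1).integrable_of_hasCompactSupport hcc.mul_right)
    (fun x _ => (hφ.diff t ht).differentiableAt) (fun x _ => (hd x).differentiableAt)
  simp only [hfd, hφ.deriv_x t ht] at key
  have e : ∫ x, φ t x * (s (cv (mol N n) (u t) x) * cv (dk N n i) (u t) x) =
      lin (φ t) (fun x => s (cv (mol N n) (u t) x) * cv (mol N n) (G i t) x) := by
    unfold lin; congr 1; ext x
    by_cases hx : x ∈ K
    · rw [W.grad_cv ht (hn x hx)]
    · simp [hφ.coef.supp t ht x hx]
  rw [e] at key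
  rw [key, neg_neg]
  rfl

end LWave

end

end HamzaZaag

/-! ### Power growth by truncation. -/

namespace HamzaZaag

noncomputable section

/-- The pure power nonlinearity. -/
def pw (p y : ℝ) : ℝ := |y| ^ (p - 1) * y

theorem pw_abs {p : ℝ} (hp : 1 < p) (y : ℝ) : |pw p y| = |y| ^ p := by
  rw [pw, abs_mul, abs_of_nonneg (Real.rpow_nonneg (abs_nonneg y) _)]
  rcases eq_or_lt_of_le (abs_nonneg y) with h | h
  · rw [← h, mul_zero, Real.zero_rpow (by linarith)]
  · rw [← Real.rpow_add_one h.ne']; simp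

theorem pw_cont {p : ℝ} (hp : 1 < p) : Continuous (pw p) := by
  unfold pw
  exact (continuous_abs.rpow_const fun x => Or.inr (by linarith)).mul continuous_id

theorem prim_pw {p : ℝ} (hp : 1 < p) (y : ℝ) : prim (pw p) y = |y| ^ (p + 1) / (p + 1) := by
  have h : ∀ x ∈ uIcc 0 y, HasDerivAt (fun x : ℝ => |x| ^ (p + 1) / (p + 1)) (pw p x) x := by
    intro x _
    have := (hasDerivAt_abs_rpow x (by linarith : 1 < p + 1)).div_const (p + 1)
    have e : (p + 1) * |x| ^ (p + 1 - 2) * x / (p + 1) = pw p x := by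
      have : p + 1 ≠ 0 := by linarith
      rw [show p + 1 - 2 = p - 1 by ring, mul_assoc, mul_div_cancel_left₀ _ this]
      rfl
    rwa [e] at this
  rw [prim, intervalIntegral.integral_eq_sub_of_hasDerivAt h
    ((pw_cont hp).intervalIntegrable _ _)]
  rw [abs_zero, Real.zero_rpow (by linarith)]
  simp

/-- This sign makes Fatou's lemma applicable to the truncated powers. -/
theorem prim_nonneg {s : ℝ → ℝ} (h : ∀ y, 0 ≤ s y * y) (y : ℝ) : 0 ≤ prim s y := by
  rcases le_total 0 y with hy | hy
  · refine intervalIntegral.integral_nonneg_of_ae_restrict hy ?_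
    filter_upwards [ae_restrict_mem measurableSet_Icc, Measure.ae_ne (volume.restrict (Icc 0 y)) 0]
      with z hz hz0
    exact nonneg_of_mul_nonneg_left (h z) (lt_of_le_of_ne hz.1 (Ne.symm hz0))
  · rw [prim, intervalIntegral.integral_symm, ← intervalIntegral.integral_neg]
    refine intervalIntegral.integral_nonneg_of_ae_restrict hy ?_
    filter_upwards [ae_restrict_mem measurableSet_Icc, Measure.ae_ne (volume.restrict (Icc y 0)) 0]
      with z hz hz0
    have hz' : z < 0 := lt_of_le_of_ne hz.2 hz0
    simp only [Pi.zero_apply]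
    nlinarith [h z]

theorem trunc_mul_nonneg (n : ℕ) (y : ℝ) : 0 ≤ trunc n y * y := by
  have hn : (0 : ℝ) ≤ n := Nat.cast_nonneg n
  rcases le_total 0 y with h | h
  · exact mul_nonneg (le_max_of_le_right (le_min h hn)) h
  · exact mul_nonneg_of_nonpos_of_nonpos (max_le (by linarith) (min_le_of_left_le h)) h

variable {N : ℕ} {t₁ t₂ : ℝ} {K O : Set (E N)}

section FixedTime

variable {s : ℝ → ℝ} {C p : ℝ}

theorem trunc_growth (hp : 0 ≤ p) (hC : 0 ≤ C) (h : ∀ y, |s y| ≤ C * (1 + |y| ^ p)) (n : ℕ)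
    (y : ℝ) : |s (trunc n y)| ≤ C * (1 + |y| ^ p) := by
  refine (h _).trans ?_
  have := Real.rpow_le_rpow (abs_nonneg _) (trunc_abs_le n y) hp
  gcongr

theorem trunc_bounded (hp : 0 ≤ p) (hC : 0 ≤ C) (h : ∀ y, |s y| ≤ C * (1 + |y| ^ p)) (n : ℕ)
    (y : ℝ) : |s (trunc n y)| ≤ C * (1 + (n : ℝ) ^ p) := by
  refine (h _).trans ?_
  have := Real.rpow_le_rpow (abs_nonneg _) (trunc_abs_le_nat n y) hp
  gcongr

theorem abs_le_one_add_rpow {q : ℝ} (hq : 1 ≤ q) (y : ℝ) : |y| ≤ 1 + |y| ^ q := by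
  have h0 := Real.rpow_nonneg (abs_nonneg y) q
  rcases le_total |y| 1 with h | h
  · linarith
  · have := Real.rpow_le_rpow_of_exponent_le h hq
    rw [Real.rpow_one] at this
    linarith

theorem prim_growth' (hp : 0 ≤ p) (hC : 0 ≤ C) (h : ∀ y, |s y| ≤ C * (1 + |y| ^ p)) (y : ℝ) :
    |prim s y| ≤ C * (1 + 2 * |y| ^ (p + 1)) := by
  refine (prim_growth hp hC h y).trans ?_
  have := abs_le_one_add_rpow (by linarith : 1 ≤ p + 1) y
  exact mul_le_mul_of_nonneg_left (by linarith) hC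

/-- The constant 1 is square integrable only on the compact set, hence the indicator. -/
theorem memLp_growth (hK : IsCompact K) {f H : E N → ℝ} (hH : AEStronglyMeasurable H volume)
    (h : ∀ x, |H x| ≤ C * (1 + |f x| ^ p)) (hf : MemLp (fun x => |f x| ^ p) 2 volume) :
    MemLp (K.indicator H) 2 volume ∧ nrm (K.indicator H) ≤
      |C| * (nrm (K.indicator (fun _ => (1 : ℝ))) + nrm (fun x => |f x| ^ p)) := by
  have κ := memLp_one_indicator hK
  have hs := κ.add hf
  have hb : ∀ x, |K.indicator H x| ≤
      C * |(K.indicator (fun _ => (1 : ℝ)) + fun x => |f x| ^ p) x| := by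
    intro x
    have h0 := Real.rpow_nonneg (abs_nonneg (f x)) p
    have hC : 0 ≤ C := by
      by_contra hC
      have := (abs_nonneg _).trans (h x)
      nlinarith
    by_cases hx : x ∈ K
    · simp only [hx, indicator_of_mem, Pi.add_apply]
      rw [abs_of_nonneg (by linarith : (0 : ℝ) ≤ 1 + |f x| ^ p)]
      exact h x
    · simp only [hx, not_false_eq_true, indicator_of_notMem, abs_zero]
      positivity
  refine ⟨hs.of_le_mul (hH.indicator hK.measurableSet) (Eventually.of_forall hb), ?_⟩
  refine (nrm_le_mul hs hb).trans ?_
  gcongr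
  have := ENNReal.toReal_mono (ENNReal.add_ne_top.2 ⟨κ.2.ne, hf.2.ne⟩)
    (eLpNorm_add_le κ.1 hf.1 (by norm_num))
  rwa [ENNReal.toReal_add κ.2.ne hf.2.ne] at this

theorem lin_growth_eq {c f g : E N → ℝ} (hcs : ∀ x, x ∉ K → c x = 0) :
    lin c (fun x => f x * g x) = bil c (K.indicator f) g := by
  unfold lin bil; congr 1; ext x
  by_cases hx : x ∈ K
  · simp [hx]
  · simp [hcs x hx]

theorem lin_growth_bound (hK : IsCompact K) {c f g H : E N → ℝ} {D : ℝ} (hc : ∀ x, |c x| ≤ D)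
    (hcs : ∀ x, x ∉ K → c x = 0) (hH : AEStronglyMeasurable H volume)
    (h : ∀ x, |H x| ≤ C * (1 + |f x| ^ p)) (hf : MemLp (fun x => |f x| ^ p) 2 volume)
    (hg : MemLp g 2 volume) :
    |lin c (fun x => H x * g x)| ≤ D * ((|C| *
      (nrm (K.indicator (fun _ => (1 : ℝ))) + nrm (fun x => |f x| ^ p))) * nrm g) := by
  obtain ⟨h1, h2⟩ := memLp_growth hK hH h hf
  rw [lin_growth_eq hcs]
  refine (abs_integral_mul_le hc h1 hg).trans ?_
  have : 0 ≤ D := (abs_nonneg _).trans (hc 0)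
  gcongr
  exact nrm_nonneg _

theorem lin_growth_integrable (hK : IsCompact K) {c f g H : E N → ℝ} (hc : Continuous c)
    (hcs : ∀ x, x ∉ K → c x = 0) (hH : AEStronglyMeasurable H volume)
    (h : ∀ x, |H x| ≤ C * (1 + |f x| ^ p)) (hf : MemLp (fun x => |f x| ^ p) 2 volume)
    (hg : MemLp g 2 volume) : Integrable (fun x => c x * (H x * g x)) := by
  obtain ⟨h1, -⟩ := memLp_growth hK hH h hf
  refine (bil_integrable hc (HasCompactSupport.intro hK hcs) h1 hg).congr
    (Eventually.of_forall fun x => ?_)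
  by_cases hx : x ∈ K
  · simp [hx]
  · simp [hcs x hx]

theorem eventually_trunc (s : ℝ → ℝ) (y : ℝ) : ∀ᶠ n : ℕ in atTop, s (trunc n y) = s y := by
  obtain ⟨m, hm⟩ := exists_nat_ge |y|
  filter_upwards [eventually_ge_atTop m] with n hn
  rw [trunc_eq (hm.trans (Nat.cast_le.2 hn))]

/-- For each y the sequence is eventually constant, so pointwise convergence is immediate and only
domination has to be checked. -/
theorem eventually_prim_trunc (s : ℝ → ℝ) (y : ℝ) :
    ∀ᶠ n : ℕ in atTop, prim (fun z => s (trunc n z)) y = prim s y := by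
  obtain ⟨m, hm⟩ := exists_nat_ge |y|
  filter_upwards [eventually_ge_atTop m] with n hn
  exact prim_trunc (hm.trans (Nat.cast_le.2 hn))

/-- Truncation does not increase absolute values, so the growth bound of s dominates all truncated
integrands at once. -/
theorem lin_trunc_tendsto (hs : Continuous s) (hp : 0 ≤ p) (hC : 0 ≤ C)
    (h : ∀ y, |s y| ≤ C * (1 + |y| ^ p)) (hK : IsCompact K) {c f g : E N → ℝ} (hc : Continuous c)
    (hcs : ∀ x, x ∉ K → c x = 0) (hfm : AEStronglyMeasurable f volume)
    (hf : MemLp (fun x => |f x| ^ p) 2 volume) (hg : MemLp g 2 volume) :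
    Tendsto (fun n => lin c (fun x => s (trunc n (f x)) * g x)) atTop
      (𝓝 (lin c (fun x => s (f x) * g x))) := by
  have hm : Measurable (fun y : ℝ => C * (1 + |y| ^ p)) := by fun_prop
  have hd := lin_growth_integrable hK (hc.abs) (fun x hx => by simp [hcs x hx])
    (H := fun x => C * (1 + |f x| ^ p))
    (hm.comp_aemeasurable hfm.aemeasurable).aestronglyMeasurable
    (fun x => by rw [abs_of_nonneg]; positivity) hf hg.abs
  refine tendsto_integral_of_dominated_convergence _ (fun n => ?_) hd
    (fun n => Eventually.of_forall fun x => ?_) (Eventually.of_forall fun x => ?_)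
  · exact hc.aestronglyMeasurable.mul
      (((hs.comp (trunc_cont n)).comp_aestronglyMeasurable hfm).mul hg.1)
  · rw [Real.norm_eq_abs, abs_mul, abs_mul]
    have := trunc_growth hp hC h n (f x)
    exact mul_le_mul_of_nonneg_left (mul_le_mul_of_nonneg_right this (abs_nonneg _)) (abs_nonneg _)
  · refine tendsto_const_nhds.congr' ?_
    filter_upwards [eventually_trunc s (f x)] with n hn
    rw [hn]

theorem lin_prim_growth (hp : 0 ≤ p) (hC : 0 ≤ C) (hs : Continuous s)
    (h : ∀ y, |s y| ≤ C * (1 + |y| ^ p)) (hK : IsCompact K) {c f : E N → ℝ} {D M : ℝ}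
    (hcm : AEStronglyMeasurable c volume) (hcD : ∀ x, |c x| ≤ D) (hcs : ∀ x, x ∉ K → c x = 0)
    (hfm : AEStronglyMeasurable f volume) (hf : IntegrableOn (fun x => |f x| ^ (p + 1)) K)
    (hM : ∫ x in K, |f x| ^ (p + 1) ≤ M) :
    Integrable (fun x => c x * prim s (f x)) ∧
    |lin c (fun x => prim s (f x))| ≤ D * (C * (volume.real K + 2 * M)) := by
  have hD : 0 ≤ D := (abs_nonneg _).trans (hcD 0)
  have hint : IntegrableOn (fun x => D * (C * (1 + 2 * |f x| ^ (p + 1)))) K :=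
    (((integrableOn_const hK.measure_ne_top).add (hf.const_mul 2)).const_mul C).const_mul D
  have hb : ∀ x, ‖c x * prim s (f x)‖ ≤
      K.indicator (fun x => D * (C * (1 + 2 * |f x| ^ (p + 1)))) x := by
    intro x
    by_cases hx : x ∈ K
    · rw [indicator_of_mem hx, norm_mul]
      exact mul_le_mul (hcD x) (prim_growth' hp hC h _) (norm_nonneg _) hD
    · simp [hx, hcs x hx]
  have hi := (integrable_indicator_iff hK.measurableSet).2 hint
  refine ⟨hi.mono' (hcm.mul ((prim_cont hs).comp_aestronglyMeasurable hfm))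
    (Eventually.of_forall hb), ?_⟩
  refine (norm_integral_le_of_norm_le hi (Eventually.of_forall hb)).trans ?_
  rw [integral_indicator hK.measurableSet, integral_const_mul, integral_const_mul,
    integral_add (integrable_const_iff.2 (Or.inr ⟨by
      rw [Measure.restrict_apply_univ]; exact hK.measure_lt_top⟩)) (hf.const_mul 2),
    integral_const_mul]
  simp only [integral_const, smul_eq_mul, mul_one]
  have e : (volume.restrict K).real univ = volume.real K := by simp
  rw [e]
  gcongr

theorem lin_prim_trunc_tendsto (hs : Continuous s) (hp : 0 ≤ p) (hC : 0 ≤ C)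
    (h : ∀ y, |s y| ≤ C * (1 + |y| ^ p)) (hK : IsCompact K) {c f : E N → ℝ} (hc : Continuous c)
    (hcs : ∀ x, x ∉ K → c x = 0) (hfm : AEStronglyMeasurable f volume)
    (hf : IntegrableOn (fun x => |f x| ^ (p + 1)) K) :
    Tendsto (fun n => lin c (fun x => prim (fun z => s (trunc n z)) (f x))) atTop
      (𝓝 (lin c (fun x => prim s (f x)))) := by
  obtain ⟨D, hD⟩ := hc.bounded_above_of_compact_support (HasCompactSupport.intro hK hcs)
  have hD0 : 0 ≤ D := (norm_nonneg _).trans (hD 0)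
  have hint : IntegrableOn (fun x => D * (C * (1 + 2 * |f x| ^ (p + 1)))) K :=
    (((integrableOn_const hK.measure_ne_top).add (hf.const_mul 2)).const_mul C).const_mul D
  refine tendsto_integral_of_dominated_convergence
    (K.indicator (fun x => D * (C * (1 + 2 * |f x| ^ (p + 1))))) (fun n => ?_)
    ((integrable_indicator_iff hK.measurableSet).2 hint)
    (fun n => Eventually.of_forall fun x => ?_) (Eventually.of_forall fun x => ?_)
  · exact hc.aestronglyMeasurable.mul
      ((prim_cont (hs.comp (trunc_cont n))).comp_aestronglyMeasurable hfm)
  · by_cases hx : x ∈ K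
    · rw [indicator_of_mem hx, norm_mul]
      exact mul_le_mul (hD x) (prim_growth' hp hC (trunc_growth hp hC h n) _) (norm_nonneg _) hD0
    · simp [hx, hcs x hx]
  · refine tendsto_const_nhds.congr' ?_
    filter_upwards [eventually_prim_trunc s (f x)] with n hn
    rw [hn]

end FixedTime

theorem isWeight_const {χ : E N → ℝ} (hχ : ContDiff ℝ ∞ χ) (hs : tsupport χ ⊆ K) :
    IsWeight t₁ t₂ K (fun _ => χ) (fun _ _ => 0) (fun i _ x => fderiv ℝ χ x (ei i)) where
  coef := ⟨(hχ.continuous.comp continuous_snd).continuousOn, fun _ _ x hx =>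
    image_eq_zero_of_notMem_tsupport fun h => hx (hs h)⟩
  coef_t := ⟨continuousOn_const, fun _ _ _ _ => rfl⟩
  coef_x i := ⟨(((hχ.continuous_fderiv (by simp)).clm_apply continuous_const).comp
      continuous_snd).continuousOn, fun _ _ x hx => by
    have : x ∉ tsupport (fderiv ℝ χ) := fun h => hx (hs (tsupport_fderiv_subset ℝ h))
    rw [image_eq_zero_of_notMem_tsupport this]; rfl⟩
  deriv_t _ _ x := hasDerivAt_const _ _
  diff _ _ := hχ.differentiable (by simp)
  deriv_x _ _ _ _ := rfl

theorem IsBFam.mono {A : ℝ → E N → ℝ} (h : IsBFam t₁ t₂ A) {a b : ℝ} (ha : t₁ ≤ a) (hb : b ≤ t₂) :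
    IsBFam a b A where
  meas := h.meas.mono_measure (by
    unfold strip
    exact Measure.prod_mono (Measure.restrict_mono (Ioc_subset_Ioc ha hb) le_rfl) le_rfl)
  mem t ht := h.mem t (Icc_subset_Icc ha hb ht)
  bd := by
    obtain ⟨C, hC⟩ := h.bd
    exact ⟨C, fun t ht => hC t (Icc_subset_Icc ha hb ht)⟩

theorem IsFam.mono {A : ℝ → E N → ℝ} {β : ℝ → ℝ} (h : IsFam t₁ t₂ A β) {a b : ℝ} (ha : t₁ ≤ a)
    (hb : b ≤ t₂) : IsFam a b A β where
  meas := h.meas.mono_measure (by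
    unfold strip
    exact Measure.prod_mono (Measure.restrict_mono (Ioc_subset_Ioc ha hb) le_rfl) le_rfl)
  bd := ae_restrict_of_ae_restrict_of_subset (Ioc_subset_Ioc ha hb) h.bd

end

end HamzaZaag

/-! ### The L^{p+1} bound and the chain rule for power growth. -/

namespace HamzaZaag

noncomputable section

variable {N : ℕ} {t₁ t₂ : ℝ} {K O : Set (E N)}

theorem IsFam.pair_integrable {A : ℝ → E N → ℝ} {β : ℝ → ℝ} (hA : IsFam t₁ t₂ A β)
    (hβ : IntegrableOn β (Ioc t₁ t₂)) {ψ : E N → ℝ} (hψ : MemLp ψ 2 volume) :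
    IntegrableOn (fun τ => ∫ x, A τ x * ψ x) (Ioc t₁ t₂) := by
  have hm : AEStronglyMeasurable (fun τ => ∫ x, A τ x * ψ x) (volume.restrict (Ioc t₁ t₂)) :=
    AEStronglyMeasurable.integral_prod_right' (f := fun z : ℝ × E N => A z.1 z.2 * ψ z.2)
      (μ := volume.restrict (Ioc t₁ t₂))
      (hA.meas.mul (hψ.1.comp_quasiMeasurePreserving Measure.quasiMeasurePreserving_snd))
  refine Integrable.mono' (hβ.mul_const (nrm ψ)) hm ?_
  filter_upwards [hA.bd] with t ht
  have := abs_integral_mul_le (c := fun _ => (1 : ℝ)) (C := 1) (by simp) ht.1 hψ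
  simp only [one_mul] at this
  exact this.trans (mul_le_mul_of_nonneg_right ht.2 (nrm_nonneg _))

theorem IsBFam.pair_integrable {A : ℝ → E N → ℝ} (hA : IsBFam t₁ t₂ A) {ψ : E N → ℝ}
    (hψ : MemLp ψ 2 volume) : IntegrableOn (fun τ => ∫ x, A τ x * ψ x) (Ioc t₁ t₂) := by
  obtain ⟨C, -, h⟩ := hA.isFam
  exact h.pair_integrable (integrableOn_const (by simp)) hψ

theorem IsTest.memLp {ψ : E N → ℝ} (h : IsTest O ψ) : MemLp ψ 2 volume :=
  memLp_two_of_compact h.smooth.continuous h.compact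

theorem IsTest.memLp_fderiv {ψ : E N → ℝ} (h : IsTest O ψ) (e : E N) :
    MemLp (fun x => fderiv ℝ ψ x e) 2 volume :=
  memLp_two_of_compact ((h.smooth.continuous_fderiv (by simp)).clm_apply continuous_const)
    (h.compact.fderiv_apply ℝ e)

namespace LWave

variable {u v h : ℝ → E N → ℝ} {G : Fin N → ℝ → E N → ℝ} {n : ℕ}
  {φ φt : ℝ → E N → ℝ} {φx : Fin N → ℝ → E N → ℝ} {s : ℝ → ℝ}

theorem restrict (W : LWave t₁ t₂ O u v h G) {a b : ℝ} (ha : t₁ ≤ a) (hab : a ≤ b)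
    (hb : b ≤ t₂) : LWave a b O u v h G where
  le := hab
  fam_u := W.fam_u.mono ha hb
  fam_v := W.fam_v.mono ha hb
  fam_G i := (W.fam_G i).mono ha hb
  fam_h := by
    obtain ⟨β, h1, h2⟩ := W.fam_h
    exact ⟨β, h1.mono_set (Ioc_subset_Ioc ha hb), h2.mono ha hb⟩
  grad t ht := W.grad t (Icc_subset_Icc ha hb ht)
  evu t ht ψ hψ := by
    have hi := W.fam_v.pair_integrable hψ.memLp
    rw [W.evu t (Icc_subset_Icc ha hb ht) ψ hψ, W.evu a ⟨ha, hab.trans hb⟩ ψ hψ, add_assoc,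
      intervalIntegral.integral_add_adjacent_intervals]
    · rw [intervalIntegrable_iff_integrableOn_Ioc_of_le ha]
      exact hi.mono_set (Ioc_subset_Ioc_right (hab.trans hb))
    · rw [intervalIntegrable_iff_integrableOn_Ioc_of_le ht.1]
      exact hi.mono_set (Ioc_subset_Ioc ha (ht.2.trans hb))
  evv t ht ψ hψ := by
    obtain ⟨β, h1, h2⟩ := W.fam_h
    have hi : IntegrableOn (fun τ => -(∑ i, ∫ x, G i τ x * fderiv ℝ ψ x (ei i)) +
        ∫ x, h τ x * ψ x) (Ioc t₁ t₂) := by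
      refine (Integrable.neg ?_).add (h2.pair_integrable h1 hψ.memLp)
      exact integrable_finsetSum _ fun i _ =>
        (W.fam_G i).pair_integrable (hψ.memLp_fderiv (ei i))
    rw [W.evv t (Icc_subset_Icc ha hb ht) ψ hψ, W.evv a ⟨ha, hab.trans hb⟩ ψ hψ, add_assoc,
      intervalIntegral.integral_add_adjacent_intervals]
    · rw [intervalIntegrable_iff_integrableOn_Ioc_of_le ha]
      exact hi.mono_set (Ioc_subset_Ioc_right (hab.trans hb))
    · rw [intervalIntegrable_iff_integrableOn_Ioc_of_le ht.1]
      exact hi.mono_set (Ioc_subset_Ioc ha (ht.2.trans hb))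

/-- The `L^{p+1}` norm stays bounded if `|u|^p` is integrable in time with values in `L²`. -/
theorem power_bound (W : LWave t₁ t₂ O u v h G) (h12 : t₁ < t₂) {p : ℝ} (hp : 1 < p)
    {β : ℝ → ℝ} (hβ : IntegrableOn β (Ioc t₁ t₂))
    (hpow : IsFam t₁ t₂ (fun t x => |u t x| ^ p) β) (hK : IsCompact K) (hO : IsOpen O)
    (hKO : K ⊆ O) {χ : E N → ℝ} (hχ : ContDiff ℝ ∞ χ) (hs : tsupport χ ⊆ K)
    (hχ0 : ∀ x, 0 ≤ χ x) (hχ1 : ∀ x, χ x ≤ 1) {K' : Set (E N)} (hK' : MeasurableSet K')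
    (hχK : ∀ x ∈ K', χ x = 1) :
    ∃ M : ℝ, ∀ t ∈ Icc t₁ t₂, IntegrableOn (fun x => |u t x| ^ (p + 1)) K' ∧
      ∫ x in K', |u t x| ^ (p + 1) ≤ M := by
  have hp0 : 0 ≤ p := by linarith
  have hwt := fun a b => isWeight_const (t₁ := a) (t₂ := b) hχ hs
  have hpwc := pw_cont hp
  have hgr : ∀ y, |pw p y| ≤ 1 * (1 + |y| ^ p) := fun y => by rw [pw_abs hp]; linarith
  have hcs : ∀ x, x ∉ K → χ x = 0 := fun x hx =>
    image_eq_zero_of_notMem_tsupport fun h => hx (hs h)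
  have hχa : ∀ x, |χ x| ≤ 1 := fun x => by rw [abs_of_nonneg (hχ0 x)]; exact hχ1 x
  obtain ⟨Cv, hCv⟩ := W.fam_v.bd
  -- a time at which the norm is finite
  obtain ⟨t₀, ht₀, hm0⟩ : ∃ t₀ ∈ Ioc t₁ t₂, MemLp (fun x => |u t₀ x| ^ p) 2 volume := by
    have h1 := hpow.bd.and (ae_restrict_mem measurableSet_Ioc)
    have : (ae (volume.restrict (Ioc t₁ t₂))).NeBot := by
      rw [ae_neBot]
      intro h0
      have := Measure.restrict_eq_zero.1 h0
      rw [Real.volume_Ioc] at this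
      simp at this
      linarith
    obtain ⟨t₀, h2, h3⟩ := h1.exists
    exact ⟨t₀, h3, h2.1⟩
  have ht₀' := Ioc_subset_Icc_self ht₀
  -- At this time both |u|^p and u are square integrable, and their product is |u|^{p+1}.
  have hi0 : Integrable (fun x => |u t₀ x| ^ (p + 1)) := by
    have := (hm0.integrable_mul (W.fam_u.mem t₀ ht₀').abs)
    refine this.congr (Eventually.of_forall fun x => ?_)
    change |u t₀ x| ^ p * |u t₀ x| = |u t₀ x| ^ (p + 1)
    rcases eq_or_lt_of_le (abs_nonneg (u t₀ x)) with h | h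
    · rw [← h, Real.zero_rpow (by linarith : p + 1 ≠ 0), mul_zero]
    · rw [Real.rpow_add_one h.ne']
  let s : ℕ → ℝ → ℝ := fun n z => pw p (trunc n z)
  have hsc : ∀ n, Continuous (s n) := fun n => hpwc.comp (trunc_cont n)
  have hsb : ∀ n y, |s n y| ≤ 1 * (1 + (n : ℝ) ^ p) := fun n =>
    trunc_bounded hp0 zero_le_one hgr n
  let M₁ : ℝ := 1 * (1 * (volume.real K + 2 * ∫ x in K, |u t₀ x| ^ (p + 1)))
  let B : ℝ → ℝ := fun t => 1 * ((|1| * (nrm (K.indicator (fun _ => (1 : ℝ))) + β t)) * Cv)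
  have hB : IntegrableOn B (Ioc t₁ t₂) :=
    ((((integrableOn_const (by simp)).add hβ).const_mul _).mul_const _).const_mul _
  let M₂ : ℝ := ∫ t in Ioc t₁ t₂, |B t|
  -- The truncated power is bounded, so its chain rule is available. Its time derivative is at most
  -- the L² norm of 1 + |u|^p on `K` times that of v; this is integrable in time and independent of
  -- n, so finiteness spreads from t₀ to all times.
  have hfin : ∀ n, ∀ t ∈ Icc t₁ t₂, lin χ (fun x => prim (s n) (u t x)) ≤ M₁ + M₂ := by
    intro n t ht
    have e0 : lin χ (fun x => prim (s n) (u t₀ x)) ≤ M₁ :=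
      (le_abs_self _).trans (lin_prim_growth hp0 zero_le_one (hsc n)
        (trunc_growth hp0 zero_le_one hgr n) hK hχ.continuous.aestronglyMeasurable hχa hcs
        (W.fam_u.mem t₀ ht₀').1 hi0.integrableOn le_rfl).2
    have hI : ∀ a b, t₁ ≤ a → a ≤ b → b ≤ t₂ →
        |lin χ (fun x => prim (s n) (u b x)) - lin χ (fun x => prim (s n) (u a x))| ≤ M₂ := by
      intro a b ha hab hb
      have P := ((W.restrict ha hab hb).prim_identity_bounded hK hO hKO (hwt a b) (hsc n)
        (hsb n)).2
      rw [P, intervalIntegral.integral_of_le hab]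
      have hsub : Ioc a b ⊆ Ioc t₁ t₂ := Ioc_subset_Ioc ha hb
      rw [← Real.norm_eq_abs]
      refine (norm_integral_le_of_norm_le (hB.mono_set hsub).abs ?_).trans
        (setIntegral_mono_set hB.abs (Eventually.of_forall fun _ => abs_nonneg _)
          hsub.eventuallyLE)
      filter_upwards [ae_restrict_of_ae_restrict_of_subset hsub hpow.bd,
        ae_restrict_mem measurableSet_Ioc] with τ h1 h2
      have h2' : τ ∈ Icc t₁ t₂ := Ioc_subset_Icc_self (hsub h2)
      have z : lin (fun _ => (0 : ℝ)) (fun x => prim (s n) (u τ x)) = 0 := by simp [lin]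
      rw [z, zero_add]
      refine le_trans ?_ (le_abs_self _)
      refine (lin_growth_bound (C := 1) hK hχa hcs
        ((hsc n).comp_aestronglyMeasurable (W.fam_u.mem τ h2').1)
        (fun x => trunc_growth hp0 zero_le_one hgr n (u τ x)) h1.1 (W.fam_v.mem τ h2')).trans ?_
      dsimp only [B]
      have := hCv τ h2'
      have := nrm_nonneg (K.indicator (fun _ : E N => (1 : ℝ)))
      have := nrm_nonneg (fun x => |u τ x| ^ p)
      have := h1.2
      have hβ0 : 0 ≤ β τ := by linarith
      gcongr
      exact nrm_nonneg _
    rcases le_total t t₀ with h | h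
    · have := abs_le.1 (hI t t₀ ht.1 h ht₀'.2)
      linarith [this.1]
    · have := abs_le.1 (hI t₀ t ht₀'.1 h ht.2)
      linarith [this.2]
  refine ⟨(p + 1) * (M₁ + M₂), fun t ht => ?_⟩
  have hut := W.fam_u.mem t ht
  have hnn : ∀ n x, 0 ≤ χ x * prim (s n) (u t x) := fun n x =>
    mul_nonneg (hχ0 x) (prim_nonneg (fun y => by
      change 0 ≤ |trunc n y| ^ (p - 1) * trunc n y * y
      rw [mul_assoc]
      exact mul_nonneg (by positivity) (trunc_mul_nonneg n y)) _)
  have hmeas : ∀ n, AEStronglyMeasurable (fun x => χ x * prim (s n) (u t x)) volume := fun n =>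
    hχ.continuous.aestronglyMeasurable.mul ((prim_cont (hsc n)).comp_aestronglyMeasurable hut.1)
  have hintn : ∀ n, Integrable (fun x => χ x * prim (s n) (u t x)) := by
    intro n
    refine (bil_integrable hχ.continuous (HasCompactSupport.intro hK hcs)
      (memLp_prim (hsc n) (hsb n) hut) (memLp_one_indicator hK)).congr
      (Eventually.of_forall fun x => ?_)
    by_cases hx : x ∈ K
    · simp [hx]
    · simp [hcs x hx]
  -- Fatou's lemma removes the truncation.
  have hle : ∫⁻ x, ENNReal.ofReal (χ x * prim (pw p) (u t x)) ≤ ENNReal.ofReal (M₁ + M₂) := by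
    have hlim : ∀ x, liminf (fun n => ENNReal.ofReal (χ x * prim (s n) (u t x))) atTop =
        ENNReal.ofReal (χ x * prim (pw p) (u t x)) := by
      intro x
      refine Tendsto.liminf_eq (tendsto_const_nhds.congr' ?_)
      filter_upwards [eventually_prim_trunc (pw p) (u t x)] with n hn
      rw [hn]
    simp only [← hlim]
    refine (lintegral_liminf_le' fun n => (hmeas n).aemeasurable.ennreal_ofReal).trans ?_
    refine liminf_le_of_frequently_le' (Frequently.of_forall fun n => ?_)
    rw [← ofReal_integral_eq_lintegral_ofReal (hintn n) (Eventually.of_forall (hnn n))]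
    exact ENNReal.ofReal_le_ofReal (hfin n t ht)
  have hbig : Integrable (fun x => χ x * prim (pw p) (u t x)) := by
    refine ⟨hχ.continuous.aestronglyMeasurable.mul
      ((prim_cont hpwc).comp_aestronglyMeasurable hut.1), ?_⟩
    rw [hasFiniteIntegral_iff_ofReal (Eventually.of_forall fun x => ?_)]
    · exact hle.trans_lt ENNReal.ofReal_lt_top
    · exact mul_nonneg (hχ0 x) (by rw [prim_pw hp]; positivity)
  have heq : ∀ x ∈ K', |u t x| ^ (p + 1) = (p + 1) * (χ x * prim (pw p) (u t x)) := by
    intro x hx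
    rw [hχK x hx, prim_pw hp, one_mul, mul_div_cancel₀ _ (by linarith)]
  have hM0 : 0 ≤ M₁ + M₂ := le_trans (integral_nonneg (hnn 0)) (hfin 0 t ht)
  refine ⟨((hbig.const_mul (p + 1)).integrableOn).congr_fun (fun x hx => (heq x hx).symm) hK', ?_⟩
  rw [setIntegral_congr_fun hK' heq, integral_const_mul]
  refine mul_le_mul_of_nonneg_left ?_ (by linarith)
  have hnn' : ∀ x, 0 ≤ χ x * prim (pw p) (u t x) := fun x =>
    mul_nonneg (hχ0 x) (by rw [prim_pw hp]; positivity)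
  refine (setIntegral_le_integral hbig (Eventually.of_forall hnn')).trans ?_
  rw [integral_eq_lintegral_of_nonneg_ae (Eventually.of_forall hnn') hbig.1]
  exact ENNReal.toReal_le_of_le_ofReal hM0 hle

variable {C p : ℝ}

/-- The chain rule in time for a nonlinearity of growth `p`. -/
theorem prim_identity (W : LWave t₁ t₂ O u v h G) (hK : IsCompact K) (hO : IsOpen O)
    (hKO : K ⊆ O) (hφ : IsWeight t₁ t₂ K φ φt φx) (hs : Continuous s) (hp : 0 ≤ p) (hC : 0 ≤ C)
    (hg : ∀ y, |s y| ≤ C * (1 + |y| ^ p)) {β : ℝ → ℝ} (hβ : IntegrableOn β (Ioc t₁ t₂))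
    (hpow : IsFam t₁ t₂ (fun t x => |u t x| ^ p) β) {M : ℝ}
    (hM : ∀ t ∈ Icc t₁ t₂, IntegrableOn (fun x => |u t x| ^ (p + 1)) K ∧
      ∫ x in K, |u t x| ^ (p + 1) ≤ M) :
    IntervalIntegrable (fun t => lin (φt t) (fun x => prim s (u t x)) +
      lin (φ t) (fun x => s (u t x) * v t x)) volume t₁ t₂ ∧
    lin (φ t₂) (fun x => prim s (u t₂ x)) - lin (φ t₁) (fun x => prim s (u t₁ x)) =
      ∫ t in t₁..t₂, (lin (φt t) (fun x => prim s (u t x)) +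
        lin (φ t) (fun x => s (u t x) * v t x)) := by
  obtain ⟨Cv, hCv⟩ := W.fam_v.bd
  obtain ⟨D, hD0, hD⟩ := hφ.coef.bdd hK
  obtain ⟨D', hD'0, hD'⟩ := hφ.coef_t.bdd hK
  have hsn : ∀ n, Continuous (fun z => s (trunc n z)) := fun n => hs.comp (trunc_cont n)
  have one : AEStronglyMeasurable (fun _ : ℝ × E N => (1 : ℝ)) (strip N t₁ t₂) :=
    aestronglyMeasurable_const
  have D1 : DomLim t₁ t₂ (fun n t => lin (φt t) (fun x => prim (fun z => s (trunc n z)) (u t x)))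
      (fun t => lin (φt t) (fun x => prim s (u t x))) := by
    refine ⟨fun n => ?_, ⟨fun _ => D' * (C * (volume.real K + 2 * M)),
      integrableOn_const (by simp), fun n => ae_Ioc fun t ht => ?_⟩, ae_Ioc fun t ht => ?_⟩
    · simp only [lin_eq_bil_one]
      exact bil_meas hφ.coef_t.meas
        ((prim_cont (hsn n)).comp_aestronglyMeasurable W.fam_u.meas) one
    · exact (lin_prim_growth hp hC (hsn n) (trunc_growth hp hC hg n) hK
        (hφ.coef_t.cont_x ht).aestronglyMeasurable (hD' t ht) (hφ.coef_t.supp t ht)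
        (W.fam_u.mem t ht).1 (hM t ht).1 (hM t ht).2).2
    · exact lin_prim_trunc_tendsto hs hp hC hg hK (hφ.coef_t.cont_x ht) (hφ.coef_t.supp t ht)
        (W.fam_u.mem t ht).1 (hM t ht).1
  have D2 : DomLim t₁ t₂ (fun n t => lin (φ t) (fun x => s (trunc n (u t x)) * v t x))
      (fun t => lin (φ t) (fun x => s (u t x) * v t x)) := by
    refine ⟨fun n => ?_, ⟨fun t => D * ((|C| * (nrm (K.indicator (fun _ => (1 : ℝ))) + β t)) * Cv),
      ((((integrableOn_const (by simp)).add hβ).const_mul _).mul_const _).const_mul _,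
      fun n => ?_⟩, ?_⟩
    · exact bil_meas hφ.coef.meas ((hsn n).comp_aestronglyMeasurable W.fam_u.meas) W.fam_v.meas
    · filter_upwards [hpow.bd, ae_Ioc fun t ht => ht] with t h1 ht
      refine (lin_growth_bound (C := C) hK (hD t ht) (hφ.coef.supp t ht)
        ((hsn n).comp_aestronglyMeasurable (W.fam_u.mem t ht).1)
        (fun x => trunc_growth hp hC hg n (u t x)) h1.1 (W.fam_v.mem t ht)).trans ?_
      have := hCv t ht
      have := nrm_nonneg (K.indicator (fun _ : E N => (1 : ℝ)))
      have := nrm_nonneg (fun x => |u t x| ^ p)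
      have := h1.2
      have hβ0 : 0 ≤ β t := by linarith
      gcongr
      exact nrm_nonneg _
    · filter_upwards [hpow.bd, ae_Ioc fun t ht => ht] with t h1 ht
      exact lin_trunc_tendsto hs hp hC hg hK (hφ.coef.cont_x ht) (hφ.coef.supp t ht)
        (W.fam_u.mem t ht).1 h1.1 (W.fam_v.mem t ht)
  have DD := D1.add D2
  have I2 := right_mem_Icc.2 W.le
  have I1 := left_mem_Icc.2 W.le
  refine ⟨DD.intervalIntegrable_lim W.le, ?_⟩
  have T := fun {t : ℝ} (ht : t ∈ Icc t₁ t₂) =>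
    lin_prim_trunc_tendsto hs hp hC hg hK (hφ.coef.cont_x ht) (hφ.coef.supp t ht)
        (W.fam_u.mem t ht).1 (hM t ht).1
  refine tendsto_nhds_unique_of_eventuallyEq ((T I2).sub (T I1)) (DD.tendsto W.le) ?_
  exact Eventually.of_forall fun n => (W.prim_identity_bounded hK hO hKO hφ (hsn n)
    (trunc_bounded hp hC hg n)).2

/-- The chain rule in space for a nonlinearity of growth `p`. -/
theorem prim_space (W : LWave t₁ t₂ O u v h G) (hK : IsCompact K) (hO : IsOpen O)
    (hKO : K ⊆ O) (hφ : IsWeight t₁ t₂ K φ φt φx) (hs : Continuous s) (hp : 0 ≤ p) (hC : 0 ≤ C)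
    (hg : ∀ y, |s y| ≤ C * (1 + |y| ^ p)) (i : Fin N) {t : ℝ} (ht : t ∈ Icc t₁ t₂)
    (hpow : MemLp (fun x => |u t x| ^ p) 2 volume)
    (hM : IntegrableOn (fun x => |u t x| ^ (p + 1)) K) :
    lin (φx i t) (fun x => prim s (u t x)) = - lin (φ t) (fun x => s (u t x) * G i t x) := by
  have hu := (W.fam_u.mem t ht).1
  refine tendsto_nhds_unique_of_eventuallyEq
    (lin_prim_trunc_tendsto hs hp hC hg hK ((hφ.coef_x i).cont_x ht) ((hφ.coef_x i).supp t ht)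
      hu hM)
    (lin_trunc_tendsto hs hp hC hg hK (hφ.coef.cont_x ht) (hφ.coef.supp t ht) hu hpow
      ((W.fam_G i).mem t ht)).neg ?_
  exact Eventually.of_forall fun n => W.prim_space_bounded hK hO hKO hφ
    (hs.comp (trunc_cont n)) (trunc_bounded hp hC hg n) i ht

end LWave

end

end HamzaZaag

/-! ### From the nonlinear equation to the linear one with a source. -/

namespace HamzaZaag

noncomputable section

variable {N : ℕ} {T : E N → ℝ} {K O : Set (E N)} {τ : ℝ}

theorem slice_anti {a b : ℝ} (h : a ≤ b) : slice T b ⊆ slice T a := fun _ hx => h.trans_lt hx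

theorem strip_restrict (t₁ t₂ : ℝ) (K : Set (E N)) : (strip N t₁ t₂).restrict (Prod.snd ⁻¹' K) =
    (volume.restrict (Ioc t₁ t₂)).prod (volume.restrict K) := by
  rw [strip, ← univ_prod, ← Measure.prod_restrict, Measure.restrict_univ]

/-- If `K` is below the graph at time τ, then (0, τ] × K is in the domain, where joint measurability
is known. -/
theorem aesm_indicator_strip (hK : IsCompact K) (hKs : K ⊆ slice T τ)
    {h : ℝ → E N → ℝ}
    (hm : AEStronglyMeasurable (fun z : E N × ℝ => h z.2 z.1) (volume.restrict (domain T))) :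
    AEStronglyMeasurable (fun z : ℝ × E N => K.indicator (h z.1) z.2) (strip N 0 τ) := by
  have e : (fun z : ℝ × E N => K.indicator (h z.1) z.2) =
      (Prod.snd ⁻¹' K).indicator (fun z : ℝ × E N => h z.1 z.2) := by
    ext z
    by_cases hz : z.2 ∈ K
    · rw [indicator_of_mem hz, indicator_of_mem (by exact hz)]
    · rw [indicator_of_notMem hz, indicator_of_notMem (by exact hz)]
  rw [e, aestronglyMeasurable_indicator_iff (measurable_snd hK.measurableSet), strip_restrict]
  have h1 : AEStronglyMeasurable (fun z : E N × ℝ => h z.2 z.1)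
      ((volume.restrict K).prod (volume.restrict (Ioc 0 τ))) := by
    rw [Measure.prod_restrict]
    refine hm.mono_measure (Measure.restrict_mono (fun z hz => ?_) le_rfl)
    exact ⟨hz.2.1.le, hz.2.2.trans_lt (hKs hz.1)⟩
  exact h1.prod_swap

theorem nrm_indicator (hK : IsCompact K) (f : E N → ℝ) :
    nrm (K.indicator f) = (eLpNorm f 2 (volume.restrict K)).toReal := by
  rw [nrm, eLpNorm_indicator_eq_eLpNorm_restrict hK.measurableSet]

/-- Continuity bounds the norm near each time; compactness of [0, τ] makes the bound uniform. -/
theorem ContL2Loc.isBFam {h : ℝ → E N → ℝ} (hh : ContL2Loc T h) (hτ : 0 ≤ τ) (hK : IsCompact K)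
    (hKs : K ⊆ slice T τ) : IsBFam 0 τ (fun t => K.indicator (h t)) where
  meas := aesm_indicator_strip hK hKs hh.meas
  mem t ht := by
    rw [memLp_indicator_iff_restrict hK.measurableSet]
    exact hh.memLp τ hτ K hK hKs t ht
  bd := by
    have h1 : ∀ t ∈ Icc 0 τ, ∃ s ∈ 𝓝[Icc 0 τ] t, ∃ C : ℝ, ∀ t' ∈ s, t' ∈ Icc 0 τ →
        nrm (K.indicator (h t')) ≤ C := by
      intro t ht
      have h2 := (tendsto_order.1 (hh.cont τ hτ K hK hKs t ht)).2 1 (by simp)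
      refine ⟨_, h2, nrm (K.indicator (h t)) + 1, fun t' ht' hI => ?_⟩
      have m1 := hh.memLp τ hτ K hK hKs t ht
      have m2 := hh.memLp τ hτ K hK hKs t' hI
      have h3 : eLpNorm (h t') 2 (volume.restrict K) ≤
          eLpNorm (h t' - h t) 2 (volume.restrict K) + eLpNorm (h t) 2 (volume.restrict K) := by
        have := eLpNorm_add_le (m2.sub m1).1 m1.1 (p := 2) (by norm_num)
        rwa [sub_add_cancel] at this
      have h4 : eLpNorm (h t') 2 (volume.restrict K) ≤
          1 + eLpNorm (h t) 2 (volume.restrict K) := h3.trans (by gcongr; exact le_of_lt ht')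
      rw [nrm_indicator hK, nrm_indicator hK]
      have := ENNReal.toReal_mono (by simp [m1.2.ne]) h4
      rw [ENNReal.toReal_add (by simp) m1.2.ne] at this
      simp at this
      linarith
    have h5 := (isCompact_Icc (a := (0 : ℝ)) (b := τ)).induction_on
      (p := fun s => ∃ C : ℝ, ∀ t' ∈ s, t' ∈ Icc 0 τ → nrm (K.indicator (h t')) ≤ C)
      ⟨0, by simp⟩ (fun s s' hs ⟨C, hC⟩ => ⟨C, fun t ht => hC t (hs ht)⟩)
      (fun s s' ⟨C, hC⟩ ⟨C', hC'⟩ => ⟨max C C', fun t ht hI => by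
        rcases ht with ht | ht
        · exact (hC t ht hI).trans (le_max_left _ _)
        · exact (hC' t ht hI).trans (le_max_right _ _)⟩) h1
    obtain ⟨C, hC⟩ := h5
    exact ⟨C, fun t ht => hC t ht ht⟩

theorem abs_coord_le (x : E N) (i : Fin N) : |x i| ≤ ‖x‖ := by
  have := PiLp.norm_apply_le x i
  simpa using this

theorem ContL2Loc.coord {G : ℝ → E N → E N} (hG : ContL2Loc T G) (i : Fin N) :
    ContL2Loc T (fun t x => G t x i) where
  meas := (EuclideanSpace.proj (𝕜 := ℝ) i).continuous.comp_aestronglyMeasurable hG.meas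
  memLp τ hτ K hK hKs t ht := by
    have := hG.memLp τ hτ K hK hKs t ht
    refine this.norm.of_le
      ((EuclideanSpace.proj (𝕜 := ℝ) i).continuous.comp_aestronglyMeasurable this.1)
      (Eventually.of_forall fun x => ?_)
    simpa using abs_coord_le (G t x) i
  cont τ hτ K hK hKs t ht := by
    refine tendsto_of_tendsto_of_tendsto_of_le_of_le tendsto_const_nhds
      (hG.cont τ hτ K hK hKs t ht) (fun _ => zero_le) (fun t' => ?_)
    refine eLpNorm_mono fun x => ?_
    have := abs_coord_le (G t' x - G t x) i
    simpa using this

theorem integral_indicator_mul {ψ : E N → ℝ} (hψ : IsTest O ψ) (hOK : O ⊆ K) (f : E N → ℝ) :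
    ∫ x, K.indicator f x * ψ x = ∫ x, f x * ψ x := by
  refine integral_congr_ae (Eventually.of_forall fun x => ?_)
  by_cases hx : x ∈ K
  · simp only [indicator_of_mem hx]
  · have : ψ x = 0 := image_eq_zero_of_notMem_tsupport fun h => hx (hOK (hψ.support_subset h))
    simp [this]

theorem integral_indicator_mul_fderiv {ψ : E N → ℝ} (hψ : IsTest O ψ) (hOK : O ⊆ K)
    (f : E N → ℝ) (e : E N) :
    ∫ x, K.indicator f x * fderiv ℝ ψ x e = ∫ x, f x * fderiv ℝ ψ x e := by
  refine integral_congr_ae (Eventually.of_forall fun x => ?_)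
  by_cases hx : x ∈ K
  · simp only [indicator_of_mem hx]
  · have : fderiv ℝ ψ x e = 0 := image_eq_zero_of_notMem_tsupport (f := fun x => fderiv ℝ ψ x e)
      fun h => hx (hOK (hψ.support_subset (tsupport_fderiv_apply_subset ℝ e h)))
    simp [this]

theorem fderiv_eq_sum (ψ : E N → ℝ) (x y : E N) :
    fderiv ℝ ψ x y = ∑ i, y i * fderiv ℝ ψ x (ei i) := by
  have h : y = ∑ i, y i • ei i := by
    ext j
    simp [ei, Finset.sum_apply, Pi.single_apply]
  conv_lhs => rw [h]
  simp [map_sum]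

/-- Young's inequality for powers. -/
theorem exists_rpow_le {p q M ε : ℝ} (hq : 0 ≤ q) (hqp : q < p) (hM : 0 ≤ M) (hε : 0 < ε) :
    ∃ C : ℝ, 0 ≤ C ∧ ∀ y : ℝ, 0 ≤ y → M * y ^ q ≤ ε * y ^ p + C := by
  -- Beyond this threshold M y^q ≤ ε y^p; below it M y^q is at most its value at Y.
  set Y : ℝ := (M / ε) ^ (1 / (p - q)) with hY
  have hY0 : 0 ≤ Y := by positivity
  refine ⟨M * Y ^ q, by positivity, fun y hy => ?_⟩
  rcases le_or_gt y Y with h | h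
  · have h1 : y ^ q ≤ Y ^ q := Real.rpow_le_rpow hy h hq
    have h2 := mul_le_mul_of_nonneg_left h1 hM
    have h3 : 0 ≤ ε * y ^ p := by positivity
    linarith
  · have hy0 : 0 < y := hY0.trans_lt h
    have h1 : M / ε ≤ y ^ (p - q) := by
      have h2 := Real.rpow_le_rpow hY0 h.le (by linarith : 0 ≤ p - q)
      rw [hY, ← Real.rpow_mul (by positivity), one_div_mul_cancel (by linarith : p - q ≠ 0),
        Real.rpow_one] at h2
      exact h2
    rw [div_le_iff₀ hε] at h1
    have h3 : y ^ p = y ^ q * y ^ (p - q) := by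
      rw [← Real.rpow_add hy0]
      congr 1
      ring
    have h4 : M * y ^ q ≤ ε * y ^ p := by
      rw [h3]
      nlinarith [Real.rpow_nonneg hy q]
    have h5 : 0 ≤ M * Y ^ q := by positivity
    linarith

namespace IsSolution

variable {p : ℝ} {f g : ℝ → ℝ} {u₀ u₁ : E N → ℝ} {u v : ℝ → E N → ℝ} {G : ℝ → E N → E N}

theorem source_meas (hp : 1 < p) (hf : Continuous f) (hg : Continuous g)
    (S : IsSolution p f g u₀ u₁ T u v G) :
    AEStronglyMeasurable (fun z : E N × ℝ => source p f g (u z.2 z.1) (v z.2 z.1))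
      (volume.restrict (domain T)) :=
  (((pw_cont hp).comp_aestronglyMeasurable S.cont_u.meas).add
    (hf.comp_aestronglyMeasurable S.cont_u.meas)).add
    (hg.comp_aestronglyMeasurable S.cont_v.meas)

theorem isFam_source (hp : 1 < p) (hf : Continuous f) (hg : Continuous g)
    (S : IsSolution p f g u₀ u₁ T u v G) (hτ : 0 ≤ τ) (hK : IsCompact K) (hKs : K ⊆ slice T τ) :
    ∃ β : ℝ → ℝ, IntegrableOn β (Ioc 0 τ) ∧
      IsFam 0 τ (fun t => K.indicator (fun x => source p f g (u t x) (v t x))) β := by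
  have hm := aesm_indicator_strip (h := fun t x => source p f g (u t x) (v t x)) hK hKs
    (S.source_meas hp hf hg)
  set H : ℝ → E N → ℝ := fun t => K.indicator (fun x => source p f g (u t x) (v t x)) with hH
  have hmβ : AEMeasurable (fun t => eLpNorm (H t) 2 volume) (volume.restrict (Ioc 0 τ)) := by
    have h1 : AEMeasurable (fun t => ∫⁻ x, ‖H t x‖ₑ ^ 2) (volume.restrict (Ioc 0 τ)) :=
      AEMeasurable.lintegral_prod_right' (f := fun z : ℝ × E N => ‖H z.1 z.2‖ₑ ^ 2)
        (hm.enorm.pow_const 2)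
    refine (h1.pow_const (1 / 2 : ℝ)).congr (Eventually.of_forall fun t => ?_)
    simp only
    rw [← eLpNorm_two_sq, ← ENNReal.rpow_natCast, ← ENNReal.rpow_mul]
    norm_num
  have hfin : ∫⁻ t in Ioc 0 τ, eLpNorm (H t) 2 volume < ⊤ := by
    refine lt_of_le_of_lt ?_ (S.source_L1L2 τ hτ K hK hKs)
    refine (lintegral_mono_set Ioc_subset_Icc_self).trans (lintegral_mono fun t => ?_)
    rw [hH, eLpNorm_indicator_eq_eLpNorm_restrict hK.measurableSet]
  have hae := ae_lt_top' hmβ hfin.ne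
  refine ⟨fun t => nrm (H t), integrable_toReal_of_lintegral_ne_top hmβ hfin.ne, hm, ?_⟩
  have hms : ∀ᵐ t ∂(volume.restrict (Ioc 0 τ)), AEStronglyMeasurable (fun x => H t x) volume :=
    hm.prodMk_left
  filter_upwards [hae, hms] with t h1 h2
  exact ⟨⟨h2, h1⟩, le_rfl⟩

/-- A solution, cut off outside of a compact set, is a weak solution of the linear wave
equation with the cut-off source in the interior of the set. -/
theorem lwave (hp : 1 < p) (hf : Continuous f) (hg : Continuous g)
    (S : IsSolution p f g u₀ u₁ T u v G) (hτ : 0 ≤ τ) (hK : IsCompact K)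
    (hKs : K ⊆ slice T τ) (hOK : O ⊆ K) :
    LWave 0 τ O (fun t => K.indicator (u t)) (fun t => K.indicator (v t))
      (fun t => K.indicator (fun x => source p f g (u t x) (v t x)))
      (fun i t => K.indicator (fun x => G t x i)) where
  le := hτ
  fam_u := S.cont_u.isBFam hτ hK hKs
  fam_v := S.cont_v.isBFam hτ hK hKs
  fam_G i := (S.cont_G.coord i).isBFam hτ hK hKs
  fam_h := S.isFam_source hp hf hg hτ hK hKs
  grad t ht ψ hψ i := by
    have hψ' : IsTest (slice T t) ψ :=
      ⟨hψ.smooth, hψ.compact, hψ.support_subset.trans (hOK.trans (hKs.trans (slice_anti ht.2)))⟩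
    rw [integral_indicator_mul_fderiv hψ hOK, integral_indicator_mul hψ hOK,
      S.grad t ht.1 ψ hψ' (ei i)]
    congr 1
    refine integral_congr_ae (Eventually.of_forall fun x => ?_)
    simp [ei, EuclideanSpace.inner_single_right]
  evu t ht ψ hψ := by
    have hψ' : IsTest (slice T t) ψ :=
      ⟨hψ.smooth, hψ.compact, hψ.support_subset.trans (hOK.trans (hKs.trans (slice_anti ht.2)))⟩
    simp only [integral_indicator_mul hψ hOK]
    rw [← S.evol_u t ht.1 ψ hψ']
    have : ∫ x, u 0 x * ψ x = ∫ x, u₀ x * ψ x := by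
      refine integral_congr_ae ?_
      filter_upwards [S.init_u] with x hx
      rw [hx]
    rw [this]
    ring
  evv t ht ψ hψ := by
    have hψ' : IsTest (slice T t) ψ :=
      ⟨hψ.smooth, hψ.compact, hψ.support_subset.trans (hOK.trans (hKs.trans (slice_anti ht.2)))⟩
    have e := S.evol_v t ht.1 ψ hψ'
    have : ∫ x, v 0 x * ψ x = ∫ x, u₁ x * ψ x := by
      refine integral_congr_ae ?_
      filter_upwards [S.init_v] with x hx
      rw [hx]
    simp only [integral_indicator_mul hψ hOK]
    rw [this, ← sub_eq_iff_eq_add', e]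
    refine intervalIntegral.integral_congr fun s hs => ?_
    rw [uIcc_of_le ht.1] at hs
    have hs' : s ∈ Icc 0 τ := ⟨hs.1, hs.2.trans ht.2⟩
    congr 2
    rw [← integral_finsetSum]
    · refine integral_congr_ae (Eventually.of_forall fun x => ?_)
      beta_reduce
      rw [fderiv_eq_sum]
      refine Finset.sum_congr rfl fun i _ => ?_
      by_cases hx : x ∈ K
      · simp only [indicator_of_mem hx]
      · have : fderiv ℝ ψ x (ei i) = 0 :=
          image_eq_zero_of_notMem_tsupport (f := fun x => fderiv ℝ ψ x (ei i))
          fun h => hx (hOK (hψ.support_subset (tsupport_fderiv_apply_subset ℝ (ei i) h)))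
        simp [this]
    · intro i _
      exact (((S.cont_G.coord i).isBFam hτ hK hKs).mem s hs').integrable_mul
        (hψ.memLp_fderiv (ei i))

/-- The power is the source minus f(u) and g(u_t); half of |a|^p absorbs f, which grows more slowly.
-/
theorem rpow_le_source {q M C : ℝ} (hp : 1 < p)
    (hC : ∀ y : ℝ, 0 ≤ y → M * y ^ q ≤ 1 / 2 * y ^ p + C) (hfM : ∀ x, |f x| ≤ M * (1 + |x| ^ q))
    (hgM : ∀ x, |g x| ≤ M * (1 + |x|)) (a b : ℝ) :
    |a| ^ p ≤ 2 * |source p f g a b| + (2 * C + 4 * M) + 2 * M * |b| := by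
  have h1 : |a| ^ p = |source p f g a b - f a - g b| := by
    rw [← pw_abs hp, pw, source]
    congr 1
    ring
  have h2 := abs_sub (source p f g a b - f a) (g b)
  have h3 := abs_sub (source p f g a b) (f a)
  have := hC |a| (abs_nonneg a)
  have := hfM a
  have := hgM b
  rw [← h1] at h2
  linarith

/-- The source is L¹ in time with values in L² by the notion of solution, and u_t is bounded in L².
The equation thus gives the integrability of |u|^p for every p in the range, without Sobolev
embeddings. -/
theorem isFam_rpow {q M C : ℝ} (hp : 1 < p) (hM : 0 < M) (hC0 : 0 ≤ C)
    (hC : ∀ y : ℝ, 0 ≤ y → M * y ^ q ≤ 1 / 2 * y ^ p + C) (hfM : ∀ x, |f x| ≤ M * (1 + |x| ^ q))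
    (hgM : ∀ x, |g x| ≤ M * (1 + |x|)) (hf : Continuous f) (hg : Continuous g)
    (S : IsSolution p f g u₀ u₁ T u v G) (hτ : 0 ≤ τ) (hK : IsCompact K) (hKs : K ⊆ slice T τ) :
    ∃ β : ℝ → ℝ, IntegrableOn β (Ioc 0 τ) ∧
      IsFam 0 τ (fun t x => |K.indicator (u t) x| ^ p) β := by
  obtain ⟨β, hβ, hF⟩ := S.isFam_source hp hf hg hτ hK hKs
  have hu := S.cont_u.isBFam hτ hK hKs
  have hv := S.cont_v.isBFam hτ hK hKs
  obtain ⟨Cv, hCv⟩ := hv.bd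
  have hp0 : 0 ≤ p := by linarith
  have hm : Continuous fun y : ℝ => |y| ^ p := by fun_prop (disch := assumption)
  set J : E N → ℝ := K.indicator fun _ => (1 : ℝ) with hJ
  refine ⟨fun t => 2 * β t + ((2 * C + 4 * M) * nrm J + 2 * M * Cv), ?_,
    hm.comp_aestronglyMeasurable hu.meas, ?_⟩
  · exact (hβ.const_mul 2).add (integrableOn_const (by simp))
  · filter_upwards [hF.bd, ae_Ioc fun t ht => ht] with t h1 ht
    have mJ := memLp_one_indicator hK
    have mv := hv.mem t ht
    have msum := ((h1.1.abs.const_mul 2).add (mJ.const_mul (2 * C + 4 * M))).add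
      (mv.abs.const_mul (2 * M))
    have hle : ∀ x, ‖|K.indicator (u t) x| ^ p‖ ≤ 2 * |K.indicator (fun x =>
        source p f g (u t x) (v t x)) x| + (2 * C + 4 * M) * J x +
        2 * M * |K.indicator (v t) x| := by
      intro x
      rw [Real.norm_of_nonneg (by positivity)]
      by_cases hx : x ∈ K
      · simp only [hJ, indicator_of_mem hx, mul_one]
        exact rpow_le_source hp hC hfM hgM _ _
      · simp only [hJ, indicator_of_notMem hx, abs_zero]
        rw [Real.zero_rpow (by linarith)]
        simp
    have mm := hm.comp_aestronglyMeasurable (hu.mem t ht).1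
    refine ⟨msum.mono' mm (Eventually.of_forall hle), ?_⟩
    have tri : ∀ {a b : E N → ℝ}, MemLp a 2 volume → MemLp b 2 volume →
        nrm (a + b) ≤ nrm a + nrm b := fun {a b} ha hb => by
      rw [nrm, nrm, nrm, ← ENNReal.toReal_add ha.2.ne hb.2.ne]
      exact ENNReal.toReal_mono (ENNReal.add_lt_top.2 ⟨ha.2, hb.2⟩).ne
        (eLpNorm_add_le ha.1 hb.1 (by norm_num))
    have hl : nrm (fun x => |K.indicator (u t) x| ^ p) ≤ _ :=
      ENNReal.toReal_mono msum.2.ne (eLpNorm_mono_real hle)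
    refine hl.trans ?_
    have t1 := tri ((h1.1.abs.const_mul 2).add (mJ.const_mul (2 * C + 4 * M)))
      (mv.abs.const_mul (2 * M))
    have t2 := tri (h1.1.abs.const_mul 2) (mJ.const_mul (2 * C + 4 * M))
    have s1 := nrm_le_mul (f := fun x => 2 * |K.indicator (fun x =>
        source p f g (u t x) (v t x)) x|) (B := 2) h1.1 (fun x => by simp [abs_mul])
    have s2 := nrm_le_mul (f := fun x => (2 * C + 4 * M) * J x) (B := 2 * C + 4 * M) mJ
      (fun x => by rw [abs_mul, abs_of_nonneg (by positivity : 0 ≤ 2 * C + 4 * M)])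
    have s3 := nrm_le_mul (f := fun x => 2 * M * |K.indicator (v t) x|) (B := 2 * M) mv
      (fun x => by rw [abs_mul, abs_abs, abs_of_nonneg (by positivity : 0 ≤ 2 * M)])
    rw [abs_of_nonneg (by positivity)] at s1 s2 s3
    have s4 := mul_le_mul_of_nonneg_left (hCv t ht) (by positivity : 0 ≤ 2 * M)
    have := h1.2
    refine t1.trans ?_
    refine (add_le_add t2 s3).trans ?_
    refine (add_le_add (add_le_add s1 s2) s4).trans ?_
    linarith

end IsSolution

end

end HamzaZaag

/-! ### Weights in light cones and smooth profiles. -/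

namespace HamzaZaag

noncomputable section

variable {N : ℕ} {t₁ t₂ : ℝ}

/-- The square of the rescaled distance `|x - x₀| / (b - t)`. -/
def zz {N : ℕ} (x₀ : E N) (b t : ℝ) (x : E N) : ℝ := ‖x - x₀‖ ^ 2 / (b - t) ^ 2

theorem zz_nonneg (x₀ : E N) (b t : ℝ) (x : E N) : 0 ≤ zz x₀ b t x := by unfold zz; positivity

/-- The sections of the cone shrink, so a point outside of the section at t₁ stays outside. Hence
one ball supports the weight at all times. -/
theorem one_le_zz {x₀ : E N} {b t : ℝ} (h1 : t₁ ≤ t) (h2 : t < b) {x : E N}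
    (hx : x ∉ Metric.closedBall x₀ (b - t₁)) : 1 ≤ zz x₀ b t x := by
  rw [Metric.mem_closedBall, dist_eq_norm, not_le] at hx
  rw [zz, one_le_div (by nlinarith)]
  nlinarith [norm_nonneg (x - x₀)]

/-- The weight `(b - t)^c P(x) a(|x - x₀|² / (b - t)²)`. -/
def pW {N : ℕ} (P : E N → ℝ) (a : ℝ → ℝ) (x₀ : E N) (b c t : ℝ) (x : E N) : ℝ :=
  (b - t) ^ c * (P x * a (zz x₀ b t x))

/-- The time derivative of `pW P a x₀ b c`. -/
def pWt {N : ℕ} (P : E N → ℝ) (a a' : ℝ → ℝ) (x₀ : E N) (b c t : ℝ) (x : E N) : ℝ :=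
  (b - t) ^ (c - 1) * (P x * (2 * zz x₀ b t x * a' (zz x₀ b t x) - c * a (zz x₀ b t x)))

/-- The partial derivatives of `pW P a x₀ b c`, if `e` is the gradient of `P`. -/
def pWx {N : ℕ} (P : E N → ℝ) (e : Fin N → ℝ) (a a' : ℝ → ℝ) (x₀ : E N) (b c : ℝ) (j : Fin N)
    (t : ℝ) (x : E N) : ℝ :=
  (b - t) ^ c * (e j * a (zz x₀ b t x) +
        P x * (a' (zz x₀ b t x) * (2 * (x j - x₀ j) / (b - t) ^ 2)))

/-- The factor `P` is 1 for the energy and a coordinate of x - x₀ for the momentum; summed over the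
coordinates, the latter produces the multiplier (x - x₀)·∇u. The profile must be C¹ on the whole
line, which is why (1-z)^α cannot be used directly. -/
theorem isWeight_profile {a a' : ℝ → ℝ} (ha : ∀ z, HasDerivAt a (a' z) z) (hc : Continuous a')
    (hs : ∀ z, 1 ≤ z → a z = 0) (hs' : ∀ z, 1 ≤ z → a' z = 0) {P : E N → ℝ} {e : Fin N → ℝ}
    (hP : ContDiff ℝ 1 P) (he : ∀ x j, fderiv ℝ P x (ei j) = e j) {b : ℝ} (hb : t₂ < b)
    (x₀ : E N) (c : ℝ) :
    IsWeight t₁ t₂ (Metric.closedBall x₀ (b - t₁)) (pW P a x₀ b c) (pWt P a a' x₀ b c)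
      (pWx P e a a' x₀ b c) := by
  unfold pW pWt pWx
  have hca : Continuous a := continuous_iff_continuousAt.2 fun z => (ha z).continuousAt
  have hcP := hP.continuous
  have hzc : ContinuousOn (fun y : ℝ × E N => zz x₀ b y.1 y.2) (Icc t₁ t₂ ×ˢ univ) := by
    unfold zz
    refine ContinuousOn.div (by fun_prop) (by fun_prop) fun y hy => ?_
    have : y.1 ≤ t₂ := hy.1.2
    have : 0 < b - y.1 := by linarith
    positivity
  have hrc : ∀ c : ℝ, ContinuousOn (fun y : ℝ × E N => (b - y.1) ^ c) (Icc t₁ t₂ ×ˢ univ) := by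
    intro c
    refine ContinuousOn.rpow_const (by fun_prop) fun y hy => Or.inl ?_
    have : y.1 ≤ t₂ := hy.1.2
    linarith
  have hic : ContinuousOn (fun y : ℝ × E N => ((b - y.1) ^ 2)⁻¹) (Icc t₁ t₂ ×ˢ univ) := by
    refine ContinuousOn.inv₀ (by fun_prop) fun y hy => ?_
    have : y.1 ≤ t₂ := hy.1.2
    have : 0 < b - y.1 := by linarith
    positivity
  have hac := hca.comp_continuousOn hzc
  have hac' := hc.comp_continuousOn hzc
  have hPc : ContinuousOn (fun y : ℝ × E N => P y.2) (Icc t₁ t₂ ×ˢ univ) := by fun_prop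
  have sa : ∀ t ∈ Icc t₁ t₂, ∀ x, x ∉ Metric.closedBall x₀ (b - t₁) → a (zz x₀ b t x) = 0 :=
    fun t ht x hx => hs _ (one_le_zz ht.1 (ht.2.trans_lt hb) hx)
  have sa' : ∀ t ∈ Icc t₁ t₂, ∀ x, x ∉ Metric.closedBall x₀ (b - t₁) → a' (zz x₀ b t x) = 0 :=
    fun t ht x hx => hs' _ (one_le_zz ht.1 (ht.2.trans_lt hb) hx)
  have hF : ∀ t ∈ Icc t₁ t₂, ∀ x, HasFDerivAt (fun x => (b - t) ^ c * (P x * a (zz x₀ b t x)))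
      ((b - t) ^ c • (P x • (a' (zz x₀ b t x) • (((b - t) ^ 2)⁻¹ •
        (2 • (innerSL ℝ (x - x₀)).comp (ContinuousLinearMap.id ℝ (E N))))) +
        a (zz x₀ b t x) • fderiv ℝ P x)) x := by
    intro t ht x
    have h1 : HasFDerivAt (fun x : E N => x - x₀) (ContinuousLinearMap.id ℝ (E N)) x :=
      (hasFDerivAt_id x).sub_const x₀
    have h2 : HasFDerivAt (zz x₀ b t) (((b - t) ^ 2)⁻¹ •
        (2 • (innerSL ℝ (x - x₀)).comp (ContinuousLinearMap.id ℝ (E N)))) x := by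
      have := h1.norm_sq.const_mul (((b - t) ^ 2)⁻¹)
      refine this.congr_of_eventuallyEq (Eventually.of_forall fun y => ?_)
      simp only [zz]
      ring
    exact (((hP.differentiable (by simp)).differentiableAt.hasFDerivAt).mul
      ((ha _).comp_hasFDerivAt x h2)).const_mul _
  refine ⟨⟨(hrc c).mul (hPc.mul hac), fun t ht x hx => by simp [sa t ht x hx]⟩,
    ⟨(hrc _).mul (hPc.mul (((continuousOn_const.mul hzc).mul hac').sub
      (continuousOn_const.mul hac))), fun t ht x hx => by simp [sa t ht x hx, sa' t ht x hx]⟩,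
    fun j => ⟨?_, fun t ht x hx => by simp [sa t ht x hx, sa' t ht x hx]⟩, ?_, ?_, ?_⟩
  · refine (hrc c).mul ((continuousOn_const.mul hac).add (hPc.mul (hac'.mul ?_)))
    simp only [div_eq_mul_inv]
    exact ContinuousOn.mul (by fun_prop) hic
  · intro t ht x
    have hr : 0 < b - t := by linarith [ht.2]
    have h0 : HasDerivAt (fun s => b - s) (-1) t := by
      simpa using (hasDerivAt_id t).const_sub b
    have h1 : HasDerivAt (fun s => (b - s) ^ c) (-1 * c * (b - t) ^ (c - 1)) t :=
      h0.rpow_const (Or.inl hr.ne')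
    have h2 : HasDerivAt (fun s => zz x₀ b s x) (2 * zz x₀ b t x / (b - t)) t := by
      have h3 := (hasDerivAt_const t (‖x - x₀‖ ^ 2)).div (h0.pow 2) (pow_pos hr 2).ne'
      refine h3.congr_deriv ?_
      simp only [zz]
      simp
      field_simp
    have h4 := h1.mul (((ha _).comp t h2).const_mul (P x))
    refine h4.congr_deriv ?_
    have : (b - t) ^ c = (b - t) ^ (c - 1) * (b - t) := by
      rw [← Real.rpow_add_one hr.ne']; ring_nf
    simp only [Function.comp, this]
    field_simp
    ring
  · intro t ht x
    exact (hF t ht x).differentiableAt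
  · intro t ht x j
    rw [(hF t ht x).fderiv]
    rw [← he x j]
    simp [ei, EuclideanSpace.inner_single_right]
    ring

theorem fderiv_one_apply (x : E N) (j : Fin N) :
    fderiv ℝ (fun _ : E N => (1 : ℝ)) x (ei j) = 0 := by simp

theorem fderiv_coord_apply (x₀ x : E N) (i j : Fin N) :
    fderiv ℝ (fun x : E N => x i - x₀ i) x (ei j) = if j = i then 1 else 0 := by
  have : HasFDerivAt (fun x : E N => x i - x₀ i) (EuclideanSpace.proj (𝕜 := ℝ) i) x :=
    (EuclideanSpace.proj (𝕜 := ℝ) i).hasFDerivAt.sub_const _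
  rw [this.fderiv]
  simp [ei, eq_comm]

theorem isWeight_radial {a a' : ℝ → ℝ} (ha : ∀ z, HasDerivAt a (a' z) z) (hc : Continuous a')
    (hs : ∀ z, 1 ≤ z → a z = 0) (hs' : ∀ z, 1 ≤ z → a' z = 0) {b : ℝ} (hb : t₂ < b)
    (x₀ : E N) (c : ℝ) : IsWeight t₁ t₂ (Metric.closedBall x₀ (b - t₁))
      (pW (fun _ => 1) a x₀ b c) (pWt (fun _ => 1) a a' x₀ b c)
      (pWx (fun _ => 1) (fun _ => 0) a a' x₀ b c) :=
  isWeight_profile ha hc hs hs' contDiff_const (fun x j => fderiv_one_apply x j) hb x₀ c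

theorem isWeight_coord {a a' : ℝ → ℝ} (ha : ∀ z, HasDerivAt a (a' z) z) (hc : Continuous a')
    (hs : ∀ z, 1 ≤ z → a z = 0) (hs' : ∀ z, 1 ≤ z → a' z = 0) {b : ℝ} (hb : t₂ < b)
    (x₀ : E N) (c : ℝ) (i : Fin N) : IsWeight t₁ t₂ (Metric.closedBall x₀ (b - t₁))
      (pW (fun x => x i - x₀ i) a x₀ b c) (pWt (fun x => x i - x₀ i) a a' x₀ b c)
      (pWx (fun x => x i - x₀ i) (fun j => if j = i then 1 else 0) a a' x₀ b c) :=
  isWeight_profile ha hc hs hs' (by fun_prop) (fun x j => fderiv_coord_apply x₀ x i j) hb x₀ c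

/-- The properties of a smooth approximation of `(1 - z)^α` vanishing near `z = 1`. -/
structure IsProfile (α ε : ℝ) (w w' w'' : ℝ → ℝ) : Prop where
  d1 : ∀ z, HasDerivAt w (w' z) z
  d2 : ∀ z, HasDerivAt w' (w'' z) z
  cont : Continuous w''
  s0 : ∀ z, 1 ≤ z → w z = 0
  s1 : ∀ z, 1 ≤ z → w' z = 0
  s2 : ∀ z, 1 ≤ z → w'' z = 0
  nonneg : ∀ z, 0 ≤ w z
  le_one : ∀ z, 0 ≤ z → w z ≤ 1
  err_nonneg : ∀ z, 0 ≤ z → 0 ≤ -(w' z * (1 - z) + α * w z)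
  err_le : ∀ z, 0 ≤ z → -(w' z * (1 - z) + α * w z) ≤ ε

/-- The cut-off version of `(1 - z)^α`. -/
def om (α k z : ℝ) : ℝ := (1 - z) ^ α * Real.smoothTransition (k * (1 - z) - 1)

theorem om_eq_zero {α k z : ℝ} (h : k * (1 - z) ≤ 1) : om α k z = 0 := by
  rw [om, Real.smoothTransition.zero_of_nonpos (by linarith), mul_zero]

/-- The cut-off vanishes for 1 - z ≤ 1/k, so the singularity of the power at z = 1 is never reached.
-/
theorem om_contDiff {α k : ℝ} (hk : 0 < k) : ContDiff ℝ ∞ (om α k) := by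
  rw [contDiff_iff_contDiffAt]
  intro z
  by_cases hz : z < 1
  · unfold om
    refine ContDiffAt.mul ?_ ?_
    · exact ContDiffAt.rpow_const_of_ne (by fun_prop) (by linarith)
    · exact (Real.smoothTransition.contDiff.comp (by fun_prop :
        ContDiff ℝ ∞ fun z : ℝ => k * (1 - z) - 1)).contDiffAt
  · have : om α k =ᶠ[𝓝 z] fun _ => 0 := by
      have h1 : ∀ᶠ y in 𝓝 z, k * (1 - y) < 1 := by
        refine ContinuousAt.eventually_lt (by fun_prop) continuousAt_const ?_
        nlinarith
      filter_upwards [h1] with y hy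
      exact om_eq_zero hy.le
    exact contDiffAt_const.congr_of_eventuallyEq this

theorem exists_smoothTransition_deriv_le :
    ∃ C : ℝ, ∀ x, 0 ≤ deriv Real.smoothTransition x ∧ deriv Real.smoothTransition x ≤ C ∧
      ((x ≤ 0 ∨ 1 ≤ x) → deriv Real.smoothTransition x = 0) := by
  have hmono : Monotone Real.smoothTransition :=
    Real.smoothTransition.monotone
  have hc : Continuous (deriv Real.smoothTransition) :=
    (Real.smoothTransition.contDiff (n := 1)).continuous_deriv le_rfl
  have h0 : ∀ x, 0 ≤ deriv Real.smoothTransition x := fun x => hmono.deriv_nonneg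
  have hz : ∀ x : ℝ, (x ≤ 0 ∨ 1 ≤ x) → deriv Real.smoothTransition x = 0 := by
    intro x hx
    have hl : ∀ y ∈ Iio (0 : ℝ) ∪ Ioi 1, deriv Real.smoothTransition y = 0 := by
      rintro y (hy | hy)
      · have : Real.smoothTransition =ᶠ[𝓝 y] fun _ => 0 := by
          filter_upwards [Iio_mem_nhds hy] with w hw
          exact Real.smoothTransition.zero_of_nonpos (le_of_lt hw)
        rw [this.deriv_eq]; simp
      · have : Real.smoothTransition =ᶠ[𝓝 y] fun _ => 1 := by
          filter_upwards [Ioi_mem_nhds hy] with w hw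
          exact Real.smoothTransition.one_of_one_le (le_of_lt hw)
        rw [this.deriv_eq]; simp
    have hcl : IsClosed {y | deriv Real.smoothTransition y = 0} :=
      isClosed_eq hc continuous_const
    have := closure_minimal hl hcl
    refine this ?_
    rw [closure_union, closure_Iio, closure_Ioi]
    exact hx
  obtain ⟨C, hC⟩ := (isCompact_Icc (a := (0 : ℝ)) (b := 1)).exists_bound_of_continuousOn
    hc.continuousOn
  refine ⟨max C 0, fun x => ⟨h0 x, ?_, hz x⟩⟩
  by_cases hx : x ∈ Icc (0 : ℝ) 1
  · exact (le_abs_self _).trans ((hC x hx).trans (le_max_left _ _))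
  · rw [hz x]
    · exact le_max_right _ _
    · by_contra! h
      exact hx ⟨h.1.le, h.2.le⟩

/-- The cut-off profiles have an arbitrarily small error. -/
theorem exists_isProfile {α : ℝ} (hα : 0 < α) :
    ∃ ε : ℕ → ℝ, Tendsto ε atTop (𝓝 0) ∧ ∀ k : ℕ, 1 ≤ k →
      IsProfile α (ε k) (om α k) (deriv (om α k)) (deriv (deriv (om α k))) := by
  obtain ⟨C, hC⟩ := exists_smoothTransition_deriv_le
  have hC0 : 0 ≤ C := (hC 0).1.trans (hC 0).2.1
  -- The error k(1-z)^{α+1}χ'(k(1-z)-1), with χ the smooth transition, is nonzero only for k(1-z) ≤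
  -- 2. There it is at most k(2/k)^{α+1}C, and α > 0 makes this tend to 0.
  refine ⟨fun k => (2 : ℝ) ^ (α + 1) * C * (k : ℝ) ^ (-α), ?_, fun k hk => ?_⟩
  · have := ((tendsto_rpow_neg_atTop hα).comp tendsto_natCast_atTop_atTop).const_mul
      ((2 : ℝ) ^ (α + 1) * C)
    simpa using this
  have hk0 : (0 : ℝ) < k := by exact_mod_cast hk
  have hs := om_contDiff (α := α) hk0
  have hs1 : ContDiff ℝ ∞ (deriv (om α k)) := hs.deriv'
  have hz0 : ∀ z, 1 ≤ z → om α k =ᶠ[𝓝 z] fun _ => 0 := by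
    intro z hz
    have h1 : ∀ᶠ y in 𝓝 z, (k : ℝ) * (1 - y) < 1 := by
      refine ContinuousAt.eventually_lt (by fun_prop) continuousAt_const ?_
      nlinarith
    filter_upwards [h1] with y hy
    exact om_eq_zero hy.le
  -- The power (1-z)^α solves ω'(1-z) + αω = 0, so only the derivative of the cut-off remains, and
  -- it has a sign.
  have herr : ∀ z, z < 1 → -(deriv (om α k) z * (1 - z) + α * om α k z) =
      k * (1 - z) ^ (α + 1) * deriv Real.smoothTransition (k * (1 - z) - 1) := by
    intro z hz
    have hz' : 0 < 1 - z := by linarith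
    have h0 : HasDerivAt (fun z : ℝ => 1 - z) (-1) z := by
      simpa using (hasDerivAt_id z).const_sub 1
    have h1 : HasDerivAt (fun z : ℝ => (1 - z) ^ α) (-1 * α * (1 - z) ^ (α - 1)) z :=
      h0.rpow_const (Or.inl hz'.ne')
    have h2 : HasDerivAt (fun z : ℝ => k * (1 - z) - 1) (k * -1) z :=
      (h0.const_mul (k : ℝ)).sub_const 1
    have h3 : HasDerivAt Real.smoothTransition
        (deriv Real.smoothTransition (k * (1 - z) - 1)) (k * (1 - z) - 1) :=
      ((Real.smoothTransition.contDiff (n := 1)).differentiable (by simp)).differentiableAt.hasDerivAt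
    have h4 : HasDerivAt (om α k) _ z := h1.mul (HasDerivAt.comp
      (h₂ := Real.smoothTransition) (h := fun z : ℝ => k * (1 - z) - 1) z h3 h2)
    rw [h4.deriv]
    have e1 : (1 - z) ^ α = (1 - z) ^ (α - 1) * (1 - z) := by
      rw [← Real.rpow_add_one hz'.ne']; ring_nf
    have e2 : (1 - z) ^ (α + 1) = (1 - z) ^ (α - 1) * (1 - z) * (1 - z) := by
      rw [Real.rpow_add_one hz'.ne', e1]
    simp only [om, e2, e1]
    ring
  have hee : ∀ z, 1 ≤ z → deriv (om α k) z * (1 - z) + α * om α k z = 0 := by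
    intro z hz
    rw [(hz0 z hz).deriv_eq, (hz0 z hz).eq_of_nhds]
    simp
  refine ⟨fun z => (hs.differentiable (by simp)).differentiableAt.hasDerivAt,
    fun z => (hs1.differentiable (by simp)).differentiableAt.hasDerivAt,
    hs1.continuous_deriv (by simp), fun z hz => (hz0 z hz).eq_of_nhds, fun z hz => ?_,
    fun z hz => ?_, fun z => ?_, fun z hz => ?_, fun z hz => ?_, fun z hz => ?_⟩
  · rw [(hz0 z hz).deriv_eq]; simp
  · rw [(hz0 z hz).deriv.deriv_eq]; simp
  · rcases le_total z 1 with h | h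
    · exact mul_nonneg (Real.rpow_nonneg (by linarith) _) (Real.smoothTransition.nonneg _)
    · rw [(hz0 z h).eq_of_nhds]
  · rcases le_total z 1 with h | h
    · exact mul_le_one₀ (Real.rpow_le_one (by linarith) (by linarith) hα.le)
        (Real.smoothTransition.nonneg _) (Real.smoothTransition.le_one _)
    · rw [(hz0 z h).eq_of_nhds]; exact zero_le_one
  · rcases lt_or_ge z 1 with h | h
    · rw [herr z h]
      have := Real.rpow_nonneg (by linarith : 0 ≤ 1 - z) (α + 1)
      have := (hC (k * (1 - z) - 1)).1
      positivity
    · rw [hee z h]; simp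
  · have hpos : 0 ≤ (2 : ℝ) ^ (α + 1) * C * (k : ℝ) ^ (-α) := by positivity
    rcases lt_or_ge z 1 with h | h
    · rw [herr z h]
      rcases le_or_gt (k * (1 - z) - 1) 1 with h1 | h1
      · have h2 : 1 - z ≤ 2 / k := by rw [le_div_iff₀ hk0]; linarith
        have h3 : (1 - z) ^ (α + 1) ≤ (2 / k) ^ (α + 1) :=
          Real.rpow_le_rpow (by linarith) h2 (by linarith)
        have h4 : (k : ℝ) * (2 / k : ℝ) ^ (α + 1) * C = (2 : ℝ) ^ (α + 1) * C * (k : ℝ) ^ (-α) := by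
          rw [Real.div_rpow (by norm_num) hk0.le, Real.rpow_add_one hk0.ne', Real.rpow_neg hk0.le]
          field_simp
        refine le_of_le_of_eq ?_ h4
        have := (hC (k * (1 - z) - 1)).2.1
        have := (hC (k * (1 - z) - 1)).1
        gcongr
      · rw [(hC _).2.2 (Or.inr h1.le), mul_zero]
        exact hpos
    · rw [hee z h]
      simpa using hpos

end

end HamzaZaag

/-! ### The multiplier identities as single space integrals. -/

namespace HamzaZaag

noncomputable section

variable {N : ℕ} {t₁ t₂ : ℝ} {K O : Set (E N)}

/-- `f` is integrable with integral `c`. -/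
structure HasInt {N : ℕ} (f : E N → ℝ) (c : ℝ) : Prop where
  int : Integrable f
  eq : ∫ x, f x = c

namespace HasInt

variable {f g : E N → ℝ} {c d : ℝ}

theorem add (hf : HasInt f c) (hg : HasInt g d) : HasInt (fun x => f x + g x) (c + d) :=
  ⟨hf.int.add hg.int, by rw [integral_add hf.int hg.int, hf.eq, hg.eq]⟩

theorem sub (hf : HasInt f c) (hg : HasInt g d) : HasInt (fun x => f x - g x) (c - d) :=
  ⟨hf.int.sub hg.int, by rw [integral_sub hf.int hg.int, hf.eq, hg.eq]⟩

theorem const_mul (hf : HasInt f c) (a : ℝ) : HasInt (fun x => a * f x) (a * c) :=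
  ⟨hf.int.const_mul a, by rw [integral_const_mul, hf.eq]⟩

theorem sum {ι : Type*} (s : Finset ι) {F : ι → E N → ℝ} {C : ι → ℝ}
    (h : ∀ i ∈ s, HasInt (F i) (C i)) : HasInt (fun x => ∑ i ∈ s, F i x) (∑ i ∈ s, C i) :=
  ⟨integrable_finsetSum _ fun i hi => (h i hi).int, by
    rw [integral_finsetSum _ fun i hi => (h i hi).int]
    exact Finset.sum_congr rfl fun i hi => (h i hi).eq⟩

theorem congr (hf : HasInt f c) (h : ∀ x, g x = f x) : HasInt g c := by
  have : g = f := funext h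
  rwa [this]

theorem congr_val (hf : HasInt f c) (h : c = d) : HasInt f d := h ▸ hf

theorem self (hf : Integrable f) : HasInt f (∫ x, f x) := ⟨hf, rfl⟩

/-- The identities produce integrals with a power of b - t inside; this takes it out and recovers
integrability of the density itself. -/
theorem mul_cancel (hf : HasInt (fun x => d * g x) c) (hd : d ≠ 0) :
    Integrable g ∧ d * ∫ x, g x = c := by
  have h := hf.const_mul d⁻¹
  have e : ∀ x, g x = d⁻¹ * (d * g x) := fun x => by field_simp
  have h2 := h.congr e
  refine ⟨h2.int, ?_⟩
  rw [h2.eq]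
  field_simp

end HasInt

theorem IsCoef.hasInt {c : ℝ → E N → ℝ} (hc : IsCoef t₁ t₂ K c) (hK : IsCompact K) {t : ℝ}
    (ht : t ∈ Icc t₁ t₂) {f g : E N → ℝ} (hf : MemLp f 2 volume) (hg : MemLp g 2 volume) :
    HasInt (fun x => c t x * (f x * g x)) (bil (c t) f g) :=
  HasInt.self (bil_integrable (hc.cont_x ht) (hc.compact hK ht) hf hg)

/-- The radial derivative `(x - x₀) · G`. -/
def rad {N : ℕ} (x₀ : E N) (G : Fin N → E N → ℝ) (x : E N) : ℝ := ∑ i, (x i - x₀ i) * G i x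

/-- The square `|G|²`. -/
def gsq {N : ℕ} (G : Fin N → E N → ℝ) (x : E N) : ℝ := ∑ i, G i x ^ 2

theorem sum_sq_coord (x₀ x : E N) {b t : ℝ} (h : t < b) :
    ∑ i, (x i - x₀ i) ^ 2 = zz x₀ b t x * (b - t) ^ 2 := by
  have : 0 < b - t := by linarith
  rw [zz, div_mul_cancel₀ _ (by positivity), EuclideanSpace.norm_eq, Real.sq_sqrt (by positivity)]
  simp

section Sums

variable (X g : Fin N → ℝ)

theorem sum_diag (c k k' R : ℝ) :
    ∑ i, c * (k + X i * (k' * (2 * X i / R))) =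
      c * (N * k + 2 * k' * (∑ i, X i ^ 2) / R) := by
  rw [← Finset.mul_sum, Finset.sum_add_distrib]
  simp only [Finset.sum_const, Finset.card_univ, Fintype.card_fin, nsmul_eq_mul]
  rw [Finset.mul_sum, Finset.sum_div]
  congr 2
  exact Finset.sum_congr rfl fun i _ => by ring

/-- The Kronecker part gives |G|²; the radial part factorises into the square of X·G. -/
theorem sum_cross (c k k' R : ℝ) :
    ∑ i, ∑ j, c * ((if j = i then 1 else 0) * k + X i * (k' * (2 * X j / R))) * (g i * g j) =
      c * (k * ∑ i, g i ^ 2) + c * (2 * k' * (∑ i, X i * g i) ^ 2 / R) := by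
  have h : ∀ i, ∑ j, c * ((if j = i then 1 else 0) * k + X i * (k' * (2 * X j / R))) *
      (g i * g j) = c * k * g i ^ 2 + c * (2 * k' / R) * (X i * g i) * ∑ j, X j * g j := by
    intro i
    have h1 : ∀ j, c * ((if j = i then 1 else 0) * k + X i * (k' * (2 * X j / R))) *
        (g i * g j) = (if j = i then c * k * (g i * g j) else 0) +
          c * (2 * k' / R) * (X i * g i) * (X j * g j) := by
      intro j
      split_ifs <;> ring
    simp only [h1, Finset.sum_add_distrib, Finset.sum_ite_eq', Finset.mem_univ, if_true]
    rw [Finset.mul_sum]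
    ring
  simp only [h, Finset.sum_add_distrib]
  rw [← Finset.mul_sum, ← Finset.sum_mul, ← Finset.mul_sum]
  ring

end Sums

section Closed

variable {a a' : ℝ → ℝ} {b c t : ℝ} {x₀ : E N} {U V H : E N → ℝ} {G : Fin N → E N → ℝ}

theorem sum_pWx (hb : t < b) (x : E N) :
    ∑ i, pWx (fun x => x i - x₀ i) (fun j => if j = i then 1 else 0) a a' x₀ b c i t x =
      (b - t) ^ c * (N * a (zz x₀ b t x) + 2 * zz x₀ b t x * a' (zz x₀ b t x)) := by
  have hr : 0 < b - t := by linarith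
  simp only [pWx, if_true, one_mul]
  rw [sum_diag (fun i => x i - x₀ i), sum_sq_coord x₀ x hb]
  field_simp

theorem energy_closed (hφ : IsWeight t₁ t₂ K (pW (fun _ => 1) a x₀ b c)
      (pWt (fun _ => 1) a a' x₀ b c) (pWx (fun _ => 1) (fun _ => 0) a a' x₀ b c))
    (hK : IsCompact K) (ht : t ∈ Icc t₁ t₂) (hV : MemLp V 2 volume)
    (hG : ∀ i, MemLp (G i) 2 volume) (hH : MemLp H 2 volume) :
    HasInt (fun x => (b - t) ^ (c - 1) * (2 * zz x₀ b t x * a' (zz x₀ b t x) -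
        c * a (zz x₀ b t x)) * (V x ^ 2 + gsq G x) -
        4 * (b - t) ^ c / (b - t) ^ 2 * a' (zz x₀ b t x) * V x * rad x₀ G x +
        2 * (b - t) ^ c * a (zz x₀ b t x) * H x * V x)
      (bil (pWt (fun _ => 1) a a' x₀ b c t) V V +
        (∑ i, bil (pWt (fun _ => 1) a a' x₀ b c t) (G i) (G i)) -
        2 * (∑ i, bil (pWx (fun _ => 1) (fun _ => 0) a a' x₀ b c i t) V (G i)) +
        2 * bil (pW (fun _ => 1) a x₀ b c t) H V) := by
  refine HasInt.congr ((((hφ.coef_t.hasInt hK ht hV hV).add (HasInt.sum _ fun i _ =>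
    hφ.coef_t.hasInt hK ht (hG i) (hG i))).sub ((HasInt.sum _ fun i _ =>
    (hφ.coef_x i).hasInt hK ht hV (hG i)).const_mul 2)).add
    ((hφ.coef.hasInt hK ht hH hV).const_mul 2)) fun x => ?_
  have e1 : ∑ i, pWt (fun _ => 1) a a' x₀ b c t x * (G i x * G i x) =
      pWt (fun _ => 1) a a' x₀ b c t x * gsq G x := by
    rw [gsq, Finset.mul_sum]
    exact Finset.sum_congr rfl fun i _ => by ring
  have e2 : ∑ i, pWx (fun _ => 1) (fun _ => 0) a a' x₀ b c i t x * (V x * G i x) =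
      (b - t) ^ c * a' (zz x₀ b t x) * 2 / (b - t) ^ 2 * V x * rad x₀ G x := by
    rw [rad, Finset.mul_sum]
    exact Finset.sum_congr rfl fun i _ => by simp only [pWx]; ring
  rw [e1, e2]
  simp only [pW, pWt]
  ring

/-- Summing the momentum identities with the weights x_i - x₀_i gives the identity of the radial
multiplier (x - x₀)·∇u. -/
theorem momentum_closed (hφ : ∀ i, IsWeight t₁ t₂ K (pW (fun x => x i - x₀ i) a x₀ b c)
      (pWt (fun x => x i - x₀ i) a a' x₀ b c)
      (pWx (fun x => x i - x₀ i) (fun j => if j = i then 1 else 0) a a' x₀ b c))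
    (hb : t < b) (hK : IsCompact K) (ht : t ∈ Icc t₁ t₂) (hV : MemLp V 2 volume)
    (hG : ∀ i, MemLp (G i) 2 volume) (hH : MemLp H 2 volume) :
    HasInt (fun x => (b - t) ^ (c - 1) * (2 * zz x₀ b t x * a' (zz x₀ b t x) -
        c * a (zz x₀ b t x)) * V x * rad x₀ G x -
        1 / 2 * (b - t) ^ c * (N * a (zz x₀ b t x) + 2 * zz x₀ b t x * a' (zz x₀ b t x)) *
          (V x ^ 2 - gsq G x) -
        (b - t) ^ c * a (zz x₀ b t x) * gsq G x -
        2 * (b - t) ^ c / (b - t) ^ 2 * a' (zz x₀ b t x) * rad x₀ G x ^ 2 +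
        (b - t) ^ c * a (zz x₀ b t x) * H x * rad x₀ G x)
      (∑ i, (bil (pWt (fun x => x i - x₀ i) a a' x₀ b c t) V (G i) -
        1 / 2 * bil (pWx (fun x => x i - x₀ i) (fun j => if j = i then 1 else 0) a a' x₀ b c i t)
          V V +
        1 / 2 * (∑ j, bil (pWx (fun x => x i - x₀ i) (fun j => if j = i then 1 else 0) a a' x₀ b c
          i t) (G j) (G j)) -
        (∑ j, bil (pWx (fun x => x i - x₀ i) (fun j => if j = i then 1 else 0) a a' x₀ b c
          j t) (G i) (G j)) +
        bil (pW (fun x => x i - x₀ i) a x₀ b c t) H (G i))) := by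
  refine HasInt.congr (HasInt.sum _ fun i _ => ((((hφ i).coef_t.hasInt hK ht hV (hG i)).sub
    ((((hφ i).coef_x i).hasInt hK ht hV hV).const_mul (1 / 2))).add
    ((HasInt.sum _ fun j _ => ((hφ i).coef_x i).hasInt hK ht (hG j) (hG j)).const_mul
      (1 / 2))).sub (HasInt.sum _ fun j _ => ((hφ i).coef_x j).hasInt hK ht (hG i) (hG j)) |>.add
    ((hφ i).coef.hasInt hK ht hH (hG i))) fun x => ?_
  simp only [Finset.sum_add_distrib, Finset.sum_sub_distrib]
  have e1 : ∑ i, pWt (fun x => x i - x₀ i) a a' x₀ b c t x * (V x * G i x) =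
      (b - t) ^ (c - 1) * (2 * zz x₀ b t x * a' (zz x₀ b t x) -
        c * a (zz x₀ b t x)) * V x * rad x₀ G x := by
    rw [rad, Finset.mul_sum]
    exact Finset.sum_congr rfl fun i _ => by simp only [pWt]; ring
  have e0 := sum_pWx (a := a) (a' := a') (c := c) (x₀ := x₀) hb x
  have e2 : ∑ i, 1 / 2 * (pWx (fun x => x i - x₀ i) (fun j => if j = i then 1 else 0) a a' x₀ b c
      i t x * (V x * V x)) = 1 / 2 * ((b - t) ^ c * (N * a (zz x₀ b t x) + 2 * zz x₀ b t x *
        a' (zz x₀ b t x))) * V x ^ 2 := by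
    rw [← e0, ← Finset.mul_sum, ← Finset.sum_mul]
    ring
  have e3 : ∑ i, 1 / 2 * ∑ j, pWx (fun x => x i - x₀ i) (fun j => if j = i then 1 else 0) a a' x₀ b c
      i t x * (G j x * G j x) = 1 / 2 * ((b - t) ^ c * (N * a (zz x₀ b t x) + 2 * zz x₀ b t x *
        a' (zz x₀ b t x))) * gsq G x := by
    rw [← e0, gsq, ← Finset.mul_sum]
    simp only [← Finset.mul_sum, ← Finset.sum_mul, sq]
    ring
  have e4 : ∑ i, ∑ j, pWx (fun x => x i - x₀ i) (fun j => if j = i then 1 else 0) a a' x₀ b c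
      j t x * (G i x * G j x) = (b - t) ^ c * a (zz x₀ b t x) * gsq G x +
        2 * (b - t) ^ c / (b - t) ^ 2 * a' (zz x₀ b t x) * rad x₀ G x ^ 2 := by
    simp only [pWx]
    rw [sum_cross (fun i => x i - x₀ i) (fun i => G i x), gsq, rad]
    ring
  have e5 : ∑ i, pW (fun x => x i - x₀ i) a x₀ b c t x * (H x * G i x) =
      (b - t) ^ c * a (zz x₀ b t x) * H x * rad x₀ G x := by
    rw [rad, Finset.mul_sum]
    exact Finset.sum_congr rfl fun i _ => by simp only [pW]; ring
  rw [e1, e2, e3, e4, e5]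
  ring

theorem mixed_closed (hφ : IsWeight t₁ t₂ K (pW (fun _ => 1) a x₀ b c)
      (pWt (fun _ => 1) a a' x₀ b c) (pWx (fun _ => 1) (fun _ => 0) a a' x₀ b c))
    (hK : IsCompact K) (ht : t ∈ Icc t₁ t₂) (hU : MemLp U 2 volume) (hV : MemLp V 2 volume)
    (hG : ∀ i, MemLp (G i) 2 volume) (hH : MemLp H 2 volume) :
    HasInt (fun x => (b - t) ^ (c - 1) * (2 * zz x₀ b t x * a' (zz x₀ b t x) -
        c * a (zz x₀ b t x)) * U x * V x + (b - t) ^ c * a (zz x₀ b t x) * (V x ^ 2 - gsq G x) -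
        2 * (b - t) ^ c / (b - t) ^ 2 * a' (zz x₀ b t x) * U x * rad x₀ G x +
        (b - t) ^ c * a (zz x₀ b t x) * H x * U x)
      (bil (pWt (fun _ => 1) a a' x₀ b c t) U V + bil (pW (fun _ => 1) a x₀ b c t) V V -
        (∑ i, bil (pWx (fun _ => 1) (fun _ => 0) a a' x₀ b c i t) U (G i)) -
        (∑ i, bil (pW (fun _ => 1) a x₀ b c t) (G i) (G i)) +
        bil (pW (fun _ => 1) a x₀ b c t) H U) := by
  refine HasInt.congr (((((hφ.coef_t.hasInt hK ht hU hV).add (hφ.coef.hasInt hK ht hV hV)).sub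
    (HasInt.sum _ fun i _ => (hφ.coef_x i).hasInt hK ht hU (hG i))).sub (HasInt.sum _ fun i _ =>
    hφ.coef.hasInt hK ht (hG i) (hG i))).add (hφ.coef.hasInt hK ht hH hU)) fun x => ?_
  have e1 : ∑ i, pW (fun _ => 1) a x₀ b c t x * (G i x * G i x) =
      pW (fun _ => 1) a x₀ b c t x * gsq G x := by
    rw [gsq, Finset.mul_sum]
    exact Finset.sum_congr rfl fun i _ => by ring
  have e2 : ∑ i, pWx (fun _ => 1) (fun _ => 0) a a' x₀ b c i t x * (U x * G i x) =
      (b - t) ^ c * a' (zz x₀ b t x) * 2 / (b - t) ^ 2 * U x * rad x₀ G x := by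
    rw [rad, Finset.mul_sum]
    exact Finset.sum_congr rfl fun i _ => by simp only [pWx]; ring
  rw [e1, e2]
  simp only [pW, pWt]
  ring

theorem sq_closed (hφ : IsWeight t₁ t₂ K (pW (fun _ => 1) a x₀ b c)
      (pWt (fun _ => 1) a a' x₀ b c) (pWx (fun _ => 1) (fun _ => 0) a a' x₀ b c))
    (hK : IsCompact K) (ht : t ∈ Icc t₁ t₂) (hU : MemLp U 2 volume) (hV : MemLp V 2 volume) :
    HasInt (fun x => (b - t) ^ (c - 1) * (2 * zz x₀ b t x * a' (zz x₀ b t x) -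
        c * a (zz x₀ b t x)) * U x ^ 2 + 2 * (b - t) ^ c * a (zz x₀ b t x) * U x * V x)
      (bil (pWt (fun _ => 1) a a' x₀ b c t) U U +
        2 * bil (pW (fun _ => 1) a x₀ b c t) U V) := by
  refine HasInt.congr ((hφ.coef_t.hasInt hK ht hU hU).add
    ((hφ.coef.hasInt hK ht hU hV).const_mul 2)) fun x => ?_
  simp only [pW, pWt]
  ring

/-- This is the integral of the divergence of a(z) u² (x - x₀). Since it vanishes, any multiple can
be added to a density; this is how u (x - x₀)·∇u is traded for u². -/
theorem space_closed (hφ : ∀ i, IsWeight t₁ t₂ K (pW (fun x => x i - x₀ i) a x₀ b c)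
      (pWt (fun x => x i - x₀ i) a a' x₀ b c)
      (pWx (fun x => x i - x₀ i) (fun j => if j = i then 1 else 0) a a' x₀ b c))
    (hb : t < b) (hK : IsCompact K) (ht : t ∈ Icc t₁ t₂) (hU : MemLp U 2 volume)
    (hG : ∀ i, MemLp (G i) 2 volume)
    (h : ∀ i, bil (pWx (fun x => x i - x₀ i) (fun j => if j = i then 1 else 0) a a' x₀ b c i t)
      U U = -2 * bil (pW (fun x => x i - x₀ i) a x₀ b c t) U (G i)) :
    HasInt (fun x => (b - t) ^ c * (N * a (zz x₀ b t x) + 2 * zz x₀ b t x * a' (zz x₀ b t x)) *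
        U x ^ 2 + 2 * (b - t) ^ c * a (zz x₀ b t x) * U x * rad x₀ G x) 0 := by
  refine HasInt.congr ((HasInt.sum Finset.univ fun i _ => (((hφ i).coef_x i).hasInt hK ht hU hU).add
    (((hφ i).coef.hasInt hK ht hU (hG i)).const_mul 2)).congr_val ?_) fun x => ?_
  · simp only [h]
    exact Finset.sum_eq_zero fun i _ => by ring
  · have e0 := sum_pWx (a := a) (a' := a') (c := c) (x₀ := x₀) hb x
    have e5 : ∑ i, 2 * (pW (fun x => x i - x₀ i) a x₀ b c t x * (U x * G i x)) =
        2 * (b - t) ^ c * a (zz x₀ b t x) * U x * rad x₀ G x := by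
      rw [rad, Finset.mul_sum]
      exact Finset.sum_congr rfl fun i _ => by simp only [pW]; ring
    rw [Finset.sum_add_distrib, e5, ← Finset.sum_mul, e0]
    ring

/-- The same for the divergence of a(z) F (x - x₀), with the chain rule in space as the hypothesis.
-/
theorem prim_space_closed (hb : t < b) {F : E N → ℝ} {S : E N → ℝ}
    (hF : ∀ i, Integrable (fun x => pWx (fun x => x i - x₀ i) (fun j => if j = i then 1 else 0)
      a a' x₀ b c i t x * F x))
    (hS : ∀ i, Integrable (fun x => pW (fun x => x i - x₀ i) a x₀ b c t x * (S x * G i x)))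
    (h : ∀ i, lin (pWx (fun x => x i - x₀ i) (fun j => if j = i then 1 else 0) a a' x₀ b c i t)
      F = - lin (pW (fun x => x i - x₀ i) a x₀ b c t) (fun x => S x * G i x)) :
    HasInt (fun x => (b - t) ^ c * (N * a (zz x₀ b t x) + 2 * zz x₀ b t x * a' (zz x₀ b t x)) *
        F x + (b - t) ^ c * a (zz x₀ b t x) * S x * rad x₀ G x) 0 := by
  refine HasInt.congr ((HasInt.sum Finset.univ fun i _ => (HasInt.self (hF i)).add
    (HasInt.self (hS i))).congr_val ?_) fun x => ?_
  · refine Finset.sum_eq_zero fun i _ => ?_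
    have := h i
    simp only [lin] at this
    rw [this]
    ring
  · have e0 := sum_pWx (a := a) (a' := a') (c := c) (x₀ := x₀) hb x
    have e5 : ∑ i, pW (fun x => x i - x₀ i) a x₀ b c t x * (S x * G i x) =
        (b - t) ^ c * a (zz x₀ b t x) * S x * rad x₀ G x := by
      rw [rad, Finset.mul_sum]
      exact Finset.sum_congr rfl fun i _ => by simp only [pW]; ring
    rw [Finset.sum_add_distrib, e5, ← Finset.sum_mul, e0]

end Closed

end

end HamzaZaag

/-! ### Evolution of the energy and of ∫ w ∂ₛw ρ. -/

namespace HamzaZaag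

noncomputable section

variable {N : ℕ} {t₁ t₂ : ℝ} {K O : Set (E N)}

/-- `F` increases by the integral of `f` between `t₁` and `t₂`. -/
structure Incr (t₁ t₂ : ℝ) (F f : ℝ → ℝ) : Prop where
  int : IntervalIntegrable f volume t₁ t₂
  eq : F t₂ - F t₁ = ∫ t in t₁..t₂, f t

namespace Incr

variable {F F' f f' : ℝ → ℝ}

theorem add (h : Incr t₁ t₂ F f) (h' : Incr t₁ t₂ F' f') :
    Incr t₁ t₂ (fun t => F t + F' t) (fun t => f t + f' t) :=
  ⟨h.int.add h'.int, by
    rw [intervalIntegral.integral_add h.int h'.int, ← h.eq, ← h'.eq]; ring⟩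

theorem sub (h : Incr t₁ t₂ F f) (h' : Incr t₁ t₂ F' f') :
    Incr t₁ t₂ (fun t => F t - F' t) (fun t => f t - f' t) :=
  ⟨h.int.sub h'.int, by
    rw [intervalIntegral.integral_sub h.int h'.int, ← h.eq, ← h'.eq]; ring⟩

theorem const_mul (h : Incr t₁ t₂ F f) (c : ℝ) :
    Incr t₁ t₂ (fun t => c * F t) (fun t => c * f t) :=
  ⟨h.int.const_mul c, by rw [intervalIntegral.integral_const_mul, ← h.eq]; ring⟩

theorem zero : Incr t₁ t₂ (fun _ => 0) (fun _ => 0) :=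
  ⟨intervalIntegrable_const, by simp⟩

theorem sum {ι : Type*} (s : Finset ι) {F f : ι → ℝ → ℝ} (h : ∀ i ∈ s, Incr t₁ t₂ (F i) (f i)) :
    Incr t₁ t₂ (fun t => ∑ i ∈ s, F i t) (fun t => ∑ i ∈ s, f i t) := by
  classical
  induction s using Finset.induction_on with
  | empty => simpa using zero
  | insert i s hi ih =>
    simp only [Finset.sum_insert hi]
    exact (h i (Finset.mem_insert_self i s)).add
      (ih fun j hj => h j (Finset.mem_insert_of_mem hj))

theorem congr (h : Incr t₁ t₂ F f) (h12 : t₁ ≤ t₂) (hF : ∀ t ∈ Icc t₁ t₂, F' t = F t)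
    (hf : ∀ᵐ t ∂(volume.restrict (Ioc t₁ t₂)), f' t = f t) : Incr t₁ t₂ F' f' := by
  have e : f =ᵐ[volume.restrict (uIoc t₁ t₂)] f' := by
    rw [uIoc_of_le h12]
    filter_upwards [hf] with t ht
    exact ht.symm
  refine ⟨h.int.congr_ae e, ?_⟩
  rw [hF _ (right_mem_Icc.2 h12), hF _ (left_mem_Icc.2 h12), h.eq]
  exact intervalIntegral.integral_congr_ae_restrict e

theorem trans {t₃ : ℝ} (h : Incr t₁ t₂ F f) (h' : Incr t₂ t₃ F f) : Incr t₁ t₃ F f :=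
  ⟨h.int.trans h'.int, by
    rw [← intervalIntegral.integral_add_adjacent_intervals h.int h'.int, ← h.eq, ← h'.eq]; ring⟩

end Incr

/-- `r^{1-c₀} ∂ₛ w` in the original variables. -/
def mv {N : ℕ} (c₀ : ℝ) (x₀ : E N) (b t : ℝ) (U V : E N → ℝ) (G : Fin N → E N → ℝ)
    (x : E N) : ℝ := -c₀ * U x + (b - t) * V x - rad x₀ G x

/-- The dissipation weight `α ω - z ω'`. -/
def dD (α : ℝ) (w w' : ℝ → ℝ) (z : ℝ) : ℝ := α * w z - z * w' z

/-- The error `-(ω' (1 - z) + α ω)` of a profile. -/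
def dErr (α : ℝ) (w w' : ℝ → ℝ) (z : ℝ) : ℝ := -(w' z * (1 - z) + α * w z)

/-- The derivative of `dD`. -/
def dD' (α : ℝ) (w' w'' : ℝ → ℝ) (z : ℝ) : ℝ := α * w' z - w' z - z * w'' z

/-- The density `r²|G|² - (X · G)²`. -/
def pot {N : ℕ} (x₀ : E N) (b t : ℝ) (G : Fin N → E N → ℝ) (x : E N) : ℝ :=
  (b - t) ^ 2 * gsq G x - rad x₀ G x ^ 2

/-- The energy density. -/
def engDens {N : ℕ} (c₀ : ℝ) (w : ℝ → ℝ) (s : ℝ → ℝ) (x₀ : E N) (b t : ℝ) (U V : E N → ℝ)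
    (G : Fin N → E N → ℝ) (x : E N) : ℝ :=
  1 / 2 * (mv c₀ x₀ b t U V G x ^ 2 + pot x₀ b t G x + c₀ * (c₀ + 1) * U x ^ 2) *
    w (zz x₀ b t x) - (b - t) ^ 2 * w (zz x₀ b t x) * prim s (U x)

/-- The density of the time derivative of the energy. -/
def engRate {N : ℕ} (c₀ α : ℝ) (w w' : ℝ → ℝ) (s g : ℝ → ℝ) (x₀ : E N) (b t : ℝ) (U V : E N → ℝ)
    (G : Fin N → E N → ℝ) (x : E N) : ℝ :=
  -2 * mv c₀ x₀ b t U V G x ^ 2 * dD α w w' (zz x₀ b t x) +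
    2 * mv c₀ x₀ b t U V G x * rad x₀ G x * dErr α w w' (zz x₀ b t x) +
    (b - t) ^ 2 * w (zz x₀ b t x) * mv c₀ x₀ b t U V G x * g (V x) +
    (b - t) ^ 2 * w (zz x₀ b t x) * ((2 * c₀ + 2) * prim s (U x) - c₀ * (s (U x) * U x))

/-- The density of the functional `∫ w ∂ₛw ρ`. -/
def momDens {N : ℕ} (c₀ : ℝ) (w : ℝ → ℝ) (x₀ : E N) (b t : ℝ) (U V : E N → ℝ)
    (G : Fin N → E N → ℝ) (x : E N) : ℝ :=
  U x * mv c₀ x₀ b t U V G x * w (zz x₀ b t x)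

/-- The density of the time derivative of the functional `∫ w ∂ₛw ρ`. -/
def momRate {N : ℕ} (c₀ α : ℝ) (w w' : ℝ → ℝ) (s g : ℝ → ℝ) (x₀ : E N) (b t : ℝ) (U V : E N → ℝ)
    (G : Fin N → E N → ℝ) (x : E N) : ℝ :=
  mv c₀ x₀ b t U V G x ^ 2 * w (zz x₀ b t x) - pot x₀ b t G x * w (zz x₀ b t x) -
    c₀ * (c₀ + 1) * U x ^ 2 * w (zz x₀ b t x) +
    2 * mv c₀ x₀ b t U V G x * rad x₀ G x * w (zz x₀ b t x) +
    U x * mv c₀ x₀ b t U V G x * ((2 * c₀ + 1) * w (zz x₀ b t x) - 4 * dD α w w' (zz x₀ b t x)) +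
    2 * dErr α w w' (zz x₀ b t x) * U x * rad x₀ G x +
    (b - t) ^ 2 * (s (U x) + g (V x)) * U x * w (zz x₀ b t x)

theorem rpow_step {b t : ℝ} (h : t < b) (c : ℝ) : (b - t) ^ c = (b - t) ^ (c - 1) * (b - t) := by
  rw [← Real.rpow_add_one (by linarith : b - t ≠ 0)]
  ring_nf

section Profile

variable {α ε : ℝ} {w w' w'' : ℝ → ℝ}

theorem IsProfile.cont_w' (h : IsProfile α ε w w' w'') : Continuous w' :=
  continuous_iff_continuousAt.2 fun z => (h.d2 z).continuousAt

theorem IsProfile.dD_deriv (h : IsProfile α ε w w' w'') (z : ℝ) :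
    HasDerivAt (dD α w w') (dD' α w' w'' z) z := by
  have := ((h.d1 z).const_mul α).sub ((hasDerivAt_id z).mul (h.d2 z))
  refine this.congr_deriv ?_
  simp only [dD', id]
  ring

theorem IsProfile.dD'_cont (h : IsProfile α ε w w' w'') : Continuous (dD' α w' w'') := by
  have := h.cont_w'
  have := h.cont
  unfold dD'
  fun_prop

theorem IsProfile.dD_s0 (h : IsProfile α ε w w' w'') (z : ℝ) (hz : 1 ≤ z) : dD α w w' z = 0 := by
  simp [dD, h.s0 z hz, h.s1 z hz]

theorem IsProfile.dD'_s0 (h : IsProfile α ε w w' w'') (z : ℝ) (hz : 1 ≤ z) :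
    dD' α w' w'' z = 0 := by
  simp [dD', h.s1 z hz, h.s2 z hz]

end Profile

namespace LWave

variable {u v h : ℝ → E N → ℝ} {G : Fin N → ℝ → E N → ℝ}
variable {α ε : ℝ} {w w' w'' : ℝ → ℝ} {b c₀ : ℝ} {x₀ : E N} {s g : ℝ → ℝ}

/-- The integral of the mixed term `u (X · G)` against a radial weight. -/
theorem radial_space (W : LWave t₁ t₂ O u v h G) (hO : IsOpen O)
    (hb : t₂ < b) (hKO : Metric.closedBall x₀ (b - t₁) ⊆ O) {a a' : ℝ → ℝ}
    (ha : ∀ z, HasDerivAt a (a' z) z) (hc : Continuous a')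
    (hs : ∀ z, 1 ≤ z → a z = 0) (hs' : ∀ z, 1 ≤ z → a' z = 0) (c : ℝ) {t : ℝ}
    (ht : t ∈ Icc t₁ t₂) :
    HasInt (fun x => (b - t) ^ c * (N * a (zz x₀ b t x) + 2 * zz x₀ b t x * a' (zz x₀ b t x)) *
      u t x ^ 2 + 2 * (b - t) ^ c * a (zz x₀ b t x) * u t x * rad x₀ (fun i => G i t) x) 0 := by
  have hwt := fun i => isWeight_coord (N := N) (t₁ := t₁) ha hc hs hs' hb x₀ c i
  exact space_closed hwt (ht.2.trans_lt hb) (isCompact_closedBall _ _) ht (W.fam_u.mem t ht)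
    (fun i => (W.fam_G i).mem t ht)
    fun i => W.space_identity (isCompact_closedBall _ _) hO hKO (hwt i) i ht

/-- The evolution of the energy in similarity variables. -/
theorem energy_evolution (W : LWave t₁ t₂ O u v h G) (hO : IsOpen O)
    (hb : t₂ < b) (hKO : Metric.closedBall x₀ (b - t₁) ⊆ O) (P : IsProfile α ε w w' w'')
    (hα : α = c₀ - ((N : ℝ) - 1) / 2) {p C : ℝ} (hp : 0 ≤ p) (hC : 0 ≤ C) (hs : Continuous s)
    (hg : ∀ y, |s y| ≤ C * (1 + |y| ^ p)) {β : ℝ → ℝ} (hβ : IntegrableOn β (Ioc t₁ t₂))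
    (hpow : IsFam t₁ t₂ (fun t x => |u t x| ^ p) β) {M : ℝ}
    (hM : ∀ t ∈ Icc t₁ t₂, IntegrableOn (fun x => |u t x| ^ (p + 1)) (Metric.closedBall x₀ (b - t₁))
      ∧ ∫ x in Metric.closedBall x₀ (b - t₁), |u t x| ^ (p + 1) ≤ M)
    (hh : ∀ t ∈ Icc t₁ t₂, ∀ x ∈ Metric.closedBall x₀ (b - t₁), h t x = s (u t x) + g (v t x)) :
    (∀ t ∈ Icc t₁ t₂, Integrable (engDens c₀ w s x₀ b t (u t) (v t) fun i => G i t)) ∧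
    (∀ᵐ t ∂(volume.restrict (Ioc t₁ t₂)),
      Integrable (engRate c₀ α w w' s g x₀ b t (u t) (v t) fun i => G i t)) ∧
    Incr t₁ t₂ (fun t => (b - t) ^ (2 * c₀ - N) *
        ∫ x, engDens c₀ w s x₀ b t (u t) (v t) (fun i => G i t) x)
      (fun t => (b - t) ^ (2 * c₀ - N - 1) *
        ∫ x, engRate c₀ α w w' s g x₀ b t (u t) (v t) (fun i => G i t) x) := by
  -- The exponent is that of the scaling: quadratic expressions in w carry (b - t)^{2c₀}, and dy is
  -- (b - t)^{-N} dx.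
  set th : ℝ := 2 * c₀ - N with hth
  have hK := isCompact_closedBall x₀ (b - t₁)
  have w2 := isWeight_radial (N := N) (t₁ := t₁) P.d1 P.cont_w' P.s0 P.s1 hb x₀ (th + 2)
  have w1 := isWeight_radial (N := N) (t₁ := t₁) P.d1 P.cont_w' P.s0 P.s1 hb x₀ (th + 1)
  have wi := fun i => isWeight_coord (N := N) (t₁ := t₁) P.d1 P.cont_w' P.s0 P.s1 hb x₀ (th + 1) i
  have wD := isWeight_radial (N := N) (t₁ := t₁) P.dD_deriv P.dD'_cont P.dD_s0 P.dD'_s0 hb x₀ th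
  have iE : Incr t₁ t₂ (fun t => bil (pW (fun _ => 1) w x₀ b (th + 2) t) (v t) (v t) +
      ∑ i, bil (pW (fun _ => 1) w x₀ b (th + 2) t) (G i t) (G i t)) _ :=
    ⟨(W.energy_identity hK hO hKO w2).1, (W.energy_identity hK hO hKO w2).2⟩
  have iM : ∀ i, Incr t₁ t₂
      (fun t => bil (pW (fun x => x i - x₀ i) w x₀ b (th + 1) t) (v t) (G i t)) _ := fun i =>
    ⟨(W.momentum_identity hK hO hKO (wi i) i).1, (W.momentum_identity hK hO hKO (wi i) i).2⟩
  have iX : Incr t₁ t₂ (fun t => bil (pW (fun _ => 1) w x₀ b (th + 1) t) (u t) (v t)) _ :=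
    ⟨(W.mixed_identity hK hO hKO w1).1, (W.mixed_identity hK hO hKO w1).2⟩
  have iS : Incr t₁ t₂ (fun t => bil (pW (fun _ => 1) (dD α w w') x₀ b th t) (u t) (u t)) _ :=
    ⟨(W.sq_identity hK hO hKO wD).1, (W.sq_identity hK hO hKO wD).2⟩
  have iP : Incr t₁ t₂ (fun t => lin (pW (fun _ => 1) w x₀ b (th + 2) t)
      (fun x => prim s (u t x))) _ :=
    ⟨(W.prim_identity hK hO hKO w2 hs hp hC hg hβ hpow hM).1,
      (W.prim_identity hK hO hKO w2 hs hp hC hg hβ hpow hM).2⟩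
  have step : ∀ t ∈ Icc t₁ t₂, (b - t) ^ (th + 2 - 1) = (b - t) ^ (th - 1) * (b - t) ^ 2 ∧
      (b - t) ^ (th + 2) = (b - t) ^ (th - 1) * (b - t) ^ 3 ∧
      (b - t) ^ (th + 1 - 1) = (b - t) ^ (th - 1) * (b - t) ∧
      (b - t) ^ (th + 1) = (b - t) ^ (th - 1) * (b - t) ^ 2 ∧
      (b - t) ^ th = (b - t) ^ (th - 1) * (b - t) := by
    intro t ht
    have h1 : t < b := ht.2.trans_lt hb
    have e1 := rpow_step h1 th
    have e2 := rpow_step h1 (th + 1)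
    have e3 := rpow_step h1 (th + 2)
    rw [show th + 1 - 1 = th by ring] at e2 ⊢
    rw [show th + 2 - 1 = th + 1 by ring] at e3 ⊢
    refine ⟨?_, ?_, e1, ?_, e1⟩
    · rw [e2, e1]; ring
    · rw [e3, e2, e1]; ring
    · rw [e2, e1]; ring
  have pos : ∀ t ∈ Icc t₁ t₂, 0 < b - t := fun t ht => by linarith [ht.2]
  -- the energy at a fixed time
  have hEng : ∀ t ∈ Icc t₁ t₂, HasInt (fun x => (b - t) ^ th *
      engDens c₀ w s x₀ b t (u t) (v t) (fun i => G i t) x)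
      (1 / 2 * (bil (pW (fun _ => 1) w x₀ b (th + 2) t) (v t) (v t) +
          ∑ i, bil (pW (fun _ => 1) w x₀ b (th + 2) t) (G i t) (G i t)) -
        (∑ i, bil (pW (fun x => x i - x₀ i) w x₀ b (th + 1) t) (v t) (G i t)) -
        c₀ * bil (pW (fun _ => 1) w x₀ b (th + 1) t) (u t) (v t) +
        c₀ * bil (pW (fun _ => 1) (dD α w w') x₀ b th t) (u t) (u t) -
        lin (pW (fun _ => 1) w x₀ b (th + 2) t) (fun x => prim s (u t x))) := by
    intro t ht
    obtain ⟨-, e2, -, e4, e5⟩ := step t ht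
    have mu := W.fam_u.mem t ht
    have mv' := W.fam_v.mem t ht
    have mG := fun i => (W.fam_G i).mem t ht
    obtain ⟨D, hD0, hD⟩ := w2.coef.bdd hK
    have hPint : HasInt (fun x => pW (fun _ => 1) w x₀ b (th + 2) t x * prim s (u t x))
        (lin (pW (fun _ => 1) w x₀ b (th + 2) t) (fun x => prim s (u t x))) :=
      HasInt.self (lin_prim_growth hp hC hs hg hK (w2.coef.cont_x ht).aestronglyMeasurable
        (hD t ht) (w2.coef.supp t ht) mu.1 (hM t ht).1 le_rfl).1
    -- Expanding the square of `mv` leaves c₀ u (x - x₀)·∇u. Removing it by the null identity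
    -- changes the coefficient of u² to c₀(αω - zω'), precisely because α = c₀ - (N-1)/2.
    have sp := (W.radial_space hO hb hKO P.d1 P.cont_w' P.s0 P.s1 th ht).const_mul (c₀ / 2)
    have := (((((((w2.coef.hasInt hK ht mv' mv').add (HasInt.sum Finset.univ fun i _ =>
      w2.coef.hasInt hK ht (mG i) (mG i))).const_mul (1 / 2)).sub (HasInt.sum Finset.univ fun i _ =>
      (wi i).coef.hasInt hK ht mv' (mG i))).sub ((w1.coef.hasInt hK ht mu mv').const_mul c₀)).add
      ((wD.coef.hasInt hK ht mu mu).const_mul c₀)).sub hPint).add sp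
    refine (this.congr fun x => ?_).congr_val (by ring)
    have s1 : ∑ i, pW (fun _ => 1) w x₀ b (th + 2) t x * (G i t x * G i t x) =
        pW (fun _ => 1) w x₀ b (th + 2) t x * gsq (fun i => G i t) x := by
      rw [gsq, Finset.mul_sum]
      exact Finset.sum_congr rfl fun i _ => by ring
    have s2 : ∑ i, pW (fun x => x i - x₀ i) w x₀ b (th + 1) t x * (v t x * G i t x) =
        (b - t) ^ (th + 1) * w (zz x₀ b t x) * v t x * rad x₀ (fun i => G i t) x := by
      rw [rad, Finset.mul_sum]
      exact Finset.sum_congr rfl fun i _ => by simp only [pW]; ring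
    rw [s1, s2]
    simp only [pW, engDens, mv, pot, dD, e2, e4, e5, hα]
    ring
  have hRate : ∀ᵐ t ∂(volume.restrict (Ioc t₁ t₂)), HasInt (fun x => (b - t) ^ (th - 1) *
      engRate c₀ α w w' s g x₀ b t (u t) (v t) (fun i => G i t) x)
      (1 / 2 * (bil (pWt (fun _ => 1) w w' x₀ b (th + 2) t) (v t) (v t) +
        (∑ i, bil (pWt (fun _ => 1) w w' x₀ b (th + 2) t) (G i t) (G i t)) -
        2 * (∑ i, bil (pWx (fun _ => 1) (fun _ => 0) w w' x₀ b (th + 2) i t) (v t) (G i t)) +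
        2 * bil (pW (fun _ => 1) w x₀ b (th + 2) t) (h t) (v t)) -
       (∑ i, (bil (pWt (fun x => x i - x₀ i) w w' x₀ b (th + 1) t) (v t) (G i t) -
        1 / 2 * bil (pWx (fun x => x i - x₀ i) (fun j => if j = i then 1 else 0) w w' x₀ b (th + 1)
          i t) (v t) (v t) +
        1 / 2 * (∑ j, bil (pWx (fun x => x i - x₀ i) (fun j => if j = i then 1 else 0) w w' x₀ b
          (th + 1) i t) (G j t) (G j t)) -
        (∑ j, bil (pWx (fun x => x i - x₀ i) (fun j => if j = i then 1 else 0) w w' x₀ b (th + 1)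
          j t) (G i t) (G j t)) +
        bil (pW (fun x => x i - x₀ i) w x₀ b (th + 1) t) (h t) (G i t))) -
       c₀ * (bil (pWt (fun _ => 1) w w' x₀ b (th + 1) t) (u t) (v t) +
        bil (pW (fun _ => 1) w x₀ b (th + 1) t) (v t) (v t) -
        (∑ i, bil (pWx (fun _ => 1) (fun _ => 0) w w' x₀ b (th + 1) i t) (u t) (G i t)) -
        (∑ i, bil (pW (fun _ => 1) w x₀ b (th + 1) t) (G i t) (G i t)) +
        bil (pW (fun _ => 1) w x₀ b (th + 1) t) (h t) (u t)) +
       c₀ * (bil (pWt (fun _ => 1) (dD α w w') (dD' α w' w'') x₀ b th t) (u t) (u t) +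
        2 * bil (pW (fun _ => 1) (dD α w w') x₀ b th t) (u t) (v t)) -
       (lin (pWt (fun _ => 1) w w' x₀ b (th + 2) t) (fun x => prim s (u t x)) +
        lin (pW (fun _ => 1) w x₀ b (th + 2) t) (fun x => s (u t x) * v t x))) := by
    filter_upwards [W.h_mem, hpow.bd, ae_Ioc fun t ht => ht] with t mh hpt ht
    obtain ⟨e1, e2, e3, e4, e5⟩ := step t ht
    have hr := pos t ht
    have htb : t < b := by linarith
    have mu := W.fam_u.mem t ht
    have mv' := W.fam_v.mem t ht
    have mG := fun i => (W.fam_G i).mem t ht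
    have lp : ∀ {c : ℝ → E N → ℝ}, IsCoef t₁ t₂ (Metric.closedBall x₀ (b - t₁)) c →
        Integrable (fun x => c t x * prim s (u t x)) := by
      intro c hc
      obtain ⟨D, hD0, hD⟩ := hc.bdd hK
      exact (lin_prim_growth hp hC hs hg hK (IsCoef.cont_x hc ht).aestronglyMeasurable
        (hD t ht) (hc.supp t ht) mu.1 (hM t ht).1 le_rfl).1
    have ls : ∀ {c : ℝ → E N → ℝ}, IsCoef t₁ t₂ (Metric.closedBall x₀ (b - t₁)) c → ∀ {f : E N → ℝ},
        MemLp f 2 volume → Integrable (fun x => c t x * (s (u t x) * f x)) := fun {c} hc {f} hf =>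
      lin_growth_integrable (C := C) hK (hc.cont_x ht) (hc.supp t ht)
        (hs.comp_aestronglyMeasurable mu.1) (fun x => hg (u t x)) hpt.1 hf
    have c1 := energy_closed w2 hK ht mv' mG mh
    have c2 := momentum_closed wi htb hK ht mv' mG mh
    have c3 := mixed_closed w1 hK ht mu mv' mG mh
    have c4 := sq_closed wD hK ht mu mv'
    have c5 := (HasInt.self (lp w2.coef_t)).add (HasInt.self (ls w2.coef mv'))
    -- Two null identities are added to the combination of derivatives: this one turns s(u)(x -
    -- x₀)·∇u into the primitive of s, and the next one treats u (x - x₀)·∇u with the weight αω -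
    -- zω'. What remains is a polynomial identity, except outside of the cone, where all weights
    -- vanish.
    have c6 := prim_space_closed (G := fun i => G i t) htb (fun i => lp ((wi i).coef_x i))
      (fun i => ls (wi i).coef (mG i))
      (fun i => W.prim_space hK hO hKO (wi i) hs hp hC hg i ht hpt.1 (hM t ht).1)
    have c7 := (W.radial_space hO hb hKO P.dD_deriv P.dD'_cont P.dD_s0 P.dD'_s0 (th - 1)
      ht).const_mul (-c₀)
    have := (((((c1.const_mul (1 / 2)).sub c2).sub (c3.const_mul c₀)).add (c4.const_mul c₀)).sub
      c5).add (c6.add c7)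
    refine (this.congr fun x => ?_).congr_val (by simp only [lin]; ring)
    have hr' := hr.ne'
    by_cases hx : x ∈ Metric.closedBall x₀ (b - t₁)
    · simp only [hh t ht x hx, pW, pWt, engRate, mv, dD, dD', dErr, e1, e2, e3, e4, e5, hα]
      generalize (b - t) ^ (th - 1) = ρ
      generalize b - t = r at hr'
      rw [hth]
      field_simp
      ring
    · have hz := one_le_zz ht.1 htb hx
      simp only [P.s0 _ hz, P.s1 _ hz, P.s2 _ hz, pW, pWt, engRate, dD, dD', dErr]
      ring
  refine ⟨fun t ht => ((hEng t ht).mul_cancel (Real.rpow_pos_of_pos (pos t ht) _).ne').1, ?_,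
    (((((iE.const_mul (1 / 2)).sub (Incr.sum Finset.univ fun i _ => iM i)).sub
      (iX.const_mul c₀)).add (iS.const_mul c₀)).sub iP).congr W.le (fun t ht => ?_) ?_⟩
  · filter_upwards [hRate, ae_Ioc pos] with t h1 h2
    exact (h1.mul_cancel (Real.rpow_pos_of_pos h2 _).ne').1
  · exact ((hEng t ht).mul_cancel (Real.rpow_pos_of_pos (pos t ht) _).ne').2
  · filter_upwards [hRate, ae_Ioc pos] with t h1 h2
    exact (h1.mul_cancel (Real.rpow_pos_of_pos h2 _).ne').2

/-- The evolution of the functional `∫ w ∂ₛw ρ` in similarity variables. -/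
theorem momentum_evolution (W : LWave t₁ t₂ O u v h G) (hO : IsOpen O)
    (hb : t₂ < b) (hKO : Metric.closedBall x₀ (b - t₁) ⊆ O) (P : IsProfile α ε w w' w'')
    (hα : α = c₀ - ((N : ℝ) - 1) / 2)
    (hh : ∀ t ∈ Icc t₁ t₂, ∀ x ∈ Metric.closedBall x₀ (b - t₁), h t x = s (u t x) + g (v t x)) :
    (∀ t ∈ Icc t₁ t₂, Integrable (momDens c₀ w x₀ b t (u t) (v t) fun i => G i t)) ∧
    (∀ᵐ t ∂(volume.restrict (Ioc t₁ t₂)),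
      Integrable (momRate c₀ α w w' s g x₀ b t (u t) (v t) fun i => G i t)) ∧
    Incr t₁ t₂ (fun t => (b - t) ^ (2 * c₀ - N) *
        ∫ x, momDens c₀ w x₀ b t (u t) (v t) (fun i => G i t) x)
      (fun t => (b - t) ^ (2 * c₀ - N - 1) *
        ∫ x, momRate c₀ α w w' s g x₀ b t (u t) (v t) (fun i => G i t) x) := by
  set th : ℝ := 2 * c₀ - N with hth
  have hK := isCompact_closedBall x₀ (b - t₁)
  have w1 := isWeight_radial (N := N) (t₁ := t₁) P.d1 P.cont_w' P.s0 P.s1 hb x₀ (th + 1)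
  have w0 := isWeight_radial (N := N) (t₁ := t₁) P.d1 P.cont_w' P.s0 P.s1 hb x₀ th
  have wD := isWeight_radial (N := N) (t₁ := t₁) P.dD_deriv P.dD'_cont P.dD_s0 P.dD'_s0 hb x₀ th
  have iX : Incr t₁ t₂ (fun t => bil (pW (fun _ => 1) w x₀ b (th + 1) t) (u t) (v t)) _ :=
    ⟨(W.mixed_identity hK hO hKO w1).1, (W.mixed_identity hK hO hKO w1).2⟩
  have i0 : Incr t₁ t₂ (fun t => bil (pW (fun _ => 1) w x₀ b th t) (u t) (u t)) _ :=
    ⟨(W.sq_identity hK hO hKO w0).1, (W.sq_identity hK hO hKO w0).2⟩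
  have iS : Incr t₁ t₂ (fun t => bil (pW (fun _ => 1) (dD α w w') x₀ b th t) (u t) (u t)) _ :=
    ⟨(W.sq_identity hK hO hKO wD).1, (W.sq_identity hK hO hKO wD).2⟩
  have step : ∀ t ∈ Icc t₁ t₂, (b - t) ^ (th + 1 - 1) = (b - t) ^ (th - 1) * (b - t) ∧
      (b - t) ^ (th + 1) = (b - t) ^ (th - 1) * (b - t) ^ 2 ∧
      (b - t) ^ th = (b - t) ^ (th - 1) * (b - t) := by
    intro t ht
    have h1 : t < b := ht.2.trans_lt hb
    have e1 := rpow_step h1 th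
    have e2 := rpow_step h1 (th + 1)
    rw [show th + 1 - 1 = th by ring] at e2 ⊢
    refine ⟨e1, ?_, e1⟩
    rw [e2, e1]; ring
  have pos : ∀ t ∈ Icc t₁ t₂, 0 < b - t := fun t ht => by linarith [ht.2]
  have hMom : ∀ t ∈ Icc t₁ t₂, HasInt (fun x => (b - t) ^ th *
      momDens c₀ w x₀ b t (u t) (v t) (fun i => G i t) x)
      (bil (pW (fun _ => 1) w x₀ b (th + 1) t) (u t) (v t) +
        1 / 2 * bil (pW (fun _ => 1) w x₀ b th t) (u t) (u t) -
        bil (pW (fun _ => 1) (dD α w w') x₀ b th t) (u t) (u t)) := by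
    intro t ht
    obtain ⟨-, e4, e5⟩ := step t ht
    have mu := W.fam_u.mem t ht
    have mv' := W.fam_v.mem t ht
    -- The same trade: -u (x - x₀)·∇u ω becomes a multiple of u², and the total coefficient of u² is
    -- ω/2 - (αω - zω').
    have sp := (W.radial_space hO hb hKO P.d1 P.cont_w' P.s0 P.s1 th ht).const_mul (-1 / 2)
    have := (((w1.coef.hasInt hK ht mu mv').add ((w0.coef.hasInt hK ht mu mu).const_mul
      (1 / 2))).sub (wD.coef.hasInt hK ht mu mu)).add sp
    refine (this.congr fun x => ?_).congr_val (by ring)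
    simp only [pW, momDens, mv, dD, e4, e5, hα]
    ring
  have hRate : ∀ᵐ t ∂(volume.restrict (Ioc t₁ t₂)), HasInt (fun x => (b - t) ^ (th - 1) *
      momRate c₀ α w w' s g x₀ b t (u t) (v t) (fun i => G i t) x)
      ((bil (pWt (fun _ => 1) w w' x₀ b (th + 1) t) (u t) (v t) +
        bil (pW (fun _ => 1) w x₀ b (th + 1) t) (v t) (v t) -
        (∑ i, bil (pWx (fun _ => 1) (fun _ => 0) w w' x₀ b (th + 1) i t) (u t) (G i t)) -
        (∑ i, bil (pW (fun _ => 1) w x₀ b (th + 1) t) (G i t) (G i t)) +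
        bil (pW (fun _ => 1) w x₀ b (th + 1) t) (h t) (u t)) +
       1 / 2 * (bil (pWt (fun _ => 1) w w' x₀ b th t) (u t) (u t) +
        2 * bil (pW (fun _ => 1) w x₀ b th t) (u t) (v t)) -
       (bil (pWt (fun _ => 1) (dD α w w') (dD' α w' w'') x₀ b th t) (u t) (u t) +
        2 * bil (pW (fun _ => 1) (dD α w w') x₀ b th t) (u t) (v t))) := by
    filter_upwards [W.h_mem, ae_Ioc fun t ht => ht] with t mh ht
    obtain ⟨e3, e4, e5⟩ := step t ht
    have hr := pos t ht
    have htb : t < b := by linarith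
    have mu := W.fam_u.mem t ht
    have mv' := W.fam_v.mem t ht
    have mG := fun i => (W.fam_G i).mem t ht
    have c3 := mixed_closed w1 hK ht mu mv' mG mh
    have c0 := sq_closed w0 hK ht mu mv'
    have c4 := sq_closed wD hK ht mu mv'
    have c6 := (W.radial_space hO hb hKO P.d1 P.cont_w' P.s0 P.s1 (th - 1) ht).const_mul
      (-1 / 2 - c₀)
    have c7 := (W.radial_space hO hb hKO P.dD_deriv P.dD'_cont P.dD_s0 P.dD'_s0 (th - 1)
      ht).const_mul 1
    have := ((c3.add (c0.const_mul (1 / 2))).sub c4).add (c6.add c7)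
    refine (this.congr fun x => ?_).congr_val (by ring)
    have hr' := hr.ne'
    by_cases hx : x ∈ Metric.closedBall x₀ (b - t₁)
    · simp only [hh t ht x hx, momRate, pot, mv, dD, dD', dErr, e3, e4, e5, hα]
      generalize (b - t) ^ (th - 1) = ρ
      generalize b - t = r at hr'
      rw [hth]
      field_simp
      ring
    · have hz := one_le_zz ht.1 htb hx
      simp only [P.s0 _ hz, P.s1 _ hz, P.s2 _ hz, momRate, dD, dD', dErr]
      ring
  refine ⟨fun t ht => ((hMom t ht).mul_cancel (Real.rpow_pos_of_pos (pos t ht) _).ne').1, ?_,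
    ((iX.add (i0.const_mul (1 / 2))).sub iS).congr W.le (fun t ht => ?_) ?_⟩
  · filter_upwards [hRate, ae_Ioc pos] with t h1 h2
    exact (h1.mul_cancel (Real.rpow_pos_of_pos h2 _).ne').1
  · exact ((hMom t ht).mul_cancel (Real.rpow_pos_of_pos (pos t ht) _).ne').2
  · filter_upwards [hRate, ae_Ioc pos] with t h1 h2
    exact (h1.mul_cancel (Real.rpow_pos_of_pos h2 _).ne').2

end LWave

end

end HamzaZaag

/-! ### Pointwise inequalities for the rates. -/

namespace HamzaZaag

noncomputable section

/-- The nonlinearity `|u|^{p-1} u + f(u)`. -/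
def nl (p : ℝ) (f : ℝ → ℝ) (y : ℝ) : ℝ := pw p y + f y

theorem nl_cont {p : ℝ} (hp : 1 < p) {f : ℝ → ℝ} (hf : Continuous f) : Continuous (nl p f) :=
  (pw_cont hp).add hf

theorem nl_growth {p q M : ℝ} (hp : 1 < p) (hq : 0 ≤ q) (hqp : q < p) (hM : 0 < M) {f : ℝ → ℝ}
    (hfM : ∀ x, |f x| ≤ M * (1 + |x| ^ q)) (y : ℝ) :
    |nl p f y| ≤ (1 + 2 * M) * (1 + |y| ^ p) := by
  have h1 : |y| ^ q ≤ 1 + |y| ^ p := by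
    rcases le_total |y| 1 with h | h
    · have := Real.rpow_le_one (abs_nonneg y) h hq
      have := Real.rpow_nonneg (abs_nonneg y) p
      linarith
    · have := Real.rpow_le_rpow_of_exponent_le h hqp.le
      linarith
  have h2 := abs_add_le (pw p y) (f y)
  rw [pw_abs hp] at h2
  have h3 := hfM y
  have h4 := Real.rpow_nonneg (abs_nonneg y) p
  unfold nl
  nlinarith

theorem prim_add {f g : ℝ → ℝ} (hf : Continuous f) (hg : Continuous g) (y : ℝ) :
    prim (fun z => f z + g z) y = prim f y + prim g y :=
  intervalIntegral.integral_add (hf.intervalIntegrable _ _) (hg.intervalIntegrable _ _)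

theorem prim_nl {p : ℝ} (hp : 1 < p) {f : ℝ → ℝ} (hf : Continuous f) (y : ℝ) :
    prim (nl p f) y = |y| ^ (p + 1) / (p + 1) + prim f y := by
  rw [← prim_pw hp, ← prim_add (pw_cont hp) hf]
  rfl

theorem nl_mul_self {p : ℝ} (hp : 1 < p) (f : ℝ → ℝ) (y : ℝ) :
    nl p f y * y = |y| ^ (p + 1) + f y * y := by
  have : pw p y * y = |y| ^ (p + 1) := by
    rw [pw, mul_assoc, ← sq, ← sq_abs, ← Real.rpow_natCast, ← Real.rpow_add' (abs_nonneg y)]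
    · norm_num
      ring_nf
    · norm_num
      linarith
  rw [nl, add_mul, this]

theorem prim_mul_bounds {q M : ℝ} (hq : 0 ≤ q) (hM : 0 < M) {f : ℝ → ℝ}
    (hfM : ∀ x, |f x| ≤ M * (1 + |x| ^ q)) (y : ℝ) :
    |prim f y| ≤ M * (|y| + |y| ^ (q + 1)) ∧ |f y * y| ≤ M * (|y| + |y| ^ (q + 1)) := by
  refine ⟨prim_growth hq hM.le hfM y, ?_⟩
  rw [abs_mul]
  have h1 : |y| ^ (q + 1) = |y| ^ q * |y| := by
    rw [Real.rpow_add_of_nonneg (abs_nonneg y) hq zero_le_one, Real.rpow_one]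
  rw [h1]
  nlinarith [hfM y, abs_nonneg y]

theorem rpow_le_one_add {a b x : ℝ} (ha : 0 ≤ a) (hab : a ≤ b) (hx : 0 ≤ x) :
    x ^ a ≤ 1 + x ^ b := by
  rcases le_total x 1 with h | h
  · have := Real.rpow_le_one hx h ha
    have := Real.rpow_nonneg hx b
    linarith
  · have := Real.rpow_le_rpow_of_exponent_le h hab
    linarith

/-- The lower order terms are small in similarity variables. -/
theorem lower_order {p q c₀ γ r U : ℝ} (hp : 1 < p) (hq : 0 ≤ q) (hqp : q < p)
    (hc : c₀ * (p - 1) = 2) (hγ : γ ≤ 1) (hγ' : γ ≤ c₀ * (p - q)) (hr : 0 < r) (hr1 : r ≤ 1) :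
    (r ^ c₀) ^ 2 * r ^ 2 * (|U| + |U| ^ (q + 1)) ≤ 2 * r ^ γ * (1 + |r ^ c₀ * U| ^ (p + 1)) := by
  have hc0 : 0 < c₀ := by
    by_contra! h
    nlinarith
  have hR : 0 < r ^ c₀ := Real.rpow_pos_of_pos hr _
  have h1 : (r ^ c₀) ^ 2 * r ^ 2 * |U| ≤ r ^ γ * |r ^ c₀ * U| := by
    rw [abs_mul, abs_of_pos hR]
    have h2 : r ^ c₀ * r ^ 2 ≤ r ^ γ := by
      rw [← Real.rpow_natCast, ← Real.rpow_add hr]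
      exact Real.rpow_le_rpow_of_exponent_ge hr hr1 (by push_cast; linarith)
    have := mul_le_mul_of_nonneg_right h2 (by positivity : 0 ≤ r ^ c₀ * |U|)
    linarith
  have h2 : (r ^ c₀) ^ 2 * r ^ 2 * |U| ^ (q + 1) ≤ r ^ γ * |r ^ c₀ * U| ^ (q + 1) := by
    rw [abs_mul, abs_of_pos hR, Real.mul_rpow hR.le (abs_nonneg _), ← Real.rpow_mul hr.le]
    -- By c₀(p-1) = 2 the exponent 2c₀ + 2 is c₀(p+1); the part c₀(q+1) rescales |u|^{q+1}, and
    -- c₀(p-q) is gained.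
    have e : (r ^ c₀) ^ 2 * r ^ 2 = r ^ (c₀ * (p - q)) * r ^ (c₀ * (q + 1)) := by
      rw [← Real.rpow_natCast, ← Real.rpow_natCast r, ← Real.rpow_mul hr.le, ← Real.rpow_add hr,
        ← Real.rpow_add hr]
      congr 1
      push_cast
      linarith
    rw [e]
    have h3 : r ^ (c₀ * (p - q)) ≤ r ^ γ := Real.rpow_le_rpow_of_exponent_ge hr hr1 hγ'
    have := mul_le_mul_of_nonneg_right h3
      (by positivity : 0 ≤ r ^ (c₀ * (q + 1)) * |U| ^ (q + 1))
    linarith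
  have hW := abs_nonneg (r ^ c₀ * U)
  have h3 := rpow_le_one_add (b := p + 1) zero_le_one (by linarith) hW
  rw [Real.rpow_one] at h3
  have h4 := rpow_le_one_add (a := q + 1) (b := p + 1) (by linarith) (by linarith) hW
  have h5 := Real.rpow_nonneg hr.le γ
  nlinarith

/-- `pt` controls Y² only with the degenerate factor 1 - z, while `D` exceeds αw by the factor
1/(1-z). In Young's inequality with the parameter (1-z)θ these two factors compensate. -/
theorem cross_le {α z w D pt X Y θ : ℝ} (hα : 0 < α) (hθ : 0 < θ) (hz : z < 1) (hw : 0 ≤ w)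
    (hD : α * w ≤ (1 - z) * D) (hY : (1 - z) * Y ^ 2 ≤ pt) :
    2 * |X| * |Y| * w ≤ X ^ 2 * D / (α * θ) + θ * (pt * w) := by
  have hk : 0 < 1 - z := by linarith
  have h1 : 2 * |X| * |Y| ≤ X ^ 2 / ((1 - z) * θ) + (1 - z) * θ * Y ^ 2 := by
    have h2 : 0 ≤ (|X| - (1 - z) * θ * |Y|) ^ 2 / ((1 - z) * θ) := by positivity
    have h3 : (|X| - (1 - z) * θ * |Y|) ^ 2 / ((1 - z) * θ) =
        X ^ 2 / ((1 - z) * θ) + (1 - z) * θ * Y ^ 2 - 2 * |X| * |Y| := by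
      rw [← sq_abs X, ← sq_abs Y]
      field_simp
      ring
    linarith
  have h4 : X ^ 2 / ((1 - z) * θ) * w ≤ X ^ 2 * D / (α * θ) := by
    rw [div_mul_eq_mul_div, div_le_div_iff₀ (by positivity) (by positivity)]
    have := mul_le_mul_of_nonneg_left hD (by positivity : 0 ≤ X ^ 2 * θ)
    linarith
  have h5 : (1 - z) * θ * Y ^ 2 * w ≤ θ * (pt * w) := by
    have := mul_le_mul_of_nonneg_right hY (by positivity : 0 ≤ θ * w)
    linarith
  have := mul_le_mul_of_nonneg_right h1 hw
  linarith

/-- Multiplying the Cauchy–Schwarz bound by 2 - z and using z(2-z) = 1 - (1-z)² ≤ 1 shows that |∇w|²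
- (y·∇w)² controls (1-|y|²)(y·∇w)². -/
theorem pot_lower {z r gs A : ℝ} (hA : A ^ 2 ≤ z * r ^ 2 * gs) (hg : 0 ≤ gs) :
    (1 - z) * A ^ 2 ≤ r ^ 2 * gs - A ^ 2 ∨ 1 < z := by
  by_cases hz : z ≤ 1
  · left
    have h1 : 0 ≤ r ^ 2 * gs := by positivity
    have h2 : (2 - z) * A ^ 2 ≤ (2 - z) * (z * r ^ 2 * gs) :=
      mul_le_mul_of_nonneg_left hA (by linarith)
    nlinarith [mul_nonneg (sq_nonneg (1 - z)) h1]
  · right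
    linarith

/-- The relation between the damping and the derivative in time. -/
theorem damping_le {M c₀ r R m U V A g : ℝ} (hM : 0 < M) (hc : 0 < c₀) (hr : 0 < r) (hR : 0 < R)
    (hRr : R * r ≤ 1) (hm : m = -c₀ * U + r * V - A) (hg : |g| ≤ M * (1 + |V|)) :
    R * (r * |g|) ≤ M * (1 + |R * m| + c₀ * |R * U| + |R * A|) := by
  have h1 : r * V = m + c₀ * U + A := by rw [hm]; ring
  have h2 : r * |V| ≤ |m| + c₀ * |U| + |A| := by
    have h0 : r * |V| = |r * V| := by rw [abs_mul, abs_of_pos hr]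
    rw [h0, h1]
    have h3 := abs_add_le (m + c₀ * U) A
    have h4 := abs_add_le m (c₀ * U)
    rw [abs_mul, abs_of_pos hc] at h4
    linarith
  rw [abs_mul, abs_mul, abs_mul, abs_of_pos hR]
  calc R * (r * |g|) ≤ R * (r * (M * (1 + |V|))) := by gcongr
    _ = M * (R * r + R * (r * |V|)) := by ring
    _ ≤ M * (1 + R * (|m| + c₀ * |U| + |A|)) := by gcongr
    _ = _ := by ring

/-- Only |S||Y|w is beyond the plain Young inequality: Y is the radial derivative, and this product
is supplied by `hcr`. -/
theorem damping_cross {α c S W Y P w D pt : ℝ} (hW : W ^ 2 ≤ 1 + P) (hw : 0 ≤ w)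
    (hP : 0 ≤ P) (hpt : 0 ≤ pt) (hSw : S ^ 2 * w ≤ S ^ 2 * D / α)
    (hcr : 2 * |S| * |Y| * w ≤ S ^ 2 * D / α + pt * w) :
    w * |S| * (1 + |S| + c * |W| + |Y|) ≤
      (1 + c ^ 2) * ((1 + P) * w) + 3 / α * (S ^ 2 * D) + pt * w := by
  have t1 : |S| ≤ 1 / 2 * S ^ 2 + 1 / 2 := by nlinarith [sq_nonneg (|S| - 1), sq_abs S]
  have t2 : |S| * (c * |W|) ≤ 1 / 2 * S ^ 2 + 1 / 2 * (c ^ 2 * W ^ 2) := by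
    nlinarith [sq_nonneg (|S| - c * |W|), sq_abs S, sq_abs W]
  have t3 : w * |S| * (1 + |S| + c * |W| + |Y|) =
      w * (|S| + |S| ^ 2 + |S| * (c * |W|)) + |S| * |Y| * w := by ring
  have t4 : w * (|S| + |S| ^ 2 + |S| * (c * |W|)) ≤
      w * (1 / 2 * S ^ 2 + 1 / 2 + S ^ 2 + (1 / 2 * S ^ 2 + 1 / 2 * (c ^ 2 * (1 + P)))) := by
    rw [sq_abs]
    gcongr
    refine t2.trans ?_
    gcongr
  have t5 : 0 ≤ c ^ 2 * ((1 + P) * w) := by positivity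
  have t6 : 0 ≤ P * w := by positivity
  have t7 : 0 ≤ pt * w := by positivity
  have e3 : 3 / α * (S ^ 2 * D) = 3 * (S ^ 2 * D / α) := by ring
  rw [t3, e3]
  have e4 : w * (1 / 2 * S ^ 2 + 1 / 2 + S ^ 2 + (1 / 2 * S ^ 2 + 1 / 2 * (c ^ 2 * (1 + P)))) =
      2 * (S ^ 2 * w) + 1 / 2 * w + 1 / 2 * (c ^ 2 * ((1 + P) * w)) := by ring
  have e5 : (1 + c ^ 2) * ((1 + P) * w) = w + P * w + c ^ 2 * ((1 + P) * w) := by ring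
  rw [e4] at t4
  rw [e5]
  have t8 : 0 ≤ S ^ 2 * w := by positivity
  linarith

theorem sq_le_one_add_rpow {p x : ℝ} (hp : 1 < p) : x ^ 2 ≤ 1 + |x| ^ (p + 1) := by
  have := rpow_le_one_add (a := 2) (b := p + 1) (by norm_num) (by linarith) (abs_nonneg x)
  rw [← sq_abs]
  exact_mod_cast this

theorem le_rpow_of_le_one {r γ : ℝ} (hγ : γ ≤ 1) (hr : 0 < r) (hr1 : r ≤ 1) : r ≤ r ^ γ := by
  have := Real.rpow_le_rpow_of_exponent_ge hr hr1 hγ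
  rwa [Real.rpow_one] at this

/-- The contribution of the nonlinearity to the rate of the energy. -/
theorem nonlinear_rate_le {p q M c₀ γ : ℝ} (hp : 1 < p) (hq : 0 ≤ q) (hqp : q < p) (hM : 0 < M)
    (hc : c₀ * (p - 1) = 2) (hc0 : 0 < c₀) (hγ : γ ≤ 1) (hγ' : γ ≤ c₀ * (p - q)) {f : ℝ → ℝ}
    (hf : Continuous f) (hfM : ∀ x, |f x| ≤ M * (1 + |x| ^ q)) {r U w : ℝ} (hr : 0 < r)
    (hr1 : r ≤ 1) (hw : 0 ≤ w) :
    (r ^ c₀) ^ 2 * (r ^ 2 * w * ((2 * c₀ + 2) * prim (nl p f) U - c₀ * (nl p f U * U))) ≤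
      2 * M * (3 * c₀ + 2) * r ^ γ * ((1 + |r ^ c₀ * U| ^ (p + 1)) * w) := by
  have hlo := lower_order (U := U) hp hq hqp hc hγ hγ' hr hr1
  obtain ⟨b1, b2⟩ := prim_mul_bounds hq hM hfM U
  have n1 : (2 * c₀ + 2) * prim (nl p f) U - c₀ * (nl p f U * U) ≤
      M * (3 * c₀ + 2) * (|U| + |U| ^ (q + 1)) := by
    rw [prim_nl hp hf, nl_mul_self hp]
    -- For the pure power the two terms cancel, since 2c₀ + 2 = c₀(p+1); only the contributions of f
    -- remain.
    have e1 : (2 * c₀ + 2) * (|U| ^ (p + 1) / (p + 1)) = c₀ * |U| ^ (p + 1) := by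
      have : p + 1 ≠ 0 := by linarith
      field_simp
      have : 2 * c₀ + 2 = c₀ * (p + 1) := by linarith
      rw [← this]; ring
    have := le_abs_self (prim f U)
    have := neg_abs_le (f U * U)
    nlinarith
  calc _ ≤ (r ^ c₀) ^ 2 * (r ^ 2 * w * (M * (3 * c₀ + 2) * (|U| + |U| ^ (q + 1)))) := by gcongr
    _ = M * (3 * c₀ + 2) * w * ((r ^ c₀) ^ 2 * r ^ 2 * (|U| + |U| ^ (q + 1))) := by ring
    _ ≤ M * (3 * c₀ + 2) * w * (2 * r ^ γ * (1 + |r ^ c₀ * U| ^ (p + 1))) :=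
        mul_le_mul_of_nonneg_left hlo (by positivity)
    _ = _ := by ring

/-- The contribution of the damping, tested with `X`. -/
theorem damping_rate_le {M c₀ γ : ℝ} (hM : 0 < M) (hc0 : 0 < c₀) (hγ : γ ≤ 1) {g : ℝ → ℝ}
    (hgM : ∀ x, |g x| ≤ M * (1 + |x|)) {r U V A m w X : ℝ} (hr : 0 < r) (hr1 : r ≤ 1)
    (hm : m = -c₀ * U + r * V - A) (hw : 0 ≤ w) :
    |(r ^ c₀) ^ 2 * (r ^ 2 * w * X * g V)| ≤
      M * r ^ γ * (w * |r ^ c₀ * X| *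
        (1 + |r ^ c₀ * m| + c₀ * |r ^ c₀ * U| + |r ^ c₀ * A|)) := by
  have hR : 0 < r ^ c₀ := Real.rpow_pos_of_pos hr _
  have hR1 : r ^ c₀ ≤ 1 := Real.rpow_le_one hr.le hr1 hc0.le
  have hrζ := le_rpow_of_le_one hγ hr hr1
  have d1 := damping_le (U := U) (V := V) hM hc0 hr hR (mul_le_one₀ hR1 hr.le hr1) hm (hgM V)
  have hL : 0 ≤ 1 + |r ^ c₀ * m| + c₀ * |r ^ c₀ * U| + |r ^ c₀ * A| := by positivity
  calc _ = r * (w * |r ^ c₀ * X| * (r ^ c₀ * (r * |g V|))) := by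
        simp only [abs_mul, abs_pow, abs_of_pos hR, abs_of_pos hr, abs_of_nonneg hw]
        ring
    _ ≤ r * (w * |r ^ c₀ * X| *
          (M * (1 + |r ^ c₀ * m| + c₀ * |r ^ c₀ * U| + |r ^ c₀ * A|))) := by
        refine mul_le_mul_of_nonneg_left (mul_le_mul_of_nonneg_left d1 ?_) hr.le
        positivity
    _ ≤ r ^ γ * (w * |r ^ c₀ * X| *
          (M * (1 + |r ^ c₀ * m| + c₀ * |r ^ c₀ * U| + |r ^ c₀ * A|))) :=
        mul_le_mul_of_nonneg_right hrζ (by positivity)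
    _ = _ := by ring

/-- Upper bound of the scaled rate of the energy. -/
theorem engRate_le {p q M c₀ α γ : ℝ} (hp : 1 < p) (hq : 0 ≤ q) (hqp : q < p) (hM : 0 < M)
    (hc : c₀ * (p - 1) = 2) (hc0 : 0 < c₀) (hα : 0 < α) (hγ : γ ≤ 1) (hγ' : γ ≤ c₀ * (p - q))
    {f g : ℝ → ℝ} (hf : Continuous f) (hfM : ∀ x, |f x| ≤ M * (1 + |x| ^ q))
    (hgM : ∀ x, |g x| ≤ M * (1 + |x|)) {r U V A m pt z w D e : ℝ} (hr : 0 < r) (hr1 : r ≤ 1)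
    (hm : m = -c₀ * U + r * V - A) (hz : z < 1) (hw : 0 ≤ w) (hD : α * w ≤ (1 - z) * D)
    (hD' : α * w ≤ D) (hpt : (1 - z) * A ^ 2 ≤ pt) :
    (r ^ c₀) ^ 2 * (-2 * m ^ 2 * D + 2 * m * A * e + r ^ 2 * w * m * g V +
        r ^ 2 * w * ((2 * c₀ + 2) * prim (nl p f) U - c₀ * (nl p f U * U))) ≤
      -2 * ((r ^ c₀ * m) ^ 2 * D) + (r ^ c₀) ^ 2 * (2 * m * A * e) +
        (2 * M * (3 * c₀ + 2) + M * (1 + c₀ ^ 2 + 3 / α)) * r ^ γ *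
          ((1 + |r ^ c₀ * U| ^ (p + 1)) * w + (r ^ c₀ * m) ^ 2 * D + (r ^ c₀) ^ 2 * pt * w) := by
  have hD0 : 0 ≤ D := le_trans (by positivity) hD'
  have hpt0 : 0 ≤ pt := le_trans (mul_nonneg (by linarith) (sq_nonneg A)) hpt
  have n2 := nonlinear_rate_le (U := U) hp hq hqp hM hc hc0 hγ hγ' hf hfM hr hr1 hw
  have d2 := (le_abs_self _).trans (damping_rate_le (X := m) hM hc0 hγ hgM hr hr1 hm hw)
  have hζ0 : 0 < r ^ γ := Real.rpow_pos_of_pos hr _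
  have hcr := cross_le (X := r ^ c₀ * m) (Y := r ^ c₀ * A) (pt := (r ^ c₀) ^ 2 * pt) hα one_pos hz
    hw hD (by
      calc (1 - z) * (r ^ c₀ * A) ^ 2 = (r ^ c₀) ^ 2 * ((1 - z) * A ^ 2) := by ring
        _ ≤ (r ^ c₀) ^ 2 * pt := mul_le_mul_of_nonneg_left hpt (sq_nonneg _))
  rw [mul_one, one_mul] at hcr
  have hW2 := sq_le_one_add_rpow (x := r ^ c₀ * U) hp
  have e0 : (r ^ c₀) ^ 2 * (-2 * m ^ 2 * D + 2 * m * A * e + r ^ 2 * w * m * g V +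
      r ^ 2 * w * ((2 * c₀ + 2) * prim (nl p f) U - c₀ * (nl p f U * U))) =
      -2 * ((r ^ c₀ * m) ^ 2 * D) + (r ^ c₀) ^ 2 * (2 * m * A * e) +
      (r ^ c₀) ^ 2 * (r ^ 2 * w * m * g V) +
      (r ^ c₀) ^ 2 * (r ^ 2 * w * ((2 * c₀ + 2) * prim (nl p f) U - c₀ * (nl p f U * U))) := by
    ring
  rw [e0]
  clear e0
  generalize r ^ c₀ * m = S at *
  generalize r ^ c₀ * A = Y at *
  generalize r ^ γ = ζ at *
  have hP0 : 0 ≤ |r ^ c₀ * U| ^ (p + 1) := by positivity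
  generalize |r ^ c₀ * U| ^ (p + 1) = P at *
  have hpt1 : 0 ≤ (r ^ c₀) ^ 2 * pt := by positivity
  generalize (r ^ c₀) ^ 2 * pt = pt' at *
  have hSw : S ^ 2 * w ≤ S ^ 2 * D / α := by
    rw [le_div_iff₀ hα]
    nlinarith [sq_nonneg S]
  have d3 := damping_cross (c := c₀) hW2 hw hP0 hpt1 hSw hcr
  have q1 : 0 ≤ (1 + P) * w := by positivity
  have q2 : 0 ≤ S ^ 2 * D := by positivity
  have q3 : 0 ≤ pt' * w := by positivity
  have q4 : 0 ≤ 3 / α := by positivity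
  have q5 : (1 + c₀ ^ 2) * ((1 + P) * w) + 3 / α * (S ^ 2 * D) + pt' * w ≤
      (1 + c₀ ^ 2 + 3 / α) * ((1 + P) * w + S ^ 2 * D + pt' * w) := by
    have z1 := mul_nonneg q4 q1
    have z2 := mul_nonneg q4 q3
    have z3 : 0 ≤ (1 + c₀ ^ 2) * (S ^ 2 * D) := by positivity
    have z4 : 0 ≤ c₀ ^ 2 * (pt' * w) := by positivity
    linarith
  have d4 := d2.trans (mul_le_mul_of_nonneg_left (d3.trans q5) (by positivity : 0 ≤ M * ζ))
  have z5 : 0 ≤ 2 * M * (3 * c₀ + 2) * ζ * (S ^ 2 * D + pt' * w) := by positivity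
  linarith

theorem sq_mul_le_of_le {α X w D : ℝ} (hα : 0 < α) (hD : α * w ≤ D) :
    X ^ 2 * w ≤ X ^ 2 * D / α := by
  rw [le_div_iff₀ hα]
  nlinarith [sq_nonneg X]

/-- The damping tested with w itself. The radial derivative is now paired with w, so W²D appears on
the right; it is later absorbed by the Hardy inequality. -/
theorem damping_cross_self {α c₀ S W Y P w D pt' : ℝ} (hW2 : W ^ 2 ≤ 1 + P) (hw : 0 ≤ w)
    (hc0 : 0 ≤ c₀) (hP0 : 0 ≤ P) (hpt1 : 0 ≤ pt') (hα : 0 < α) (hD0 : 0 ≤ D) (hD' : α * w ≤ D)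
    (cr2 : 2 * |W| * |Y| * w ≤ W ^ 2 * D / α + pt' * w) :
    w * |W| * (1 + |S| + c₀ * |W| + |Y|) ≤
      (2 + c₀ + 1 / α) * ((1 + P) * w + S ^ 2 * D + pt' * w + W ^ 2 * D) := by
  have t1 : |W| ≤ 1 / 2 * (1 + P) + 1 / 2 * (1 + P) := by
    nlinarith [sq_nonneg (|W| - 1), sq_abs W]
  have t2 : |W| * |S| ≤ 1 / 2 * S ^ 2 + 1 / 2 * (1 + P) := by
    nlinarith [sq_nonneg (|S| - |W|), sq_abs S, sq_abs W]
  have t4 : w * (|W| + |W| * |S| + c₀ * |W| ^ 2) ≤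
      w * (1 / 2 * (1 + P) + 1 / 2 * (1 + P) + (1 / 2 * S ^ 2 + 1 / 2 * (1 + P)) +
        c₀ * (1 + P)) := by
    rw [sq_abs]
    refine mul_le_mul_of_nonneg_left ?_ hw
    have := mul_le_mul_of_nonneg_left hW2 hc0
    linarith
  have t5 := sq_mul_le_of_le (X := S) hα hD'
  have q1 : 0 ≤ (1 + P) * w := by positivity
  have q2 : 0 ≤ S ^ 2 * D := by positivity
  have q3 : 0 ≤ pt' * w := by positivity
  have q4 : 0 ≤ W ^ 2 * D := by positivity
  have q5 : 0 ≤ 1 / α := by positivity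
  have e2 : S ^ 2 * D / α = 1 / α * (S ^ 2 * D) := by ring
  have e3 : W ^ 2 * D / α = 1 / α * (W ^ 2 * D) := by ring
  rw [e2] at t5
  rw [e3] at cr2
  have z1 := mul_nonneg q5 q1
  have z2 := mul_nonneg q5 q2
  have z3 := mul_nonneg q5 q3
  have z4 := mul_nonneg q5 q4
  have z5 : 0 ≤ c₀ * (S ^ 2 * D + pt' * w + W ^ 2 * D) := by positivity
  have e4 : w * |W| * (1 + |S| + c₀ * |W| + |Y|) = w * (|W| + |W| * |S| + c₀ * |W| ^ 2) +
    |W| * |Y| * w := by ring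
  rw [e4]
  linarith

/-- Young's inequality with a small coefficient on W², the large one falling on the dissipation. -/
theorem cross_young {α δ S W w D : ℝ} (hα : 0 < α) (hδ : 0 < δ) (hw : 0 ≤ w) (hD' : α * w ≤ D)
    (c : ℝ) : -(δ * (W ^ 2 * w) + c ^ 2 / (4 * δ * α) * (S ^ 2 * D)) ≤ W * S * (c * w) := by
  have h1 : 0 ≤ (2 * δ * W + c * S) ^ 2 / (4 * δ) * w := by positivity
  have h2 : (2 * δ * W + c * S) ^ 2 / (4 * δ) * w = δ * (W ^ 2 * w) +
      c ^ 2 / (4 * δ) * (S ^ 2 * w) + W * S * (c * w) := by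
    field_simp
    ring
  have h3 := mul_le_mul_of_nonneg_left (sq_mul_le_of_le (X := S) hα hD')
    (by positivity : 0 ≤ c ^ 2 / (4 * δ))
  have h4 : c ^ 2 / (4 * δ) * (S ^ 2 * D / α) = c ^ 2 / (4 * δ * α) * (S ^ 2 * D) := by
    field_simp
  linarith

theorem cross_young' {δ S W D : ℝ} (hδ : 0 < δ) (hD : 0 ≤ D) :
    -(δ * (W ^ 2 * D) + 4 / δ * (S ^ 2 * D)) ≤ -(W * S * (4 * D)) := by
  have h1 : 0 ≤ (δ * W - 2 * S) ^ 2 / δ * D := by positivity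
  have h2 : (δ * W - 2 * S) ^ 2 / δ * D = δ * (W ^ 2 * D) + 4 / δ * (S ^ 2 * D) -
      W * S * (4 * D) := by
    field_simp
    ring
  linarith

/-- Lower bound of the scaled rate of the functional `∫ w ∂ₛw ρ`. -/
theorem momRate_ge {p q M c₀ α γ δ : ℝ} (hp : 1 < p) (hq : 0 ≤ q) (hqp : q < p) (hM : 0 < M)
    (hc : c₀ * (p - 1) = 2) (hc0 : 0 < c₀) (hα : 0 < α) (hγ : γ ≤ 1) (hγ' : γ ≤ c₀ * (p - q))
    {f g : ℝ → ℝ} (hfM : ∀ x, |f x| ≤ M * (1 + |x| ^ q))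
    (hgM : ∀ x, |g x| ≤ M * (1 + |x|)) {r U V A m pt z w D e : ℝ} (hr : 0 < r) (hr1 : r ≤ 1)
    (hm : m = -c₀ * U + r * V - A) (hz : z < 1) (hw : 0 ≤ w) (hD : α * w ≤ (1 - z) * D)
    (hD' : α * w ≤ D) (hpt : (1 - z) * A ^ 2 ≤ pt) (hδ : 0 < δ) :
    (r ^ c₀ * m) ^ 2 * w - (r ^ c₀) ^ 2 * pt * w - c₀ * (c₀ + 1) * ((r ^ c₀ * U) ^ 2 * w) +
        |r ^ c₀ * U| ^ (p + 1) * w -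
        δ * ((r ^ c₀) ^ 2 * pt * w + (r ^ c₀ * U) ^ 2 * w + (r ^ c₀ * U) ^ 2 * D) -
        (1 / (α * δ) + (2 * c₀ + 1) ^ 2 / (4 * δ * α) + 4 / δ) * ((r ^ c₀ * m) ^ 2 * D) +
        (r ^ c₀) ^ 2 * (2 * e * U * A) -
        (2 * M + M * (2 + c₀ + 1 / α)) * r ^ γ *
          ((1 + |r ^ c₀ * U| ^ (p + 1)) * w + (r ^ c₀ * m) ^ 2 * D + (r ^ c₀) ^ 2 * pt * w +
            (r ^ c₀ * U) ^ 2 * D) ≤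
    (r ^ c₀) ^ 2 * (m ^ 2 * w - pt * w - c₀ * (c₀ + 1) * U ^ 2 * w + 2 * m * A * w +
      U * m * ((2 * c₀ + 1) * w - 4 * D) + 2 * e * U * A + r ^ 2 * (nl p f U + g V) * U * w) := by
  have hD0 : 0 ≤ D := le_trans (by positivity) hD'
  have hpt0 : 0 ≤ pt := le_trans (mul_nonneg (by linarith) (sq_nonneg A)) hpt
  have hlo := lower_order (U := U) hp hq hqp hc hγ hγ' hr hr1
  obtain ⟨b1, b2⟩ := prim_mul_bounds hq hM hfM U
  have hR : 0 < r ^ c₀ := Real.rpow_pos_of_pos hr _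
  have d2 := (neg_abs_le _).trans' (neg_le_neg
    (damping_rate_le (X := U) hM hc0 hγ hgM hr hr1 hm hw))
  have hζ0 : 0 < r ^ γ := Real.rpow_pos_of_pos hr _
  have hY : (1 - z) * (r ^ c₀ * A) ^ 2 ≤ (r ^ c₀) ^ 2 * pt := by
    calc (1 - z) * (r ^ c₀ * A) ^ 2 = (r ^ c₀) ^ 2 * ((1 - z) * A ^ 2) := by ring
      _ ≤ (r ^ c₀) ^ 2 * pt := mul_le_mul_of_nonneg_left hpt (sq_nonneg _)
  -- The term 2 w_s (y·∇w) has no factor r^γ, so it is split with the small parameter δ; for the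
  -- damping, which has this factor, θ = 1 is enough.
  have cr1 := cross_le (X := r ^ c₀ * m) (Y := r ^ c₀ * A) hα hδ hz hw hD hY
  have cr2 := cross_le (X := r ^ c₀ * U) (Y := r ^ c₀ * A) hα one_pos hz hw hD hY
  rw [mul_one, one_mul] at cr2
  -- the nonlinear term
  have n0 : (r ^ c₀) ^ 2 * (r ^ 2 * (f U * U) * w) ≥ -(2 * M * r ^ γ *
      ((1 + |r ^ c₀ * U| ^ (p + 1)) * w)) := by
    have h1 : -(f U * U) ≤ M * (|U| + |U| ^ (q + 1)) := (neg_le_abs _).trans b2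
    have h2 := mul_le_mul_of_nonneg_left h1 (by positivity : 0 ≤ (r ^ c₀) ^ 2 * r ^ 2 * w)
    have h3 := mul_le_mul_of_nonneg_left hlo (by positivity : 0 ≤ M * w)
    linarith
  have n1 : (r ^ c₀) ^ 2 * (r ^ 2 * |U| ^ (p + 1)) = |r ^ c₀ * U| ^ (p + 1) := by
    rw [abs_mul, abs_of_pos hR, Real.mul_rpow hR.le (abs_nonneg _), ← Real.rpow_mul hr.le,
      ← mul_assoc]
    congr 1
    rw [← Real.rpow_natCast, ← Real.rpow_natCast r, ← Real.rpow_mul hr.le, ← Real.rpow_add hr]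
    congr 1
    push_cast
    linarith
  have e0 : (r ^ c₀) ^ 2 * (m ^ 2 * w - pt * w - c₀ * (c₀ + 1) * U ^ 2 * w + 2 * m * A * w +
      U * m * ((2 * c₀ + 1) * w - 4 * D) + 2 * e * U * A + r ^ 2 * (nl p f U + g V) * U * w) =
      (r ^ c₀ * m) ^ 2 * w - (r ^ c₀) ^ 2 * pt * w - c₀ * (c₀ + 1) * ((r ^ c₀ * U) ^ 2 * w) +
      2 * ((r ^ c₀ * m) * (r ^ c₀ * A)) * w + (r ^ c₀ * U) * (r ^ c₀ * m) *
        ((2 * c₀ + 1) * w - 4 * D) + (r ^ c₀) ^ 2 * (2 * e * U * A) +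
      (|r ^ c₀ * U| ^ (p + 1) * w + (r ^ c₀) ^ 2 * (r ^ 2 * (f U * U) * w)) +
      (r ^ c₀) ^ 2 * (r ^ 2 * w * U * g V) := by
    have := nl_mul_self hp f U
    rw [← n1]
    linear_combination (r ^ c₀) ^ 2 * r ^ 2 * w * this
  rw [e0]
  clear e0 n1 hlo b1 b2
  have hW2 := sq_le_one_add_rpow (x := r ^ c₀ * U) hp
  have hP0 : 0 ≤ |r ^ c₀ * U| ^ (p + 1) := by positivity
  have hpt1 : 0 ≤ (r ^ c₀) ^ 2 * pt := by positivity
  generalize |r ^ c₀ * U| ^ (p + 1) = P at *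
  generalize (r ^ c₀) ^ 2 * pt = pt' at *
  generalize r ^ c₀ * m = S at *
  generalize r ^ c₀ * A = Y at *
  generalize r ^ c₀ * U = W at *
  generalize r ^ γ = ζ at *
  have a1 : -(2 * |S| * |Y| * w) ≤ 2 * (S * Y) * w := by
    have := neg_abs_le (S * Y)
    rw [abs_mul] at this
    have := mul_le_mul_of_nonneg_right this hw
    linarith
  have a2 := cross_young (S := S) (W := W) hα hδ hw hD' (2 * c₀ + 1)
  have a3 := cross_young' (S := S) (W := W) hδ hD0
  have e1 : S ^ 2 * D / (α * δ) = 1 / (α * δ) * (S ^ 2 * D) := by ring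
  rw [e1] at cr1
  have b1 := damping_cross_self (S := S) hW2 hw hc0.le hP0 hpt1 hα hD0 hD' cr2
  have b2 := mul_le_mul_of_nonneg_left b1 (by positivity : 0 ≤ M * ζ)
  have q1 : 0 ≤ 2 * M * ζ * (S ^ 2 * D + pt' * w + W ^ 2 * D) := by positivity
  have f1 : (2 * M + M * (2 + c₀ + 1 / α)) * ζ * ((1 + P) * w + S ^ 2 * D + pt' * w + W ^ 2 * D) =
      2 * M * ζ * ((1 + P) * w) + 2 * M * ζ * (S ^ 2 * D + pt' * w + W ^ 2 * D) +
      M * ζ * ((2 + c₀ + 1 / α) * ((1 + P) * w + S ^ 2 * D + pt' * w + W ^ 2 * D)) := by ring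
  have f2 : W * S * ((2 * c₀ + 1) * w - 4 * D) = W * S * ((2 * c₀ + 1) * w) - W * S * (4 * D) := by
    ring
  rw [f1, f2]
  clear f1 f2 hW2 hm hpt hY hc hp hγ hγ'
  linarith

/-- The scaled energy density. -/
theorem engDens_close {p q M c₀ γ : ℝ} (hp : 1 < p) (hq : 0 ≤ q) (hqp : q < p) (hM : 0 < M)
    (hc : c₀ * (p - 1) = 2) (hγ : γ ≤ 1) (hγ' : γ ≤ c₀ * (p - q))
    {f : ℝ → ℝ} (hf : Continuous f) (hfM : ∀ x, |f x| ≤ M * (1 + |x| ^ q)) {r U m pt w : ℝ}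
    (hr : 0 < r) (hr1 : r ≤ 1) (hw : 0 ≤ w) :
    |(r ^ c₀) ^ 2 * (1 / 2 * (m ^ 2 + pt + c₀ * (c₀ + 1) * U ^ 2) * w -
        r ^ 2 * w * prim (nl p f) U) -
      (1 / 2 * ((r ^ c₀ * m) ^ 2 * w + (r ^ c₀) ^ 2 * pt * w +
        c₀ * (c₀ + 1) * ((r ^ c₀ * U) ^ 2 * w)) - |r ^ c₀ * U| ^ (p + 1) * w / (p + 1))| ≤
      2 * M * r ^ γ * ((1 + |r ^ c₀ * U| ^ (p + 1)) * w) := by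
  have hlo := lower_order (U := U) hp hq hqp hc hγ hγ' hr hr1
  obtain ⟨b1, b2⟩ := prim_mul_bounds hq hM hfM U
  have hR : 0 < r ^ c₀ := Real.rpow_pos_of_pos hr _
  have n1 : |r ^ c₀ * U| ^ (p + 1) = (r ^ c₀) ^ 2 * (r ^ 2 * |U| ^ (p + 1)) := by
    rw [abs_mul, abs_of_pos hR, Real.mul_rpow hR.le (abs_nonneg _), ← Real.rpow_mul hr.le,
      ← mul_assoc]
    congr 1
    rw [← Real.rpow_natCast, ← Real.rpow_natCast r, ← Real.rpow_mul hr.le, ← Real.rpow_add hr]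
    congr 1
    push_cast
    linarith
  have e0 : (r ^ c₀) ^ 2 * (1 / 2 * (m ^ 2 + pt + c₀ * (c₀ + 1) * U ^ 2) * w -
        r ^ 2 * w * prim (nl p f) U) -
      (1 / 2 * ((r ^ c₀ * m) ^ 2 * w + (r ^ c₀) ^ 2 * pt * w +
        c₀ * (c₀ + 1) * ((r ^ c₀ * U) ^ 2 * w)) - |r ^ c₀ * U| ^ (p + 1) * w / (p + 1)) =
      -((r ^ c₀) ^ 2 * r ^ 2 * w * prim f U) := by
    rw [prim_nl hp hf]
    have := congrArg (fun x => x * w / (p + 1)) n1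
    beta_reduce at this
    rw [this]
    ring
  rw [e0, abs_neg, abs_mul, abs_of_nonneg (by positivity)]
  have h2 := mul_le_mul_of_nonneg_left b1 (by positivity : 0 ≤ (r ^ c₀) ^ 2 * r ^ 2 * w)
  have h3 := mul_le_mul_of_nonneg_left hlo (by positivity : 0 ≤ M * w)
  linarith

end

end HamzaZaag

/-! ### Integrals in rescaled variables. -/

namespace HamzaZaag

noncomputable section

/-- The relations between the parameters. -/
structure Params (N : ℕ) (p q M c₀ α γ : ℝ) : Prop where
  hp : 1 < p
  hq : 0 ≤ q
  hqp : q < p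
  hM : 0 < M
  hc : c₀ * (p - 1) = 2
  hc0 : 0 < c₀
  hα : 0 < α
  hαc : α = c₀ - ((N : ℝ) - 1) / 2
  hγ0 : 0 < γ
  hγ : γ ≤ 1
  hγ' : γ ≤ c₀ * (p - q)

/-- The assumptions on the lower order terms. -/
structure LowerOrder (q M : ℝ) (f g : ℝ → ℝ) : Prop where
  hf : Continuous f
  hg : Continuous g
  hfM : ∀ x, |f x| ≤ M * (1 + |x| ^ q)
  hgM : ∀ x, |g x| ≤ M * (1 + |x|)

/-- The integral of `F` in the rescaled variable `y = (x - x₀) / (b - t)`. -/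
def nint {N : ℕ} (b t : ℝ) (F : E N → ℝ) : ℝ := (b - t) ^ (-(N : ℝ)) * ∫ x, F x

variable {N : ℕ} {b t : ℝ} {x₀ : E N}

theorem nint_mono (hb : t < b) {F F' : E N → ℝ} (h : Integrable F) (h' : Integrable F')
    (hle : ∀ x, F x ≤ F' x) : nint b t F ≤ nint b t F' :=
  mul_le_mul_of_nonneg_left (integral_mono h h' hle)
    (Real.rpow_nonneg (by linarith) _)

theorem nint_nonneg (hb : t < b) {F : E N → ℝ} (h : ∀ x, 0 ≤ F x) : 0 ≤ nint b t F :=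
  mul_nonneg (Real.rpow_nonneg (by linarith) _) (integral_nonneg h)

theorem nint_add {F F' : E N → ℝ} (h : Integrable F) (h' : Integrable F') :
    nint b t (fun x => F x + F' x) = nint b t F + nint b t F' := by
  rw [nint, integral_add h h', mul_add]; rfl

theorem nint_sub {F F' : E N → ℝ} (h : Integrable F) (h' : Integrable F') :
    nint b t (fun x => F x - F' x) = nint b t F - nint b t F' := by
  rw [nint, integral_sub h h', mul_sub]; rfl

theorem nint_const_mul (F : E N → ℝ) (c : ℝ) :
    nint b t (fun x => c * F x) = c * nint b t F := by
  rw [nint, integral_const_mul, nint]; ring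

theorem nint_neg (F : E N → ℝ) : nint b t (fun x => - F x) = - nint b t F := by
  rw [nint, integral_neg, nint]; ring

theorem abs_nint_le (hb : t < b) {F F' : E N → ℝ} (h : Integrable F) (h' : Integrable F')
    (hle : ∀ x, |F x| ≤ F' x) : |nint b t F| ≤ nint b t F' := by
  rw [abs_le]
  constructor
  · rw [neg_le, ← nint_neg]
    exact nint_mono hb h.neg h' fun x => (neg_le_abs _).trans (hle x)
  · exact nint_mono hb h h' fun x => (le_abs_self _).trans (hle x)

/-- `F` is integrable with rescaled integral `c`. -/
structure HasNint {N : ℕ} (b t : ℝ) (F : E N → ℝ) (c : ℝ) : Prop where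
  int : Integrable F
  eq : nint b t F = c

namespace HasNint

variable {F F' : E N → ℝ} {c c' : ℝ}

theorem add (h : HasNint b t F c) (h' : HasNint b t F' c') :
    HasNint b t (fun x => F x + F' x) (c + c') :=
  ⟨h.int.add h'.int, by rw [nint_add h.int h'.int, h.eq, h'.eq]⟩

theorem sub (h : HasNint b t F c) (h' : HasNint b t F' c') :
    HasNint b t (fun x => F x - F' x) (c - c') :=
  ⟨h.int.sub h'.int, by rw [nint_sub h.int h'.int, h.eq, h'.eq]⟩

theorem const_mul (h : HasNint b t F c) (k : ℝ) : HasNint b t (fun x => k * F x) (k * c) :=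
  ⟨h.int.const_mul k, by rw [nint_const_mul, h.eq]⟩

theorem le (h : HasNint b t F c) (h' : HasNint b t F' c') (hb : t < b) (hle : ∀ x, F x ≤ F' x) :
    c ≤ c' := by
  rw [← h.eq, ← h'.eq]
  exact nint_mono hb h.int h'.int hle

theorem abs_le (h : HasNint b t F c) (h' : HasNint b t F' c') (hb : t < b)
    (hle : ∀ x, |F x| ≤ F' x) : |c| ≤ c' := by
  rw [← h.eq, ← h'.eq]
  exact abs_nint_le hb h.int h'.int hle

theorem self (h : Integrable F) : HasNint b t F (nint b t F) := ⟨h, rfl⟩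

end HasNint

theorem rpow_two_sub (hb : t < b) (c : ℝ) :
    (b - t) ^ (2 * c - N) = (b - t) ^ (-(N : ℝ)) * ((b - t) ^ c) ^ 2 := by
  have : 0 < b - t := by linarith
  rw [← Real.rpow_natCast, ← Real.rpow_mul this.le, ← Real.rpow_add this]
  congr 1
  push_cast
  ring

theorem nint_scaled (hb : t < b) (c : ℝ) (F : E N → ℝ) :
    (b - t) ^ (2 * c - N) * ∫ x, F x = nint b t fun x => ((b - t) ^ c) ^ 2 * F x := by
  rw [nint_const_mul, nint, rpow_two_sub hb]; ring

theorem zz_continuous (x₀ : E N) (b t : ℝ) : Continuous (zz x₀ b t) := by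
  unfold zz; fun_prop

theorem integrable_weight_mul {B : Set (E N)} (hB : IsCompact B) {c f g : E N → ℝ}
    (hc : Continuous c) (hs : ∀ x, x ∉ B → c x = 0) (hf : MemLp f 2 (volume.restrict B))
    (hg : MemLp g 2 (volume.restrict B)) : Integrable (fun x => c x * (f x * g x)) := by
  have h1 : IntegrableOn (fun x => f x * g x) B := hf.integrable_mul hg
  obtain ⟨C, hC⟩ := hB.exists_bound_of_continuousOn hc.continuousOn
  rw [← integrableOn_iff_integrable_of_support_subset (s := B)]
  · refine Integrable.bdd_mul (c := C) h1 hc.aestronglyMeasurable ?_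
    filter_upwards [ae_restrict_mem hB.measurableSet] with x hx
    exact hC x hx
  · intro x hx
    by_contra h
    exact hx (by simp [hs x h])

theorem integrable_weight_mul' {B : Set (E N)} (hB : IsCompact B) {c f : E N → ℝ}
    (hc : Continuous c) (hs : ∀ x, x ∉ B → c x = 0) (hf : IntegrableOn f B) :
    Integrable (fun x => c x * f x) := by
  obtain ⟨C, hC⟩ := hB.exists_bound_of_continuousOn hc.continuousOn
  rw [← integrableOn_iff_integrable_of_support_subset (s := B)]
  · refine Integrable.bdd_mul (c := C) hf hc.aestronglyMeasurable ?_
    filter_upwards [ae_restrict_mem hB.measurableSet] with x hx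
    exact hC x hx
  · intro x hx
    by_contra h
    exact hx (by simp [hs x h])

theorem HasNint.scaled (hb : t < b) (c : ℝ) {F : E N → ℝ} (h : Integrable F) :
    HasNint b t (fun x => ((b - t) ^ c) ^ 2 * F x) ((b - t) ^ (2 * c - N) * ∫ x, F x) :=
  ⟨h.const_mul _, (nint_scaled hb c F).symm⟩

/-- The regularity of the values of `(u, u_t, ∇u)` at a fixed time. -/
structure IsState {N : ℕ} (p : ℝ) (x₀ : E N) (b t : ℝ) (U V : E N → ℝ)
    (G : Fin N → E N → ℝ) : Prop where
  lt : t < b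
  mU : MemLp U 2 (volume.restrict (Metric.closedBall x₀ (b - t)))
  mV : MemLp V 2 (volume.restrict (Metric.closedBall x₀ (b - t)))
  mG : ∀ i, MemLp (G i) 2 (volume.restrict (Metric.closedBall x₀ (b - t)))
  pow : IntegrableOn (fun x => |U x| ^ (p + 1)) (Metric.closedBall x₀ (b - t))

theorem abs_coord_sub_le {x : E N} {r : ℝ} (hx : x ∈ Metric.closedBall x₀ r) (i : Fin N) :
    |x i - x₀ i| ≤ r := by
  have h := abs_coord_le (x - x₀) i
  rw [Metric.mem_closedBall, dist_eq_norm] at hx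
  exact h.trans hx

/-- Cauchy–Schwarz in ℝ^N, with |x - x₀|² = z (b - t)². -/
theorem rad_sq_le (G : Fin N → E N → ℝ) (x : E N) (h : t < b) :
    rad x₀ G x ^ 2 ≤ zz x₀ b t x * (b - t) ^ 2 * gsq G x := by
  rw [← sum_sq_coord x₀ x h]
  exact Finset.sum_mul_sq_le_sq_mul_sq _ _ _

theorem gsq_nonneg (G : Fin N → E N → ℝ) (x : E N) : 0 ≤ gsq G x :=
  Finset.sum_nonneg fun _ _ => sq_nonneg _

namespace IsState

variable {p c₀ α ε : ℝ} {w w' w'' : ℝ → ℝ} {U V : E N → ℝ} {G : Fin N → E N → ℝ}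

theorem rad (S : IsState p x₀ b t U V G) :
    MemLp (rad x₀ G) 2 (volume.restrict (Metric.closedBall x₀ (b - t))) := by
  unfold HamzaZaag.rad
  refine memLp_finsetSum _ fun i _ => ?_
  refine MemLp.of_le_mul (c := b - t) (S.mG i) ?_ ?_
  · refine AEStronglyMeasurable.mul ?_ (S.mG i).1
    exact Continuous.aestronglyMeasurable (by fun_prop)
  · filter_upwards [ae_restrict_mem Metric.isClosed_closedBall.measurableSet] with x hx
    rw [norm_mul]
    exact mul_le_mul_of_nonneg_right (abs_coord_sub_le hx i) (norm_nonneg _)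

theorem mv (S : IsState p x₀ b t U V G) (c₀ : ℝ) :
    MemLp (mv c₀ x₀ b t U V G) 2 (volume.restrict (Metric.closedBall x₀ (b - t))) :=
  ((S.mU.const_mul (-c₀)).add (S.mV.const_mul (b - t))).sub S.rad

/-- A weight depending on the rescaled distance. -/
structure _root_.HamzaZaag.IsCut (a : ℝ → ℝ) : Prop where
  cont : Continuous a
  s0 : ∀ z, 1 ≤ z → a z = 0

theorem cut_zero {a : ℝ → ℝ} (ha : IsCut a) (hb : t < b) (x : E N)
    (hx : x ∉ Metric.closedBall x₀ (b - t)) : a (zz x₀ b t x) = 0 :=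
  ha.s0 _ (one_le_zz le_rfl hb hx)

theorem int_mul (S : IsState p x₀ b t U V G) {a : ℝ → ℝ} (ha : IsCut a) {f g : E N → ℝ}
    (hf : MemLp f 2 (volume.restrict (Metric.closedBall x₀ (b - t))))
    (hg : MemLp g 2 (volume.restrict (Metric.closedBall x₀ (b - t)))) :
    Integrable (fun x => a (zz x₀ b t x) * (f x * g x)) :=
  integrable_weight_mul (isCompact_closedBall _ _) (ha.cont.comp (zz_continuous x₀ b t))
    (fun x hx => cut_zero ha S.lt x hx) hf hg

theorem int_sq (S : IsState p x₀ b t U V G) {a : ℝ → ℝ} (ha : IsCut a) {f : E N → ℝ}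
    (hf : MemLp f 2 (volume.restrict (Metric.closedBall x₀ (b - t)))) (c : ℝ) :
    Integrable (fun x => (c * f x) ^ 2 * a (zz x₀ b t x)) := by
  refine ((S.int_mul ha hf hf).const_mul (c ^ 2)).congr (Eventually.of_forall fun x => ?_)
  ring

theorem int_pow (S : IsState p x₀ b t U V G) {a : ℝ → ℝ} (ha : IsCut a) (c : ℝ) :
    Integrable (fun x => |c * U x| ^ (p + 1) * a (zz x₀ b t x)) := by
  have h := integrable_weight_mul' (isCompact_closedBall _ _) (ha.cont.comp (zz_continuous x₀ b t))
    (fun x hx => cut_zero ha S.lt x hx) S.pow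
  refine (h.const_mul (|c| ^ (p + 1))).congr (Eventually.of_forall fun x => ?_)
  simp only [Function.comp]
  rw [abs_mul, Real.mul_rpow (abs_nonneg _) (abs_nonneg _)]
  ring

theorem int_pot (S : IsState p x₀ b t U V G) {a : ℝ → ℝ} (ha : IsCut a) (c : ℝ) :
    Integrable (fun x => c * pot x₀ b t G x * a (zz x₀ b t x)) := by
  have h1 : Integrable (fun x => ∑ i, a (zz x₀ b t x) * (G i x * G i x)) :=
    integrable_finsetSum _ fun i _ => S.int_mul ha (S.mG i) (S.mG i)
  refine (((h1.const_mul ((b - t) ^ 2)).sub (S.int_mul ha S.rad S.rad)).const_mul c).congr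
    (Eventually.of_forall fun x => ?_)
  simp only [pot, gsq, Pi.sub_apply, ← Finset.mul_sum, ← sq]
  ring

theorem int_one {a : ℝ → ℝ} (ha : IsCut a) (hb : t < b) : Integrable (fun x => a (zz x₀ b t x)) := by
  have := integrable_weight_mul' (isCompact_closedBall x₀ (b - t))
    (ha.cont.comp (zz_continuous x₀ b t)) (fun x hx => cut_zero ha hb x hx)
    (integrableOn_const (C := (1 : ℝ)) (isCompact_closedBall x₀ (b - t)).measure_ne_top)
  simpa using this

end IsState

section Profile

variable {α ε : ℝ} {w w' w'' : ℝ → ℝ}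

theorem IsProfile.cut (P : IsProfile α ε w w' w'') : IsCut w :=
  ⟨continuous_iff_continuousAt.2 fun z => (P.d1 z).continuousAt, P.s0⟩

theorem IsProfile.cut_dD (P : IsProfile α ε w w' w'') : IsCut (dD α w w') where
  cont := by
    have := P.cut.cont
    have := P.cont_w'
    unfold dD
    fun_prop
  s0 := P.dD_s0

theorem IsProfile.cut_dErr (P : IsProfile α ε w w' w'') : IsCut (dErr α w w') where
  cont := by
    have := P.cut.cont
    have := P.cont_w'
    unfold dErr
    fun_prop
  s0 z hz := by simp [dErr, P.s0 z hz, P.s1 z hz]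

/-- The identity (1-z)(αω - zω') = αω + z·(error), with a nonnegative error. This is what remains of
αω - zω' = αω/(1-z), exact for ω = (1-z)^α. -/
theorem IsProfile.dD_ge (P : IsProfile α ε w w' w'') (hα : 0 ≤ α) {z : ℝ} (hz : 0 ≤ z)
    (hz1 : z < 1) : α * w z ≤ (1 - z) * dD α w w' z ∧ α * w z ≤ dD α w w' z := by
  have h1 := P.err_nonneg z hz
  have e : (1 - z) * dD α w w' z = α * w z + z * -(w' z * (1 - z) + α * w z) := by
    simp only [dD]; ring
  have h2 : α * w z ≤ (1 - z) * dD α w w' z := by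
    rw [e]
    have := mul_nonneg hz h1
    linarith
  refine ⟨h2, ?_⟩
  have h4 : 0 ≤ α * w z := mul_nonneg hα (P.nonneg z)
  have h3 : 0 ≤ dD α w w' z := by
    by_contra! h
    nlinarith
  nlinarith

end Profile

/-- The volume of the unit ball. -/
def vol1 (N : ℕ) : ℝ := volume.real (Metric.closedBall (0 : E N) 1)

theorem vol1_nonneg (N : ℕ) : 0 ≤ vol1 N := measureReal_nonneg

/-- The profile is at most 1 and lives on a ball of radius b - t, whose volume cancels the
normalisation. The bound is uniform in the profile. -/
theorem nint_one_le {α ε : ℝ} {w w' w'' : ℝ → ℝ} (P : IsProfile α ε w w' w'') (hb : t < b) :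
    nint b t (fun x => w (zz x₀ b t x)) ≤ vol1 N := by
  have hr : 0 < b - t := by linarith
  have h1 : ∫ x, w (zz x₀ b t x) ≤ volume.real (Metric.closedBall x₀ (b - t)) := by
    have h2 := integral_mono (IsState.int_one (x₀ := x₀) P.cut hb)
      (g := (Metric.closedBall x₀ (b - t)).indicator fun _ => (1 : ℝ))
      ((integrable_indicator_iff Metric.isClosed_closedBall.measurableSet).2
        (integrableOn_const (isCompact_closedBall x₀ (b - t)).measure_ne_top)) fun x => by
        by_cases hx : x ∈ Metric.closedBall x₀ (b - t)
        · rw [indicator_of_mem hx]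
          exact P.le_one _ (zz_nonneg _ _ _ _)
        · rw [indicator_of_notMem hx, IsState.cut_zero P.cut hb x hx]
    refine h2.trans (le_of_eq ?_)
    rw [integral_indicator Metric.isClosed_closedBall.measurableSet]
    simp
  have h3 : volume.real (Metric.closedBall x₀ (b - t)) = (b - t) ^ (N : ℝ) * vol1 N := by
    rw [vol1, Measure.real, Measure.real, Measure.addHaar_closedBall' _ _ hr.le]
    simp [ENNReal.toReal_mul, hr.le]
  have h4 := mul_le_mul_of_nonneg_left h1 (Real.rpow_nonneg hr.le (-(N : ℝ)))
  refine h4.trans (le_of_eq ?_)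
  rw [h3, ← mul_assoc, ← Real.rpow_add hr]
  simp

end

end HamzaZaag

/-! ### Integrated inequalities for the functionals. -/

namespace HamzaZaag

noncomputable section

variable {N : ℕ}

/-- `∫ |∂ₛ w|² ω`, if `a = ω`. -/
def qS {N : ℕ} (c₀ : ℝ) (a : ℝ → ℝ) (x₀ : E N) (b t : ℝ) (U V : E N → ℝ)
    (G : Fin N → E N → ℝ) : ℝ :=
  nint b t fun x => ((b - t) ^ c₀ * mv c₀ x₀ b t U V G x) ^ 2 * a (zz x₀ b t x)

/-- `∫ (|∇w|² - (y · ∇w)²) ω`, if `a = ω`. -/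
def qG {N : ℕ} (c₀ : ℝ) (a : ℝ → ℝ) (x₀ : E N) (b t : ℝ) (G : Fin N → E N → ℝ) : ℝ :=
  nint b t fun x => ((b - t) ^ c₀) ^ 2 * pot x₀ b t G x * a (zz x₀ b t x)

/-- `∫ w² ω`, if `a = ω`. -/
def qW {N : ℕ} (c₀ : ℝ) (a : ℝ → ℝ) (x₀ : E N) (b t : ℝ) (U : E N → ℝ) : ℝ :=
  nint b t fun x => ((b - t) ^ c₀ * U x) ^ 2 * a (zz x₀ b t x)

/-- `∫ |w|^{p+1} ω`, if `a = ω`. -/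
def qP {N : ℕ} (p c₀ : ℝ) (a : ℝ → ℝ) (x₀ : E N) (b t : ℝ) (U : E N → ℝ) : ℝ :=
  nint b t fun x => |(b - t) ^ c₀ * U x| ^ (p + 1) * a (zz x₀ b t x)

/-- The square of the energy norm in the section of the backward light cone of `(x₀, b)`. -/
def qN {N : ℕ} (x₀ : E N) (b t : ℝ) (U V : E N → ℝ) (G : Fin N → E N → ℝ) : ℝ :=
  ∫ x in Metric.closedBall x₀ (b - t), (U x ^ 2 + V x ^ 2 + gsq G x)

/-- The error due to the cut-off. -/
def qErr {N : ℕ} (c₀ ε : ℝ) (x₀ : E N) (b t : ℝ) (U V : E N → ℝ) (G : Fin N → E N → ℝ) : ℝ :=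
  (b - t) ^ (2 * c₀ - N) * (ε * ((3 * c₀ ^ 2 + 4) * qN x₀ b t U V G))

variable {x₀ : E N} {b t : ℝ}

section Pointwise

variable {α ε c₀ : ℝ} {w w' w'' : ℝ → ℝ} (U V : E N → ℝ) (G : Fin N → E N → ℝ)

theorem pot_ge (hb : t < b) (x : E N) (hz : zz x₀ b t x < 1) :
    (1 - zz x₀ b t x) * rad x₀ G x ^ 2 ≤ pot x₀ b t G x := by
  rcases pot_lower (rad_sq_le (x₀ := x₀) G x hb) (gsq_nonneg G x) with h | h
  · exact h
  · linarith

theorem pot_mul_nonneg (hb : t < b) {a : ℝ → ℝ} (ha : IsCut a) (h0 : ∀ z, 0 ≤ z → 0 ≤ a z)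
    (x : E N) : 0 ≤ pot x₀ b t G x * a (zz x₀ b t x) := by
  rcases lt_or_ge (zz x₀ b t x) 1 with h | h
  · refine mul_nonneg ((mul_nonneg (by linarith) (sq_nonneg _)).trans (pot_ge G hb x h)) (h0 _ ?_)
    exact zz_nonneg _ _ _ _
  · rw [ha.s0 _ h, mul_zero]

theorem IsProfile.dD_nonneg (P : IsProfile α ε w w' w'') (hα : 0 ≤ α) {z : ℝ} (hz : 0 ≤ z) :
    0 ≤ dD α w w' z := by
  rcases lt_or_ge z 1 with h | h
  · exact (mul_nonneg hα (P.nonneg z)).trans (P.dD_ge hα hz h).2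
  · rw [P.dD_s0 z h]

theorem rad_sq_le_gsq (hb : t < b) (hr1 : b - t ≤ 1) (x : E N) (hz : zz x₀ b t x ≤ 1) :
    rad x₀ G x ^ 2 ≤ gsq G x := by
  refine (rad_sq_le (x₀ := x₀) G x hb).trans ?_
  have h1 : (b - t) ^ 2 ≤ 1 := by nlinarith
  have h2 : zz x₀ b t x * (b - t) ^ 2 ≤ 1 := mul_le_one₀ hz (by positivity) h1
  have := mul_le_mul_of_nonneg_right h2 (gsq_nonneg G x)
  linarith

/-- The error of the profile is at most ε, and the remaining factors are quadratic in (u, u_t, ∇u)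
with b - t ≤ 1. The unweighted energy is enough here, since ε tends to 0 with everything else fixed.
-/
theorem cut_errors (P : IsProfile α ε w w' w'') (hb : t < b) (hr1 : b - t ≤ 1) (x : E N) :
    |2 * mv c₀ x₀ b t U V G x * rad x₀ G x * dErr α w w' (zz x₀ b t x)| ≤
      (Metric.closedBall x₀ (b - t)).indicator
        (fun x => ε * ((3 * c₀ ^ 2 + 4) * (U x ^ 2 + V x ^ 2 + gsq G x))) x ∧
    |2 * dErr α w w' (zz x₀ b t x) * U x * rad x₀ G x| ≤
      (Metric.closedBall x₀ (b - t)).indicator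
        (fun x => ε * ((3 * c₀ ^ 2 + 4) * (U x ^ 2 + V x ^ 2 + gsq G x))) x := by
  have hr : 0 < b - t := by linarith
  by_cases hx : x ∈ Metric.closedBall x₀ (b - t)
  · rw [indicator_of_mem hx]
    have hz0 := zz_nonneg x₀ b t x
    have hz : zz x₀ b t x ≤ 1 := by
      rw [zz, div_le_one (by positivity)]
      rw [Metric.mem_closedBall, dist_eq_norm] at hx
      have := norm_nonneg (x - x₀)
      gcongr
    have hA := rad_sq_le_gsq G hb hr1 x hz
    have e0 := P.err_nonneg _ hz0
    have e1 := P.err_le _ hz0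
    have e2 : |dErr α w w' (zz x₀ b t x)| ≤ ε := by rw [dErr, abs_of_nonneg e0]; exact e1
    have hε : 0 ≤ ε := e0.trans e1
    have hm : mv c₀ x₀ b t U V G x ^ 2 ≤ 3 * (c₀ ^ 2 * U x ^ 2 + V x ^ 2 + rad x₀ G x ^ 2) := by
      have h1 : (b - t) ^ 2 * V x ^ 2 ≤ V x ^ 2 := by
        have : (b - t) ^ 2 ≤ 1 := by nlinarith
        nlinarith [sq_nonneg (V x)]
      simp only [mv]
      nlinarith [sq_nonneg (-c₀ * U x - (b - t) * V x), sq_nonneg (-c₀ * U x + rad x₀ G x),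
        sq_nonneg ((b - t) * V x + rad x₀ G x)]
    have hg := gsq_nonneg G x
    have hcU : 0 ≤ c₀ ^ 2 * V x ^ 2 := by positivity
    have hcV : 0 ≤ c₀ ^ 2 * gsq G x := by positivity
    have hcW : 0 ≤ c₀ ^ 2 * U x ^ 2 := by positivity
    constructor
    · have h3 : |2 * mv c₀ x₀ b t U V G x * rad x₀ G x| ≤
          (3 * c₀ ^ 2 + 4) * (U x ^ 2 + V x ^ 2 + gsq G x) := by
        have h4 : |2 * mv c₀ x₀ b t U V G x * rad x₀ G x| ≤
            mv c₀ x₀ b t U V G x ^ 2 + rad x₀ G x ^ 2 := by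
          rw [abs_le]
          constructor <;> nlinarith [sq_nonneg (mv c₀ x₀ b t U V G x + rad x₀ G x),
            sq_nonneg (mv c₀ x₀ b t U V G x - rad x₀ G x)]
        nlinarith [sq_nonneg (U x), sq_nonneg (V x)]
      rw [abs_mul, mul_comm]
      exact mul_le_mul e2 h3 (abs_nonneg _) hε
    · have h3 : |2 * U x * rad x₀ G x| ≤
          (3 * c₀ ^ 2 + 4) * (U x ^ 2 + V x ^ 2 + gsq G x) := by
        have h4 : |2 * U x * rad x₀ G x| ≤ U x ^ 2 + rad x₀ G x ^ 2 := by
          rw [abs_le]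
          constructor <;> nlinarith [sq_nonneg (U x + rad x₀ G x),
            sq_nonneg (U x - rad x₀ G x)]
        nlinarith [sq_nonneg (U x), sq_nonneg (V x)]
      rw [show 2 * dErr α w w' (zz x₀ b t x) * U x * rad x₀ G x =
        dErr α w w' (zz x₀ b t x) * (2 * U x * rad x₀ G x) by ring, abs_mul]
      exact mul_le_mul e2 h3 (abs_nonneg _) hε
  · have hz := one_le_zz (x₀ := x₀) le_rfl hb hx
    simp [dErr, P.s0 _ hz, P.s1 _ hz, indicator_of_notMem hx]

end Pointwise

namespace IsState

variable {p q M c₀ α ε γ : ℝ} {w w' w'' : ℝ → ℝ} {U V : E N → ℝ} {G : Fin N → E N → ℝ}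
  {f g : ℝ → ℝ}

theorem qS_nonneg (S : IsState p x₀ b t U V G) {a : ℝ → ℝ} (h : ∀ z, 0 ≤ z → 0 ≤ a z) :
    0 ≤ qS c₀ a x₀ b t U V G :=
  nint_nonneg S.lt fun _ => mul_nonneg (sq_nonneg _) (h _ (zz_nonneg _ _ _ _))

theorem qW_nonneg (S : IsState p x₀ b t U V G) {a : ℝ → ℝ} (h : ∀ z, 0 ≤ z → 0 ≤ a z) :
    0 ≤ qW c₀ a x₀ b t U :=
  nint_nonneg S.lt fun _ => mul_nonneg (sq_nonneg _) (h _ (zz_nonneg _ _ _ _))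

theorem qP_nonneg (S : IsState p x₀ b t U V G) {a : ℝ → ℝ} (h : ∀ z, 0 ≤ z → 0 ≤ a z) :
    0 ≤ qP p c₀ a x₀ b t U :=
  nint_nonneg S.lt fun _ => mul_nonneg (Real.rpow_nonneg (abs_nonneg _) _) (h _ (zz_nonneg _ _ _ _))

theorem qG_nonneg (S : IsState p x₀ b t U V G) {a : ℝ → ℝ} (ha : IsCut a)
    (h : ∀ z, 0 ≤ z → 0 ≤ a z) : 0 ≤ qG c₀ a x₀ b t G :=
  nint_nonneg S.lt fun x => by
    rw [mul_assoc]
    exact mul_nonneg (sq_nonneg _) (pot_mul_nonneg G S.lt ha h x)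

theorem qS_le (S : IsState p x₀ b t U V G) (P : IsProfile α ε w w' w'') (hα : 0 ≤ α) :
    α * qS c₀ w x₀ b t U V G ≤ qS c₀ (dD α w w') x₀ b t U V G := by
  unfold qS
  rw [← nint_const_mul]
  refine nint_mono S.lt ((S.int_sq P.cut (S.mv c₀) _).const_mul _)
    (S.int_sq P.cut_dD (S.mv c₀) _) fun x => ?_
  rcases lt_or_ge (zz x₀ b t x) 1 with h | h
  · have := mul_le_mul_of_nonneg_left (P.dD_ge hα (zz_nonneg x₀ b t x) h).2
      (sq_nonneg ((b - t) ^ c₀ * HamzaZaag.mv c₀ x₀ b t U V G x))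
    linarith
  · rw [P.s0 _ h, P.dD_s0 _ h]; simp

/-- Young's inequality under the integral, with the constant integrated against a weight at most 1.
-/
theorem qW_le (S : IsState p x₀ b t U V G) (P : IsProfile α ε w w' w'') {x C : ℝ} (hC : 0 ≤ C)
    (h : ∀ y : ℝ, y ^ 2 ≤ x * |y| ^ (p + 1) + C) :
    qW c₀ w x₀ b t U ≤ x * qP p c₀ w x₀ b t U + C * vol1 N := by
  have h1 : qW c₀ w x₀ b t U ≤ nint b t fun y => x * (|(b - t) ^ c₀ * U y| ^ (p + 1) *
      w (zz x₀ b t y)) + C * w (zz x₀ b t y) := by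
    refine nint_mono S.lt (S.int_sq P.cut S.mU _) (((S.int_pow P.cut _).const_mul _).add
      ((int_one P.cut S.lt).const_mul _)) fun y => ?_
    have := mul_le_mul_of_nonneg_right (h ((b - t) ^ c₀ * U y)) (P.nonneg (zz x₀ b t y))
    linarith
  rw [nint_add ((S.int_pow P.cut _).const_mul _) ((int_one P.cut S.lt).const_mul _),
    nint_const_mul, nint_const_mul] at h1
  have := mul_le_mul_of_nonneg_left (nint_one_le (x₀ := x₀) P S.lt) hC
  unfold qP
  linarith

/-- The free parameter is chosen later in terms of the cut-off in time. -/
theorem abs_mom_le (S : IsState p x₀ b t U V G) (P : IsProfile α ε w w' w'')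
    (hJ : Integrable (momDens c₀ w x₀ b t U V G)) {x : ℝ} (hx : 0 < x) :
    |(b - t) ^ (2 * c₀ - N) * ∫ y, momDens c₀ w x₀ b t U V G y| ≤
      x * qS c₀ w x₀ b t U V G + 1 / (4 * x) * qW c₀ w x₀ b t U := by
  rw [nint_scaled S.lt]
  unfold qS qW
  rw [← nint_const_mul, ← nint_const_mul, ← nint_add ((S.int_sq P.cut (S.mv c₀) _).const_mul _)
    ((S.int_sq P.cut S.mU _).const_mul _)]
  refine abs_nint_le S.lt (hJ.const_mul _) (((S.int_sq P.cut (S.mv c₀) _).const_mul _).add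
    ((S.int_sq P.cut S.mU _).const_mul _)) fun y => ?_
  rw [momDens]
  generalize (b - t) ^ c₀ = R
  generalize HamzaZaag.mv c₀ x₀ b t U V G y = m
  have hw := P.nonneg (zz x₀ b t y)
  generalize w (zz x₀ b t y) = w₀ at *
  have h1 : |R ^ 2 * (U y * m * w₀)| = |R * U y| * |R * m| * w₀ := by
    simp only [abs_mul, abs_of_nonneg hw, abs_pow]
    ring
  rw [h1]
  have h2 : |R * U y| * |R * m| ≤ x * (R * m) ^ 2 + 1 / (4 * x) * (R * U y) ^ 2 := by
    rw [← sq_abs (R * m), ← sq_abs (R * U y)]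
    have h3 : 0 ≤ (2 * x * |R * m| - |R * U y|) ^ 2 / (4 * x) := by positivity
    have h4 : (2 * x * |R * m| - |R * U y|) ^ 2 / (4 * x) = x * |R * m| ^ 2 +
      1 / (4 * x) * |R * U y| ^ 2 - |R * U y| * |R * m| := by
      field_simp
      ring
    linarith
  have := mul_le_mul_of_nonneg_right h2 hw
  linarith

theorem energy_close (S : IsState p x₀ b t U V G) (P : IsProfile α ε w w' w'')
    (A : Params N p q M c₀ α γ) (L : LowerOrder q M f g) (hr1 : b - t ≤ 1)
    (hE : Integrable (engDens c₀ w (nl p f) x₀ b t U V G)) :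
    |(b - t) ^ (2 * c₀ - N) * (∫ y, engDens c₀ w (nl p f) x₀ b t U V G y) -
      (1 / 2 * (qS c₀ w x₀ b t U V G + qG c₀ w x₀ b t G + c₀ * (c₀ + 1) * qW c₀ w x₀ b t U) -
        1 / (p + 1) * qP p c₀ w x₀ b t U)| ≤
      2 * M * (b - t) ^ γ * (vol1 N + qP p c₀ w x₀ b t U) := by
  have hr : 0 < b - t := by linarith [S.lt]
  have n0 := HasNint.self (b := b) (t := t) (int_one (x₀ := x₀) P.cut S.lt)
  have n1 : HasNint b t _ (qS c₀ w x₀ b t U V G) := .self (S.int_sq P.cut (S.mv c₀) ((b - t) ^ c₀))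
  have n2 : HasNint b t _ (qG c₀ w x₀ b t G) := .self (S.int_pot P.cut (((b - t) ^ c₀) ^ 2))
  have n3 : HasNint b t _ (qW c₀ w x₀ b t U) := .self (S.int_sq P.cut S.mU ((b - t) ^ c₀))
  have n4 : HasNint b t _ (qP p c₀ w x₀ b t U) := .self (S.int_pow P.cut ((b - t) ^ c₀))
  have hV := nint_one_le (x₀ := x₀) P S.lt
  have h0 : 0 ≤ 2 * M * (b - t) ^ γ := by have := A.hM; positivity
  refine le_trans ?_ (mul_le_mul_of_nonneg_left (add_le_add_left hV _) h0)
  refine ((HasNint.scaled S.lt c₀ hE).sub ((((n1.add n2).add (n3.const_mul _)).const_mul _).sub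
    (n4.const_mul _))).abs_le ((n0.add n4).const_mul _) S.lt fun x => ?_
  have := engDens_close (U := U x) (m := HamzaZaag.mv c₀ x₀ b t U V G x) (pt := pot x₀ b t G x)
    A.hp A.hq A.hqp A.hM A.hc A.hγ A.hγ' L.hf L.hfM hr hr1 (P.nonneg (zz x₀ b t x))
  rw [engDens]
  convert this using 2
  · ring_nf
  · ring

/-- Inside the cone `engRate_le` is integrated; for z ≥ 1 all weights vanish. The cut-off error is
kept apart, as it has no factor r^γ. -/
theorem energy_rate (S : IsState p x₀ b t U V G) (P : IsProfile α ε w w' w'')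
    (A : Params N p q M c₀ α γ) (L : LowerOrder q M f g) (hr1 : b - t ≤ 1)
    (hE : Integrable (engRate c₀ α w w' (nl p f) g x₀ b t U V G)) :
    (b - t) ^ (2 * c₀ - N) * (∫ y, engRate c₀ α w w' (nl p f) g x₀ b t U V G y) ≤
      -2 * qS c₀ (dD α w w') x₀ b t U V G + qErr c₀ ε x₀ b t U V G +
      (2 * M * (3 * c₀ + 2) + M * (1 + c₀ ^ 2 + 3 / α)) * (b - t) ^ γ *
        (vol1 N + qP p c₀ w x₀ b t U + qS c₀ (dD α w w') x₀ b t U V G + qG c₀ w x₀ b t G) := by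
  have hr : 0 < b - t := by linarith [S.lt]
  have hα := A.hα
  have hM := A.hM
  have hc0 := A.hc0
  have n0 := HasNint.self (b := b) (t := t) (int_one (x₀ := x₀) P.cut S.lt)
  have n1' : HasNint b t _ (qS c₀ (dD α w w') x₀ b t U V G) :=
    .self (S.int_sq P.cut_dD (S.mv c₀) ((b - t) ^ c₀))
  have n2 : HasNint b t _ (qG c₀ w x₀ b t G) := .self (S.int_pot P.cut (((b - t) ^ c₀) ^ 2))
  have n4 : HasNint b t _ (qP p c₀ w x₀ b t U) := .self (S.int_pow P.cut ((b - t) ^ c₀))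
  have iN : IntegrableOn (fun x => U x ^ 2 + V x ^ 2 + gsq G x) (Metric.closedBall x₀ (b - t)) :=
    (S.mU.integrable_sq.add S.mV.integrable_sq).add
      (integrable_finsetSum _ fun i _ => (S.mG i).integrable_sq)
  have hB := Metric.isClosed_closedBall (x := x₀) (ε := b - t) |>.measurableSet
  have i5 := (integrable_indicator_iff hB).2 ((iN.const_mul (3 * c₀ ^ 2 + 4)).const_mul ε)
  set Z : E N → ℝ := (Metric.closedBall x₀ (b - t)).indicator
    (fun x => ε * ((3 * c₀ ^ 2 + 4) * (U x ^ 2 + V x ^ 2 + gsq G x))) with hZ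
  have eZ : HasNint b t (fun x => ((b - t) ^ c₀) ^ 2 * Z x) (qErr c₀ ε x₀ b t U V G) := by
    have := HasNint.scaled S.lt c₀ i5
    rwa [integral_indicator hB, integral_const_mul, integral_const_mul] at this
  set C := 2 * M * (3 * c₀ + 2) + M * (1 + c₀ ^ 2 + 3 / α) with hCd
  have hC : 0 ≤ C := by positivity
  have hV := nint_one_le (x₀ := x₀) P S.lt
  have h0 : 0 ≤ C * (b - t) ^ γ := by positivity
  refine le_trans ?_ (add_le_add_right (mul_le_mul_of_nonneg_left
    (add_le_add_left (add_le_add_left (add_le_add_left hV _) _) _) h0) _)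
  refine (HasNint.scaled S.lt c₀ hE).le (((n1'.const_mul _).add eZ).add
    ((((n0.add n4).add n1').add n2).const_mul _)) S.lt fun x => ?_
  rcases lt_or_ge (zz x₀ b t x) 1 with h | h
  · have hz0 := zz_nonneg x₀ b t x
    obtain ⟨d1, d2⟩ := P.dD_ge hα.le hz0 h
    have := engRate_le (U := U x) (V := V x) (A := HamzaZaag.rad x₀ G x)
      (e := dErr α w w' (zz x₀ b t x))
      A.hp A.hq A.hqp A.hM A.hc A.hc0 hα A.hγ A.hγ' L.hf L.hfM L.hgM hr hr1
      (show HamzaZaag.mv c₀ x₀ b t U V G x = _ from rfl) h (P.nonneg _) d1 d2 (pot_ge G S.lt x h)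
    rw [← hCd] at this
    have hz := mul_le_mul_of_nonneg_left ((le_abs_self _).trans
      (cut_errors (c₀ := c₀) (x₀ := x₀) U V G P S.lt hr1 x).1) (sq_nonneg ((b - t) ^ c₀))
    rw [← hZ] at hz
    rw [engRate]
    linarith
  · have hz1 := P.cut_dErr.s0 _ h
    have h1 : 0 ≤ Z x := (abs_nonneg _).trans (cut_errors (c₀ := c₀) (x₀ := x₀) U V G P S.lt hr1 x).1
    have h2 : 0 ≤ ((b - t) ^ c₀) ^ 2 * Z x := mul_nonneg (sq_nonneg _) h1
    rw [engRate, P.s0 _ h, P.dD_s0 _ h, hz1]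
    simpa using h2

/-- Integration of `momRate_ge`. The quantities with the weight αω - zω' applied to w² are left for
the Hardy inequality. -/
theorem momentum_rate (S : IsState p x₀ b t U V G) (P : IsProfile α ε w w' w'')
    (A : Params N p q M c₀ α γ) (L : LowerOrder q M f g) (hr1 : b - t ≤ 1)
    (hJ : Integrable (momRate c₀ α w w' (nl p f) g x₀ b t U V G)) {δ : ℝ} (hδ : 0 < δ) :
    qS c₀ w x₀ b t U V G - qG c₀ w x₀ b t G - c₀ * (c₀ + 1) * qW c₀ w x₀ b t U +
      qP p c₀ w x₀ b t U -
      δ * (qG c₀ w x₀ b t G + qW c₀ w x₀ b t U + qW c₀ (dD α w w') x₀ b t U) -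
      (1 / (α * δ) + (2 * c₀ + 1) ^ 2 / (4 * δ * α) + 4 / δ) * qS c₀ (dD α w w') x₀ b t U V G -
      qErr c₀ ε x₀ b t U V G -
      (2 * M + M * (2 + c₀ + 1 / α)) * (b - t) ^ γ *
        (vol1 N + qP p c₀ w x₀ b t U + qS c₀ (dD α w w') x₀ b t U V G + qG c₀ w x₀ b t G +
          qW c₀ (dD α w w') x₀ b t U) ≤
    (b - t) ^ (2 * c₀ - N) * (∫ y, momRate c₀ α w w' (nl p f) g x₀ b t U V G y) := by
  have hr : 0 < b - t := by linarith [S.lt]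
  have hα := A.hα
  have hM := A.hM
  have hc0 := A.hc0
  have n0 := HasNint.self (b := b) (t := t) (int_one (x₀ := x₀) P.cut S.lt)
  have n1 : HasNint b t _ (qS c₀ w x₀ b t U V G) := .self (S.int_sq P.cut (S.mv c₀) ((b - t) ^ c₀))
  have n1' : HasNint b t _ (qS c₀ (dD α w w') x₀ b t U V G) :=
    .self (S.int_sq P.cut_dD (S.mv c₀) ((b - t) ^ c₀))
  have n2 : HasNint b t _ (qG c₀ w x₀ b t G) := .self (S.int_pot P.cut (((b - t) ^ c₀) ^ 2))
  have n3 : HasNint b t _ (qW c₀ w x₀ b t U) := .self (S.int_sq P.cut S.mU ((b - t) ^ c₀))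
  have n3' : HasNint b t _ (qW c₀ (dD α w w') x₀ b t U) :=
    .self (S.int_sq P.cut_dD S.mU ((b - t) ^ c₀))
  have n4 : HasNint b t _ (qP p c₀ w x₀ b t U) := .self (S.int_pow P.cut ((b - t) ^ c₀))
  have iN : IntegrableOn (fun x => U x ^ 2 + V x ^ 2 + gsq G x) (Metric.closedBall x₀ (b - t)) :=
    (S.mU.integrable_sq.add S.mV.integrable_sq).add
      (integrable_finsetSum _ fun i _ => (S.mG i).integrable_sq)
  have hB := Metric.isClosed_closedBall (x := x₀) (ε := b - t) |>.measurableSet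
  have i5 := (integrable_indicator_iff hB).2 ((iN.const_mul (3 * c₀ ^ 2 + 4)).const_mul ε)
  set Z : E N → ℝ := (Metric.closedBall x₀ (b - t)).indicator
    (fun x => ε * ((3 * c₀ ^ 2 + 4) * (U x ^ 2 + V x ^ 2 + gsq G x))) with hZ
  have eZ : HasNint b t (fun x => ((b - t) ^ c₀) ^ 2 * Z x) (qErr c₀ ε x₀ b t U V G) := by
    have := HasNint.scaled S.lt c₀ i5
    rwa [integral_indicator hB, integral_const_mul, integral_const_mul] at this
  set C := 2 * M + M * (2 + c₀ + 1 / α) with hCd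
  set C' := 1 / (α * δ) + (2 * c₀ + 1) ^ 2 / (4 * δ * α) + 4 / δ with hCd'
  have hC : 0 ≤ C := by positivity
  have hV := nint_one_le (x₀ := x₀) P S.lt
  have h0 : 0 ≤ C * (b - t) ^ γ := by positivity
  refine le_trans (sub_le_sub_left (mul_le_mul_of_nonneg_left
    (add_le_add_left (add_le_add_left (add_le_add_left (add_le_add_left hV _) _) _) _) h0) _) ?_
  refine HasNint.le (((((((n1.sub n2).sub (n3.const_mul _)).add n4).sub
    (((n2.add n3).add n3').const_mul _)).sub (n1'.const_mul _)).sub eZ).sub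
    (((((n0.add n4).add n1').add n2).add n3').const_mul _)) (HasNint.scaled S.lt c₀ hJ) S.lt
    fun x => ?_
  rcases lt_or_ge (zz x₀ b t x) 1 with h | h
  · have hz0 := zz_nonneg x₀ b t x
    obtain ⟨d1, d2⟩ := P.dD_ge hα.le hz0 h
    have := momRate_ge (U := U x) (V := V x) (A := HamzaZaag.rad x₀ G x) (f := f) (g := g)
      (e := dErr α w w' (zz x₀ b t x))
      A.hp A.hq A.hqp A.hM A.hc A.hc0 hα A.hγ A.hγ' L.hfM L.hgM hr hr1
      (show HamzaZaag.mv c₀ x₀ b t U V G x = _ from rfl) h (P.nonneg _) d1 d2 (pot_ge G S.lt x h) hδ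
    rw [← hCd, ← hCd'] at this
    have hz := mul_le_mul_of_nonneg_left ((neg_le_abs _).trans
      (cut_errors (c₀ := c₀) (x₀ := x₀) U V G P S.lt hr1 x).2) (sq_nonneg ((b - t) ^ c₀))
    rw [← hZ] at hz
    rw [momRate]
    linarith
  · have hz1 := P.cut_dErr.s0 _ h
    have h1 : 0 ≤ Z x := (abs_nonneg _).trans (cut_errors (c₀ := c₀) (x₀ := x₀) U V G P S.lt hr1 x).1
    have h2 : 0 ≤ ((b - t) ^ c₀) ^ 2 * Z x := mul_nonneg (sq_nonneg _) h1
    rw [momRate, P.s0 _ h, P.dD_s0 _ h, hz1]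
    simpa using h2

/-- A Hardy inequality. -/
theorem hardy (S : IsState p x₀ b t U V G) (P : IsProfile α ε w w' w'') (hα : 0 < α)
    (hH : HasInt (fun x => (b - t) ^ (2 * c₀ - N) * (N * w (zz x₀ b t x) + 2 * zz x₀ b t x *
      w' (zz x₀ b t x)) * U x ^ 2 + 2 * (b - t) ^ (2 * c₀ - N) * w (zz x₀ b t x) * U x *
        HamzaZaag.rad x₀ G x) 0) :
    qW c₀ (dD α w w') x₀ b t U ≤
      (2 * α + N) * qW c₀ w x₀ b t U + 1 / α * qG c₀ w x₀ b t G := by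
  have hr : 0 < b - t := by linarith [S.lt]
  have n2 : HasNint b t _ (qG c₀ w x₀ b t G) := .self (S.int_pot P.cut (((b - t) ^ c₀) ^ 2))
  have n3 : HasNint b t _ (qW c₀ w x₀ b t U) := .self (S.int_sq P.cut S.mU ((b - t) ^ c₀))
  have n3' : HasNint b t _ (qW c₀ (dD α w w') x₀ b t U) :=
    .self (S.int_sq P.cut_dD S.mU ((b - t) ^ c₀))
  have hr0 := (Real.rpow_pos_of_pos hr (-(N : ℝ))).ne'
  have hI : Integrable (fun x => ((b - t) ^ c₀) ^ 2 * ((N * w (zz x₀ b t x) + 2 * zz x₀ b t x *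
      w' (zz x₀ b t x)) * U x ^ 2 + 2 * w (zz x₀ b t x) * U x * HamzaZaag.rad x₀ G x)) ∧
      nint b t (fun x => ((b - t) ^ c₀) ^ 2 * ((N * w (zz x₀ b t x) + 2 * zz x₀ b t x *
      w' (zz x₀ b t x)) * U x ^ 2 + 2 * w (zz x₀ b t x) * U x * HamzaZaag.rad x₀ G x)) = 0 := by
    refine (hH.congr fun x => ?_).mul_cancel hr0
    rw [rpow_two_sub S.lt]
    ring
  have key : qW c₀ (dD α w w') x₀ b t U ≤ (2 * α + N) * qW c₀ w x₀ b t U +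
      1 / α * qG c₀ w x₀ b t G - 0 := by
    refine n3'.le (((n3.const_mul _).add (n2.const_mul _)).sub ⟨hI.1, hI.2⟩) S.lt fun x => ?_
    rcases lt_or_ge (zz x₀ b t x) 1 with h | h
    · have hz0 := zz_nonneg x₀ b t x
      obtain ⟨d1, d2⟩ := P.dD_ge hα.le hz0 h
      -- The null identity reads 2∫DU² = (2α+N)∫ωU² + 2∫ωU X·∇U with D = αω - zω'. The choice θ =
      -- 1/α bounds the last term by ∫DU² plus the gradient term, and half of the left side remains.
      have := cross_le (X := U x) (Y := HamzaZaag.rad x₀ G x) hα (by positivity : 0 < 1 / α) h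
        (P.nonneg _) d1 (pot_ge G S.lt x h)
      rw [show α * (1 / α) = 1 by field_simp, div_one] at this
      have h2 : 2 * w (zz x₀ b t x) * U x * HamzaZaag.rad x₀ G x ≤
          2 * |U x| * |HamzaZaag.rad x₀ G x| * w (zz x₀ b t x) := by
        have h3 := le_abs_self (U x * HamzaZaag.rad x₀ G x)
        rw [abs_mul] at h3
        have := mul_le_mul_of_nonneg_right h3 (P.nonneg (zz x₀ b t x))
        linarith
      have h4 := mul_le_mul_of_nonneg_left (h2.trans this) (sq_nonneg ((b - t) ^ c₀))
      simp only [dD] at h4 ⊢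
      linarith
    · rw [P.s0 _ h, P.dD_s0 _ h, P.s1 _ h]
      simp
  rw [sub_zero] at key
  exact key

end IsState

end

end HamzaZaag

/-! ### Solutions in truncated light cones. -/

namespace HamzaZaag

noncomputable section

variable {N : ℕ} {x₀ : E N} {b t : ℝ}

section Congr

variable {α ε c₀ : ℝ} {w w' w'' s g : ℝ → ℝ} {U V U' V' : E N → ℝ} {G G' : Fin N → E N → ℝ}

/-- All densities vanish for z ≥ 1, so a solution and its cut-off, which agree on the section of the
cone, have equal densities. -/
theorem eq_of_eqOn_cone (hb : t < b) {F F' : E N → ℝ}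
    (h : ∀ x ∈ Metric.closedBall x₀ (b - t), F x = F' x)
    (h1 : ∀ x, 1 ≤ zz x₀ b t x → F x = 0) (h2 : ∀ x, 1 ≤ zz x₀ b t x → F' x = 0) : F = F' := by
  funext x
  by_cases hx : x ∈ Metric.closedBall x₀ (b - t)
  · exact h x hx
  · have := one_le_zz (x₀ := x₀) le_rfl hb hx
    rw [h1 x this, h2 x this]

theorem rad_congr {x : E N} (h : ∀ i, G i x = G' i x) : rad x₀ G x = rad x₀ G' x := by
  simp only [rad, h]

theorem gsq_congr {x : E N} (h : ∀ i, G i x = G' i x) : gsq G x = gsq G' x := by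
  simp only [gsq, h]

theorem engDens_congr (P : IsProfile α ε w w' w'') (hb : t < b)
    (hU : ∀ x ∈ Metric.closedBall x₀ (b - t), U x = U' x)
    (hV : ∀ x ∈ Metric.closedBall x₀ (b - t), V x = V' x)
    (hG : ∀ x ∈ Metric.closedBall x₀ (b - t), ∀ i, G i x = G' i x) :
    engDens c₀ w s x₀ b t U V G = engDens c₀ w s x₀ b t U' V' G' :=
  eq_of_eqOn_cone (x₀ := x₀) hb (fun x hx => by
    simp only [engDens, mv, pot, hU x hx, hV x hx, rad_congr (hG x hx), gsq_congr (hG x hx)])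
    (fun x hx => by simp [engDens, P.s0 _ hx]) (fun x hx => by simp [engDens, P.s0 _ hx])

theorem momDens_congr (P : IsProfile α ε w w' w'') (hb : t < b)
    (hU : ∀ x ∈ Metric.closedBall x₀ (b - t), U x = U' x)
    (hV : ∀ x ∈ Metric.closedBall x₀ (b - t), V x = V' x)
    (hG : ∀ x ∈ Metric.closedBall x₀ (b - t), ∀ i, G i x = G' i x) :
    momDens c₀ w x₀ b t U V G = momDens c₀ w x₀ b t U' V' G' :=
  eq_of_eqOn_cone (x₀ := x₀) hb (fun x hx => by
    simp only [momDens, mv, hU x hx, hV x hx, rad_congr (hG x hx)])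
    (fun x hx => by simp [momDens, P.s0 _ hx]) (fun x hx => by simp [momDens, P.s0 _ hx])

theorem engRate_congr (P : IsProfile α ε w w' w'') (hb : t < b)
    (hU : ∀ x ∈ Metric.closedBall x₀ (b - t), U x = U' x)
    (hV : ∀ x ∈ Metric.closedBall x₀ (b - t), V x = V' x)
    (hG : ∀ x ∈ Metric.closedBall x₀ (b - t), ∀ i, G i x = G' i x) :
    engRate c₀ α w w' s g x₀ b t U V G = engRate c₀ α w w' s g x₀ b t U' V' G' :=
  eq_of_eqOn_cone (x₀ := x₀) hb (fun x hx => by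
    simp only [engRate, mv, hU x hx, hV x hx, rad_congr (hG x hx)])
    (fun x hx => by simp [engRate, dErr, P.dD_s0 _ hx, P.s0 _ hx, P.s1 _ hx])
    (fun x hx => by simp [engRate, dErr, P.dD_s0 _ hx, P.s0 _ hx, P.s1 _ hx])

theorem momRate_congr (P : IsProfile α ε w w' w'') (hb : t < b)
    (hU : ∀ x ∈ Metric.closedBall x₀ (b - t), U x = U' x)
    (hV : ∀ x ∈ Metric.closedBall x₀ (b - t), V x = V' x)
    (hG : ∀ x ∈ Metric.closedBall x₀ (b - t), ∀ i, G i x = G' i x) :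
    momRate c₀ α w w' s g x₀ b t U V G = momRate c₀ α w w' s g x₀ b t U' V' G' :=
  eq_of_eqOn_cone (x₀ := x₀) hb (fun x hx => by
    simp only [momRate, mv, pot, hU x hx, hV x hx, rad_congr (hG x hx), gsq_congr (hG x hx)])
    (fun x hx => by simp [momRate, dErr, P.dD_s0 _ hx, P.s0 _ hx, P.s1 _ hx])
    (fun x hx => by simp [momRate, dErr, P.dD_s0 _ hx, P.s0 _ hx, P.s1 _ hx])

end Congr

/-- The coordinates of the gradient. -/
def gco {N : ℕ} (G : ℝ → E N → E N) (t : ℝ) (i : Fin N) (x : E N) : ℝ := G t x i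

/-- The energy in the section at time `t` of the backward light cone of `(x₀, b)`. -/
def eng {N : ℕ} (c₀ : ℝ) (w s : ℝ → ℝ) (x₀ : E N) (b : ℝ) (u v : ℝ → E N → ℝ)
    (G : ℝ → E N → E N) (t : ℝ) : ℝ :=
  (b - t) ^ (2 * c₀ - N) * ∫ x, engDens c₀ w s x₀ b t (u t) (v t) (gco G t) x

/-- The functional `∫ w ∂ₛw ρ` at time `t`. -/
def mom {N : ℕ} (c₀ : ℝ) (w : ℝ → ℝ) (x₀ : E N) (b : ℝ) (u v : ℝ → E N → ℝ)
    (G : ℝ → E N → E N) (t : ℝ) : ℝ :=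
  (b - t) ^ (2 * c₀ - N) * ∫ x, momDens c₀ w x₀ b t (u t) (v t) (gco G t) x

/-- The derivative of the energy with respect to `-log (b - t)`. -/
def engD {N : ℕ} (c₀ α : ℝ) (w w' s g : ℝ → ℝ) (x₀ : E N) (b : ℝ) (u v : ℝ → E N → ℝ)
    (G : ℝ → E N → E N) (t : ℝ) : ℝ :=
  (b - t) ^ (2 * c₀ - N) * ∫ x, engRate c₀ α w w' s g x₀ b t (u t) (v t) (gco G t) x

/-- The derivative of `mom` with respect to `-log (b - t)`. -/
def momD {N : ℕ} (c₀ α : ℝ) (w w' s g : ℝ → ℝ) (x₀ : E N) (b : ℝ) (u v : ℝ → E N → ℝ)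
    (G : ℝ → E N → E N) (t : ℝ) : ℝ :=
  (b - t) ^ (2 * c₀ - N) * ∫ x, momRate c₀ α w w' s g x₀ b t (u t) (v t) (gco G t) x

/-- Regularity of a solution in a truncated light cone at the time `t`. -/
structure ConeAt {N : ℕ} (p c₀ : ℝ) (f w w' : ℝ → ℝ) (x₀ : E N) (b : ℝ) (u v : ℝ → E N → ℝ)
    (G : ℝ → E N → E N) (t : ℝ) : Prop where
  state : IsState p x₀ b t (u t) (v t) (gco G t)
  hardy : HasInt (fun x => (b - t) ^ (2 * c₀ - N) * (N * w (zz x₀ b t x) + 2 * zz x₀ b t x *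
      w' (zz x₀ b t x)) * u t x ^ 2 + 2 * (b - t) ^ (2 * c₀ - N) * w (zz x₀ b t x) * u t x *
        rad x₀ (gco G t) x) 0
  eng : Integrable (engDens c₀ w (nl p f) x₀ b t (u t) (v t) (gco G t))
  mom : Integrable (momDens c₀ w x₀ b t (u t) (v t) (gco G t))

/-- The evolution of the energy and of `mom` in a truncated light cone. -/
structure ConeEvol {N : ℕ} (p c₀ α : ℝ) (f g w w' : ℝ → ℝ) (x₀ : E N) (b : ℝ) (u v : ℝ → E N → ℝ)
    (G : ℝ → E N → E N) (t₁ t₂ : ℝ) : Prop where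
  le : t₁ ≤ t₂
  cone : ∀ t ∈ Icc t₁ t₂, ConeAt p c₀ f w w' x₀ b u v G t
  rate : ∀ᵐ t ∂(volume.restrict (Ioc t₁ t₂)),
    Integrable (engRate c₀ α w w' (nl p f) g x₀ b t (u t) (v t) (gco G t)) ∧
    Integrable (momRate c₀ α w w' (nl p f) g x₀ b t (u t) (v t) (gco G t))
  eng : Incr t₁ t₂ (eng c₀ w (nl p f) x₀ b u v G)
    (fun t => (b - t)⁻¹ * engD c₀ α w w' (nl p f) g x₀ b u v G t)
  mom : Incr t₁ t₂ (mom c₀ w x₀ b u v G)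
    (fun t => (b - t)⁻¹ * momD c₀ α w w' (nl p f) g x₀ b u v G t)
  bdd : ∃ C : ℝ, ∀ t ∈ Icc t₁ t₂, qN x₀ b t (u t) (v t) (gco G t) ≤ C

theorem ConeEvol.trans {p c₀ α : ℝ} {f g w w' : ℝ → ℝ} {u v : ℝ → E N → ℝ} {G : ℝ → E N → E N}
    {t₁ t₂ t₃ : ℝ} (h : ConeEvol p c₀ α f g w w' x₀ b u v G t₁ t₂)
    (h' : ConeEvol p c₀ α f g w w' x₀ b u v G t₂ t₃) :
    ConeEvol p c₀ α f g w w' x₀ b u v G t₁ t₃ where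
  le := h.le.trans h'.le
  cone t ht := by
    rcases le_total t t₂ with h1 | h1
    · exact h.cone t ⟨ht.1, h1⟩
    · exact h'.cone t ⟨h1, ht.2⟩
  rate := by
    rw [← Ioc_union_Ioc_eq_Ioc h.le h'.le, ae_restrict_union_iff]
    exact ⟨h.rate, h'.rate⟩
  eng := h.eng.trans h'.eng
  mom := h.mom.trans h'.mom
  bdd := by
    obtain ⟨C, hC⟩ := h.bdd
    obtain ⟨C', hC'⟩ := h'.bdd
    refine ⟨max C C', fun t ht => ?_⟩
    rcases le_total t t₂ with h1 | h1
    · exact (hC t ⟨ht.1, h1⟩).trans (le_max_left _ _)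
    · exact (hC' t ⟨h1, ht.2⟩).trans (le_max_right _ _)

/-- T is 1-Lipschitz, so it exceeds T(x₀) - r on the ball. -/
theorem slice_ball {T : E N → ℝ} (hT : LipschitzWith 1 T) {r τ : ℝ} (h : r + τ < T x₀) :
    Metric.closedBall x₀ r ⊆ slice T τ := by
  intro x hx
  have h1 := hT.dist_le_mul x₀ x
  rw [Metric.mem_closedBall, dist_comm] at hx
  simp only [NNReal.coe_one, one_mul, Real.dist_eq] at h1
  have := le_abs_self (T x₀ - T x)
  show τ < T x
  linarith

theorem setIntegral_sq_le {K B : Set (E N)} (hB : MeasurableSet B)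
    (hBK : B ⊆ K) {h : E N → ℝ} (hm : MemLp (K.indicator h) 2 volume) {C : ℝ}
    (hC : nrm (K.indicator h) ≤ C) : ∫ x in B, h x ^ 2 ≤ C ^ 2 := by
  have h1 : ∫ x in B, h x ^ 2 = ∫ x in B, K.indicator h x ^ 2 :=
    setIntegral_congr_fun hB fun x hx => by simp only [indicator_of_mem (hBK hx)]
  have h2 : ∫ x in B, K.indicator h x ^ 2 ≤ ∫ x, K.indicator h x ^ 2 :=
    setIntegral_le_integral hm.integrable_sq (Eventually.of_forall fun x => sq_nonneg _)
  have h3 : ∫ x, K.indicator h x ^ 2 = nrm (K.indicator h) ^ 2 := by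
    have h4 := eLpNorm_two_sq (K.indicator h)
    rw [nrm, ← ENNReal.toReal_pow, h4, integral_eq_lintegral_of_nonneg_ae
      (Eventually.of_forall fun x => sq_nonneg _) hm.integrable_sq.1]
    congr 1
    refine lintegral_congr fun x => ?_
    rw [← sq_abs, ENNReal.ofReal_pow (abs_nonneg _), ← Real.norm_eq_abs, ofReal_norm]
  rw [h1]
  refine h2.trans ?_
  rw [h3]
  exact pow_le_pow_left₀ (nrm_nonneg _) hC 2

namespace IsSolution

variable {p q M c₀ α γ ε : ℝ} {f g : ℝ → ℝ} {u₀ u₁ : E N → ℝ} {T : E N → ℝ}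
  {u v : ℝ → E N → ℝ} {G : ℝ → E N → E N} {w w' w'' : ℝ → ℝ}

/-- The integral of `|u|^{p+1}` is bounded, locally in the domain. -/
theorem exists_power_bound (S : IsSolution p f g u₀ u₁ T u v G) (hp : 1 < p) (hq : 0 ≤ q)
    (hqp : q < p) (hM : 0 < M) (L : LowerOrder q M f g) {t₁ t₂ r r' : ℝ} (h0 : 0 ≤ t₁)
    (h12 : t₁ < t₂) (hr : 0 < r) (hrr : r < r') (hK : Metric.closedBall x₀ r' ⊆ slice T t₂) :
    ∃ C : ℝ, ∀ t ∈ Icc t₁ t₂, IntegrableOn (fun x => |u t x| ^ (p + 1)) (Metric.closedBall x₀ r) ∧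
      ∫ x in Metric.closedBall x₀ r, |u t x| ^ (p + 1) ≤ C := by
  obtain ⟨C, hC0, hC⟩ := exists_rpow_le hq hqp hM.le (by norm_num : (0 : ℝ) < 1 / 2)
  have hτ : 0 ≤ t₂ := h0.trans h12.le
  have hKc := isCompact_closedBall x₀ r'
  obtain ⟨β, hβ, hF⟩ := S.isFam_rpow hp hM hC0 hC L.hfM L.hgM L.hf L.hg hτ hKc hK
  have W := (S.lwave hp L.hf L.hg hτ hKc hK (O := Metric.ball x₀ r')
    Metric.ball_subset_closedBall).restrict h0 h12.le le_rfl
  -- The cut-off must be 1 on the smaller ball and supported strictly inside the larger one, where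
  -- the localised equation holds.
  let χ : ContDiffBump x₀ := ⟨r, (r + r') / 2, hr, by linarith⟩
  obtain ⟨D, hD⟩ := W.power_bound h12 hp (hβ.mono_set (Ioc_subset_Ioc_left h0))
    (hF.mono h0 le_rfl) (isCompact_closedBall x₀ ((r + r') / 2)) Metric.isOpen_ball
    (Metric.closedBall_subset_ball (by linarith)) χ.contDiff (by rw [χ.tsupport_eq])
    (fun x => χ.nonneg) (fun x => χ.le_one) (K' := Metric.closedBall x₀ r)
    Metric.isClosed_closedBall.measurableSet (fun x hx => χ.one_of_mem_closedBall hx)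
  have hsub : Metric.closedBall x₀ r ⊆ Metric.closedBall x₀ r' :=
    Metric.closedBall_subset_closedBall hrr.le
  have hB := Metric.isClosed_closedBall (x := x₀) (ε := r) |>.measurableSet
  refine ⟨D, fun t ht => ?_⟩
  have e : EqOn (fun x => |(Metric.closedBall x₀ r').indicator (u t) x| ^ (p + 1))
      (fun x => |u t x| ^ (p + 1)) (Metric.closedBall x₀ r) := fun x hx => by
    simp only [indicator_of_mem (hsub hx)]
  obtain ⟨h1, h2⟩ := hD t ht
  exact ⟨h1.congr_fun e hB, (setIntegral_congr_fun hB e) ▸ h2⟩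

/-- The identities live in a cylinder, which has to contain the wide section at t₁ and still be in
the domain at t₂. With δ = T(x₀) - b, times at most δ/4 apart and the radius b - t₁ + δ/2, one has
radius + t₂ ≤ b + 3δ/4 < T(x₀). -/
theorem coneEvol_short (S : IsSolution p f g u₀ u₁ T u v G) (A : Params N p q M c₀ α γ)
    (L : LowerOrder q M f g) (P : IsProfile α ε w w' w'') {t₁ t₂ : ℝ}
    (h0 : 0 ≤ t₁) (h12 : t₁ < t₂) (h2b : t₂ < b) (hsh : t₂ - t₁ ≤ (T x₀ - b) / 4) :
    ConeEvol p c₀ α f g w w' x₀ b u v G t₁ t₂ := by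
  set δ := T x₀ - b with hδ
  have hδ0 : 0 < δ := by linarith
  have hp := A.hp
  have hτ : 0 ≤ t₂ := h0.trans h12.le
  have hKc := isCompact_closedBall x₀ (b - t₁ + δ / 2)
  have hKs : Metric.closedBall x₀ (b - t₁ + δ / 2) ⊆ slice T t₂ := slice_ball S.T_lip (by linarith)
  have hKO : Metric.closedBall x₀ (b - t₁) ⊆ Metric.ball x₀ (b - t₁ + δ / 4) :=
    Metric.closedBall_subset_ball (by linarith)
  have hOK : Metric.ball x₀ (b - t₁ + δ / 4) ⊆ Metric.closedBall x₀ (b - t₁ + δ / 2) :=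
    Metric.ball_subset_closedBall.trans (Metric.closedBall_subset_closedBall (by linarith))
  obtain ⟨C, hC0, hC⟩ := exists_rpow_le A.hq A.hqp A.hM.le (by norm_num : (0 : ℝ) < 1 / 2)
  obtain ⟨β, hβ, hF⟩ := S.isFam_rpow hp A.hM hC0 hC L.hfM L.hgM L.hf L.hg hτ hKc hKs
  have W := (S.lwave hp L.hf L.hg hτ hKc hKs hOK).restrict h0 h12.le le_rfl
  obtain ⟨D, hD⟩ := S.exists_power_bound hp A.hq A.hqp A.hM L h0 h12
    (by linarith : 0 < b - t₁) (by linarith : b - t₁ < b - t₁ + δ / 2) hKs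
  set K := Metric.closedBall x₀ (b - t₁ + δ / 2) with hK
  have hsub : Metric.closedBall x₀ (b - t₁) ⊆ K := hKO.trans hOK
  have hB := Metric.isClosed_closedBall (x := x₀) (ε := b - t₁) |>.measurableSet
  have hsubt : ∀ t ∈ Icc t₁ t₂, Metric.closedBall x₀ (b - t) ⊆ Metric.closedBall x₀ (b - t₁) :=
    fun t ht => Metric.closedBall_subset_closedBall (by linarith [ht.1])
  have ind : ∀ (h : E N → ℝ), ∀ t ∈ Icc t₁ t₂, ∀ x ∈ Metric.closedBall x₀ (b - t),
      K.indicator h x = h x := fun h t ht x hx => indicator_of_mem (hsub (hsubt t ht hx)) _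
  have hM' : ∀ t ∈ Icc t₁ t₂, IntegrableOn (fun x => |K.indicator (u t) x| ^ (p + 1))
      (Metric.closedBall x₀ (b - t₁)) ∧
      ∫ x in Metric.closedBall x₀ (b - t₁), |K.indicator (u t) x| ^ (p + 1) ≤ D := by
    intro t ht
    have e : EqOn (fun x => |u t x| ^ (p + 1))
        (fun x => |K.indicator (u t) x| ^ (p + 1)) (Metric.closedBall x₀ (b - t₁)) := fun x hx => by
      simp only [indicator_of_mem (hsub hx)]
    obtain ⟨h1, h2⟩ := hD t ht
    exact ⟨h1.congr_fun e hB, (setIntegral_congr_fun hB e) ▸ h2⟩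
  have hh : ∀ t ∈ Icc t₁ t₂, ∀ x ∈ Metric.closedBall x₀ (b - t₁),
      K.indicator (fun x => source p f g (u t x) (v t x)) x =
        nl p f (K.indicator (u t) x) + g (K.indicator (v t) x) := by
    intro t ht x hx
    simp only [indicator_of_mem (hsub hx)]
    rfl
  obtain ⟨e1, e2, e3⟩ := W.energy_evolution Metric.isOpen_ball h2b hKO P A.hαc
    (by linarith : 0 ≤ p) (by linarith [A.hM] : 0 ≤ 1 + 2 * M) (nl_cont hp L.hf)
    (nl_growth hp A.hq A.hqp A.hM L.hfM) (hβ.mono_set (Ioc_subset_Ioc_left h0))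
    (hF.mono h0 le_rfl) hM' hh
  obtain ⟨m1, m2, m3⟩ := W.momentum_evolution Metric.isOpen_ball h2b hKO P A.hαc hh
  have cE : ∀ t ∈ Icc t₁ t₂, engDens c₀ w (nl p f) x₀ b t (K.indicator (u t)) (K.indicator (v t))
      (fun i => K.indicator (fun x => G t x i)) =
      engDens c₀ w (nl p f) x₀ b t (u t) (v t) (gco G t) := fun t ht =>
    engDens_congr P (ht.2.trans_lt h2b) (ind _ t ht) (ind _ t ht) fun x hx i => ind _ t ht x hx
  have cJ : ∀ t ∈ Icc t₁ t₂, momDens c₀ w x₀ b t (K.indicator (u t)) (K.indicator (v t))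
      (fun i => K.indicator (fun x => G t x i)) =
      momDens c₀ w x₀ b t (u t) (v t) (gco G t) := fun t ht =>
    momDens_congr P (ht.2.trans_lt h2b) (ind _ t ht) (ind _ t ht) fun x hx i => ind _ t ht x hx
  have cE' : ∀ t ∈ Icc t₁ t₂, engRate c₀ α w w' (nl p f) g x₀ b t (K.indicator (u t))
      (K.indicator (v t)) (fun i => K.indicator (fun x => G t x i)) =
      engRate c₀ α w w' (nl p f) g x₀ b t (u t) (v t) (gco G t) := fun t ht =>
    engRate_congr P (ht.2.trans_lt h2b) (ind _ t ht) (ind _ t ht) fun x hx i => ind _ t ht x hx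
  have cJ' : ∀ t ∈ Icc t₁ t₂, momRate c₀ α w w' (nl p f) g x₀ b t (K.indicator (u t))
      (K.indicator (v t)) (fun i => K.indicator (fun x => G t x i)) =
      momRate c₀ α w w' (nl p f) g x₀ b t (u t) (v t) (gco G t) := fun t ht =>
    momRate_congr P (ht.2.trans_lt h2b) (ind _ t ht) (ind _ t ht) fun x hx i => ind _ t ht x hx
  have rp : ∀ t ∈ Icc t₁ t₂, ∀ y : ℝ, (b - t) ^ (2 * c₀ - N - 1) * y =
      (b - t)⁻¹ * ((b - t) ^ (2 * c₀ - N) * y) := by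
    intro t ht y
    have : 0 < b - t := by linarith [ht.2]
    rw [Real.rpow_sub_one this.ne']
    ring
  refine ⟨h12.le, fun t ht => ⟨⟨ht.2.trans_lt h2b, ?_, ?_, ?_, ?_⟩, ?_, ?_, ?_⟩, ?_, ?_, ?_, ?_⟩
  · exact S.cont_u.memLp t (h0.trans ht.1) _ (isCompact_closedBall _ _)
      (slice_ball S.T_lip (by linarith)) t ⟨h0.trans ht.1, le_rfl⟩
  · exact S.cont_v.memLp t (h0.trans ht.1) _ (isCompact_closedBall _ _)
      (slice_ball S.T_lip (by linarith)) t ⟨h0.trans ht.1, le_rfl⟩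
  · exact fun i => (S.cont_G.coord i).memLp t (h0.trans ht.1) _ (isCompact_closedBall _ _)
      (slice_ball S.T_lip (by linarith)) t ⟨h0.trans ht.1, le_rfl⟩
  · exact (hD t ht).1.mono_set (hsubt t ht)
  · have := W.radial_space Metric.isOpen_ball h2b hKO P.d1 P.cont_w' P.s0 P.s1 (2 * c₀ - N) ht
    have e : (fun x => (b - t) ^ (2 * c₀ - N) * (N * w (zz x₀ b t x) + 2 * zz x₀ b t x *
      w' (zz x₀ b t x)) * K.indicator (u t) x ^ 2 + 2 * (b - t) ^ (2 * c₀ - N) * w (zz x₀ b t x) *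
        K.indicator (u t) x * rad x₀ (fun i => K.indicator (fun x => G t x i)) x) =
        (fun x => (b - t) ^ (2 * c₀ - N) * (N * w (zz x₀ b t x) + 2 * zz x₀ b t x *
      w' (zz x₀ b t x)) * u t x ^ 2 + 2 * (b - t) ^ (2 * c₀ - N) * w (zz x₀ b t x) *
        u t x * rad x₀ (gco G t) x) := by
      refine eq_of_eqOn_cone (x₀ := x₀) (ht.2.trans_lt h2b) (fun x hx => ?_) (fun x hx => ?_)
        fun x hx => ?_
      · have : rad x₀ (fun i => K.indicator (fun x => G t x i)) x = rad x₀ (gco G t) x :=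
          rad_congr fun i => ind _ t ht x hx
        rw [this, ind _ t ht x hx]
      · simp [P.s0 _ hx, P.s1 _ hx]
      · simp [P.s0 _ hx, P.s1 _ hx]
    rwa [e] at this
  · rw [← cE t ht]
    exact e1 t ht
  · rw [← cJ t ht]
    exact m1 t ht
  · filter_upwards [e2, m2, ae_Ioc fun t ht => ht] with t h1 h2 ht
    rw [← cE' t ht, ← cJ' t ht]
    exact ⟨h1, h2⟩
  · refine e3.congr h12.le (fun t ht => ?_) (ae_Ioc fun t ht => ?_)
    · rw [eng, ← cE t ht]
    · rw [rp t ht, engD, ← cE' t ht]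
  · refine m3.congr h12.le (fun t ht => ?_) (ae_Ioc fun t ht => ?_)
    · rw [mom, ← cJ t ht]
    · rw [rp t ht, momD, ← cJ' t ht]
  · obtain ⟨Cu, hCu⟩ := W.fam_u.bd
    obtain ⟨Cv, hCv⟩ := W.fam_v.bd
    choose CG hCG using fun i => (W.fam_G i).bd
    refine ⟨Cu ^ 2 + Cv ^ 2 + ∑ i, CG i ^ 2, fun t ht => ?_⟩
    have hs := (hsubt t ht).trans hsub
    have hBt := Metric.isClosed_closedBall (x := x₀) (ε := b - t) |>.measurableSet
    have ii : ∀ {h : E N → ℝ}, MemLp (K.indicator h) 2 volume →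
        IntegrableOn (fun x => h x ^ 2) (Metric.closedBall x₀ (b - t)) := fun {h} hm =>
      hm.integrable_sq.integrableOn.congr_fun
        (fun x hx => by simp only [indicator_of_mem (hs hx)]) hBt
    have iu := ii (W.fam_u.mem t ht)
    have iv := ii (W.fam_v.mem t ht)
    have iG : ∀ i, IntegrableOn (fun x => gco G t i x ^ 2) (Metric.closedBall x₀ (b - t)) :=
      fun i => ii ((W.fam_G i).mem t ht)
    have e : qN x₀ b t (u t) (v t) (gco G t) = (∫ x in Metric.closedBall x₀ (b - t), u t x ^ 2) +
        (∫ x in Metric.closedBall x₀ (b - t), v t x ^ 2) +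
        ∑ i, ∫ x in Metric.closedBall x₀ (b - t), gco G t i x ^ 2 := by
      rw [← integral_finsetSum _ fun i _ => iG i, ← integral_add iu iv]
      exact integral_add (iu.add iv) (integrable_finsetSum _ fun i _ => iG i)
    rw [e]
    refine add_le_add (add_le_add ?_ ?_) (Finset.sum_le_sum fun i _ => ?_)
    · exact setIntegral_sq_le hBt hs (W.fam_u.mem t ht) (hCu t ht)
    · exact setIntegral_sq_le hBt hs (W.fam_v.mem t ht) (hCv t ht)
    · exact setIntegral_sq_le hBt hs ((W.fam_G i).mem t ht) (hCG i t ht)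

/-- The evolution of the energy in backward light cones. -/
theorem coneEvol (S : IsSolution p f g u₀ u₁ T u v G) (A : Params N p q M c₀ α γ)
    (L : LowerOrder q M f g) (P : IsProfile α ε w w' w'') (hbT : b < T x₀) {t₁ t₂ : ℝ}
    (h0 : 0 ≤ t₁) (h12 : t₁ < t₂) (h2b : t₂ < b) :
    ConeEvol p c₀ α f g w w' x₀ b u v G t₁ t₂ := by
  have hδ : 0 < (T x₀ - b) / 4 := by linarith
  -- Short cones are concatenated; the admissible length δ/4 does not shrink as the vertex is
  -- approached, so finitely many suffice.
  have key : ∀ n : ℕ, ∀ t₁ t₂ : ℝ, 0 ≤ t₁ → t₁ < t₂ → t₂ < b →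
      t₂ - t₁ ≤ (n + 1) * ((T x₀ - b) / 4) → ConeEvol p c₀ α f g w w' x₀ b u v G t₁ t₂ := by
    intro n
    induction n with
    | zero =>
      intro t₁ t₂ h0 h12 h2b h
      exact S.coneEvol_short A L P h0 h12 h2b (by simpa using h)
    | succ n ih =>
      intro t₁ t₂ h0 h12 h2b h
      by_cases hs : t₂ - t₁ ≤ (T x₀ - b) / 4
      · exact S.coneEvol_short A L P h0 h12 h2b hs
      · push Not at hs
        push_cast at h
        exact (S.coneEvol_short A L P h0 (by linarith : t₁ < t₁ + (T x₀ - b) / 4)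
          (by linarith) (by linarith)).trans
          (ih _ _ (by linarith) (by linarith) h2b (by linarith))
  obtain ⟨n, hn⟩ := exists_nat_ge ((t₂ - t₁) / ((T x₀ - b) / 4))
  refine key n t₁ t₂ h0 h12 h2b ?_
  rw [div_le_iff₀ hδ] at hn
  linarith

end IsSolution

end

end HamzaZaag

/-! ### The algebra of the modified energy. -/

namespace HamzaZaag

noncomputable section

/-- The relations at a fixed time between the energy `E`, the functional `J`, and the integrals of
`|∂ₛw|²`, `|∇w|² - (y·∇w)²`, `w²`, `|w|^{p+1}` (`a`, `b`, `c`, `d`) and the dissipation `A`;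
here `n = 1 / (p + 1)`. -/
structure IsBalance (n κ α C₀ Cc a b c d A E J ζ : ℝ) : Prop where
  ha : 0 ≤ a
  hb : 0 ≤ b
  hc : 0 ≤ c
  hd : 0 ≤ d
  hA : 0 ≤ A
  hαa : α * a ≤ A
  hE : |E - (1 / 2 * (a + b + κ * c) - n * d)| ≤ C₀ * ζ * (1 + d)
  hJ : ∀ y : ℝ, 0 < y → |J| ≤ y * a + 1 / (4 * y) * c
  hcd : c ≤ (1 - 2 * n) / 16 * d + Cc

/-- Bounds of the derivatives `lE`, `lJ` of `E` and `J`, with the error `e`. -/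
structure IsRate (n κ C₀ C₁ a b c d A ζ lE lJ e : ℝ) : Prop where
  he : 0 ≤ e
  hE : lE ≤ -2 * A + e + C₀ * ζ * (1 + d + A + b)
  hJ : a - b - κ * c + d - (1 - 2 * n) / 32 * (b + c) - C₁ * A - e -
    C₀ * ζ * (1 + d + A + b + c) ≤ lJ

namespace IsBalance

variable {n κ α C₀ C₁ Cc a b c d A E J ζ η : ℝ}

theorem abs_J_le (h : IsBalance n κ α C₀ Cc a b c d A E J ζ) : |J| ≤ a + c := by
  have := h.hJ 1 one_pos
  have := h.hc
  linarith

/-- The error C₀ζ(1+d) is at most n(1+d) and is absorbed by -n d. This is why no bound on the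
initial nonlinear term is needed. -/
theorem le_of_small (h : IsBalance n κ α C₀ Cc a b c d A E J ζ) (hκ : 0 ≤ κ)
    (hη : 0 ≤ η) (hζ0 : 0 ≤ ζ)
    (h1 : C₀ * ζ ≤ n) (h2 : η * ζ ≤ 1) (hn1 : n ≤ 1) :
    E - η * ζ * J ≤ (κ + 2) * (1 + a + b + c) := by
  have hJ := h.abs_J_le
  have e1 := (abs_le.1 h.hE).2
  have ha := h.ha; have hb := h.hb; have hc := h.hc; have hd := h.hd
  have e2 : C₀ * ζ * (1 + d) ≤ n * (1 + d) := mul_le_mul_of_nonneg_right h1 (by linarith)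
  have e3 : -(η * ζ * J) ≤ 1 * (a + c) := by
    have h3 : η * ζ * |J| ≤ 1 * (a + c) := mul_le_mul h2 hJ (abs_nonneg _) zero_le_one
    have h4 := mul_le_mul_of_nonneg_left (neg_le_abs J) (mul_nonneg hη hζ0)
    linarith
  nlinarith [mul_nonneg hκ ha, mul_nonneg hκ hb, mul_nonneg hκ hc]

/-- When d ≤ 1 the only negative contributions are n d, the error, and ηζJ, which is absorbed by a/2
and a bounded multiple of c. -/
theorem ge_of_small (h : IsBalance n κ α C₀ Cc a b c d A E J ζ) (hκ : 0 ≤ κ)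
    (hn0 : 0 ≤ n) (hη : 0 ≤ η) (hζ0 : 0 ≤ ζ)
    (h1 : C₀ * ζ ≤ n) (h2 : η * ζ ≤ 1 / 16) (hn1 : n ≤ 1 / 2) (hd1 : d ≤ 1) :
    -(4 + Cc) ≤ E - η * ζ * J := by
  have hJ := h.abs_J_le
  have e1 := (abs_le.1 h.hE).1
  have ha := h.ha; have hb := h.hb; have hc := h.hc; have hd := h.hd
  have e2 : C₀ * ζ * (1 + d) ≤ n * (1 + d) := mul_le_mul_of_nonneg_right h1 (by linarith)
  have e3 : η * ζ * J ≤ 1 / 16 * (a + c) := by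
    have h3 : η * ζ * |J| ≤ 1 / 16 * (a + c) := mul_le_mul h2 hJ (abs_nonneg _) (by norm_num)
    have h4 := mul_le_mul_of_nonneg_left (le_abs_self J) (mul_nonneg hη hζ0)
    linarith
  have e4 := h.hcd
  nlinarith [mul_nonneg hκ hc]

/-- The definition of the energy is used twice: to bound the gradient term, and to eliminate b and c
from the derivative of J, which becomes 2a - 2E + (1-2n)d. -/
theorem pot_le (h : IsBalance n κ α C₀ Cc a b c d A E J ζ) (hκ : 0 ≤ κ) {x : ℝ}
    (h1 : C₀ * ζ ≤ x) : b ≤ 2 * E + 2 * n * d + 2 * x * (1 + d) ∧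
      2 * a - 2 * E + (1 - 2 * n) * d - 2 * x * (1 + d) ≤ a - b - κ * c + d := by
  obtain ⟨e1, e2⟩ := abs_le.1 h.hE
  have hd := h.hd
  have ha := h.ha
  have e3 : C₀ * ζ * (1 + d) ≤ x * (1 + d) := mul_le_mul_of_nonneg_right h1 (by linarith)
  have := mul_nonneg hκ h.hc
  constructor <;> linarith

/-- The modified energy decreases up to small errors. -/
theorem decay (h : IsBalance n κ α C₀ Cc a b c d A E J ζ) (hκ : 0 ≤ κ) (hC₀ : 1 ≤ C₀)
    (hC₁ : 0 ≤ C₁) (hCc : 0 ≤ Cc) (hn0 : 0 < n) (hn1 : n < 1 / 2) (hζ0 : 0 ≤ ζ)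
    (hη : η = 8 * C₀ / (1 - 2 * n)) (h1 : C₀ * ζ ≤ (1 - 2 * n) / 96)
    (h2 : (3 * C₀ + 2 * η) * ζ ≤ 1) (h3 : (C₀ + η * C₁ + η) * ζ ≤ 1) {lE lJ e γ : ℝ}
    (hr : IsRate n κ C₀ C₁ a b c d A ζ lE lJ e) (hγ0 : 0 ≤ γ) (hγ1 : γ ≤ 1) :
    lE - η * ζ * lJ + η * γ * ζ * J - (3 * C₀ + 2 * η) * ζ * (E - η * ζ * J) ≤
      -A + (4 * C₀ + 2 * η + 3 * η * Cc + 1) * (ζ + e) := by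
  set m := 1 - 2 * n with hm
  have hm0 : 0 < m := by linarith
  have hm1 : m < 1 := by linarith
  have hηm : η * m = 8 * C₀ := by rw [hη]; field_simp
  have hη0 : 0 < η := by rw [hη]; positivity
  have ha := h.ha; have hb := h.hb; have hc := h.hc; have hd := h.hd; have hA := h.hA
  have he := hr.he
  have hJ := h.abs_J_le
  obtain ⟨b1, b2⟩ := h.pot_le hκ h1
  -- the bracket
  set y := m / 96 with hy
  have d2 : 2 * a - 2 * E + m * d - 2 * y * (1 + d) - m / 32 * (b + c) - C₁ * A - e -
      y * (1 + d + A + b + c) ≤ lJ := by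
    have h5 := hr.hJ
    have h6 : C₀ * ζ * (1 + d + A + b + c) ≤ y * (1 + d + A + b + c) :=
      mul_le_mul_of_nonneg_right h1 (by linarith)
    linarith
  have d3 := mul_le_mul_of_nonneg_left d2 (mul_nonneg hη0.le hζ0)
  -- This term and the next are each bounded by ηζ(a + c). Together they use up the 2a in the
  -- derivative of J, and c is absorbed by d.
  have d4 : η * γ * ζ * J ≤ η * ζ * (a + c) := by
    have h5 : γ * J ≤ a + c := by
      have h6 : γ * J ≤ γ * |J| := mul_le_mul_of_nonneg_left (le_abs_self J) hγ0
      have h7 : γ * |J| ≤ 1 * |J| := mul_le_mul_of_nonneg_right hγ1 (abs_nonneg J)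
      linarith
    have := mul_le_mul_of_nonneg_left h5 (mul_nonneg hη0.le hζ0)
    linarith
  have d5 : (3 * C₀ + 2 * η) * ζ * (η * ζ * J) ≤ η * ζ * (a + c) := by
    have h5 : η * ζ * J ≤ η * ζ * (a + c) :=
      mul_le_mul_of_nonneg_left ((le_abs_self J).trans hJ) (mul_nonneg hη0.le hζ0)
    have h6 : 0 ≤ (3 * C₀ + 2 * η) * ζ := by positivity
    have h7 : 0 ≤ η * ζ * (a + c) := by positivity
    calc _ ≤ (3 * C₀ + 2 * η) * ζ * (η * ζ * (a + c)) := mul_le_mul_of_nonneg_left h5 h6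
      _ ≤ 1 * (η * ζ * (a + c)) := mul_le_mul_of_nonneg_right h2 h7
      _ = _ := one_mul _
  -- everything but `-2 A + e` is a multiple of `ζ`
  have key : C₀ * (1 + d + A + b) - η * (2 * a - 2 * E + m * d - 2 * y * (1 + d) - m / 32 * (b + c) -
      C₁ * A - e - y * (1 + d + A + b + c)) + 2 * (η * (a + c)) - (3 * C₀ + 2 * η) * E ≤
      (C₀ + η * C₁ + η) * A + (4 * C₀ + 2 * η + 3 * η * Cc) + η * e := by
    have hηy : η * y = C₀ / 12 := by rw [hy]; linarith
    have f1 : η * (m / 32) = C₀ / 4 := by linarith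
    have f2 : η * c ≤ η * (m / 16 * d + Cc) := mul_le_mul_of_nonneg_left h.hcd hη0.le
    have f3 : η * (m / 16 * d + Cc) = C₀ / 2 * d + η * Cc := by linear_combination d / 16 * hηm
    have f4 : C₀ * b ≤ C₀ * (2 * E + 2 * n * d + 2 * y * (1 + d)) :=
      mul_le_mul_of_nonneg_left b1 (by linarith)
    have f5 : 2 * n * d ≤ 1 * d := mul_le_mul_of_nonneg_right (by linarith) hd
    have f6 : 2 * y * (1 + d) ≤ 1 / 48 * (1 + d) :=
      mul_le_mul_of_nonneg_right (by linarith) (by linarith)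
    have f7 : C₀ * (2 * E + 2 * n * d + 2 * y * (1 + d)) ≤ C₀ * (2 * E + d + 1 / 48 * (1 + d)) :=
      mul_le_mul_of_nonneg_left (by linarith) (by linarith)
    have f8 : C₀ * c ≤ C₀ * (1 / 16 * d + Cc) := by
      refine mul_le_mul_of_nonneg_left (h.hcd.trans ?_) (by linarith)
      have := mul_le_mul_of_nonneg_right hm1.le hd
      linarith
    -- The choice ηm = 8C₀ turns ηmd into 8C₀d, which dominates all other multiples of d. The terms
    -- 2ηE cancel between the derivative of J and the integrating factor, leaving -3C₀E.
    have e1 : C₀ * (1 + d + A + b) - η * (2 * a - 2 * E + m * d - 2 * y * (1 + d) -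
        m / 32 * (b + c) - C₁ * A - e - y * (1 + d + A + b + c)) + 2 * (η * (a + c)) -
        (3 * C₀ + 2 * η) * E = C₀ * (1 + d + A) + C₀ * b - 8 * C₀ * d +
        2 * (C₀ / 12) * (1 + d) + C₀ / 4 * (b + c) + η * C₁ * A + η * e +
        C₀ / 12 * (1 + d + A + b + c) + 2 * (η * c) - 3 * C₀ * E := by
      linear_combination (-d) * hηm + (2 * (1 + d) + (1 + d + A + b + c)) * hηy + (b + c) * f1
    rw [e1]
    have g1 : 0 ≤ C₀ * d := by positivity
    have g2 : 0 ≤ C₀ * A := by positivity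
    have g3 : C₀ ≤ η := by
      rw [hη, le_div_iff₀ hm0]
      nlinarith
    have g4 := mul_le_mul_of_nonneg_right g3 hCc
    have g5 := mul_le_mul_of_nonneg_right g3 hA
    have g7 := mul_nonneg hη0.le hCc
    have g6 : 0 ≤ C₀ * b := by positivity
    -- The sign of E is not known, so it has to cancel exactly: b ≥ 0 allows its coefficient 4C₀/3
    -- to be raised to 3C₀/2, whose bound through `f4` contains precisely 3C₀E.
    linarith
  have key2 := mul_le_mul_of_nonneg_left key hζ0
  have h3' := mul_le_mul_of_nonneg_right h3 hA
  have hE := hr.hE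
  have g7 : ζ * (η * e) ≤ 1 * e := by
    have : η * ζ ≤ 1 := by
      have : 0 ≤ (C₀ + η * C₁) * ζ := by positivity
      linarith
    have := mul_le_mul_of_nonneg_right this he
    linarith
  have g8 : 1 * e ≤ (4 * C₀ + 2 * η + 3 * η * Cc) * e := by
    refine mul_le_mul_of_nonneg_right ?_ he
    have := mul_nonneg hη0.le hCc
    linarith
  have g9 : (4 * C₀ + 2 * η + 3 * η * Cc + 1) * (ζ + e) =
    ζ * (4 * C₀ + 2 * η + 3 * η * Cc) + ζ + (4 * C₀ + 2 * η + 3 * η * Cc) * e + e := by ring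
  rw [g9]
  have g10 : 0 ≤ ζ * (4 * C₀ + 2 * η + 3 * η * Cc) := by positivity
  linarith

/-- The nonlinear term is controlled by the derivative of `J` and the dissipation. -/
theorem nonlinear_le (h : IsBalance n κ α C₀ Cc a b c d A E J ζ) (hκ : 0 ≤ κ)
    (hn0 : 0 < n) (hn1 : n < 1 / 2) (hζ0 : 0 ≤ ζ) (hη : 0 ≤ η)
    (h1 : C₀ * ζ ≤ (1 - 2 * n) / 96)
    (h2 : η * ζ ≤ 1 / 16) {lE lJ e : ℝ}
    (hr : IsRate n κ C₀ C₁ a b c d A ζ lE lJ e) :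
    (1 - 2 * n) / 2 * d ≤ lJ + 3 * |E - η * ζ * J| + (C₁ + 1) * A + (1 + Cc) + e := by
  set m := 1 - 2 * n with hm
  have hm0 : 0 < m := by linarith
  have hm1 : m < 1 := by linarith
  have ha := h.ha; have hb := h.hb; have hc := h.hc; have hd := h.hd; have hA := h.hA
  have hJ := h.abs_J_le
  obtain ⟨b1, b2⟩ := h.pot_le hκ h1
  have h5 := hr.hJ
  have h6 : C₀ * ζ * (1 + d + A + b + c) ≤ m / 96 * (1 + d + A + b + c) :=
    mul_le_mul_of_nonneg_right h1 (by linarith)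
  have h7 : E ≤ |E - η * ζ * J| + 1 / 16 * (a + c) := by
    have h3 : η * ζ * |J| ≤ 1 / 16 * (a + c) := mul_le_mul h2 hJ (abs_nonneg _) (by norm_num)
    have h4 := mul_le_mul_of_nonneg_left (le_abs_self J) (mul_nonneg hη hζ0)
    have := le_abs_self (E - η * ζ * J)
    linarith
  have h8 := h.hcd
  have hH := abs_nonneg (E - η * ζ * J)
  generalize |E - η * ζ * J| = H at *
  -- In the derivative of J, after elimination, b occurs only with small multiples of m; the energy
  -- bounds it at the price of E, and E by the modified energy.
  have f0 : m * b ≤ m * (2 * E + 2 * n * d + 2 * (m / 96) * (1 + d)) :=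
    mul_le_mul_of_nonneg_left b1 hm0.le
  have f1 : m * (2 * E + 2 * n * d + 2 * (m / 96) * (1 + d)) ≤
      m * (2 * (H + 1 / 16 * (a + c)) + d + 1 / 48 * (1 + d)) := by
    refine mul_le_mul_of_nonneg_left ?_ hm0.le
    have := mul_le_mul_of_nonneg_right (by linarith : 2 * n ≤ 1) hd
    have := mul_le_mul_of_nonneg_right (by linarith : 2 * (m / 96) ≤ 1 / 48)
      (by linarith : 0 ≤ 1 + d)
    linarith
  have g1 : m * H ≤ 1 * H := mul_le_mul_of_nonneg_right hm1.le hH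
  have g2 : m * a ≤ 1 * a := mul_le_mul_of_nonneg_right hm1.le ha
  have g3 : m * c ≤ 1 * c := mul_le_mul_of_nonneg_right hm1.le hc
  have g4 : m * A ≤ 1 * A := mul_le_mul_of_nonneg_right hm1.le hA
  have g5 : 0 ≤ m * d := by positivity
  nlinarith

end IsBalance

end

end HamzaZaag

/-! ### The choice of the constants. -/

namespace HamzaZaag

noncomputable section

variable {N : ℕ} {p q M c₀ α γ : ℝ}

theorem IsProfile.eps_nonneg {ε : ℝ} {w w' w'' : ℝ → ℝ} (P : IsProfile α ε w w' w'') : 0 ≤ ε :=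
  (P.err_nonneg 0 le_rfl).trans (P.err_le 0 le_rfl)

theorem qN_nonneg (x₀ : E N) (b t : ℝ) (U V : E N → ℝ) (G : Fin N → E N → ℝ) :
    0 ≤ qN x₀ b t U V G :=
  integral_nonneg fun x => by
    have := gsq_nonneg G x
    positivity

/-- Normalises the volume of the ball to 1 at the cost of a larger constant. -/
theorem const_mul_le {V x y C C' : ℝ} (hV : 0 ≤ V) (hx : 0 ≤ x) (hxy : x ≤ y) (hC : 0 ≤ C)
    (h : C * (1 + V) ≤ C') : C * (V + x) ≤ C' * (1 + y) := by
  have h1 : V + x ≤ (1 + V) * (1 + y) := by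
    have := mul_nonneg hV (hx.trans hxy)
    linarith
  have h2 := mul_le_mul_of_nonneg_left h1 hC
  have h3 := mul_le_mul_of_nonneg_right h (by linarith : 0 ≤ 1 + y)
  linarith

theorem hardy_const_le {V x b c h k C C' : ℝ} (hV : 0 ≤ V) (hx : 0 ≤ x) (hb : 0 ≤ b) (hc : 0 ≤ c)
    (hk : 1 ≤ k) (hh : b + c + h ≤ k * (b + c)) (hC : 0 ≤ C) (h' : C * (1 + V) * k ≤ C') :
    C * (V + x + b + h) ≤ C' * (1 + x + b + c) := by
  have h1 : V + x + b + h ≤ (1 + V) * (k * (1 + x + b + c)) := by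
    have e1 : 1 * ((1 + V) * (1 + x)) ≤ k * ((1 + V) * (1 + x)) :=
      mul_le_mul_of_nonneg_right hk (by positivity)
    have e2 : 0 ≤ V * (k * (b + c)) := by positivity
    have e3 := mul_nonneg hV hx
    linarith
  have h2 := mul_le_mul_of_nonneg_left h1 hC
  have h3 := mul_le_mul_of_nonneg_right h' (by linarith : 0 ≤ 1 + x + b + c)
  linarith

/-- The relations between the integral quantities, for a solution in a light cone. -/
theorem exists_balance (A : Params N p q M c₀ α γ) : ∃ C₀ Cc C₁ : ℝ, 1 ≤ C₀ ∧ 0 ≤ Cc ∧ 0 ≤ C₁ ∧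
    ∀ (ε : ℝ) (w w' w'' : ℝ → ℝ), IsProfile α ε w w' w'' → ∀ f g : ℝ → ℝ, LowerOrder q M f g →
    ∀ (x₀ : E N) (b : ℝ) (u v : ℝ → E N → ℝ) (G : ℝ → E N → E N) (t : ℝ), b - t ≤ 1 →
    ConeAt p c₀ f w w' x₀ b u v G t →
    IsBalance (1 / (p + 1)) (c₀ * (c₀ + 1)) α C₀ Cc
      (qS c₀ w x₀ b t (u t) (v t) (gco G t)) (qG c₀ w x₀ b t (gco G t)) (qW c₀ w x₀ b t (u t))
      (qP p c₀ w x₀ b t (u t)) (qS c₀ (dD α w w') x₀ b t (u t) (v t) (gco G t))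
      (eng c₀ w (nl p f) x₀ b u v G t) (mom c₀ w x₀ b u v G t) ((b - t) ^ γ) ∧
    (Integrable (engRate c₀ α w w' (nl p f) g x₀ b t (u t) (v t) (gco G t)) ∧
      Integrable (momRate c₀ α w w' (nl p f) g x₀ b t (u t) (v t) (gco G t)) →
    IsRate (1 / (p + 1)) (c₀ * (c₀ + 1)) C₀ C₁
      (qS c₀ w x₀ b t (u t) (v t) (gco G t)) (qG c₀ w x₀ b t (gco G t)) (qW c₀ w x₀ b t (u t))
      (qP p c₀ w x₀ b t (u t)) (qS c₀ (dD α w w') x₀ b t (u t) (v t) (gco G t)) ((b - t) ^ γ)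
      (engD c₀ α w w' (nl p f) g x₀ b u v G t) (momD c₀ α w w' (nl p f) g x₀ b u v G t)
      (qErr c₀ ε x₀ b t (u t) (v t) (gco G t))) := by
  have hp := A.hp
  have hM := A.hM
  have hα := A.hα
  have hc0 := A.hc0
  have hV := vol1_nonneg N
  have hp1 : 0 < p + 1 := by linarith
  set m : ℝ := 1 - 2 * (1 / (p + 1)) with hm
  have hm0 : 0 < m := by
    have : 1 / (p + 1) < 1 / 2 := by
      rw [div_lt_div_iff₀ hp1 two_pos]; linarith
    linarith
  -- Young's inequality for y² against (m/16)|y|^{p+1}, the coefficient required by `IsBalance.hcd`.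
  obtain ⟨C, hC0, hC⟩ := exists_rpow_le (p := p + 1) (q := 2) (M := 1) (by norm_num) (by linarith)
    zero_le_one (by positivity : (0 : ℝ) < m / 16)
  -- After the Hardy inequality the loss δ'(b + c + h) is at most δ'k(b + c), and δ' is chosen to
  -- make this m/32 times b + c, as `IsRate.hJ` demands.
  set δ' : ℝ := m / 32 / (1 + 2 * α + N + 1 / α) with hδ'
  have hk : 0 < 1 + 2 * α + N + 1 / α := by positivity
  have hδ0 : 0 < δ' := by positivity
  set CE : ℝ := 2 * M * (3 * c₀ + 2) + M * (1 + c₀ ^ 2 + 3 / α) with hCE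
  set CJ : ℝ := 2 * M + M * (2 + c₀ + 1 / α) with hCJ
  set C1 : ℝ := 1 / (α * δ') + (2 * c₀ + 1) ^ 2 / (4 * δ' * α) + 4 / δ' with hC1
  set V := vol1 N with hVd
  have hCE0 : 0 ≤ CE := by positivity
  have hCJ0 : 0 ≤ CJ := by positivity
  have hC10 : 0 ≤ C1 := by positivity
  set k : ℝ := 1 + 2 * α + N + 1 / α with hkd
  set C0 : ℝ := 1 + 2 * M * (1 + V) + CE * (1 + V) + CJ * (1 + V) * k with hC0d
  have p1 : 0 ≤ 2 * M * (1 + V) := by positivity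
  have p2 : 0 ≤ CE * (1 + V) := by positivity
  have p3 : 0 ≤ CJ * (1 + V) * k := by positivity
  have q0 : 1 ≤ C0 := by linarith
  have q1 : 2 * M * (1 + V) ≤ C0 := by linarith
  have q2 : CE * (1 + V) ≤ C0 := by linarith
  have q3 : CJ * (1 + V) * k ≤ C0 := by linarith
  have hk1 : 1 ≤ k := by
    have : 0 ≤ 2 * α + N + 1 / α := by positivity
    rw [hkd]; linarith
  have hkδ : δ' * k = m / 32 := by rw [hδ']; field_simp
  have hkh : ∀ b c h : ℝ, 0 ≤ b → 0 ≤ c → h ≤ (2 * α + N) * c + 1 / α * b →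
      b + c + h ≤ k * (b + c) := by
    intro b c h hb hc hh
    have e1 : 0 ≤ (2 * α + N) * b := by positivity
    have e2 : 0 ≤ 1 / α * c := by positivity
    rw [hkd]
    linarith
  clear_value C0 k δ'
  refine ⟨C0, C * V, C1, q0, by positivity, hC10, ?_⟩
  intro ε w w' w'' P f g L x₀ b u v G t hr1 H
  have hr : 0 < b - t := by linarith [H.state.lt]
  have hζ : 0 < (b - t) ^ γ := Real.rpow_pos_of_pos hr _
  have hw : ∀ z, 0 ≤ z → 0 ≤ w z := fun z _ => P.nonneg z
  have hD : ∀ z, 0 ≤ z → 0 ≤ dD α w w' z := fun z hz => P.dD_nonneg hα.le hz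
  have ha := H.state.qS_nonneg (c₀ := c₀) hw
  have hA := H.state.qS_nonneg (c₀ := c₀) hD
  have hb := H.state.qG_nonneg (c₀ := c₀) P.cut hw
  have hc := H.state.qW_nonneg (c₀ := c₀) hw
  have hd := H.state.qP_nonneg (c₀ := c₀) hw
  refine ⟨⟨ha, hb, hc, hd, hA, H.state.qS_le P hα.le, ?_, ?_, ?_⟩, fun hI => ⟨?_, ?_, ?_⟩⟩
  · refine (H.state.energy_close P A L hr1 H.eng).trans ?_
    have h1 := const_mul_le hV hd le_rfl (by positivity : 0 ≤ 2 * M) q1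
    have := mul_le_mul_of_nonneg_left h1 hζ.le
    linarith
  · intro y hy
    exact H.state.abs_mom_le P H.mom hy
  · refine H.state.qW_le P hC0 fun y => ?_
    have := hC |y| (abs_nonneg y)
    rw [one_mul] at this
    rw [← sq_abs]
    exact_mod_cast this
  · have := P.eps_nonneg
    have := qN_nonneg x₀ b t (u t) (v t) (gco G t)
    unfold qErr
    positivity
  · have h0 := H.state.energy_rate P A L hr1 hI.1
    rw [← hCE] at h0
    unfold engD
    generalize qS c₀ (dD α w w') x₀ b t (u t) (v t) (gco G t) = A' at *
    generalize qG c₀ w x₀ b t (gco G t) = b' at *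
    generalize qP p c₀ w x₀ b t (u t) = d at *
    have h1 := const_mul_le hV (by positivity : 0 ≤ d + A' + b') le_rfl hCE0 q2
    clear_value CE
    have := mul_le_mul_of_nonneg_left h1 hζ.le
    linarith
  · have h0 := H.state.momentum_rate P A L hr1 hI.2 hδ0
    have hH := H.state.hardy P hα H.hardy
    rw [← hCJ, ← hC1] at h0
    unfold momD
    generalize qS c₀ (dD α w w') x₀ b t (u t) (v t) (gco G t) = A' at *
    generalize qG c₀ w x₀ b t (gco G t) = b' at *
    generalize qP p c₀ w x₀ b t (u t) = d at *
    generalize qW c₀ (dD α w w') x₀ b t (u t) = h at *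
    generalize qW c₀ w x₀ b t (u t) = c at *
    have hh := hkh b' c h hb hc hH
    have h1 : δ' * (b' + c + h) ≤ m / 32 * (b' + c) := by
      have := mul_le_mul_of_nonneg_left hh hδ0.le
      rwa [← mul_assoc, hkδ] at this
    have h2 := hardy_const_le (h := h) hV (by positivity : 0 ≤ d + A') hb hc hk1 hh hCJ0 q3
    clear_value CJ C1 m
    rw [← hm]
    have := mul_le_mul_of_nonneg_left h2 hζ.le
    linarith

end

end HamzaZaag

/-! ### Integration of the differential inequalities. -/

namespace HamzaZaag

noncomputable section

section Weight

variable {t₁ t₂ : ℝ} {A a c ct : ℝ → ℝ}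

theorem Incr.of_le {t : ℝ} (h : ∀ t ∈ Icc t₁ t₂, Incr t₁ t A a) {s : ℝ} (hs : s ∈ Icc t₁ t₂)
    (ht : t ∈ Icc t₁ t₂) : Incr s t A a where
  int := (h s hs).int.symm.trans (h t ht).int
  eq := by
    rw [← intervalIntegral.integral_add_adjacent_intervals (h s hs).int.symm (h t ht).int,
      intervalIntegral.integral_symm, ← (h s hs).eq, ← (h t ht).eq]
    ring

theorem Incr.continuousOn (h12 : t₁ ≤ t₂) (h : ∀ t ∈ Icc t₁ t₂, Incr t₁ t A a) :
    ContinuousOn A (Icc t₁ t₂) := by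
  have hi := (h t₂ (right_mem_Icc.2 h12)).int
  have h1 : ContinuousOn (fun t => A t₁ + ∫ x in t₁..t, a x) (Icc t₁ t₂) := by
    refine continuousOn_const.add ?_
    have := intervalIntegral.continuousOn_primitive_interval (μ := volume)
      (intervalIntegrable_iff_integrableOn_Icc_of_le h12 |>.1 hi |> fun h => by
        rwa [← uIcc_of_le h12] at h)
    rwa [uIcc_of_le h12] at this
  refine h1.congr fun t ht => ?_
  show A t = A t₁ + ∫ x in t₁..t, a x
  rw [← (h t ht).eq]
  ring

/-- Product of a primitive and a `C¹` function. -/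
theorem Incr.weight (h12 : t₁ ≤ t₂) (h : ∀ t ∈ Icc t₁ t₂, Incr t₁ t A a)
    (hc : ∀ t ∈ Icc t₁ t₂, HasDerivAt c (ct t) t) (hct : ContinuousOn ct (Icc t₁ t₂)) :
    Incr t₁ t₂ (fun t => c t * A t) (fun t => ct t * A t + c t * a t) where
  int := by
    have hA := Incr.continuousOn h12 h
    have hcc : ContinuousOn c (Icc t₁ t₂) := fun t ht => (hc t ht).continuousAt.continuousWithinAt
    rw [← uIcc_of_le h12] at hA hcc hct
    exact ((hct.mul hA).intervalIntegrable).add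
      ((h t₂ (right_mem_Icc.2 h12)).int.continuousOn_mul hcc)
  eq := by
    have := ac_product (A := A) (B := fun _ => 1) (a := a) (b := fun _ => 0) h12
      (h t₂ (right_mem_Icc.2 h12)).int (by simp)
      (fun t ht => by rw [← (h t ht).eq]; ring) (by simp) hc hct
    simpa using this

end Weight

/-- The constants in `IsBalance` and `IsRate`. -/
structure Coeffs where
  (n κ α C₀ C₁ Cc γ : ℝ)
  hn0 : 0 < n
  hn1 : n < 1 / 2
  hκ : 0 ≤ κ
  hα : 0 < α
  hC₀ : 1 ≤ C₀
  hC₁ : 0 ≤ C₁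
  hCc : 0 ≤ Cc
  hγ0 : 0 < γ
  hγ1 : γ ≤ 1

namespace Coeffs

/-- The coefficient of `J` in the modified energy. -/
def η (k : Coeffs) : ℝ := 8 * k.C₀ / (1 - 2 * k.n)

/-- The rate in the exponential factor of the modified energy. -/
def Λ (k : Coeffs) : ℝ := 3 * k.C₀ + 2 * k.η

/-- The supremum of the exponential factor. -/
def μ₁ (k : Coeffs) : ℝ := Real.exp (k.Λ / k.γ)

/-- The coefficient of the errors in the decay of the modified energy. -/
def C₄ (k : Coeffs) : ℝ := k.μ₁ * (4 * k.C₀ + 2 * k.η + 3 * k.η * k.Cc + 1)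

variable (k : Coeffs)

theorem m_pos : 0 < 1 - 2 * k.n := by linarith [k.hn1]

theorem η_pos : 0 < k.η := by
  have := k.m_pos
  have := k.hC₀
  unfold η
  positivity

theorem Λ_pos : 0 < k.Λ := by
  have := k.η_pos
  have := k.hC₀
  unfold Λ
  positivity

theorem μ₁_pos : 0 < k.μ₁ := Real.exp_pos _

theorem C₄_nonneg : 0 ≤ k.C₄ := by
  have := k.η_pos
  have := k.hC₀
  have := k.hCc
  have := k.μ₁_pos
  unfold C₄
  positivity

/-- Smallness of `ζ` compared to the constants. -/
structure Small (k : Coeffs) (ζ : ℝ) : Prop where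
  le_one : ζ ≤ 1
  le_n : k.C₀ * ζ ≤ k.n
  le_m : k.C₀ * ζ ≤ (1 - 2 * k.n) / 96
  le_η : k.η * ζ ≤ 1 / 16
  le_Λ : k.Λ * ζ ≤ 1
  le_C₁ : (k.C₀ + k.η * k.C₁ + k.η) * ζ ≤ 1

theorem Small.mono {k : Coeffs} {ζ ζ' : ℝ} (h : k.Small ζ) (hζ : ζ' ≤ ζ) : k.Small ζ' := by
  have h1 := k.η_pos.le
  have h2 : 0 ≤ k.C₀ := by linarith [k.hC₀]
  have h3 := k.Λ_pos.le
  have h4 := k.hC₁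
  have h5 : 0 ≤ k.C₀ + k.η * k.C₁ + k.η := by positivity
  exact ⟨hζ.trans h.le_one, (mul_le_mul_of_nonneg_left hζ h2).trans h.le_n,
    (mul_le_mul_of_nonneg_left hζ h2).trans h.le_m, (mul_le_mul_of_nonneg_left hζ h1).trans h.le_η,
    (mul_le_mul_of_nonneg_left hζ h3).trans h.le_Λ,
    (mul_le_mul_of_nonneg_left hζ h5).trans h.le_C₁⟩

/-- Finitely many conditions of the form xζ ≤ y with y > 0 hold for all small ζ > 0. -/
theorem exists_small : ∃ ζ₀ : ℝ, 0 < ζ₀ ∧ k.Small ζ₀ := by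
  have h (x y : ℝ) (hy : 0 < y) : ∀ᶠ ζ in 𝓝[>] (0 : ℝ), x * ζ ≤ y := by
    have : Tendsto (fun ζ : ℝ => x * ζ) (𝓝[>] 0) (𝓝 (x * 0)) :=
      (tendsto_nhdsWithin_of_tendsto_nhds (continuous_const.mul continuous_id).continuousAt)
    rw [mul_zero] at this
    exact (this.eventually_lt_const hy).mono fun _ => le_of_lt
  have hm := k.m_pos
  have h0 : ∀ᶠ ζ in 𝓝[>] (0 : ℝ), 0 < ζ := self_mem_nhdsWithin
  obtain ⟨ζ, hζ, h1, h2, h3, h4, h5, h6⟩ := (h0.and ((h 1 1 one_pos).and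
    ((h k.C₀ k.n k.hn0).and ((h k.C₀ ((1 - 2 * k.n) / 96) (by positivity)).and
    ((h k.η (1 / 16) (by norm_num)).and ((h k.Λ 1 one_pos).and
    (h (k.C₀ + k.η * k.C₁ + k.η) 1 one_pos))))))).exists
  exact ⟨ζ, hζ, ⟨by linarith, h2, h3, h4, h5, h6⟩⟩

end Coeffs

/-- The functionals of a solution along a truncated light cone with vertex time `T`. -/
structure Trajectory (k : Coeffs) (a b c d A E J lE lJ e : ℝ → ℝ) (T ν t₁ t₂ : ℝ) : Prop where
  le : t₁ ≤ t₂
  lt : t₂ < T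
  small : k.Small ((T - t₁) ^ k.γ)
  bal : ∀ t ∈ Icc t₁ t₂, IsBalance k.n k.κ k.α k.C₀ k.Cc (a t) (b t) (c t) (d t) (A t) (E t) (J t)
    ((T - t) ^ k.γ)
  rate : ∀ᵐ t ∂(volume.restrict (Ioc t₁ t₂)),
    IsRate k.n k.κ k.C₀ k.C₁ (a t) (b t) (c t) (d t) (A t) ((T - t) ^ k.γ) (lE t) (lJ t) (e t)
  incrE : ∀ t ∈ Icc t₁ t₂, Incr t₁ t E (fun t => (T - t)⁻¹ * lE t)
  incrJ : ∀ t ∈ Icc t₁ t₂, Incr t₁ t J (fun t => (T - t)⁻¹ * lJ t)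
  err : ∀ t ∈ Icc t₁ t₂, e t ≤ ν
  err_nonneg : 0 ≤ ν
  err_le_one : ν ≤ 1
  err_log : ν * (Real.log (T - t₁) - Real.log (T - t₂)) ≤ 1

section Derivs

variable {T t : ℝ}

theorem hasDerivAt_sub_rpow (h : t < T) (γ : ℝ) :
    HasDerivAt (fun τ => (T - τ) ^ γ) (-(γ * ((T - t)⁻¹ * (T - t) ^ γ))) t := by
  have h0 : 0 < T - t := sub_pos.2 h
  have h1 := ((hasDerivAt_id t).const_sub T).rpow_const (p := γ) (Or.inl h0.ne')
  simp only [id] at h1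
  refine h1.congr_deriv ?_
  rw [Real.rpow_sub_one h0.ne']
  ring

theorem hasDerivAt_neg_log_sub (h : t < T) :
    HasDerivAt (fun τ => -Real.log (T - τ)) (T - t)⁻¹ t := by
  have h0 : 0 < T - t := sub_pos.2 h
  have h1 := (((hasDerivAt_id t).const_sub T).log h0.ne').neg
  simp only [id] at h1
  refine h1.congr_deriv ?_
  ring

theorem continuousOn_sub_inv {t₁ t₂ : ℝ} (h : t₂ < T) :
    ContinuousOn (fun t => (T - t)⁻¹) (Icc t₁ t₂) :=
  (continuousOn_const.sub continuousOn_id).inv₀ fun _ ht => (sub_pos.2 (ht.2.trans_lt h)).ne'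

theorem continuousOn_sub_rpow {t₁ t₂ : ℝ} (h : t₂ < T) (γ : ℝ) :
    ContinuousOn (fun t => (T - t) ^ γ) (Icc t₁ t₂) := fun _ ht =>
  (hasDerivAt_sub_rpow (ht.2.trans_lt h) γ).continuousAt.continuousWithinAt

theorem Incr.of_hasDerivAt {t₁ t₂ : ℝ} {F f : ℝ → ℝ} (h12 : t₁ ≤ t₂)
    (h : ∀ t ∈ Icc t₁ t₂, HasDerivAt F (f t) t) (hf : ContinuousOn f (Icc t₁ t₂)) :
    Incr t₁ t₂ F f := by
  rw [← uIcc_of_le h12] at h hf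
  exact ⟨hf.intervalIntegrable,
    (intervalIntegral.integral_eq_sub_of_hasDerivAt h hf.intervalIntegrable).symm⟩

end Derivs

namespace Trajectory

variable {k : Coeffs} {a b c d A E J lE lJ e : ℝ → ℝ} {T ν t₁ t₂ : ℝ}

/-- The exponential factor of the modified energy. -/
def fac (k : Coeffs) (T t : ℝ) : ℝ := Real.exp (k.Λ / k.γ * (T - t) ^ k.γ)

/-- The modified energy. -/
def modE (k : Coeffs) (E J : ℝ → ℝ) (T t : ℝ) : ℝ :=
  fac k T t * E t - (fac k T t * (k.η * (T - t) ^ k.γ)) * J t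

/-- The derivative of the modified energy. -/
def modD (k : Coeffs) (E J lE lJ : ℝ → ℝ) (T t : ℝ) : ℝ :=
  (T - t)⁻¹ * (fac k T t * (lE t - k.η * (T - t) ^ k.γ * lJ t + k.η * k.γ * (T - t) ^ k.γ * J t -
    k.Λ * (T - t) ^ k.γ * (E t - k.η * (T - t) ^ k.γ * J t)))

/-- A bound of the errors in the evolution of the modified energy. -/
def errD (k : Coeffs) (T ν t : ℝ) : ℝ := k.C₄ * ((T - t)⁻¹ * ((T - t) ^ k.γ + ν))

/-- With s = -log(T - t), the derivative of (T - t)^γ in s is -γ(T - t)^γ, so the exponent Λ/γ (T -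
t)^γ yields the rate -Λ(T - t)^γ required by `IsBalance.decay`. -/
theorem hasDerivAt_fac {t : ℝ} (h : t < T) :
    HasDerivAt (fac k T) (-(k.Λ * ((T - t)⁻¹ * (T - t) ^ k.γ) * fac k T t)) t := by
  have h1 := ((hasDerivAt_sub_rpow h k.γ).const_mul (k.Λ / k.γ)).exp
  refine h1.congr_deriv ?_
  have := k.hγ0.ne'
  simp only [fac]
  field_simp

theorem modE_eq (t : ℝ) : modE k E J T t = fac k T t * (E t - k.η * (T - t) ^ k.γ * J t) := by
  simp only [modE]
  ring

theorem sub_mem (h : Trajectory k a b c d A E J lE lJ e T ν t₁ t₂) {t : ℝ} (ht : t ∈ Icc t₁ t₂) :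
    0 < T - t ∧ 0 ≤ (T - t) ^ k.γ ∧ k.Small ((T - t) ^ k.γ) ∧ 1 ≤ fac k T t ∧ fac k T t ≤ k.μ₁ := by
  have h0 : 0 < T - t := sub_pos.2 (ht.2.trans_lt h.lt)
  have h1 : 0 ≤ (T - t) ^ k.γ := Real.rpow_nonneg h0.le _
  have h2 : (T - t) ^ k.γ ≤ (T - t₁) ^ k.γ :=
    Real.rpow_le_rpow h0.le (by linarith [ht.1]) k.hγ0.le
  have h3 := h.small.mono h2
  have h4 : 0 < k.Λ / k.γ := div_pos k.Λ_pos k.hγ0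
  refine ⟨h0, h1, h3, Real.one_le_exp (by positivity), Real.exp_le_exp.2 ?_⟩
  calc _ ≤ k.Λ / k.γ * 1 := mul_le_mul_of_nonneg_left h3.le_one h4.le
    _ = _ := mul_one _

theorem incr_modE (h : Trajectory k a b c d A E J lE lJ e T ν t₁ t₂) {s t : ℝ}
    (hs : t₁ ≤ s) (hst : s ≤ t) (ht : t ≤ t₂) :
    Incr s t (modE k E J T) (modD k E J lE lJ T) := by
  have hsub : ∀ τ ∈ Icc s t, τ ∈ Icc t₁ t₂ := fun τ h' => ⟨hs.trans h'.1, h'.2.trans ht⟩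
  have hs' := hsub s (left_mem_Icc.2 hst)
  have htT := ht.trans_lt h.lt
  have c1 : ContinuousOn (fac k T) (Icc s t) := fun τ hτ =>
    (hasDerivAt_fac (hτ.2.trans_lt htT)).continuousAt.continuousWithinAt
  have c2 := continuousOn_sub_rpow (t₁ := s) htT k.γ
  have c3 := continuousOn_sub_inv (t₁ := s) htT
  have hE := Incr.weight (c := fac k T) hst (fun τ hτ => Incr.of_le h.incrE hs' (hsub τ hτ))
    (fun τ hτ => hasDerivAt_fac (hτ.2.trans_lt htT))
    (((continuousOn_const.mul (c3.mul c2)).mul c1).neg)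
  have hJ := Incr.weight hst (fun τ hτ => Incr.of_le h.incrJ hs' (hsub τ hτ))
    (fun τ hτ => (hasDerivAt_fac (k := k) (hτ.2.trans_lt htT)).mul
      ((hasDerivAt_sub_rpow (hτ.2.trans_lt htT) k.γ).const_mul k.η))
    ((((continuousOn_const.mul (c3.mul c2)).mul c1).neg.mul (continuousOn_const.mul c2)).add
      (c1.mul (continuousOn_const.mul ((continuousOn_const.mul (c3.mul c2)).neg))))
  refine (hE.sub hJ).congr hst (fun τ _ => ?_) (ae_of_all _ fun τ => ?_)
  · simp only [modE, Pi.mul_apply]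
  · simp only [modD, Pi.mul_apply]
    ring

theorem incr_err (ν : ℝ) {s t : ℝ} (hst : s ≤ t) (ht : t < T) :
    Incr s t (fun t => k.C₄ * (-(1 / k.γ * (T - t) ^ k.γ) + ν * (-Real.log (T - t))))
      (errD k T ν) := by
  refine (Incr.of_hasDerivAt hst (fun τ hτ => ?_) ?_)
  · have h1 := ((((hasDerivAt_sub_rpow (hτ.2.trans_lt ht) k.γ).const_mul (1 / k.γ)).neg).add
      ((hasDerivAt_neg_log_sub (hτ.2.trans_lt ht)).const_mul ν)).const_mul k.C₄
    refine h1.congr_deriv ?_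
    have := k.hγ0.ne'
    simp only [errD]
    field_simp
  · exact continuousOn_const.mul ((continuousOn_sub_inv ht).mul
      ((continuousOn_sub_rpow ht _).add continuousOn_const))

/-- `IsBalance.decay` times the exponential factor: its lower bound 1 keeps the full dissipation,
its upper bound enters the constant of the errors. -/
theorem rate_le (h : Trajectory k a b c d A E J lE lJ e T ν t₁ t₂) :
    ∀ᵐ t ∂(volume.restrict (Ioc t₁ t₂)),
      (T - t)⁻¹ * A t ≤ errD k T ν t - modD k E J lE lJ T t := by
  filter_upwards [h.rate, ae_restrict_mem measurableSet_Ioc] with t hr ht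
  have ht' := Ioc_subset_Icc_self ht
  obtain ⟨h0, h1, h2, h3, h4⟩ := h.sub_mem ht'
  have hb := h.bal t ht'
  have hd := hb.decay (η := k.η) k.hκ k.hC₀ k.hC₁ k.hCc k.hn0 k.hn1 h1 rfl h2.le_m h2.le_Λ h2.le_C₁ hr
    k.hγ0.le k.hγ1
  have hx : 0 ≤ 4 * k.C₀ + 2 * k.η + 3 * k.η * k.Cc + 1 := by
    have := k.η_pos
    have := k.hC₀
    have := k.hCc
    positivity
  have he := h.err t ht'
  have key : fac k T t * (lE t - k.η * (T - t) ^ k.γ * lJ t + k.η * k.γ * (T - t) ^ k.γ * J t -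
      k.Λ * (T - t) ^ k.γ * (E t - k.η * (T - t) ^ k.γ * J t)) ≤
      -A t + k.C₄ * ((T - t) ^ k.γ + ν) := by
    refine (mul_le_mul_of_nonneg_left hd (zero_le_one.trans h3)).trans ?_
    have e1 := mul_le_mul_of_nonneg_right h3 hb.hA
    have e2 : fac k T t * ((4 * k.C₀ + 2 * k.η + 3 * k.η * k.Cc + 1) * ((T - t) ^ k.γ + e t)) ≤
        k.μ₁ * ((4 * k.C₀ + 2 * k.η + 3 * k.η * k.Cc + 1) * ((T - t) ^ k.γ + ν)) := by
      refine mul_le_mul h4 (mul_le_mul_of_nonneg_left (by linarith) hx)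
        (mul_nonneg hx (by linarith [hr.he])) k.μ₁_pos.le
    rw [Coeffs.C₄, mul_assoc k.μ₁]
    linarith
  have := mul_le_mul_of_nonneg_left key (inv_nonneg.2 h0.le)
  simp only [modD, errD]
  linarith

/-- (T - t)^γ is integrable against dt/(T - t), and the cut-off error ν is small compared with the
logarithmic length of the trajectory, so the total does not depend on how close to the vertex the
trajectory ends. -/
theorem err_bound (h : Trajectory k a b c d A E J lE lJ e T ν t₁ t₂) {s t : ℝ}
    (hs : t₁ ≤ s) (hst : s ≤ t) (ht : t ≤ t₂) :
    ∫ τ in s..t, errD k T ν τ ≤ k.C₄ * (1 / k.γ + 1) := by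
  rw [← (incr_err ν hst (ht.trans_lt h.lt)).eq, ← mul_sub]
  refine mul_le_mul_of_nonneg_left ?_ k.C₄_nonneg
  obtain ⟨a0, a1, a2, -, -⟩ := h.sub_mem (t := s) ⟨hs, hst.trans ht⟩
  obtain ⟨b0, b1, -, -, -⟩ := h.sub_mem (t := t) ⟨hs.trans hst, ht⟩
  obtain ⟨c0, -, -, -, -⟩ := h.sub_mem (t := t₂) ⟨h.le, le_rfl⟩
  have e1 : Real.log (T - s) ≤ Real.log (T - t₁) := Real.log_le_log a0 (by linarith)
  have e2 : Real.log (T - t₂) ≤ Real.log (T - t) := Real.log_le_log c0 (by linarith)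
  have e3 := mul_le_mul_of_nonneg_left (by linarith : Real.log (T - s) - Real.log (T - t) ≤
    Real.log (T - t₁) - Real.log (T - t₂)) h.err_nonneg
  have e4 := h.err_log
  have hg : 0 < 1 / k.γ := by have := k.hγ0; positivity
  have e5 := mul_le_mul_of_nonneg_left a2.le_one hg.le
  have e6 := mul_nonneg hg.le b1
  linarith

theorem modE_sub_le (h : Trajectory k a b c d A E J lE lJ e T ν t₁ t₂) {s t : ℝ}
    (hs : t₁ ≤ s) (hst : s ≤ t) (ht : t ≤ t₂) :
    modE k E J T t ≤ modE k E J T s + k.C₄ * (1 / k.γ + 1) := by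
  have h1 := h.incr_modE hs hst ht
  have h2 := incr_err (k := k) ν hst (ht.trans_lt h.lt)
  have h3 : ∫ τ in s..t, modD k E J lE lJ T τ ≤ ∫ τ in s..t, errD k T ν τ := by
    refine intervalIntegral.integral_mono_ae_restrict hst h1.int h2.int ?_
    rw [← Measure.restrict_congr_set Ioc_ae_eq_Icc]
    filter_upwards [ae_restrict_of_ae_restrict_of_subset (Ioc_subset_Ioc hs ht) h.rate_le,
      ae_restrict_mem measurableSet_Ioc] with τ hτ hτ'
    have hm : τ ∈ Icc t₁ t₂ := ⟨hs.trans hτ'.1.le, hτ'.2.trans ht⟩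
    have := mul_nonneg (inv_nonneg.2 (h.sub_mem hm).1.le) (h.bal τ hm).hA
    linarith
  have h4 := h.err_bound hs hst ht
  have h5 := h1.eq
  linarith

/-- A bound of the modified energy. -/
def modBound (k : Coeffs) (x : ℝ) : ℝ :=
  k.μ₁ * ((k.κ + 2) * x) + k.μ₁ * (4 + k.Cc) + k.C₄ * (1 / k.γ + 1)

/-- The upper bound is propagated forward from the data at t₁. The lower bound is propagated
backward from t₂, where the smallness of the nonlinear term keeps the modified energy above a
constant. -/
theorem abs_modE_le (h : Trajectory k a b c d A E J lE lJ e T ν t₁ t₂) (hd : d t₂ ≤ 1) {t : ℝ}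
    (ht : t ∈ Icc t₁ t₂) : |modE k E J T t| ≤ modBound k (1 + a t₁ + b t₁ + c t₁) := by
  obtain ⟨-, a1, a2, a3, a4⟩ := h.sub_mem (left_mem_Icc.2 h.le)
  obtain ⟨-, b1, b2, b3, b4⟩ := h.sub_mem (right_mem_Icc.2 h.le)
  have hb := h.bal t₁ (left_mem_Icc.2 h.le)
  have hn := k.hn1
  have x0 : 0 ≤ (k.κ + 2) * (1 + a t₁ + b t₁ + c t₁) :=
    mul_nonneg (by linarith [k.hκ]) (by linarith [hb.ha, hb.hb, hb.hc])
  have u1 : modE k E J T t₁ ≤ k.μ₁ * ((k.κ + 2) * (1 + a t₁ + b t₁ + c t₁)) := by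
    rw [modE_eq]
    refine (mul_le_mul_of_nonneg_left (hb.le_of_small k.hκ k.η_pos.le a1 a2.le_n
      (by linarith [a2.le_η]) (by linarith)) (by linarith)).trans
      (mul_le_mul_of_nonneg_right a4 x0)
  have u2 : -(k.μ₁ * (4 + k.Cc)) ≤ modE k E J T t₂ := by
    rw [modE_eq]
    have h1 := (h.bal t₂ (right_mem_Icc.2 h.le)).ge_of_small k.hκ k.hn0.le k.η_pos.le b1 b2.le_n
      b2.le_η hn.le hd
    have h2 := mul_le_mul_of_nonneg_left h1 (zero_le_one.trans b3)
    have h3 := mul_le_mul_of_nonneg_right b4 (by linarith [k.hCc] : 0 ≤ 4 + k.Cc)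
    linarith
  have u3 := h.modE_sub_le le_rfl ht.1 ht.2
  have u4 := h.modE_sub_le ht.1 ht.2 le_rfl
  have m1 := mul_nonneg k.μ₁_pos.le x0
  have m2 := mul_nonneg k.μ₁_pos.le (by linarith [k.hCc] : 0 ≤ 4 + k.Cc)
  rw [abs_le, modBound]
  constructor <;> linarith

theorem abs_le_modE (h : Trajectory k a b c d A E J lE lJ e T ν t₁ t₂) {t : ℝ}
    (ht : t ∈ Icc t₁ t₂) : |E t - k.η * (T - t) ^ k.γ * J t| ≤ |modE k E J T t| := by
  obtain ⟨-, -, -, a3, -⟩ := h.sub_mem ht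
  rw [modE_eq, abs_mul, abs_of_pos (zero_lt_one.trans_le a3)]
  exact le_mul_of_one_le_left (abs_nonneg _) a3

theorem incr_cutoff (h : Trajectory k a b c d A E J lE lJ e T ν t₁ t₂) {τ₁ τ₂ s : ℝ}
    (h1 : t₁ ≤ τ₁) (h12 : τ₁ ≤ τ₂) (h2 : τ₂ ≤ t₂) :
    Incr τ₁ τ₂ (fun t => ((-Real.log (T - t) - s) * (s + 2 - -Real.log (T - t))) ^ 2 * J t)
      (fun t => 2 * ((-Real.log (T - t) - s) * (s + 2 - -Real.log (T - t))) *
        ((T - t)⁻¹ * (2 * s + 2 - 2 * -Real.log (T - t))) * J t +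
        ((-Real.log (T - t) - s) * (s + 2 - -Real.log (T - t))) ^ 2 * ((T - t)⁻¹ * lJ t)) := by
  have hsub : ∀ τ ∈ Icc τ₁ τ₂, τ ∈ Icc t₁ t₂ := fun τ h' => ⟨h1.trans h'.1, h'.2.trans h2⟩
  have hT := h2.trans_lt h.lt
  have hl : ContinuousOn (fun t => -Real.log (T - t)) (Icc τ₁ τ₂) := fun τ hτ =>
    (hasDerivAt_neg_log_sub (hτ.2.trans_lt hT)).continuousAt.continuousWithinAt
  refine Incr.weight h12
    (fun τ hτ => Incr.of_le h.incrJ (hsub τ₁ (left_mem_Icc.2 h12)) (hsub τ hτ)) (fun τ hτ => ?_) ?_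
  · have hd := hasDerivAt_neg_log_sub (hτ.2.trans_lt hT)
    refine (((hd.sub_const s).mul (hd.const_sub (s + 2))).pow 2).congr_deriv ?_
    simp only [Pi.mul_apply, Nat.cast_ofNat]
    ring
  · have hi := continuousOn_sub_inv (t₁ := τ₁) hT
    exact ((continuousOn_const.mul ((hl.sub continuousOn_const).mul (continuousOn_const.sub hl))).mul
      (hi.mul (continuousOn_const.sub (continuousOn_const.mul hl))))

/-- The derivative of the squared cut-off has only one factor θ. The parameter y = 4/(mθ) puts θ² on
c, where it is absorbed by θ²d, and no θ on a, which is controlled by the dissipation. -/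
theorem cutoff_le {m α a c d Cc A J θ x : ℝ} (hm : 0 < m) (hm1 : m ≤ 1) (hα : 0 < α)
    (hαa : α * a ≤ A) (hA : 0 ≤ A) (hc : c ≤ d + Cc) (hCc : 0 ≤ Cc)
    (hJ : ∀ y : ℝ, 0 < y → |J| ≤ y * a + 1 / (4 * y) * c) (hθ0 : 0 ≤ θ) (hθ1 : θ ≤ 1)
    (hx : |x| ≤ 2) : -(2 * θ * x * J) ≤ 16 / (m * α) * A + m / 4 * θ ^ 2 * d + Cc := by
  rcases hθ0.eq_or_lt with rfl | hθ
  · simp only [mul_zero, zero_mul, neg_zero, ne_eq, OfNat.ofNat_ne_zero, not_false_eq_true,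
      zero_pow, add_zero]
    positivity
  have h1 := hJ (4 / (m * θ)) (by positivity)
  have h2 : -(2 * θ * x * J) ≤ 2 * θ * 2 * |J| := by
    rw [show -(2 * θ * x * J) = 2 * θ * -(x * J) by ring, mul_assoc (2 * θ)]
    refine mul_le_mul_of_nonneg_left ?_ (by positivity)
    refine (neg_le_abs _).trans ?_
    rw [abs_mul]
    exact mul_le_mul_of_nonneg_right hx (abs_nonneg _)
  have h3 := mul_le_mul_of_nonneg_left h1 (by positivity : 0 ≤ 2 * θ * 2)
  have h4 : 2 * θ * 2 * (4 / (m * θ) * a + 1 / (4 * (4 / (m * θ))) * c) =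
      16 / (m * α) * (α * a) + m / 4 * θ ^ 2 * c := by
    field_simp
    ring
  have h5 : 16 / (m * α) * (α * a) ≤ 16 / (m * α) * A :=
    mul_le_mul_of_nonneg_left hαa (by positivity)
  have h6 : m / 4 * θ ^ 2 * c ≤ m / 4 * θ ^ 2 * (d + Cc) :=
    mul_le_mul_of_nonneg_left hc (by positivity)
  have h7 : m / 4 * θ ^ 2 * Cc ≤ 1 * Cc := by
    refine mul_le_mul_of_nonneg_right ?_ hCc
    have : θ ^ 2 ≤ 1 := pow_le_one₀ hθ0 hθ1
    nlinarith
  linarith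

theorem window_le {a b c d A E J lE lJ e ζ θ x Q : ℝ}
    (hb : IsBalance k.n k.κ k.α k.C₀ k.Cc a b c d A E J ζ)
    (hr : IsRate k.n k.κ k.C₀ k.C₁ a b c d A ζ lE lJ e) (hs : k.Small ζ) (hζ : 0 ≤ ζ)
    (hθ0 : 0 ≤ θ) (hθ1 : θ ≤ 1) (hx : |x| ≤ 2) (hQ : |E - k.η * ζ * J| ≤ Q) (he : e ≤ 1) :
    θ ^ 2 * ((1 - 2 * k.n) / 4 * d) ≤ 2 * θ * x * J + θ ^ 2 * lJ + (3 * Q + 2 + 2 * k.Cc) +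
      (16 / ((1 - 2 * k.n) * k.α) + k.C₁ + 1) * A := by
  have n1 := hb.nonlinear_le k.hκ k.hn0 k.hn1 hζ k.η_pos.le hs.le_m hs.le_η hr
  have hm := k.m_pos
  have hcd := hb.hcd
  have hC₁ := k.hC₁
  have hCc := k.hCc
  have hm1 : 1 - 2 * k.n ≤ 1 := by linarith [k.hn0]
  set m := 1 - 2 * k.n with hmd
  have hcd' : c ≤ d + k.Cc := by
    have := mul_le_mul_of_nonneg_right (by linarith : m / 16 ≤ 1) hb.hd
    linarith
  have n3 := cutoff_le hm hm1 k.hα hb.hαa hb.hA hcd' hCc hb.hJ hθ0 hθ1 hx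
  have hΘ1 : θ ^ 2 ≤ 1 := pow_le_one₀ hθ0 hθ1
  have q1 := mul_le_mul_of_nonneg_left n1 (sq_nonneg θ)
  have q2 : θ ^ 2 * (3 * |E - k.η * ζ * J| + (k.C₁ + 1) * A + (1 + k.Cc) + e) ≤
      1 * (3 * Q + (k.C₁ + 1) * A + (1 + k.Cc) + 1) := by
    have q3 := abs_nonneg (E - k.η * ζ * J)
    have q4 := mul_nonneg (by linarith : 0 ≤ k.C₁ + 1) hb.hA
    exact mul_le_mul hΘ1 (by linarith) (by linarith [hr.he]) zero_le_one
  linarith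

set_option maxHeartbeats 800000 in
/-- The nonlinear term is bounded on time windows of length one in the variable `-log (T - t)`. -/
theorem lintegral_le (h : Trajectory k a b c d A E J lE lJ e T ν t₁ t₂) (hd : d t₂ ≤ 1)
    {s τ₁ τ₂ τ₁' τ₂' : ℝ} (h1 : t₁ ≤ τ₁) (h2 : τ₂ ≤ t₂) (hτ1 : -Real.log (T - τ₁) = s)
    (hτ2 : -Real.log (T - τ₂) = s + 2) (hτ1' : -Real.log (T - τ₁') = s + 1 / 2)
    (hτ2' : -Real.log (T - τ₂') = s + 3 / 2) (l1 : τ₁ ≤ τ₁') (l2 : τ₁' ≤ τ₂') (l3 : τ₂' ≤ τ₂)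
    {Q : ℝ} (hQ : Q = modBound k (1 + a t₁ + b t₁ + c t₁)) :
    ∫⁻ t in Ioc τ₁' τ₂', ENNReal.ofReal ((T - t)⁻¹ * d t) ≤
      ENNReal.ofReal (8 / (1 - 2 * k.n) * (2 * (3 * Q + 2 + 2 * k.Cc) +
        (16 / ((1 - 2 * k.n) * k.α) + k.C₁ + 1) * (3 * Q))) := by
  have h12 : τ₁ ≤ τ₂ := l1.trans (l2.trans l3)
  have hm := k.m_pos
  have hα := k.hα
  have hC₁ := k.hC₁
  have hCc := k.hCc
  set m := 1 - 2 * k.n with hmd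
  set C₈ := 16 / (m * k.α) + k.C₁ + 1 with hC₈
  have hC₈0 : 0 ≤ C₈ := by positivity
  have hT := h2.trans_lt h.lt
  have hsub : ∀ τ ∈ Icc τ₁ τ₂, τ ∈ Icc t₁ t₂ := fun τ h' => ⟨h1.trans h'.1, h'.2.trans h2⟩
  have i1 := h.incr_cutoff (s := s) h1 h12 h2
  have i2 := Incr.of_hasDerivAt h12 (fun t ht => hasDerivAt_neg_log_sub (ht.2.trans_lt hT))
    (continuousOn_sub_inv hT)
  have i3 := incr_err (k := k) ν h12 hT
  -- Γ below is the derivative of θ²J plus a constant rate plus C₈ times the error minus the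
  -- derivative of the modified energy. The last difference dominates the dissipation, so Γ
  -- dominates θ² times the nonlinear term.
  have i4 := h.incr_modE h1 h12 h2
  have i5 := (i1.add (i2.const_mul (3 * Q + 2 + 2 * k.Cc))).add ((i3.sub i4).const_mul C₈)
  set Γ : ℝ → ℝ := _ with hΓ
  have i5' : Incr τ₁ τ₂ _ Γ := i5
  have tot : ∫ t in τ₁..τ₂, Γ t ≤ 2 * (3 * Q + 2 + 2 * k.Cc) + C₈ * (3 * Q) := by
    rw [← i5'.eq]
    have e0 := h.err_bound h1 h12 h2
    rw [← i3.eq] at e0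
    have e1 := abs_le.1 (h.abs_modE_le hd (hsub τ₁ (left_mem_Icc.2 h12)))
    have e2 := abs_le.1 (h.abs_modE_le hd (hsub τ₂ (right_mem_Icc.2 h12)))
    rw [← hQ] at e1 e2
    -- The total error is part of Q, and the two values of the modified energy cost 2Q, hence the
    -- factor 3. The boundary terms of θ²J vanish, since θ vanishes at s and s + 2.
    have e3 : k.C₄ * (1 / k.γ + 1) ≤ Q := by
      have hb := h.bal t₁ (left_mem_Icc.2 h.le)
      have x0 : 0 ≤ (k.κ + 2) * (1 + a t₁ + b t₁ + c t₁) :=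
        mul_nonneg (by linarith [k.hκ]) (by linarith [hb.ha, hb.hb, hb.hc])
      have m1 := mul_nonneg k.μ₁_pos.le x0
      have m2 := mul_nonneg k.μ₁_pos.le (by linarith [k.hCc] : 0 ≤ 4 + k.Cc)
      rw [hQ, modBound]
      linarith
    rw [hτ1] at e0 ⊢
    rw [hτ2] at e0 ⊢
    have e4 := mul_le_mul_of_nonneg_left (by linarith [e1.2, e2.1] :
      (k.C₄ * (-(1 / k.γ * (T - τ₂) ^ k.γ) + ν * (s + 2)) - modE k E J T τ₂) -
      (k.C₄ * (-(1 / k.γ * (T - τ₁) ^ k.γ) + ν * s) - modE k E J T τ₁) ≤ 3 * Q) hC₈0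
    have e5 : ((s - s) * (s + 2 - s)) ^ 2 * J τ₁ = 0 := by ring
    have e6 : ((s + 2 - s) * (s + 2 - (s + 2))) ^ 2 * J τ₂ = 0 := by ring
    rw [e5, e6]
    linarith
  have pt : ∀ᵐ t ∂(volume.restrict (Ioc τ₁ τ₂)),
      ((-Real.log (T - t) - s) * (s + 2 - -Real.log (T - t))) ^ 2 *
        (m / 4 * ((T - t)⁻¹ * d t)) ≤ Γ t := by
    filter_upwards [ae_restrict_of_ae_restrict_of_subset (Ioc_subset_Ioc h1 h2) h.rate_le,
      ae_restrict_of_ae_restrict_of_subset (Ioc_subset_Ioc h1 h2) h.rate,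
      ae_restrict_mem measurableSet_Ioc] with t hA hr ht
    have ht0 := Ioc_subset_Icc_self ht
    have ht' := hsub t ht0
    obtain ⟨g0, g1, g2, g3, g4⟩ := h.sub_mem ht'
    have hb := h.bal t ht'
    have n2 := (h.abs_le_modE ht').trans (h.abs_modE_le hd ht')
    rw [← hQ] at n2
    have he : e t ≤ 1 := (h.err t ht').trans h.err_le_one
    have x1 : s ≤ -Real.log (T - t) := by
      rw [← hτ1]
      exact neg_le_neg (Real.log_le_log g0 (by linarith [ht0.1]))
    have x2 : -Real.log (T - t) ≤ s + 2 := by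
      rw [← hτ2]
      exact neg_le_neg (Real.log_le_log (sub_pos.2 hT) (by linarith [ht0.2]))
    simp only [hΓ]
    generalize -Real.log (T - t) = σ at x1 x2 ⊢
    set θ := (σ - s) * (s + 2 - σ) with hθ
    have hθ0 : 0 ≤ θ := mul_nonneg (by linarith) (by linarith)
    have hθ1 : θ ≤ 1 := by nlinarith [sq_nonneg (σ - s - 1)]
    have n5 := window_le hb hr g2 g1 hθ0 hθ1 (x := 2 * s + 2 - 2 * σ)
      (abs_le.2 ⟨by linarith, by linarith⟩) n2 he
    rw [← hmd, ← hC₈] at n5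
    have n6 := mul_le_mul_of_nonneg_left n5 (inv_nonneg.2 g0.le)
    have n7 := mul_le_mul_of_nonneg_left hA hC₈0
    linarith
  have pos : 0 ≤ᵐ[volume.restrict (Ioc τ₁ τ₂)] Γ := by
    filter_upwards [pt, ae_restrict_mem measurableSet_Ioc] with t ht ht0
    have ht' := hsub t (Ioc_subset_Icc_self ht0)
    have := (h.bal t ht').hd
    have := (h.sub_mem ht').1
    refine le_trans ?_ ht
    positivity
  have fin : ENNReal.ofReal (∫ t in τ₁..τ₂, 8 / m * Γ t) =
      ∫⁻ t in Ioc τ₁ τ₂, ENNReal.ofReal (8 / m * Γ t) := by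
    rw [intervalIntegral.integral_of_le h12]
    refine ofReal_integral_eq_lintegral_ofReal ?_ ?_
    · exact ((intervalIntegrable_iff_integrableOn_Ioc_of_le h12).1 i5'.int).const_mul _
    · filter_upwards [pos] with t ht
      have : 0 ≤ Γ t := ht
      show 0 ≤ 8 / m * Γ t
      positivity
  calc _ ≤ ∫⁻ t in Ioc τ₁' τ₂', ENNReal.ofReal (8 / m * Γ t) := by
        refine lintegral_mono_ae ?_
        filter_upwards [ae_restrict_of_ae_restrict_of_subset (Ioc_subset_Ioc l1 l3) pt,
          ae_restrict_mem measurableSet_Ioc] with t hp ht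
        refine ENNReal.ofReal_le_ofReal ?_
        have ht' := hsub t ⟨l1.trans ht.1.le, ht.2.trans l3⟩
        have g0 := (h.sub_mem ht').1
        have hT' := l3.trans_lt hT
        have x1 : s + 1 / 2 ≤ -Real.log (T - t) := by
          rw [← hτ1']
          exact neg_le_neg (Real.log_le_log g0 (by linarith [ht.1]))
        have x2 : -Real.log (T - t) ≤ s + 3 / 2 := by
          rw [← hτ2']
          exact neg_le_neg (Real.log_le_log (sub_pos.2 hT') (by linarith [ht.2]))
        generalize -Real.log (T - t) = σ at x1 x2 hp
        -- On the middle half of the window the cut-off is bounded below; 8/m is the inverse of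
        -- (1/2)(m/4).
        have hθ : 3 / 4 ≤ (σ - s) * (s + 2 - σ) := by
          nlinarith [mul_nonneg (sub_nonneg.2 x1) (sub_nonneg.2 x2)]
        have hΘ : 1 / 2 ≤ ((σ - s) * (s + 2 - σ)) ^ 2 :=
          le_trans (by norm_num) (pow_le_pow_left₀ (by norm_num) hθ 2)
        have h0 : 0 ≤ (T - t)⁻¹ * d t := mul_nonneg (inv_nonneg.2 g0.le) (h.bal t ht').hd
        have q1 := mul_le_mul_of_nonneg_right hΘ (by positivity : 0 ≤ m / 4 * ((T - t)⁻¹ * d t))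
        have q2 := mul_le_mul_of_nonneg_left (q1.trans hp) (by positivity : 0 ≤ 8 / m)
        have q3 : 8 / m * (1 / 2 * (m / 4 * ((T - t)⁻¹ * d t))) = (T - t)⁻¹ * d t := by
          field_simp
          norm_num
        linarith
    _ ≤ ∫⁻ t in Ioc τ₁ τ₂, ENNReal.ofReal (8 / m * Γ t) :=
        lintegral_mono_set (Ioc_subset_Ioc l1 l3)
    _ ≤ _ := by
        rw [← fin, intervalIntegral.integral_const_mul]
        exact ENNReal.ofReal_le_ofReal (mul_le_mul_of_nonneg_left tot (by positivity))

end Trajectory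

end

end HamzaZaag

/-! ### The bound in cones with vertex inside the domain. -/

namespace HamzaZaag

noncomputable section

variable {N : ℕ} {x₀ : E N} {b t p q M c₀ α γ ε : ℝ} {w w' w'' : ℝ → ℝ}

section State

variable {U V : E N → ℝ} {G : Fin N → E N → ℝ}

/-- The functionals at a fixed time are bounded by the energy norm. -/
theorem data_le (S : IsState p x₀ b t U V G) (P : IsProfile α ε w w' w'') (hr : b - t ≤ 1) :
    qS c₀ w x₀ b t U V G + qG c₀ w x₀ b t G + qW c₀ w x₀ b t U ≤
      (b - t) ^ (2 * c₀ - N) * ((3 * c₀ ^ 2 + 4) * qN x₀ b t U V G) := by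
  have hb := S.lt
  have hr0 : 0 < b - t := sub_pos.2 hb
  have i1 := S.int_sq P.cut (S.mv c₀) ((b - t) ^ c₀)
  have i2 := S.int_pot P.cut (((b - t) ^ c₀) ^ 2)
  have i3 := S.int_sq P.cut S.mU ((b - t) ^ c₀)
  have j1 := S.int_sq P.cut (S.mv c₀) 1
  have j2 := S.int_pot P.cut 1
  have j3 := S.int_sq P.cut S.mU 1
  have hB := Metric.isClosed_closedBall (x := x₀) (ε := b - t) |>.measurableSet
  have iN : IntegrableOn (fun x => U x ^ 2 + V x ^ 2 + gsq G x) (Metric.closedBall x₀ (b - t)) :=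
    (S.mU.integrable_sq.add S.mV.integrable_sq).add
      (integrable_finsetSum _ fun i _ => (S.mG i).integrable_sq)
  have e : qS c₀ w x₀ b t U V G + qG c₀ w x₀ b t G + qW c₀ w x₀ b t U =
      nint b t fun x => ((b - t) ^ c₀) ^ 2 * ((1 * mv c₀ x₀ b t U V G x) ^ 2 * w (zz x₀ b t x) +
        1 * pot x₀ b t G x * w (zz x₀ b t x) + (1 * U x) ^ 2 * w (zz x₀ b t x)) := by
    have i12 := i1.add i2
    simp only [Pi.add_def] at i12
    rw [qS, qG, qW, ← nint_add i1 i2, ← nint_add i12 i3]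
    congr 1
    funext x
    ring
  rw [e, ← nint_scaled hb]
  refine mul_le_mul_of_nonneg_left ?_ (Real.rpow_nonneg hr0.le _)
  rw [qN, ← integral_const_mul, ← integral_indicator hB]
  refine integral_mono ((j1.add j2).add j3) ((integrable_indicator_iff hB).2 (iN.const_mul _))
    fun x => ?_
  by_cases hx : x ∈ Metric.closedBall x₀ (b - t)
  · have hz : zz x₀ b t x ≤ 1 := by
      rw [Metric.mem_closedBall, dist_eq_norm] at hx
      rw [zz, div_le_one (by positivity)]
      exact pow_le_pow_left₀ (norm_nonneg _) hx 2
    rw [indicator_of_mem hx]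
    have w0 := P.nonneg (zz x₀ b t x)
    have w1 := P.le_one (zz x₀ b t x) (zz_nonneg _ _ _ _)
    have hg := gsq_nonneg G x
    have h1 := rad_sq_le_gsq G hb hr x hz
    have h2 : (b - t) ^ 2 ≤ 1 := pow_le_one₀ hr0.le hr
    have h3 := mul_le_mul_of_nonneg_right h2 hg
    have h4 := mul_le_mul_of_nonneg_right h2 (sq_nonneg (V x))
    have h5 : mv c₀ x₀ b t U V G x ^ 2 ≤
        3 * (c₀ ^ 2 * U x ^ 2 + (b - t) ^ 2 * V x ^ 2 + rad x₀ G x ^ 2) := by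
      rw [mv]
      nlinarith [sq_nonneg (c₀ * U x + (b - t) * V x), sq_nonneg (c₀ * U x - rad x₀ G x),
        sq_nonneg ((b - t) * V x + rad x₀ G x)]
    have h6 : mv c₀ x₀ b t U V G x ^ 2 + pot x₀ b t G x + U x ^ 2 ≤
        (3 * c₀ ^ 2 + 4) * (U x ^ 2 + V x ^ 2 + gsq G x) := by
      rw [pot]
      nlinarith [sq_nonneg (U x), sq_nonneg (V x), sq_nonneg (rad x₀ G x),
        mul_nonneg (sq_nonneg c₀) (sq_nonneg (V x)), mul_nonneg (sq_nonneg c₀) hg]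
    have h7 : 0 ≤ (3 * c₀ ^ 2 + 4) * (U x ^ 2 + V x ^ 2 + gsq G x) := by positivity
    calc _ = w (zz x₀ b t x) * (mv c₀ x₀ b t U V G x ^ 2 + pot x₀ b t G x + U x ^ 2) := by ring
      _ ≤ w (zz x₀ b t x) * ((3 * c₀ ^ 2 + 4) * (U x ^ 2 + V x ^ 2 + gsq G x)) :=
          mul_le_mul_of_nonneg_left h6 w0
      _ ≤ _ := mul_le_of_le_one_left h7 w1
  · rw [indicator_of_notMem hx]
    simp only [IsState.cut_zero P.cut hb x hx, mul_zero, add_zero, le_refl]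

/-- Scaling: |w|^{p+1} dy is (b - t)^{2c₀+2-N}|u|^{p+1} dx. -/
theorem qP_le (S : IsState p x₀ b t U V G) (P : IsProfile α ε w w' w'')
    (hc : c₀ * (p - 1) = 2) :
    qP p c₀ w x₀ b t U ≤ (b - t) ^ (2 * c₀ + 2 - N) *
      ∫ x in Metric.closedBall x₀ (b - t), |U x| ^ (p + 1) := by
  have hr0 : 0 < b - t := sub_pos.2 S.lt
  have hB := Metric.isClosed_closedBall (x := x₀) (ε := b - t) |>.measurableSet
  have e : (b - t) ^ (2 * c₀ + 2 - N) = (b - t) ^ (-(N : ℝ)) * (b - t) ^ (c₀ * (p + 1)) := by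
    rw [← Real.rpow_add hr0]
    congr 1
    linarith
  rw [e, mul_assoc, qP, nint]
  refine mul_le_mul_of_nonneg_left ?_ (Real.rpow_nonneg hr0.le _)
  rw [← integral_const_mul, ← integral_indicator hB]
  refine integral_mono (S.int_pow P.cut _) ((integrable_indicator_iff hB).2 (S.pow.const_mul _))
    fun x => ?_
  by_cases hx : x ∈ Metric.closedBall x₀ (b - t)
  · rw [indicator_of_mem hx]
    dsimp only
    rw [abs_mul, Real.mul_rpow (abs_nonneg _) (abs_nonneg _),
      abs_of_nonneg (Real.rpow_nonneg hr0.le _), ← Real.rpow_mul hr0.le]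
    exact mul_le_of_le_one_right (by positivity) (P.le_one _ (zz_nonneg _ _ _ _))
  · rw [indicator_of_notMem hx]
    simp only [IsState.cut_zero P.cut S.lt x hx, mul_zero, le_refl]

end State

theorem Incr.of_Ioc {F f : ℝ → ℝ} {t₁ t₂ : ℝ}
    (h : ∀ t ∈ Ioc t₁ t₂, Incr t₁ t F f) : ∀ t ∈ Icc t₁ t₂, Incr t₁ t F f := by
  intro t ht
  rcases ht.1.eq_or_lt with rfl | h1
  · exact ⟨by simp, by simp⟩
  · exact h t ⟨h1, ht.2⟩

variable {f g : ℝ → ℝ} {u₀ u₁ : E N → ℝ} {T : E N → ℝ} {u v : ℝ → E N → ℝ} {G : ℝ → E N → E N}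

/-- Close to the vertex of a light cone contained in the domain, the nonlinear term is small. -/
theorem IsSolution.eventually_qP_le (S : IsSolution p f g u₀ u₁ T u v G)
    (A : Params N p q M c₀ α γ) (L : LowerOrder q M f g) (hb : 0 < b) (hbT : b < T x₀) :
    ∀ᶠ r in 𝓝[>] (0 : ℝ), ∀ ε w w' w'', IsProfile α ε w w' w'' →
      IsState p x₀ b (b - r) (u (b - r)) (v (b - r)) (gco G (b - r)) →
      qP p c₀ w x₀ b (b - r) (u (b - r)) ≤ 1 := by
  obtain ⟨C, hC⟩ := S.exists_power_bound A.hp A.hq A.hqp A.hM L (x₀ := x₀) le_rfl hb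
    (r := (T x₀ - b) / 4) (r' := (T x₀ - b) / 2) (by linarith) (by linarith)
    (slice_ball S.T_lip (by linarith))
  -- The exponent is 2α + 1.
  have he : 0 < 2 * c₀ + 2 - N := by
    have := A.hαc
    have := A.hα
    linarith
  have h1 : Tendsto (fun r : ℝ => r ^ (2 * c₀ + 2 - N) * C) (𝓝[>] 0) (𝓝 0) := by
    have : Tendsto (fun r : ℝ => r ^ (2 * c₀ + 2 - N) * C) (𝓝 0) (𝓝 (0 ^ (2 * c₀ + 2 - N) * C)) :=
      ((Real.continuousAt_rpow_const 0 _ (Or.inr he.le)).mul continuousAt_const)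
    rw [Real.zero_rpow he.ne', zero_mul] at this
    exact this.mono_left nhdsWithin_le_nhds
  have h2 : ∀ᶠ r in 𝓝[>] (0 : ℝ), r < min b ((T x₀ - b) / 4) :=
    mem_nhdsWithin_of_mem_nhds (Iio_mem_nhds (lt_min hb (by linarith)))
  filter_upwards [h1.eventually_lt_const one_pos, h2, self_mem_nhdsWithin] with r hr1 hr2 hr0
    ε w w' w'' P Q
  have hr0 : 0 < r := hr0
  obtain ⟨hr2, hr3⟩ := lt_min_iff.1 hr2
  refine (qP_le Q P A.hc).trans (le_trans ?_ hr1.le)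
  rw [sub_sub_cancel]
  refine mul_le_mul_of_nonneg_left ?_ (Real.rpow_nonneg hr0.le _)
  obtain ⟨g1, g2⟩ := hC (b - r) ⟨by linarith, by linarith⟩
  exact (setIntegral_mono_set g1 (Eventually.of_forall fun x => Real.rpow_nonneg (abs_nonneg _) _)
    (Metric.closedBall_subset_closedBall hr3.le).eventuallyLE).trans g2

/-- The error due to the cut-off is small. -/
theorem IsSolution.eventually_qErr_le (S : IsSolution p f g u₀ u₁ T u v G)
    (A : Params N p q M c₀ α γ) (L : LowerOrder q M f g) {e : ℕ → ℝ}
    (he : Tendsto e atTop (𝓝 0)) (P : IsProfile α ε w w' w'') (he0 : ∀ᶠ k in atTop, 0 ≤ e k)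
    {t₁ t₂ : ℝ} (h0 : 0 ≤ t₁)
    (h12 : t₁ < t₂) (h2b : t₂ < b) (hbT : b < T x₀) {ν : ℝ} (hν : 0 < ν) :
    ∀ᶠ k in atTop, ∀ t ∈ Icc t₁ t₂, qErr c₀ (e k) x₀ b t (u t) (v t) (gco G t) ≤ ν := by
  obtain ⟨C, hC⟩ := (S.coneEvol A L P hbT h0 h12 h2b).bdd
  obtain ⟨D, hD⟩ := isCompact_Icc.exists_bound_of_continuousOn
    (continuousOn_sub_rpow (t₁ := t₁) h2b (2 * c₀ - N))
  have h1 : Tendsto (fun k => D * (e k * ((3 * c₀ ^ 2 + 4) * C))) atTop (𝓝 0) := by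
    have := ((he.mul_const ((3 * c₀ ^ 2 + 4) * C)).const_mul D)
    simpa using this
  filter_upwards [h1.eventually_lt_const hν, he0] with k hk hk0 t ht
  refine le_trans ?_ hk.le
  have h2 := (Real.le_norm_self _).trans (hD t ht)
  have h3 := qN_nonneg x₀ b t (u t) (v t) (gco G t)
  have h4 := hC t ht
  have h5 : 0 ≤ (3 * c₀ ^ 2 + 4) := by positivity
  refine mul_le_mul h2 (mul_le_mul_of_nonneg_left (mul_le_mul_of_nonneg_left h4 h5) hk0)
    (mul_nonneg hk0 (mul_nonneg h5 h3)) ?_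
  exact (Real.rpow_nonneg (by linarith [ht.2]) _).trans h2

/-- The bound of the nonlinear term in truncated light cones contained in the domain. -/
theorem exists_cone_bound (A : Params N p q M c₀ α γ) : ∃ ζ₀ C : ℝ, 0 < ζ₀ ∧ 0 ≤ C ∧
    ∀ (f g : ℝ → ℝ) (u₀ u₁ : E N → ℝ) (T : E N → ℝ) (u v : ℝ → E N → ℝ) (G : ℝ → E N → E N),
    LowerOrder q M f g → IsSolution p f g u₀ u₁ T u v G →
    ∀ (x₀ : E N) (b t₁ s : ℝ), 0 ≤ t₁ → t₁ < b → b < T x₀ → (b - t₁) ^ γ ≤ ζ₀ → b - t₁ ≤ 1 →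
    -Real.log (b - t₁) ≤ s →
    ∀ (e : ℕ → ℝ) (w w' w'' : ℕ → ℝ → ℝ), Tendsto e atTop (𝓝 0) →
    (∀ k, 1 ≤ k → IsProfile α (e k) (w k) (w' k) (w'' k)) →
    ∀ᶠ k in atTop, ∫⁻ t in Ioc (b - Real.exp (-(s + 1 / 2))) (b - Real.exp (-(s + 3 / 2))),
        ENNReal.ofReal ((b - t)⁻¹ * qP p c₀ (w k) x₀ b t (u t)) ≤
      ENNReal.ofReal (C * (1 + (b - t₁) ^ (2 * c₀ - N) * qN x₀ b t₁ (u t₁) (v t₁) (gco G t₁))) := by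
  obtain ⟨C₀, Cc, C₁, hC₀, hCc, hC₁, key⟩ := exists_balance A
  have hp := A.hp
  have hc0 := A.hc0
  let k₀ : Coeffs :=
    { n := 1 / (p + 1), κ := c₀ * (c₀ + 1), α := α, C₀ := C₀, C₁ := C₁, Cc := Cc, γ := γ
      hn0 := by positivity
      hn1 := one_div_lt_one_div_of_lt two_pos (by linarith)
      hκ := by positivity
      hα := A.hα
      hC₀ := hC₀
      hC₁ := hC₁
      hCc := hCc
      hγ0 := A.hγ0
      hγ1 := A.hγ }
  obtain ⟨ζ₀, hζ₀, hsm⟩ := k₀.exists_small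
  have hm := k₀.m_pos
  have hα := A.hα
  set Q₁ := Trajectory.modBound k₀ 1 with hQ₁
  have hQ₁0 : 0 ≤ Q₁ := by
    have := k₀.μ₁_pos
    have := k₀.C₄_nonneg
    have := k₀.hκ
    have := k₀.hγ0
    have := k₀.hCc
    rw [hQ₁, Trajectory.modBound]
    positivity
  set C := 8 / (1 - 2 * k₀.n) * (2 * (3 * Q₁ + 2 + 2 * k₀.Cc) +
        (16 / ((1 - 2 * k₀.n) * k₀.α) + k₀.C₁ + 1) * (3 * Q₁)) with hCd
  have hα' := k₀.hα
  have hC₁' := k₀.hC₁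
  have hCc' := k₀.hCc
  have hC0 : 0 ≤ C := by rw [hCd]; positivity
  refine ⟨ζ₀, C * (3 * c₀ ^ 2 + 4), hζ₀, by positivity, ?_⟩
  intro f g u₀ u₁ T u v G L S x₀ b t₁ s h0 h1b hbT hζ hr1 hs e w w' w'' he P
  -- the final time
  have ev1 := S.eventually_qP_le A L (h0.trans_lt h1b) hbT
  have ev2 : ∀ᶠ r in 𝓝[>] (0 : ℝ), r < Real.exp (-(s + 2)) :=
    mem_nhdsWithin_of_mem_nhds (Iio_mem_nhds (Real.exp_pos _))
  have ev3 : ∀ᶠ r in 𝓝[>] (0 : ℝ), 0 < r := self_mem_nhdsWithin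
  -- The trajectory ends at b - r, beyond the window and so close to the vertex that the nonlinear
  -- term is at most 1.
  obtain ⟨r, hqP, hr2, hr0⟩ := (ev1.and (ev2.and ev3)).exists
  have hbt : 0 < b - t₁ := sub_pos.2 h1b
  have hexp (x : ℝ) (hx : 0 ≤ x) : Real.exp (-(s + x)) ≤ b - t₁ := by
    rw [← Real.le_log_iff_exp_le hbt]
    linarith
  have hτ1 := hexp 0 le_rfl
  rw [add_zero] at hτ1
  have h12 : t₁ < b - r := by
    have := hexp 2 (by norm_num)
    linarith
  have h2b : b - r < b := by linarith
  -- the error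
  set ℓ := Real.log (b - t₁) - Real.log (b - (b - r)) with hℓ
  have hℓ0 : 0 ≤ ℓ := sub_nonneg.2 (Real.log_le_log (by linarith) (by linarith))
  -- With the end time fixed, the profile error can be made smaller than the inverse of the
  -- logarithmic length ℓ, so its integral is at most 1.
  have hν : 0 < 1 / (1 + ℓ) := by positivity
  have ev4 := S.eventually_qErr_le A L he (P 1 le_rfl)
    ((eventually_ge_atTop 1).mono fun k hk => (P k hk).eps_nonneg) h0 h12 h2b hbT hν
  filter_upwards [ev4, eventually_ge_atTop 1] with k hk hk1
  have Pk := P k hk1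
  have ev := S.coneEvol A L Pk hbT h0 h12 h2b
  have evt (t : ℝ) (ht : t ∈ Ioc t₁ (b - r)) := S.coneEvol A L Pk hbT h0 ht.1 (ht.2.trans_lt h2b)
  have traj : Trajectory k₀ (fun t => qS c₀ (w k) x₀ b t (u t) (v t) (gco G t))
      (fun t => qG c₀ (w k) x₀ b t (gco G t)) (fun t => qW c₀ (w k) x₀ b t (u t))
      (fun t => qP p c₀ (w k) x₀ b t (u t))
      (fun t => qS c₀ (dD α (w k) (w' k)) x₀ b t (u t) (v t) (gco G t))
      (eng c₀ (w k) (nl p f) x₀ b u v G) (mom c₀ (w k) x₀ b u v G)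
      (engD c₀ α (w k) (w' k) (nl p f) g x₀ b u v G) (momD c₀ α (w k) (w' k) (nl p f) g x₀ b u v G)
      (fun t => qErr c₀ (e k) x₀ b t (u t) (v t) (gco G t)) b (1 / (1 + ℓ)) t₁ (b - r) :=
    { le := h12.le
      lt := h2b
      small := hsm.mono hζ
      bal := fun t ht => (key _ _ _ _ Pk f g L x₀ b u v G t (by linarith [ht.1]) (ev.cone t ht)).1
      rate := by
        filter_upwards [ev.rate, ae_restrict_mem measurableSet_Ioc] with t hrt ht
        exact (key _ _ _ _ Pk f g L x₀ b u v G t (by linarith [ht.1])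
          (ev.cone t (Ioc_subset_Icc_self ht))).2 hrt
      incrE := Incr.of_Ioc fun t ht => (evt t ht).eng
      incrJ := Incr.of_Ioc fun t ht => (evt t ht).mom
      err := hk
      err_nonneg := hν.le
      err_le_one := by
        rw [div_le_one (by positivity)]
        linarith
      err_log := by
        rw [← hℓ, one_div_mul_eq_div, div_le_one (by positivity)]
        linarith }
  have hlog (x : ℝ) : -Real.log (b - (b - Real.exp (-(s + x)))) = s + x := by
    rw [sub_sub_cancel, Real.log_exp, neg_neg]
  have hmono (x y : ℝ) (hxy : x ≤ y) : b - Real.exp (-(s + x)) ≤ b - Real.exp (-(s + y)) :=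
    sub_le_sub_left (Real.exp_le_exp.2 (by linarith)) _
  have hlog0 := hlog 0
  rw [add_zero] at hlog0
  have hmono0 := hmono 0 (1 / 2) (by norm_num)
  rw [add_zero] at hmono0
  have st := (ev.cone t₁ (left_mem_Icc.2 h12.le)).state
  have hd := hqP _ _ _ _ Pk (ev.cone (b - r) (right_mem_Icc.2 h12.le)).state
  refine (traj.lintegral_le hd (s := s) (by linarith) (by linarith) hlog0 (hlog 2) (hlog (1 / 2))
    (hlog (3 / 2)) hmono0 (hmono _ _ (by norm_num)) (hmono _ _ (by norm_num)) rfl).trans ?_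
  refine ENNReal.ofReal_le_ofReal ?_
  set X := 1 + qS c₀ (w k) x₀ b t₁ (u t₁) (v t₁) (gco G t₁) + qG c₀ (w k) x₀ b t₁ (gco G t₁) +
    qW c₀ (w k) x₀ b t₁ (u t₁) with hX
  have hw : ∀ z, 0 ≤ z → 0 ≤ w k z := fun z _ => Pk.nonneg z
  have hX1 : 1 ≤ X := by
    have := IsState.qS_nonneg (c₀ := c₀) st hw
    have := IsState.qG_nonneg (c₀ := c₀) st Pk.cut hw
    have := IsState.qW_nonneg (c₀ := c₀) st hw
    rw [hX]
    linarith
  have hXle : X ≤ (3 * c₀ ^ 2 + 4) *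
      (1 + (b - t₁) ^ (2 * c₀ - N) * qN x₀ b t₁ (u t₁) (v t₁) (gco G t₁)) := by
    have := data_le (c₀ := c₀) st Pk hr1
    have := sq_nonneg c₀
    rw [hX]
    linarith
  -- `modBound` is affine and X ≥ 1, so it is bounded by a multiple of X; the final bound is thus
  -- linear in the squared data norm.
  have hQ : Trajectory.modBound k₀ X ≤ Q₁ * X := by
    rw [hQ₁, Trajectory.modBound, Trajectory.modBound]
    have h1 : k₀.μ₁ * (4 + k₀.Cc) ≤ k₀.μ₁ * (4 + k₀.Cc) * X :=
      le_mul_of_one_le_right (by have := k₀.μ₁_pos; positivity) hX1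
    have h2 : k₀.C₄ * (1 / k₀.γ + 1) ≤ k₀.C₄ * (1 / k₀.γ + 1) * X :=
      le_mul_of_one_le_right (by have := k₀.C₄_nonneg; have := k₀.hγ0; positivity) hX1
    linarith
  have h3 : 8 / (1 - 2 * k₀.n) * (2 * (3 * Trajectory.modBound k₀ X + 2 + 2 * k₀.Cc) +
      (16 / ((1 - 2 * k₀.n) * k₀.α) + k₀.C₁ + 1) * (3 * Trajectory.modBound k₀ X)) ≤ C * X := by
    rw [hCd, mul_assoc (8 / (1 - 2 * k₀.n))]
    refine mul_le_mul_of_nonneg_left ?_ (by positivity)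
    have h4 := mul_le_mul_of_nonneg_left hQ
      (by positivity : 0 ≤ 16 / ((1 - 2 * k₀.n) * k₀.α) + k₀.C₁ + 1)
    have h5 : 2 + 2 * k₀.Cc ≤ (2 + 2 * k₀.Cc) * X := le_mul_of_one_le_right (by positivity) hX1
    linarith
  refine h3.trans ?_
  rw [mul_assoc C]
  exact mul_le_mul_of_nonneg_left hXle hC0

end

end HamzaZaag

/-! ### Similarity variables and space-time densities. -/

namespace HamzaZaag

noncomputable section

variable {N : ℕ} {x₀ : E N} {b t p q M c₀ α γ : ℝ} {T : E N → ℝ} {u : ℝ → E N → ℝ}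

/-- The weight `(1 - z)^α`, extended by zero. -/
def omLim (α : ℝ) : ℝ → ℝ := (Iio 1).indicator fun z => (1 - z) ^ α

theorem omLim_measurable : Measurable (omLim α) :=
  ((measurable_const.sub measurable_id).pow_const α).indicator measurableSet_Iio

/-- The function `u`, extended by zero outside of its domain. -/
def ext (T : E N → ℝ) (u : ℝ → E N → ℝ) : E N × ℝ → ℝ :=
  (domain T).indicator fun z => u z.2 z.1

/-- The density in space-time of `∫∫ |w|^{p+1} a`. -/
def dens (p c₀ : ℝ) (a : ℝ → ℝ) (x₀ : E N) (b : ℝ) (U : E N × ℝ → ℝ) (z : E N × ℝ) : ℝ :=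
  (b - z.2)⁻¹ * ((b - z.2) ^ (-(N : ℝ)) *
    (|(b - z.2) ^ c₀ * U z| ^ (p + 1) * a (zz x₀ b z.2 z.1)))

theorem measurableSet_domain (hT : LipschitzWith 1 T) : MeasurableSet (domain T) :=
  (measurableSet_le measurable_const measurable_snd).inter
    (measurableSet_lt measurable_snd (hT.continuous.measurable.comp measurable_fst))

theorem ext_aemeasurable (hT : LipschitzWith 1 T) (hu : ContL2Loc T u) :
    AEMeasurable (ext T u) :=
  ((aestronglyMeasurable_indicator_iff (measurableSet_domain hT)).2 hu.meas).aemeasurable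

theorem dens_aemeasurable {U : E N × ℝ → ℝ} (hU : AEMeasurable U) {a : ℝ → ℝ} (ha : Measurable a)
    {W : Set ℝ} (hW : MeasurableSet W) : AEMeasurable
      ((Prod.snd ⁻¹' W).indicator fun z => ENNReal.ofReal (dens p c₀ a x₀ b U z)) := by
  refine AEMeasurable.indicator (AEMeasurable.ennreal_ofReal ?_) (measurable_snd hW)
  have h1 : Measurable fun z : E N × ℝ => b - z.2 := measurable_const.sub measurable_snd
  have h2 : Measurable fun z : E N × ℝ => zz x₀ b z.2 z.1 :=
    ((measurable_fst.sub measurable_const).norm.pow_const 2).div (h1.pow_const 2)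
  exact h1.inv.aemeasurable.mul ((h1.pow_const _).aemeasurable.mul
    (((((h1.pow_const _).aemeasurable.mul hU).abs).pow_const _).mul (ha.comp h2).aemeasurable))

theorem lintegral_dens {U : E N × ℝ → ℝ} (hU : AEMeasurable U) {a : ℝ → ℝ} (ha : Measurable a)
    {W : Set ℝ} (hW : MeasurableSet W) :
    ∫⁻ z, (Prod.snd ⁻¹' W).indicator (fun z => ENNReal.ofReal (dens p c₀ a x₀ b U z)) z =
      ∫⁻ t in W, ∫⁻ x, ENNReal.ofReal (dens p c₀ a x₀ b U (x, t)) := by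
  rw [← lintegral_indicator hW, Measure.volume_eq_prod,
    lintegral_prod_symm _ (dens_aemeasurable hU ha hW)]
  refine lintegral_congr fun t => ?_
  by_cases ht : t ∈ W
  · rw [indicator_of_mem ht]
    exact lintegral_congr fun x => indicator_of_mem (by exact ht) _
  · rw [indicator_of_notMem ht]
    refine (lintegral_congr fun x => indicator_of_notMem (by exact ht) _).trans lintegral_zero

/-- The light cone of (x₀, b) lies in the domain when b ≤ T(x₀). The extension by zero is only
needed to have a measurable function on all of space-time. -/
theorem ext_eq (hT : LipschitzWith 1 T) (ht : 0 ≤ t) (hb : b ≤ T x₀) (htb : t < b) {x : E N}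
    (hz : zz x₀ b t x < 1) : ext T u (x, t) = u t x := by
  have hm : (x, t) ∈ domain T := ⟨ht, ?_⟩
  · exact indicator_of_mem hm _
  have hr : 0 < b - t := sub_pos.2 htb
  rw [zz, div_lt_one (by positivity)] at hz
  have h1 := lt_of_pow_lt_pow_left₀ 2 hr.le hz
  refine slice_ball hT (x₀ := x₀) (r := ‖x - x₀‖) (by linarith) ?_
  rw [Metric.mem_closedBall, dist_eq_norm]

theorem lintegral_dens_slice (hT : LipschitzWith 1 T) (ht : 0 ≤ t) (hb : b ≤ T x₀)
    {V : E N → ℝ} {G : Fin N → E N → ℝ}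
    (S : IsState p x₀ b t (u t) V G) {ε : ℝ} {w w' w'' : ℝ → ℝ} (P : IsProfile α ε w w' w'') :
    ∫⁻ x, ENNReal.ofReal (dens p c₀ w x₀ b (ext T u) (x, t)) =
      ENNReal.ofReal ((b - t)⁻¹ * qP p c₀ w x₀ b t (u t)) := by
  have hr : 0 < b - t := sub_pos.2 S.lt
  rw [qP, nint, ← integral_const_mul, ← integral_const_mul, ofReal_integral_eq_lintegral_ofReal]
  · refine lintegral_congr fun x => ?_
    by_cases hz : zz x₀ b t x < 1
    · simp only [dens, ext_eq hT ht hb S.lt hz]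
    · simp only [dens, P.s0 _ (not_lt.1 hz), mul_zero]
  · exact ((S.int_pow P.cut _).const_mul _).const_mul _
  · refine Eventually.of_forall fun x => ?_
    have := P.nonneg (zz x₀ b t x)
    show 0 ≤ (b - t)⁻¹ * ((b - t) ^ (-(N : ℝ)) * (|(b - t) ^ c₀ * u t x| ^ (p + 1) *
      w (zz x₀ b t x)))
    positivity

/-- Convergence of the densities as the vertex and the weight converge. -/
theorem tendsto_dens (hp : 0 < p + 1) {B : ℕ → ℝ} (hB : Tendsto B atTop (𝓝 b)) {κ : ℕ → ℕ}
    (hκ : Tendsto κ atTop atTop) {U : E N × ℝ → ℝ} {x : E N} (ht : t < b)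
    (hz : zz x₀ b t x < 1) :
    Tendsto (fun j => dens p c₀ (om α (κ j)) x₀ (B j) U (x, t)) atTop
      (𝓝 (dens p c₀ (omLim α) x₀ b U (x, t))) := by
  have h0 : b - t ≠ 0 := (sub_pos.2 ht).ne'
  have h1 : Tendsto (fun j => B j - t) atTop (𝓝 (b - t)) := hB.sub_const t
  have h2 : Tendsto (fun j => zz x₀ (B j) t x) atTop (𝓝 (zz x₀ b t x)) :=
    tendsto_const_nhds.div (h1.pow 2) (pow_ne_zero 2 h0)
  have h3 : Tendsto (fun j => om α (κ j) (zz x₀ (B j) t x)) atTop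
      (𝓝 (omLim α (zz x₀ b t x))) := by
    have h4 := (h2.const_sub 1)
    -- For fixed z < 1 the argument of the smooth cut-off tends to infinity, so eventually the
    -- profile is (1-z)^α itself.
    have h5 : Tendsto (fun j => (κ j : ℝ) * (1 - zz x₀ (B j) t x)) atTop atTop :=
      (tendsto_natCast_atTop_atTop.comp hκ).atTop_mul_pos (sub_pos.2 hz) h4
    rw [omLim, indicator_of_mem (by exact hz)]
    refine (h4.rpow_const (Or.inl (sub_pos.2 hz).ne')).congr' ?_
    filter_upwards [h5.eventually_ge_atTop 2] with j hj
    rw [om, Real.smoothTransition.one_of_one_le (by linarith), mul_one]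
  exact (h1.inv₀ h0).mul ((h1.rpow_const (Or.inl h0)).mul
    ((((h1.rpow_const (Or.inl h0)).mul_const _).abs.rpow_const (Or.inr hp.le)).mul h3))

theorem lintegral_comp_add_smul {r : ℝ} (hr : 0 < r) (x₀ : E N) (h : E N → ℝ≥0∞) :
    ∫⁻ y, h (x₀ + r • y) = ENNReal.ofReal (r ^ (-(N : ℝ))) * ∫⁻ x, h x := by
  have e := (Homeomorph.smulOfNeZero r hr.ne' (α := E N)).measurableEmbedding.lintegral_map
    (μ := volume) fun z => h (x₀ + z)
  have e2 : Measure.map (Homeomorph.smulOfNeZero r hr.ne' (α := E N)) volume = _ :=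
    Measure.map_addHaar_smul volume hr.ne'
  rw [e2, lintegral_smul_measure, lintegral_add_left_eq_self h] at e
  rw [show (∫⁻ y, h (x₀ + r • y)) = _ from e.symm, finrank_euclideanSpace_fin,
    abs_of_pos (by positivity), Real.rpow_neg hr.le, Real.rpow_natCast, smul_eq_mul]
  rfl

/-- The passage from similarity variables to the original ones, at a fixed time. -/
theorem lintegral_simW (hT : LipschitzWith 1 T) (hα : α = alpha N p) (hb : b ≤ T x₀) {σ : ℝ}
    (hσ : 0 ≤ b - Real.exp (-σ)) :
    ∫⁻ y in Metric.ball (0 : E N) 1,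
        ENNReal.ofReal (|simW p u x₀ b y σ| ^ (p + 1) * rho p y) =
      ENNReal.ofReal (Real.exp (-σ)) *
        ∫⁻ x, ENNReal.ofReal (dens p (2 / (p - 1)) (omLim α) x₀ b (ext T u)
          (x, b - Real.exp (-σ))) := by
  set r := Real.exp (-σ) with hr
  have hr0 : 0 < r := Real.exp_pos _
  have e1 : b - (b - r) = r := sub_sub_cancel _ _
  rw [← lintegral_const_mul' _ _ ENNReal.ofReal_ne_top]
  have e2 (x : E N) : ENNReal.ofReal r *
      ENNReal.ofReal (dens p (2 / (p - 1)) (omLim α) x₀ b (ext T u) (x, b - r)) =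
      ENNReal.ofReal (r ^ (-(N : ℝ))) * ENNReal.ofReal
        (|r ^ (2 / (p - 1)) * ext T u (x, b - r)| ^ (p + 1) * omLim α (zz x₀ b (b - r) x)) := by
    rw [← ENNReal.ofReal_mul hr0.le, ← ENNReal.ofReal_mul (by positivity)]
    simp only [dens, e1]
    rw [mul_inv_cancel_left₀ hr0.ne']
  rw [lintegral_congr e2, lintegral_const_mul' _ _ ENNReal.ofReal_ne_top,
    ← lintegral_comp_add_smul hr0 x₀, ← lintegral_indicator Metric.isOpen_ball.measurableSet]
  refine lintegral_congr fun y => ?_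
  have e3 : zz x₀ b (b - r) (x₀ + r • y) = ‖y‖ ^ 2 := by
    rw [zz, e1, add_sub_cancel_left, norm_smul, Real.norm_of_nonneg hr0.le]
    field_simp
  by_cases hy : y ∈ Metric.ball (0 : E N) 1
  · rw [indicator_of_mem hy]
    have hy1 : ‖y‖ ^ 2 < 1 := by
      rw [mem_ball_zero_iff] at hy
      exact pow_lt_one₀ (norm_nonneg _) hy two_ne_zero
    rw [ext_eq hT hσ hb (by linarith) (by rw [e3]; exact hy1), e3, omLim,
      indicator_of_mem (by exact hy1), simW, rho, hα]
  · rw [indicator_of_notMem hy, e3, omLim, indicator_of_notMem, mul_zero, ENNReal.ofReal_zero]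
    rw [mem_ball_zero_iff, not_lt] at hy
    exact not_lt.2 (one_le_pow₀ hy)

/-- The passage from similarity variables to the original ones. -/
theorem lintegral_lintegral_simW_le (hT : LipschitzWith 1 T) (hα : α = alpha N p) (hb : b ≤ T x₀)
    {s : ℝ} (hs : 0 ≤ b - Real.exp (-s)) :
    ∫⁻ σ in Icc s (s + 1), ∫⁻ y in Metric.ball (0 : E N) 1,
        ENNReal.ofReal (|simW p u x₀ b y σ| ^ (p + 1) * rho p y) ≤
      ∫⁻ t in Ioo (b - Real.exp (-s)) (b - Real.exp (-(s + 1))),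
        ∫⁻ x, ENNReal.ofReal (dens p (2 / (p - 1)) (omLim α) x₀ b (ext T u) (x, t)) := by
  have hd (σ : ℝ) : HasDerivAt (fun σ => b - Real.exp (-σ)) (Real.exp (-σ)) σ := by
    refine ((hasDerivAt_neg σ).exp.const_sub b).congr_deriv ?_
    ring
  have key := lintegral_image_eq_lintegral_abs_deriv_mul (s := Icc s (s + 1)) measurableSet_Icc
    (fun σ _ => (hd σ).hasDerivWithinAt) (fun x _ y _ hxy => by simpa using hxy)
    (fun t => ∫⁻ x, ENNReal.ofReal (dens p (2 / (p - 1)) (omLim α) x₀ b (ext T u) (x, t)))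
  have e : ∫⁻ σ in Icc s (s + 1), ∫⁻ y in Metric.ball (0 : E N) 1,
        ENNReal.ofReal (|simW p u x₀ b y σ| ^ (p + 1) * rho p y) = _ :=
    (setLIntegral_congr_fun measurableSet_Icc fun σ hσ => by
      rw [abs_of_pos (Real.exp_pos _)]
      refine lintegral_simW hT hα hb ?_
      have := Real.exp_le_exp.2 (neg_le_neg hσ.1)
      linarith).trans key.symm
  -- The end points are a null set. The open window is kept because its points are eventually in the
  -- windows of the approximating cones.
  rw [e, setLIntegral_congr Ioo_ae_eq_Icc]
  refine lintegral_mono_set ?_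
  rintro _ ⟨σ, hσ, rfl⟩
  exact ⟨sub_le_sub_left (Real.exp_le_exp.2 (neg_le_neg hσ.1)) _,
    sub_le_sub_left (Real.exp_le_exp.2 (neg_le_neg hσ.2)) _⟩

end

end HamzaZaag

/-! ### The limit as the vertex tends to the final time. -/

namespace HamzaZaag

noncomputable section

variable {N : ℕ} {x₀ : E N} {b p q M α γ : ℝ} {T : E N → ℝ} {u : ℝ → E N → ℝ}

/-- Bounds with smooth weights in light cones inside the domain pass to the limit. -/
theorem lintegral_simW_le_of_approx (hT : LipschitzWith 1 T) (hu : ContL2Loc T u) (hp : 1 < p)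
    (hα : α = alpha N p) (hα0 : 0 < α) (hb : b ≤ T x₀) {s : ℝ} {B : ℕ → ℝ}
    (hB : Tendsto B atTop (𝓝 b)) (hBb : ∀ j, B j < b) (hBs : ∀ j, 0 ≤ B j - Real.exp (-s))
    (hst : ∀ j, ∀ t ∈ Ioc (B j - Real.exp (-s)) (B j - Real.exp (-(s + 1))),
      ∃ V G, IsState p x₀ (B j) t (u t) V G) {K : ℝ≥0∞}
    (hK : ∀ j, ∀ᶠ k : ℕ in atTop, ∫⁻ t in Ioc (B j - Real.exp (-s)) (B j - Real.exp (-(s + 1))),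
      ENNReal.ofReal ((B j - t)⁻¹ * qP p (2 / (p - 1)) (om α k) x₀ (B j) t (u t)) ≤ K) :
    ∫⁻ σ in Icc s (s + 1), ∫⁻ y in Metric.ball (0 : E N) 1,
        ENNReal.ofReal (|simW p u x₀ b y σ| ^ (p + 1) * rho p y) ≤ K := by
  refine (lintegral_lintegral_simW_le hT hα hb ((hBs 0).trans (by linarith [hBb 0]))).trans ?_
  have hU := ext_aemeasurable hT hu
  obtain ⟨ε, -, hε⟩ := exists_isProfile hα0
  -- For each vertex one index of the profile is fixed for which the bound holds, and `κ j > j`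
  -- forces the profiles to converge along with the vertices.
  choose κ hκ using fun j => ((hK j).and (eventually_ge_atTop (j + 1))).exists
  have hκ' : Tendsto κ atTop atTop :=
    tendsto_atTop_mono (fun j => (Nat.le_succ j).trans (hκ j).2) tendsto_id
  have hP (j : ℕ) := hε (κ j) (le_trans (by omega) (hκ j).2)
  rw [← lintegral_dens hU omLim_measurable measurableSet_Ioo]
  set F : ℕ → E N × ℝ → ℝ≥0∞ := fun j =>
    (Prod.snd ⁻¹' Ioc (B j - Real.exp (-s)) (B j - Real.exp (-(s + 1)))).indicator fun z =>
      ENNReal.ofReal (dens p (2 / (p - 1)) (om α (κ j)) x₀ (B j) (ext T u) z) with hF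
  have hFm (j : ℕ) : AEMeasurable (F j) :=
    dens_aemeasurable hU (hP j).cut.cont.measurable measurableSet_Ioc
  have hFle (j : ℕ) : ∫⁻ z, F j z ≤ K := by
    rw [hF]
    dsimp only
    rw [lintegral_dens hU (hP j).cut.cont.measurable measurableSet_Ioc]
    refine (setLIntegral_congr_fun measurableSet_Ioc fun t ht => ?_).le.trans (hκ j).1
    obtain ⟨V, G, S⟩ := hst j t ht
    exact lintegral_dens_slice hT (by linarith [ht.1, hBs j]) ((hBb j).le.trans hb) S (hP j)
  calc _ ≤ ∫⁻ z, liminf (fun j => F j z) atTop := by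
        refine lintegral_mono fun ⟨x, t⟩ => ?_
        by_cases ht : t ∈ Ioo (b - Real.exp (-s)) (b - Real.exp (-(s + 1)))
        · rw [indicator_of_mem (by exact ht)]
          have htb : t < b := ht.2.trans (by linarith [Real.exp_pos (-(s + 1))])
          by_cases hz : zz x₀ b t x < 1
          · have h1 := (ENNReal.continuous_ofReal.tendsto _).comp
              (tendsto_dens (c₀ := 2 / (p - 1)) (α := α) (p := p) (by linarith) hB hκ' (U := ext T u) htb hz)
            -- The windows move with the vertex, so a point of the limiting open window is
            -- eventually in all of them and the indicators converge there to 1.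
            have h2 : ∀ᶠ j in atTop, t < B j - Real.exp (-(s + 1)) :=
              (hB.sub_const _).eventually_const_lt ht.2
            refine (Tendsto.liminf_eq (h1.congr' ?_)).ge
            filter_upwards [h2] with j hj
            have hm : ((x, t) : E N × ℝ) ∈ Prod.snd ⁻¹'
                Ioc (B j - Real.exp (-s)) (B j - Real.exp (-(s + 1))) :=
              ⟨by linarith [ht.1, hBb j], hj.le⟩
            simp only [hF]
            rw [indicator_of_mem hm]
            rfl
          · simp only [dens, omLim]
            rw [indicator_of_notMem (by exact hz)]
            simp
        · rw [indicator_of_notMem (by exact ht)]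
          exact zero_le
    _ ≤ liminf (fun j => ∫⁻ z, F j z) atTop := lintegral_liminf_le' hFm
    _ ≤ K := liminf_le_of_le (by isBoundedDefault) fun c hc => by
        obtain ⟨j, hj⟩ := hc.exists
        exact hj.trans (hFle j)

/-- The exponent 2c₀ - N has no definite sign, hence the absolute value. -/
theorem rpow_le_exp {r x s : ℝ} (h0 : Real.exp (-s) ≤ r) (h1 : r ≤ 1) :
    r ^ x ≤ Real.exp (|x| * s) := by
  have hr : 0 < r := (Real.exp_pos _).trans_le h0
  rw [Real.rpow_def_of_pos hr, Real.exp_le_exp]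
  have h2 := (Real.le_log_iff_exp_le hr).2 h0
  have h3 := Real.log_nonpos hr.le h1
  calc _ ≤ |Real.log r * x| := le_abs_self _
    _ = |x| * -Real.log r := by rw [abs_mul, abs_of_nonpos h3, mul_comm]
    _ ≤ _ := mul_le_mul_of_nonneg_left (by linarith) (abs_nonneg _)

/-- Subcriticality of p is exactly the positivity of α. -/
theorem params_of_subcritical (hN : 1 ≤ N) (hp : 1 < p)
    (hpc : 2 ≤ N → p < 1 + 4 / ((N : ℝ) - 1)) (hq : 0 ≤ q) (hqp : q < p) (hM : 0 < M) :
    Params N p q M (2 / (p - 1)) (alpha N p) (min 1 (2 / (p - 1) * (p - q))) := by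
  have hp1 : 0 < p - 1 := by linarith
  have hpq : 0 < p - q := by linarith
  refine ⟨hp, hq, hqp, hM, div_mul_cancel₀ _ hp1.ne', by positivity, ?_, rfl,
    lt_min one_pos (by positivity), min_le_left _ _, min_le_right _ _⟩
  rw [alpha, sub_pos]
  rcases hN.eq_or_lt with rfl | h2
  · simp [hp1]
  · have h3 : (0 : ℝ) < N - 1 := by
      have : (1 : ℝ) < N := by exact_mod_cast h2
      linarith
    have h4 : (p - 1) * (N - 1) < 4 := by
      rw [← lt_div_iff₀ h3]
      linarith [hpc h2]
    rw [lt_div_iff₀ hp1]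
    linarith

/-- The ball is contained in a section of the cone of slope δ₀ below (x₀, T(x₀)), which is in the
domain because x₀ is non-characteristic. This makes the norm of the data on the large ball finite.
-/
theorem closedBall_subset_slice {x₀ : E N} {δ₀ T₀ ŝ : ℝ} (hx : NonCharacteristic T x₀ δ₀)
    (hT₀ : T₀ ≤ T x₀) (h : Real.exp (-ŝ) ≤ T₀) :
    Metric.closedBall x₀ (Real.exp (-ŝ) / δ₀) ⊆ slice T (T₀ - Real.exp (-ŝ)) := by
  intro ξ hξ
  have he := Real.exp_pos (-ŝ)
  rw [Metric.mem_closedBall, dist_eq_norm, le_div_iff₀ hx.1] at hξ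
  have hm : (ξ, T₀ - Real.exp (-ŝ)) ∈ cone x₀ (T x₀) δ₀ :=
    ⟨fun h1 => ?_, by simpa using h, ?_⟩
  · exact (hx.2.2 hm).2
  · have := congrArg Prod.snd h1
    simp only at this
    linarith
  · show T₀ - Real.exp (-ŝ) ≤ T x₀ - δ₀ * ‖ξ - x₀‖
    linarith

theorem qN_le_energyNorm {f g : ℝ → ℝ} {u₀ u₁ : E N → ℝ} {v : ℝ → E N → ℝ} {G : ℝ → E N → E N}
    (S : IsSolution p f g u₀ u₁ T u v G) {t r : ℝ} (ht : 0 ≤ t)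
    (hK : Metric.closedBall x₀ r ⊆ slice T t) (hb : b - t < r) :
    qN x₀ b t (u t) (v t) (gco G t) ≤ energyNorm u v G t x₀ r ^ 2 := by
  have hKc := isCompact_closedBall x₀ r
  have htt : t ∈ Icc 0 t := ⟨ht, le_rfl⟩
  have e (x : E N) : u t x ^ 2 + v t x ^ 2 + gsq (gco G t) x =
      u t x ^ 2 + ‖G t x‖ ^ 2 + v t x ^ 2 := by
    rw [EuclideanSpace.real_norm_sq_eq]
    simp only [gsq, gco]
    ring
  have hi : IntegrableOn (fun x => u t x ^ 2 + ‖G t x‖ ^ 2 + v t x ^ 2)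
      (Metric.closedBall x₀ r) :=
    ((S.cont_u.memLp t ht _ hKc hK t htt).integrable_sq.add
      (S.cont_G.memLp t ht _ hKc hK t htt).norm.integrable_sq).add
      (S.cont_v.memLp t ht _ hKc hK t htt).integrable_sq
  rw [energyNorm, Real.sq_sqrt (integral_nonneg fun x => by positivity), qN]
  simp only [e]
  exact setIntegral_mono_set (hi.mono_set Metric.ball_subset_closedBall)
    (Eventually.of_forall fun x => by positivity) (Metric.closedBall_subset_ball hb).eventuallyLE

end

end HamzaZaag

/-! ### The main theorem. -/

theorem proposition3p2 (N : ℕ) (hN : 1 ≤ N) (p q M : ℝ) (hp : 1 < p)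
    (hpc : 2 ≤ N → p < 1 + 4 / ((N : ℝ) - 1)) (hq : 0 ≤ q) (hqp : q < p) (hM : 0 < M) :
    ∃ (S₃ : ℝ) (K₁ : ℝ → ℝ → ℝ),
      ∀ f g : ℝ → ℝ, LocallyLipschitz f → LocallyLipschitz g →
      (∀ x, |f x| ≤ M * (1 + |x| ^ q)) → (∀ x, |g x| ≤ M * (1 + |x|)) →
      ∀ (u₀ u₁ : HamzaZaag.E N → ℝ) (T : HamzaZaag.E N → ℝ) (u v : ℝ → HamzaZaag.E N → ℝ)
        (G : ℝ → HamzaZaag.E N → HamzaZaag.E N),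
      HamzaZaag.IsBlowupSolution p f g u₀ u₁ T u v G →
      ∀ (x₀ : HamzaZaag.E N) (δ₀ : ℝ), HamzaZaag.NonCharacteristic T x₀ δ₀ →
      ∀ T₀ : ℝ, 0 < T₀ → T₀ ≤ T x₀ →
      ∀ s : ℝ, 1 + HamzaZaag.sHat S₃ T₀ ≤ s →
        ∫⁻ σ in Icc s (s + 1), ∫⁻ y in Metric.ball (0 : HamzaZaag.E N) 1,
          ENNReal.ofReal (|HamzaZaag.simW p u x₀ T₀ y σ| ^ (p + 1) * HamzaZaag.rho p y)
        ≤ ENNReal.ofReal (K₁ (HamzaZaag.sHat S₃ T₀)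
            (HamzaZaag.energyNorm u v G
              (T₀ - Real.exp (-HamzaZaag.sHat S₃ T₀)) x₀
              (Real.exp (-HamzaZaag.sHat S₃ T₀) / δ₀))) := by
  have A := HamzaZaag.params_of_subcritical hN hp hpc hq hqp hM
  set γ := min 1 (2 / (p - 1) * (p - q)) with hγ
  obtain ⟨ζ₀, C, hζ₀, hC, key⟩ := HamzaZaag.exists_cone_bound A
  -- The starting time makes e^{-ŝ} ≤ 1 and e^{-γŝ} ≤ ζ₀. In K₁ the exponential bounds the scaling
  -- factor (b - t₃)^{2c₀-N}.
  refine ⟨max 0 (-Real.log ζ₀ / γ), fun s n =>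
    C * (1 + Real.exp (|2 * (2 / (p - 1)) - N| * (s + 1)) * n ^ 2), ?_⟩
  intro f g hf hg hfM hgM u₀ u₁ T u v G hB x₀ δ₀ hx T₀ hT₀ hT₀T s hs
  set ŝ := HamzaZaag.sHat (max 0 (-Real.log ζ₀ / γ)) T₀ with hŝ
  have S := hB.sol
  have L : HamzaZaag.LowerOrder q M f g := ⟨hf.continuous, hg.continuous, hfM, hgM⟩
  have ŝ0 : 0 ≤ ŝ := (le_max_left _ _).trans (le_max_left _ _)
  have ŝζ : -Real.log ζ₀ / γ ≤ ŝ := (le_max_right _ _).trans (le_max_left _ _)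
  have hexpT : Real.exp (-ŝ) ≤ T₀ := by
    rw [← Real.le_log_iff_exp_le hT₀]
    have : -Real.log T₀ ≤ ŝ := le_max_right _ _
    linarith
  have hexp1 : Real.exp (-ŝ) ≤ 1 := Real.exp_le_one_iff.2 (by linarith)
  set t₃ := T₀ - Real.exp (-ŝ) with ht₃
  have ht₃0 : 0 ≤ t₃ := sub_nonneg.2 hexpT
  -- The vertices T₀ - η/(j+1) increase to T₀ and stay at distance at least e^{-(ŝ+1/2)} from t₃.
  set η := Real.exp (-ŝ) - Real.exp (-(ŝ + 1 / 2)) with hη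
  have hη0 : 0 < η := sub_pos.2 (Real.exp_lt_exp.2 (by linarith))
  set B : ℕ → ℝ := fun j => T₀ - η * (1 / ((j : ℝ) + 1)) with hBd
  have hBT (j : ℕ) : B j < T₀ := sub_lt_self _ (by positivity)
  have hBlow (j : ℕ) : Real.exp (-(ŝ + 1 / 2)) ≤ B j - t₃ := by
    have h1 : 1 / ((j : ℝ) + 1) ≤ 1 := by
      rw [div_le_one (by positivity)]
      linarith [Nat.cast_nonneg (α := ℝ) j]
    have := mul_le_mul_of_nonneg_left h1 hη0.le
    simp only [hBd]
    linarith
  have hBup (j : ℕ) : B j - t₃ < Real.exp (-ŝ) := by linarith [hBT j]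
  have hBpos (j : ℕ) : 0 < B j - t₃ := (Real.exp_pos _).trans_le (hBlow j)
  have hse : Real.exp (-s) < Real.exp (-(ŝ + 1 / 2)) := Real.exp_lt_exp.2 (by linarith)
  have hBtend : Tendsto B atTop (𝓝 T₀) := by
    have := (tendsto_one_div_add_atTop_nhds_zero_nat (𝕜 := ℝ)).const_mul η |>.const_sub T₀
    rwa [mul_zero, sub_zero] at this
  obtain ⟨ε, hε0, hε⟩ := HamzaZaag.exists_isProfile A.hα
  refine HamzaZaag.lintegral_simW_le_of_approx S.T_lip S.cont_u hp rfl A.hα hT₀T hBtend hBT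
    (fun j => by linarith [hBlow j]) (fun j t ht => ?_) fun j => ?_
  · exact ⟨_, _, ((S.coneEvol A L (hε 1 le_rfl) ((hBT j).trans_le hT₀T) ht₃0
      (by linarith [hBlow j, ht.1]) (by linarith [ht.2, Real.exp_pos (-(s + 1))])).cone t
      (right_mem_Icc.2 (by linarith [hBlow j, ht.1]))).state⟩
  -- The window of the cone bound starts 1/2 after its parameter, hence s - 1/2. The unit in s ≥ 1 +
  -- ŝ is spent in two halves: one for this shift, one for the motion of the vertex.
  have h1 := key f g u₀ u₁ T u v G L S x₀ (B j) t₃ (s - 1 / 2) ht₃0 (sub_pos.1 (hBpos j))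
    ((hBT j).trans_le hT₀T) ?_ ((hBup j).le.trans hexp1) ?_ ε
    (fun k => HamzaZaag.om (HamzaZaag.alpha N p) k) _ _ hε0 hε
  · filter_upwards [h1] with k hk
    rw [show s - 1 / 2 + 1 / 2 = s by ring, show s - 1 / 2 + 3 / 2 = s + 1 by ring] at hk
    refine hk.trans (ENNReal.ofReal_le_ofReal ?_)
    refine mul_le_mul_of_nonneg_left (add_le_add_right ?_ 1) hC
    -- Since δ₀ < 1, the ball of the data contains the section of the light cone.
    have hδ : Real.exp (-ŝ) ≤ Real.exp (-ŝ) / δ₀ :=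
      le_div_self (Real.exp_pos _).le hx.1 hx.2.1.le
    refine mul_le_mul (HamzaZaag.rpow_le_exp (le_trans ?_ (hBlow j)) ((hBup j).le.trans hexp1))
      (HamzaZaag.qN_le_energyNorm S ht₃0 (HamzaZaag.closedBall_subset_slice hx hT₀T hexpT)
        ((hBup j).trans_le hδ)) (HamzaZaag.qN_nonneg _ _ _ _ _ _) (Real.exp_pos _).le
    exact Real.exp_le_exp.2 (by linarith)
  · refine (Real.rpow_le_rpow (hBpos j).le (hBup j).le A.hγ0.le).trans ?_
    rw [← Real.exp_mul, ← Real.le_log_iff_exp_le hζ₀]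
    rw [div_le_iff₀ A.hγ0] at ŝζ
    linarith
  · have := (Real.le_log_iff_exp_le (hBpos j)).2 (hBlow j)
    linarith
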